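/- **Proposition (Differentials of an orbifold morphism).** *Setting.* Let $X$ be a complex manifold of dimension $n$ and $\Delta=\sum_{l}(1-\frac{1}{m_l})\Delta_l$ an orbifold divisor on it, where $\sum_l\Delta_l$ is a normal crossing divisor and $m_l=a_l/b_l\in(1,\infty]$ for integers $a_l>b_l\ge 0$. Put $m=1$ for hypersurfaces not contained in $|\Delta|=\bigcup_l\Delta_l$. A finite surjective holomorphic Galois covering $\pi\colon Y\to X$ from a connected complex manifold is *adapted* to $(X,\Delta)$ if $\pi^*\Delta_l=p_lD_l$ with $a_l\mid p_l$ and $D_l$ a simple normal crossing divisor, for every $l$, and if the support of $\pi^*\Delta+\mathrm{Ram}(\pi)$ and the branch locus of $\pi$ have normal crossings. Around any point of $Y$ there are then adapted coordinates $w$ on $Y$ and $z$ on $X$ with $\pi(w)=(w_1^{p_1},\dots,w_n^{p_n})$, in which each $\Delta_l$ is a union of hyperplanes $z_i=0$, and $p_i$ is a multiple of the integer $a$ attached to $z_i=0$ (with $a=b=1$ if $z_i=0$ is not in $\Delta$). Let $d^jz_i$ be the jet coordinates on the space $J_kX$ of $k$-jets of holomorphic curves (normalized as Taylor coefficients). The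 orbifold jet space $J_k(\pi,\Delta)$ is the relative analytic spectrum over $Y$ of the sheaf of $\mathcal O_Y$-algebras generated, in adapted coordinates, by the functions $w_i^{-p_i(1-j/m_i)^+}\pi^*(d^jz_i)$, $1\le i\le n$, $1\le j\le k$. It has a canonical map to $\pi^*J_kX$, which is an isomorphism over $Y\setminus\pi^{-1}|\Delta|$. Intersection multiplicities with the $\Delta_l$ are taken along each local branch of $\Delta_l$ (there is only one if $\Delta_l$ is smooth). A holomorphic curve $f$ from a disc $\mathbb D$ centred at $0$ to $X$ is *orbifold* if $f(\mathbb D)\not\subseteq|\Delta|$ and $\operatorname{mult}_t(f^*\Delta_l)\ge m_l$ whenever $f(t)\in\Delta_l$. A holomorphic map $\varphi\colon X\to X'$ is an *orbifold morphism* $(X,\Delta)\to(X',\Delta')$ if $\varphi(X)\not\subseteq|\Delta'|$ and if, whenever a prime divisor $D$ of $X$ has multiplicity $t\ge1$ in $\varphi^*\Delta'_l$, one has $t\cdot m_\Delta(D)\ge m'_l$. *Statement.* Let $\varphi\colon(X,\Delta)\to(X',\Delta')$ be an orbifold morphism, $\pi\colon Y\to X$ and $\pi'\colon Y'\to X'$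 adapted coverings for $(X,\Delta)$ and $(X',\Delta')$, and $\tilde\varphi\colon Y\to Y'$ a holomorphic map with $\pi'\circ\tilde\varphi=\varphi\circ\pi$. For every $k\ge0$ there is one and only one holomorphic map $$\varphi_*\colon J_k(\pi,\Delta)\to J_k(\pi',\Delta')$$ over $\tilde\varphi$ which coincides with the lift of the $k$-th differential $J_kX\to J_kX'$ of $\varphi$ outside of $\Delta$; that is, over $Y\setminus\pi^{-1}|\Delta|$ its composition with $J_k(\pi',\Delta')\to\pi'^*J_kX'$ is the map induced by $[\gamma]\mapsto[\varphi\circ\gamma]$. Moreover, let $V$ be a connected Riemann surface, $\rho\colon V\to\mathbb D$ a proper surjective holomorphic map, $f\colon\mathbb D\to X$ an orbifold curve and $g\colon V\to Y$ a holomorphic map with $\pi\circ g=f\circ\rho$. Then the map $(g,f'\circ\rho,\dots,f^{(k)}\circ\rho)\colon V\to\pi^*J_kX$, sending $v$ to $g(v)$ and the $k$-jet of $f$ at $\rho(v)$, lifts to a unique holomorphic map $j_k^\star(g)\colon V\to J_k(\pi,\Delta)$, and $\varphi_*\circ j_k^\star(g)$ is a holomorphic lift to $J_k(\pi',\Delta')$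 of $$\left(\tilde\varphi\circ g,(\varphi\circ f)'\circ\rho,\dots,(\varphi\circ f)^{(k)}\circ\rho\right).$$ -/

import Mathlib

open Topology Set Filter
open scoped Manifold ContDiff ENNReal

universe uV

namespace OrbiJet

noncomputable section

/-! ## Complex manifolds and holomorphic functions

A complex manifold of dimension `n` is a manifold modelled on `Fin n → ℂ` whose transition maps are
complex analytic, i.e. `IsManifold 𝓘(ℂ, Fin n → ℂ) ω X`. -/

/-- `h : X → ℂ` is holomorphic near the point `x` of the `n`-dimensional complex manifold `X`. -/
def HolAt (n : ℕ) {X : Type*} [TopologicalSpace X] [ChartedSpace (Fin n → ℂ) X]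
    (h : X → ℂ) (x : X) : Prop :=
  ContMDiffAt 𝓘(ℂ, Fin n → ℂ) 𝓘(ℂ, ℂ) ω h x

/-- `φ : X → X'` is a holomorphic map of complex manifolds of dimensions `n`, `n'`. -/
def Hol (n n' : ℕ) {X X' : Type*} [TopologicalSpace X] [ChartedSpace (Fin n → ℂ) X]
    [TopologicalSpace X'] [ChartedSpace (Fin n' → ℂ) X'] (φ : X → X') : Prop :=
  ContMDiff 𝓘(ℂ, Fin n → ℂ) 𝓘(ℂ, Fin n' → ℂ) ω φ

/-- `f`, defined on (a part of) `ℂ`, is a curve in `X` which is holomorphic near `t`. -/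
def CurveHolAt (n : ℕ) {X : Type*} [TopologicalSpace X] [ChartedSpace (Fin n → ℂ) X]
    (f : ℂ → X) (t : ℂ) : Prop :=
  ContMDiffAt 𝓘(ℂ, ℂ) 𝓘(ℂ, Fin n → ℂ) ω f t

/-- Holomorphic local coordinate systems on `X`. -/
abbrev holCharts (n : ℕ) (X : Type*) [TopologicalSpace X] [ChartedSpace (Fin n → ℂ) X] :
    Set (OpenPartialHomeomorph X (Fin n → ℂ)) :=
  IsManifold.maximalAtlas 𝓘(ℂ, Fin n → ℂ) ω X

/-! ## Normal crossing divisors -/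

section NC

variable {X : Type*} [TopologicalSpace X]

/-- In the local coordinates `z`, each `E c` is the union of the coordinate hyperplanes
`z_i = 0` whose label `lab i` is `c` (unlabelled hyperplanes belong to no `E c`). -/
structure IsNCChart (n : ℕ) [ChartedSpace (Fin n → ℂ) X] {κ : Type*} (E : κ → Set X)
    (z : OpenPartialHomeomorph X (Fin n → ℂ)) (lab : Fin n → Option κ) : Prop where
  mem : z ∈ holCharts n X
  eq : ∀ c, E c ∩ z.source = {x ∈ z.source | ∃ i, lab i = some c ∧ z x i = 0}

/-- The reduced divisor `∑ c, E c` has normal crossings. -/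
def IsNCFamily (n : ℕ) [ChartedSpace (Fin n → ℂ) X] {κ : Type*} (E : κ → Set X) : Prop :=
  ∀ x, ∃ z lab, x ∈ z.source ∧ IsNCChart n E z lab

/-- The subset `S` is (the support of) a normal crossing divisor. -/
def IsNC (n : ℕ) [ChartedSpace (Fin n → ℂ) X] (S : Set X) : Prop :=
  IsNCFamily n (fun _ : Unit => S)

/-- The subset `S` is (the support of) a simple normal crossing divisor: a normal crossing union
of hypersurfaces each of which has at most one local branch at each point, i.e. is smooth. -/
def IsSNC (n : ℕ) [ChartedSpace (Fin n → ℂ) X] (S : Set X) : Prop :=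
  ∃ E : ℕ → Set X, S = ⋃ c, E c ∧
    ∀ x, ∃ z lab, x ∈ z.source ∧ IsNCChart n E z lab ∧
      ∀ i i' c, lab i = some c → lab i' = some c → i = i'

end NC

/-! ## Smooth orbifold pairs -/

/-- A smooth orbifold pair `(X, Δ)`, `Δ = ∑ l, (1 - b l / a l) Δ_l`, where `∑ l, Δ_l` is a normal
crossing divisor and `a l > b l ≥ 0` (not necessarily coprime). -/
structure OrbifoldPair (n : ℕ) (X : Type*) [TopologicalSpace X] [ChartedSpace (Fin n → ℂ) X]
    (ι : Type*) where
  comp : ι → Set X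
  a : ι → ℕ
  b : ι → ℕ
  b_lt_a : ∀ l, b l < a l
  nc : IsNCFamily n comp

namespace OrbifoldPair

variable {n : ℕ} {X : Type*} [TopologicalSpace X] [ChartedSpace (Fin n → ℂ) X] {ι : Type*}
  (P : OrbifoldPair n X ι)

/-- The support `|Δ|`. -/
def support : Set X := ⋃ l, P.comp l

/-- The coefficient `a` of a local hypersurface: `a_l` on a branch of `Δ_l`, and `1` on a
hypersurface which is not in `Δ`. -/
def numer : Option ι → ℕ
  | some l => P.a l
  | none => 1

/-- The coefficient `b`: `b_l` on a branch of `Δ_l`, and `1` outside `Δ`. -/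
def denom : Option ι → ℕ
  | some l => P.b l
  | none => 1

/-- The orbifold multiplicity `m = a / b ∈ [1, ∞]`; it is `∞` when `b = 0`. -/
def mult (o : Option ι) : ℝ≥0∞ := (P.numer o : ℝ≥0∞) / (P.denom o : ℝ≥0∞)

end OrbifoldPair

/-! ## Adapted coverings -/

section Coverings

variable {X Y : Type*} [TopologicalSpace X] [TopologicalSpace Y] (n : ℕ)
  [ChartedSpace (Fin n → ℂ) X] [ChartedSpace (Fin n → ℂ) Y]

/-- A (ramified) Galois covering: a finite surjective holomorphic map such that the group of
its biholomorphic deck transformations acts transitively on each fibre. -/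
structure IsGaloisCovering (π : Y → X) : Prop where
  hol : Hol n n π
  surj : Function.Surjective π
  proper : IsProperMap π
  finite_fiber : ∀ x, (π ⁻¹' {x}).Finite
  galois : ∀ y y', π y = π y' →
    ∃ σ : Diffeomorph 𝓘(ℂ, Fin n → ℂ) 𝓘(ℂ, Fin n → ℂ) Y Y ω, (∀ u, π (σ u) = π u) ∧ σ y = y'

/-- The ramification locus: the points where the differential of `π` is not invertible. -/
def ramification (π : Y → X) : Set Y :=
  {y | ¬ Function.Bijective (mfderiv 𝓘(ℂ, Fin n → ℂ) 𝓘(ℂ, Fin n → ℂ) π y)}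

variable {n} {ι : Type*}

/-- The equality of divisors `π^* Δ_l = p • D`, where `D` is the reduced divisor with normal
crossing support `π ⁻¹ Δ_l`: a local equation of `Δ_l` pulls back to a unit times the `p`-th power
of a local equation of `D`. -/
def PullbackEq (P : OrbifoldPair n X ι) (π : Y → X) (l : ι) (p : ℕ) : Prop :=
  ∀ (y : Y) (z : OpenPartialHomeomorph X (Fin n → ℂ)) (lab : Fin n → Option ι)
    (w : OpenPartialHomeomorph Y (Fin n → ℂ)) (lab' : Fin n → Option Unit),
    IsNCChart n P.comp z lab → π y ∈ z.source →
    IsNCChart n (fun _ : Unit => π ⁻¹' P.comp l) w lab' → y ∈ w.source →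
    ∃ u : Y → ℂ, HolAt n u y ∧ u y ≠ 0 ∧
      ∀ᶠ y' in 𝓝 y, (∏ᶠ (i : Fin n) (_ : lab i = some l), z (π y') i) =
        u y' * (∏ᶠ (s : Fin n) (_ : lab' s = some ()), w y' s) ^ p

/-- `π : Y → X` is an adapted covering for the pair `P = (X, Δ)`. -/
structure IsAdapted (P : OrbifoldPair n X ι) (π : Y → X) : Prop extends
    IsGaloisCovering n π where
  snc : ∀ l, IsSNC n (π ⁻¹' P.comp l)
  pullback : ∀ l, ∃ p, P.a l ∣ p ∧ PullbackEq P π l p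
  nc_ram : IsNC n (π ⁻¹' P.support ∪ ramification n π)
  nc_branch : IsNC n (π '' ramification n π)

/-- Local adapted coordinates `w` on an open subset of `Y` and `z` on an open subset of `X`, in
which `π` is `(w_1, …, w_n) ↦ (w_1 ^ p_1, …, w_n ^ p_n)`, the components of `Δ` are unions of
hyperplanes `z_i = 0`, and `p_i` is a multiple of the coefficient `a` of `z_i = 0`. -/
structure AdaptedChart (P : OrbifoldPair n X ι) (π : Y → X) where
  w : OpenPartialHomeomorph Y (Fin n → ℂ)
  z : OpenPartialHomeomorph X (Fin n → ℂ)
  lab : Fin n → Option ι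
  p : Fin n → ℕ
  w_mem : w ∈ holCharts n Y
  z_nc : IsNCChart n P.comp z lab
  p_pos : ∀ i, 0 < p i
  dvd_p : ∀ i, P.numer (lab i) ∣ p i
  mapsTo : MapsTo π w.source z.source
  power : ∀ y ∈ w.source, ∀ i, z (π y) i = w y i ^ p i

/-- The integer `p_i (1 - j / m_i)⁺ = (p_i / a_i) (a_i - j b_i)⁺`. -/
def AdaptedChart.poleOrder {P : OrbifoldPair n X ι} {π : Y → X} (C : AdaptedChart P π)
    (i : Fin n) (j : ℕ) : ℕ :=
  (C.p i / P.numer (C.lab i)) * (P.numer (C.lab i) - j * P.denom (C.lab i))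

end Coverings

/-! ## Jets of holomorphic curves -/

section Jets

variable {X : Type*} [TopologicalSpace X] (n k : ℕ) [ChartedSpace (Fin n → ℂ) X]

/-- Two germs of holomorphic curves `(ℂ, 0) → X` have the same `k`-jet. -/
def jetSetoid (X : Type*) [TopologicalSpace X] [ChartedSpace (Fin n → ℂ) X] :
    Setoid {γ : ℂ → X // CurveHolAt n γ 0} where
  r γ δ := γ.1 0 = δ.1 0 ∧ ∀ h : X → ℂ, HolAt n h (γ.1 0) → ∀ j ≤ k,
    iteratedDeriv j (h ∘ γ.1) 0 = iteratedDeriv j (h ∘ δ.1) 0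
  iseqv :=
    { refl := fun _ => ⟨rfl, fun _ _ _ _ => rfl⟩
      symm := fun H => ⟨H.1.symm, fun h hh j hj => (H.2 h (H.1 ▸ hh) j hj).symm⟩
      trans := fun H H' => ⟨H.1.trans H'.1, fun h hh j hj =>
        (H.2 h hh j hj).trans (H'.2 h (H.1 ▸ hh) j hj)⟩ }

/-- The space `J_k X` of `k`-jets of holomorphic curves in `X`. -/
def Jet (X : Type*) [TopologicalSpace X] [ChartedSpace (Fin n → ℂ) X] : Type _ :=
  Quotient (jetSetoid n k X)

variable {n}

/-- The `k`-jet at the time `t` of a curve `f` that is holomorphic near `t`. -/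
def Jet.ofCurve (f : ℂ → X) (t : ℂ) (hf : CurveHolAt n f t) : Jet n k X :=
  Quotient.mk (jetSetoid n k X) ⟨fun s => f (t + s), by
    have h1 : ContMDiffAt 𝓘(ℂ, ℂ) 𝓘(ℂ, ℂ) ω (fun s : ℂ => t + s) 0 :=
      (contDiffAt_const.add contDiffAt_id).contMDiffAt
    have h2 : ContMDiffAt 𝓘(ℂ, ℂ) 𝓘(ℂ, Fin n → ℂ) ω f ((fun s : ℂ => t + s) 0) := by
      simpa [CurveHolAt] using hf
    exact ContMDiffAt.comp (0 : ℂ) h2 h1⟩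

variable {k}

/-- The base point in `X` of a jet. -/
def Jet.base (ξ : Jet n k X) : X :=
  Quotient.lift (s := jetSetoid n k X) (fun γ => γ.1 0) (fun _ _ H => H.1) ξ

open Classical in
/-- The jet coordinate `d^j h` of a function `h` that is holomorphic near the base point, for
`j ≤ k`, with the normalization of Taylor coefficients: `d^j h` takes the value
`(h ∘ γ)^(j) (0) / j!` on the jet of `γ`. -/
def Jet.coord (j : ℕ) (h : X → ℂ) (ξ : Jet n k X) : ℂ :=
  Quotient.lift (s := jetSetoid n k X)
    (fun γ => if HolAt n h (γ.1 0) ∧ j ≤ k then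
      iteratedDeriv j (h ∘ γ.1) 0 / (j.factorial : ℂ) else 0)
    (fun γ δ (H : γ.1 0 = δ.1 0 ∧ ∀ h : X → ℂ, HolAt n h (γ.1 0) → ∀ j ≤ k,
        iteratedDeriv j (h ∘ γ.1) 0 = iteratedDeriv j (h ∘ δ.1) 0) => by
      by_cases hh : HolAt n h (γ.1 0) ∧ j ≤ k
      · have hh' : HolAt n h (δ.1 0) ∧ j ≤ k := by rw [← H.1]; exact hh
        simp only [if_pos hh, if_pos hh', H.2 h hh.1 j hh.2]
      · have hh' : ¬ (HolAt n h (δ.1 0) ∧ j ≤ k) := by rw [← H.1]; exact hh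
        simp only [if_neg hh, if_neg hh']) ξ

/-- The `k`-th differential `J_k X → J_k X'` of a holomorphic map `φ : X → X'`: it sends the jet
of `γ` to the jet of `φ ∘ γ`. -/
def Jet.map {n' : ℕ} {X' : Type*} [TopologicalSpace X'] [ChartedSpace (Fin n' → ℂ) X']
    (φ : X → X') (hφ : Hol n n' φ) (ξ : Jet n k X) : Jet n' k X' :=
  Quotient.map (sa := jetSetoid n k X) (sb := jetSetoid n' k X')
    (fun γ => ⟨φ ∘ γ.1, (hφ (γ.1 0)).comp (0 : ℂ) γ.2⟩)
    (fun γ _ H => ⟨congrArg φ H.1, fun h hh j hj =>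
      H.2 (h ∘ φ) (ContMDiffAt.comp (γ.1 0) hh (hφ (γ.1 0))) j hj⟩) ξ

end Jets

/-! ## Orbifold jet differentials and orbifold jet spaces -/

section OrbifoldJets

variable {X Y : Type*} [TopologicalSpace X] [TopologicalSpace Y] {n : ℕ}
  [ChartedSpace (Fin n → ℂ) X] [ChartedSpace (Fin n → ℂ) Y] {ι : Type*}

/-- The pulled back jet space `π^* J_k X`. -/
def PullJet (n k : ℕ) {X Y : Type*} [TopologicalSpace X] [ChartedSpace (Fin n → ℂ) X]
    (π : Y → X) : Type _ :=
  {τ : Y × Jet n k X // τ.2.base = π τ.1}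

variable (k : ℕ) (P : OrbifoldPair n X ι) (π : Y → X)

/-- The filter on `π^* J_k X` of the neighbourhoods of the fibre over `y`, restricted to the
complement of `π ⁻¹ |Δ|`. -/
def fiberFilter (y : Y) : Filter (PullJet n k π) :=
  Filter.comap (fun τ => τ.1.1) (𝓝[(π ⁻¹' P.support)ᶜ] y)

/-- Germs near the fibre over `y` of functions on `π^* J_k X` over the complement of `π ⁻¹ |Δ|`. -/
abbrev FiberGerm (y : Y) : Type _ := Filter.Germ (fiberFilter k P π y) ℂ

/-- The germ at `y` of a function on `π^* J_k X`. -/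
def germAt (s : PullJet n k π → ℂ) (y : Y) : FiberGerm k P π y := (s : FiberGerm k P π y)

/-- A function on `Y`, seen as a function on `π^* J_k X`. -/
def ofBase (n : ℕ) {X Y : Type*} [TopologicalSpace X] [ChartedSpace (Fin n → ℂ) X] (π : Y → X)
    (h : Y → ℂ) : PullJet n k π → ℂ := fun τ => h τ.1.1

variable {P π} in
/-- The function `w_i ^ (-p_i (1 - j / m_i)⁺) π^* (d^j z_i)` on `π^* J_k X`, outside `π ⁻¹ |Δ|`. -/
def AdaptedChart.gen (C : AdaptedChart P π) (i : Fin n) (j : ℕ) : PullJet n k π → ℂ :=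
  fun τ => (C.w τ.1.1 i ^ C.poleOrder i j)⁻¹ * Jet.coord j (fun x => C.z x i) τ.1.2

/-- The stalk at `y` of the sheaf of `𝒪_Y`-algebras `⨁ N, E_{k,N} Ω_{π,Δ}` of orbifold jet
differentials of order `k`: it is generated, over the germs of holomorphic functions on `Y`, by the
elements `w_i ^ (-p_i (1 - j / m_i)⁺) π^* (d^j z_i)`, `1 ≤ j ≤ k`, in adapted coordinates. -/
def stalk (y : Y) : Subring (FiberGerm k P π y) :=
  Subring.closure
    ({q | ∃ h : Y → ℂ, HolAt n h y ∧ q = germAt k P π (ofBase k n π h) y} ∪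
     {q | ∃ (C : AdaptedChart P π) (i : Fin n) (j : ℕ), y ∈ C.w.source ∧ 1 ≤ j ∧ j ≤ k ∧
        q = germAt k P π (C.gen k i j) y})

theorem ofBase_mem_stalk {y : Y} {h : Y → ℂ} (hh : HolAt n h y) :
    germAt k P π (ofBase k n π h) y ∈ stalk k P π y :=
  Subring.subset_closure (Or.inl ⟨h, hh, rfl⟩)

theorem gen_mem_stalk {y : Y} (C : AdaptedChart P π) (hy : y ∈ C.w.source) (i : Fin n) {j : ℕ}
    (h1 : 1 ≤ j) (hk : j ≤ k) : germAt k P π (C.gen k i j) y ∈ stalk k P π y :=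
  Subring.subset_closure (Or.inr ⟨C, i, j, hy, h1, hk, rfl⟩)

/-- `s` is a section of the sheaf of orbifold jet differentials over the open set `U`. -/
def IsSection (U : Set Y) (s : PullJet n k π → ℂ) : Prop :=
  IsOpen U ∧ ∀ y ∈ U, germAt k P π s y ∈ stalk k P π y

/-- The orbifold jet space `J_k(π, Δ)`: the relative (analytic) spectrum over `Y` of the sheaf of
algebras of orbifold jet differentials. A point over `pt` is a ring homomorphism from the stalk to
`ℂ` that extends the evaluation at `pt` of holomorphic functions (so it is `ℂ`-linear). -/
structure OrbJet where
  pt : Y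
  ev : stalk k P π pt →+* ℂ
  ev_base : ∀ (h : Y → ℂ) (hh : HolAt n h pt),
    ev ⟨germAt k P π (ofBase k n π h) pt, ofBase_mem_stalk k P π hh⟩ = h pt

namespace OrbJet

variable {k P π}

open Classical in
/-- The value of an orbifold jet differential `s`, defined near `q.pt`, at the point `q`. -/
def eval (s : PullJet n k π → ℂ) (q : OrbJet k P π) : ℂ :=
  if h : germAt k P π s q.pt ∈ stalk k P π q.pt then q.ev ⟨_, h⟩ else 0

/-- The coarsest topology for which the projection to `Y` and all the local orbifold jet
differentials are continuous. In adapted coordinates it is the topology of `U × ℂ^(n k)`. -/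
instance : TopologicalSpace (OrbJet k P π) :=
  TopologicalSpace.generateFrom
    {O | ∃ (U : Set Y) (s : PullJet n k π → ℂ) (W : Set ℂ), IsSection k P π U s ∧ IsOpen W ∧
      O = {q | q.pt ∈ U ∧ eval s q ∈ W}}

/-- Holomorphic functions on `J_k(π, Δ)`: locally, they are holomorphic functions of finitely many
local orbifold jet differentials (which include the holomorphic functions on `Y`). -/
def HolFunAt (h : OrbJet k P π → ℂ) (q : OrbJet k P π) : Prop :=
  ∃ (U : Set Y) (r : ℕ) (s : Fin r → PullJet n k π → ℂ) (H : (Fin r → ℂ) → ℂ),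
    q.pt ∈ U ∧ (∀ i, IsSection k P π U (s i)) ∧ AnalyticAt ℂ H (fun i => eval (s i) q) ∧
      ∀ᶠ q' in 𝓝 q, h q' = H (fun i => eval (s i) q')

/-- Holomorphic maps between orbifold jet spaces: continuous maps which pull back
local orbifold jet differentials to holomorphic functions. -/
def HolMap {n' : ℕ} {X' Y' ι' : Type*} [TopologicalSpace X'] [TopologicalSpace Y']
    [ChartedSpace (Fin n' → ℂ) X'] [ChartedSpace (Fin n' → ℂ) Y'] {P' : OrbifoldPair n' X' ι'}
    {π' : Y' → X'} (F : OrbJet k P π → OrbJet k P' π') : Prop :=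
  Continuous F ∧ ∀ (U' : Set Y') (s' : PullJet n' k π' → ℂ), IsSection k P' π' U' s' →
    ∀ q, (F q).pt ∈ U' → HolFunAt (fun q' => eval s' (F q')) q

/-- Holomorphic maps from a Riemann surface `V` to an orbifold jet space. -/
def HolCurve {V : Type*} [TopologicalSpace V] [ChartedSpace ℂ V] (σ : V → OrbJet k P π) : Prop :=
  Continuous σ ∧ ∀ (U : Set Y) (s : PullJet n k π → ℂ), IsSection k P π U s →
    ∀ v, (σ v).pt ∈ U → ContMDiffAt 𝓘(ℂ, ℂ) 𝓘(ℂ, ℂ) ω (fun v' => eval s (σ v')) v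

/-- The image of `q` under the canonical map `J_k(π, Δ) → π^* J_k X` over `Y` is `(q.pt, ξ)`. This
map is dual to the inclusion of the functions `π^* (d^j z_i)` in the orbifold jet differentials,
`π^* (d^j z_i) = w_i ^ (p_i (1 - j / m_i)⁺) • (w_i ^ (-p_i (1 - j / m_i)⁺) π^* (d^j z_i))`. -/
def LiesOver (q : OrbJet k P π) (ξ : Jet n k X) : Prop :=
  ξ.base = π q.pt ∧ ∀ (C : AdaptedChart P π) (hC : q.pt ∈ C.w.source) (i : Fin n) (j : ℕ)
    (h1 : 1 ≤ j) (hk : j ≤ k),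
    Jet.coord j (fun x => C.z x i) ξ = C.w q.pt i ^ C.poleOrder i j *
      q.ev ⟨germAt k P π (C.gen k i j) q.pt, gen_mem_stalk k P π C hC i h1 hk⟩

end OrbJet

end OrbifoldJets

/-! ## Orbifold curves, orbifold morphisms, lifting diagrams -/

section Morphisms

variable {X Y : Type*} [TopologicalSpace X] [TopologicalSpace Y] {n : ℕ}
  [ChartedSpace (Fin n → ℂ) X] [ChartedSpace (Fin n → ℂ) Y] {ι : Type*}

/-- The holomorphic curve `f` on the disc of radius `r` is orbifold for the pair `P = (X, Δ)`: it is
not contained in `|Δ|`, and where it meets (a local branch `z_i = 0` of) `Δ_l` the intersection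
multiplicity is at least `m_l`. -/
structure IsOrbifoldCurve (P : OrbifoldPair n X ι) (r : ℝ) (f : ℂ → X) : Prop where
  hol : ∀ t ∈ Metric.ball (0 : ℂ) r, CurveHolAt n f t
  not_subset : ∃ t ∈ Metric.ball (0 : ℂ) r, f t ∉ P.support
  mult_le : ∀ t ∈ Metric.ball (0 : ℂ) r,
    ∀ (z : OpenPartialHomeomorph X (Fin n → ℂ)) (lab : Fin n → Option ι),
    IsNCChart n P.comp z lab → f t ∈ z.source → ∀ i l, lab i = some l → z (f t) i = 0 →
      P.mult (some l) ≤ ((analyticOrderAt (fun s => z (f s) i) t : ℕ∞) : ℝ≥0∞)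

/-- `φ : (X, Δ) → (X', Δ')` is an orbifold morphism: it is holomorphic, its image is not contained
in `|Δ'|`, and if a prime divisor `D` of `X` appears with multiplicity `t ≥ 1` in the pullback of a
component `Δ'_l` then `t * m_Δ(D) ≥ m'_l`. The prime divisor is given by its equation `z_i = 0` near
one of its points `x`, and `Δ'_l` by its equation `z'_i' = 0` near `φ x`: the multiplicity is `t` when
`z'_i' ∘ φ = z_i ^ t * u` with `u` not identically zero on `z_i = 0`. The orbifold multiplicity
`m_Δ(D)` is `1` if `D` is not contained in `Δ`. -/
structure IsOrbifoldMorphism {n' : ℕ} {X' ι' : Type*} [TopologicalSpace X']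
    [ChartedSpace (Fin n' → ℂ) X'] (P : OrbifoldPair n X ι) (P' : OrbifoldPair n' X' ι')
    (φ : X → X') : Prop where
  hol : Hol n n' φ
  not_subset : ¬ range φ ⊆ P'.support
  mult_le : ∀ (x : X) (z : OpenPartialHomeomorph X (Fin n → ℂ)) (lab : Fin n → Option ι)
    (z' : OpenPartialHomeomorph X' (Fin n' → ℂ)) (lab' : Fin n' → Option ι'),
    IsNCChart n P.comp z lab → x ∈ z.source →
    IsNCChart n' P'.comp z' lab' → φ x ∈ z'.source →
    ∀ (i : Fin n) (i' : Fin n') (l : ι'), z x i = 0 → lab' i' = some l →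
    ∀ (t : ℕ) (u : X → ℂ), 1 ≤ t → HolAt n u x →
      (∀ᶠ y in 𝓝 x, z' (φ y) i' = z y i ^ t * u y) →
      (∃ᶠ y in 𝓝 x, z y i = 0 ∧ u y ≠ 0) →
      P'.mult (some l) ≤ (t : ℝ≥0∞) * P.mult (lab i)

/-- A commutative diagram `π ∘ g = f ∘ ρ`, where `f` is a holomorphic curve on the disc of
radius `r`, `ρ` is a proper surjective holomorphic map from the Riemann surface `V` to this disc,
and `g : V → Y` is holomorphic. -/
structure IsLifting (n : ℕ) {X Y : Type*} [TopologicalSpace X] [TopologicalSpace Y]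
    [ChartedSpace (Fin n → ℂ) X] [ChartedSpace (Fin n → ℂ) Y] (π : Y → X) {r : ℝ} (f : ℂ → X)
    {V : Type*} [TopologicalSpace V] [ChartedSpace ℂ V]
    (ρ : V → Metric.ball (0 : ℂ) r) (g : V → Y) : Prop where
  f_hol : ∀ t ∈ Metric.ball (0 : ℂ) r, CurveHolAt n f t
  rho_hol : ContMDiff 𝓘(ℂ, ℂ) 𝓘(ℂ, ℂ) ω (fun v => (ρ v : ℂ))
  rho_proper : IsProperMap ρ
  rho_surj : Function.Surjective ρ
  g_hol : ContMDiff 𝓘(ℂ, ℂ) 𝓘(ℂ, Fin n → ℂ) ω g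
  comm : ∀ v, π (g v) = f (ρ v)

/-- `σ : V → J_k(π, Δ)` is the holomorphic map `j_k^⋆(g)` over `g`: its image in `π^* J_k X` is, at
`v`, the `k`-jet at `ρ v` of `f`, i.e. `(g, f' ∘ ρ, …, f^(k) ∘ ρ)`. -/
def IsJetLift {k : ℕ} {P : OrbifoldPair n X ι} {π : Y → X} {r : ℝ} (f : ℂ → X)
    (hf : ∀ t ∈ Metric.ball (0 : ℂ) r, CurveHolAt n f t)
    {V : Type*} [TopologicalSpace V] [ChartedSpace ℂ V]
    (ρ : V → Metric.ball (0 : ℂ) r) (g : V → Y) (σ : V → OrbJet k P π) : Prop :=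
  OrbJet.HolCurve σ ∧ ∀ v, (σ v).pt = g v ∧
    (σ v).LiesOver (Jet.ofCurve k f (ρ v) (hf _ (ρ v).2))

/-- `F : J_k(π, Δ) → J_k(π', Δ')` is holomorphic, lies over `φt : Y → Y'`, and coincides with (the
lift of) the `k`-th differential of `φ` outside of `Δ`. -/
def IsDifferential {n' : ℕ} {X' Y' ι' : Type*} [TopologicalSpace X'] [TopologicalSpace Y']
    [ChartedSpace (Fin n' → ℂ) X'] [ChartedSpace (Fin n' → ℂ) Y'] {k : ℕ}
    {P : OrbifoldPair n X ι} {π : Y → X} {P' : OrbifoldPair n' X' ι'} {π' : Y' → X'}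
    (φ : X → X') (hφ : Hol n n' φ) (φt : Y → Y') (F : OrbJet k P π → OrbJet k P' π') : Prop :=
  OrbJet.HolMap F ∧ (∀ q, (F q).pt = φt q.pt) ∧
    ∀ q : OrbJet k P π, π q.pt ∉ P.support →
      ∃ ξ : Jet n k X, q.LiesOver ξ ∧ (F q).LiesOver (Jet.map φ hφ ξ)

theorem CurveHolAt.comp {n' : ℕ} {X' : Type*} [TopologicalSpace X'] [ChartedSpace (Fin n' → ℂ) X']
    {φ : X → X'} (hφ : Hol n n' φ) {f : ℂ → X} {t : ℂ} (hf : CurveHolAt n f t) :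
    CurveHolAt n' (φ ∘ f) t :=
  ContMDiffAt.comp t (hφ (f t)) hf

end Morphisms

end

end OrbiJet

/-! In adapted coordinates `J_k(π, Δ)` is a product of a coordinate domain of `Y` with `ℂ^(nk)`. The
stalk consists of the polynomials, with holomorphic coefficients, in the generators
`w_i^(-p_i(1-j/m_i)⁺) d^j z_i`, and these satisfy no relation (`exists_polyFun`,
`OrbJet.exists_pt_coords`). Hence `φ_*` exists as soon as the generators of the target pull back to
such polynomials. Uniqueness, and independence of charts, follow by continuity: outside the divisors
a point is determined by its jet, and the set of points to be discarded is nowhere dense.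

Let `z'` be an equation of a branch of `Δ'`, `Ψ = z' ∘ φ`, and let `W` be the matching coordinate of
`φt`, so that `W^p' = Ψ ∘ π`. By the chain rule the `j`-th Taylor coefficient of `Ψ` along a curve
is a polynomial in the generators, and it has to be divided by `W^(p'(1-j/m')⁺)`. Divisibility can
be checked in codimension one (`germDvd_of_nice`), at points where `W ∏ w_i = 0` is a smooth
hypersurface. On `w_i = 0` one has `Ψ = z_i^t u` and `W = w_i^N U` with units `u`, `U`, and `p_i t =
N p'`. The product rule makes the `j`-th coefficient divisible by `w_i^((p_i/a_i)(t a_i - j b_i)⁺)`,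
and the orbifold condition `t m_i ≥ m'` says that this is enough (`weight_le`). Off the coordinate
hyperplanes `w ↦ w^p` is a local isomorphism and the same argument applies with multiplicity one.
This is `exists_divided_rep` and `exists_differential_rep`. Applied to the identity of `X`, it also
compares two adapted charts.

Adapted coordinates exist (`exists_adaptedChart`) because the components of `π` along the branch
locus are monomials times units. Their logarithmic Jacobian can only vanish on coordinate
hyperplanes, and it is not identically zero on any of them, since a map with finite fibres is
generically immersive there; so it is invertible. This leaves a single hyperplane over each branch
component, and roots of the units give the coordinates.

For a lifted curve, divisibility is an inequality between orders of vanishing in one variable,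
supplied by the contact condition (`exists_iteratedDeriv_quotient`).

The facts about several variables come from one device: the average of `c / A` over a circle in a
complex line is analytic in the centre (`exists_circle_extension`). -/

namespace OrbiJet

/-! ## Several complex variables -/

/-! ### Averages over circles in complex lines. -/

section SeveralVariables

variable {E : Type*} [NormedAddCommGroup E] [NormedSpace ℂ E]

/-- The pointwise action of a continuous multilinear form on continuous maps. -/
noncomputable def pointwiseMultilinear (K : Type*) [TopologicalSpace K] [CompactSpace K] {k : ℕ}
    (p : ContinuousMultilinearMap ℂ (fun _ : Fin k => E) ℂ) :
    ContinuousMultilinearMap ℂ (fun _ : Fin k => C(K, E)) C(K, ℂ) :=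
  MultilinearMap.mkContinuous
    { toFun := fun m => ⟨fun x => p (fun i => m i x),
        p.cont.comp (continuous_pi fun i => (m i).continuous)⟩
      map_update_add' := by
        intro _ m i a b
        ext x
        have h : ∀ c : C(K, E), (fun j => (Function.update m i c) j x) =
            Function.update (fun j => m j x) i (c x) := by
          intro c; ext j; by_cases hj : j = i
          · subst hj; simp
          · simp [hj]
        simp [h]
      map_update_smul' := by
        intro _ m i a b
        ext x
        have h : ∀ c : C(K, E), (fun j => (Function.update m i c) j x) =
            Function.update (fun j => m j x) i (c x) := by
          intro c; ext j; by_cases hj : j = i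
          · subst hj; simp
          · simp [hj]
        simp [h] }
    ‖p‖ (by
      intro m
      rw [ContinuousMap.norm_le _ (by positivity)]
      intro x
      refine (p.le_opNorm _).trans ?_
      gcongr with i
      exact (m i).norm_coe_le_norm x)

/-- The power series of `f`, applied pointwise, has coefficients of norm at most those of `f`, so it
converges on balls of the Banach space `C(K, E)`. This makes parameter integrals analytic without
differentiating under the integral sign. -/
theorem exists_superposition (K : Type*) [TopologicalSpace K] [CompactSpace K]
    {f : E → ℂ} {w₀ : E} (hf : AnalyticAt ℂ f w₀) :
    ∃ r > 0, ∃ N : C(K, E) → C(K, ℂ), AnalyticOnNhd ℂ N (Metric.ball 0 r) ∧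
      ∀ x ∈ Metric.ball (0 : C(K, E)) r, ∀ t, N x t = f (w₀ + x t) := by
  obtain ⟨p, r₀, hp⟩ := hf
  let q : FormalMultilinearSeries ℂ C(K, E) C(K, ℂ) := fun k => pointwiseMultilinear K (p k)
  have hqp : ∀ k, ‖q k‖ ≤ ‖p k‖ := fun k =>
    MultilinearMap.mkContinuous_norm_le _ (norm_nonneg _) _
  have hrad : r₀ ≤ q.radius := by
    refine hp.r_le.trans ?_
    exact FormalMultilinearSeries.radius_le_of_le (fun {k} => hqp k)
  have hq := q.hasFPowerSeriesOnBall (hp.r_pos.trans_le hrad)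
  obtain ⟨r, hr0, hr⟩ := ENNReal.lt_iff_exists_nnreal_btwn.1 hp.r_pos
  refine ⟨r, by exact_mod_cast hr0, q.sum, ?_, ?_⟩
  · intro x hx
    refine hq.analyticOnNhd x ?_
    rw [Metric.mem_ball, dist_zero_right] at hx
    have : ‖x‖ₑ < r := by
      rw [enorm_eq_nnnorm]; exact_mod_cast hx
    have h2 := this.trans (hr.trans_le hrad)
    simpa [Metric.mem_eball, edist_zero_right] using h2
  · intro x hx t
    rw [Metric.mem_ball, dist_zero_right] at hx
    have h1 : ‖x‖ₑ < r := by
      rw [enorm_eq_nnnorm]; exact_mod_cast hx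
    have h2 := h1.trans (hr.trans_le hrad)
    have h3 : HasSum (fun k => q k fun _ => x) (q.sum x) := by
      have := hq.hasSum (y := x) (by simpa [Metric.mem_eball, edist_zero_right] using h2)
      simpa using this
    have h4 : HasSum (fun k => (q k fun _ => x) t) (q.sum x t) :=
      h3.mapL (ContinuousMap.evalCLM ℂ t)
    have h5 : ‖x t‖ₑ < r₀ := by
      refine lt_of_le_of_lt ?_ (h1.trans hr)
      rw [enorm_eq_nnnorm, enorm_eq_nnnorm]
      exact_mod_cast x.norm_coe_le_norm t
    have h6 := hp.hasSum (y := x t) (by simpa [Metric.mem_eball, edist_zero_right] using h5)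
    exact h4.unique h6

/-- Averaging over the unit circle. -/
noncomputable def circleMean : C(Circle, ℂ) →L[ℂ] ℂ :=
  LinearMap.mkContinuous
    { toFun := fun f => (2 * Real.pi : ℂ)⁻¹ * ∫ θ in (0 : ℝ)..2 * Real.pi, f (Circle.exp θ)
      map_add' := by
        intro f g
        rw [← mul_add, ← intervalIntegral.integral_add]
        · rfl
        · exact (f.continuous.comp Circle.exp.continuous).intervalIntegrable _ _
        · exact (g.continuous.comp Circle.exp.continuous).intervalIntegrable _ _
      map_smul' := by
        intro c f
        simp only [ContinuousMap.coe_smul, Pi.smul_apply, smul_eq_mul, RingHom.id_apply]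
        rw [intervalIntegral.integral_const_mul]
        ring }
    1 (by
      intro f
      have h : ‖∫ θ in (0 : ℝ)..2 * Real.pi, f (Circle.exp θ)‖ ≤ ‖f‖ * |2 * Real.pi - 0| :=
        intervalIntegral.norm_integral_le_of_norm_le_const (fun θ _ => f.norm_coe_le_norm _)
      have hpi := Real.pi_pos
      simp only [LinearMap.coe_mk, AddHom.coe_mk, norm_mul, norm_inv, Complex.norm_real,
        Complex.norm_ofNat, one_mul]
      rw [sub_zero, abs_of_pos (by positivity)] at h
      rw [Real.norm_of_nonneg hpi.le, inv_mul_le_iff₀ (by positivity)]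
      linarith [h])

theorem circleMean_eq {f : C(Circle, ℂ)} {Q : ℂ → ℂ}
    (hQ : ∀ t ∈ Metric.closedBall (0 : ℂ) 1, AnalyticAt ℂ Q t)
    (h : ∀ t : Circle, f t = Q t) : circleMean f = Q 0 := by
  have h1 : DiffContOnCl ℂ Q (Metric.ball 0 |1|) := by
    refine DifferentiableOn.diffContOnCl ?_
    intro t ht
    refine (hQ t ?_).differentiableAt.differentiableWithinAt
    have := Metric.closure_ball_subset_closedBall ht
    simpa using this
  rw [← h1.circleAverage, Real.circleAverage]
  simp only [circleMean, LinearMap.mkContinuous_apply, LinearMap.coe_mk, AddHom.coe_mk,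
    Complex.real_smul]
  congr 1
  · push_cast; rfl
  · refine intervalIntegral.integral_congr fun θ _ => ?_
    simp [h, circleMap, Circle.coe_exp]

/-- `g` averages `c / A` over the circle `‖t‖ = 1` in the line `w + t d`. It is composed of
superposition operators, inversion in the Banach algebra `C(Circle, ℂ)` and a continuous linear
form, so only zeros of `A` on the circle matter for its analyticity. When the quotient extends over
the disc, the mean value property identifies `g` with its value at the centre. Since `r` does not
depend on `d`, the direction may be rescaled later. -/
theorem exists_circle_extension {c A : E → ℂ} {w₀ : E} (hc : AnalyticAt ℂ c w₀)
    (hA : AnalyticAt ℂ A w₀) :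
    ∃ r > 0, ∀ d : E, ∃ g : E → ℂ, ∀ w₁ : E, ‖w₁ - w₀‖ + ‖d‖ < r →
      (∀ t : ℂ, ‖t‖ = 1 → A (w₁ + t • d) ≠ 0) → AnalyticAt ℂ g w₁ ∧
      ∀ Q : ℂ → ℂ, (∀ t ∈ Metric.closedBall (0 : ℂ) 1, AnalyticAt ℂ Q t) →
        (∀ t : ℂ, ‖t‖ = 1 → Q t * A (w₁ + t • d) = c (w₁ + t • d)) → g w₁ = Q 0 := by
  obtain ⟨r₁, hr₁, N₁, hN₁, hN₁'⟩ := exists_superposition Circle hc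
  obtain ⟨r₂, hr₂, N₂, hN₂, hN₂'⟩ := exists_superposition Circle hA
  refine ⟨min r₁ r₂, lt_min hr₁ hr₂, fun d => ?_⟩
  let δ : C(Circle, E) := ⟨fun t => (t : ℂ) • d, by fun_prop⟩
  have hδ : ‖δ‖ ≤ ‖d‖ := by
    rw [ContinuousMap.norm_le _ (norm_nonneg _)]
    intro t
    simp [δ, norm_smul, Circle.norm_coe]
  let ι : E →L[ℂ] C(Circle, E) := ContinuousLinearMap.const ℂ Circle
  let x : E → C(Circle, E) := fun w => ι (w - w₀) + δ
  have hx : ∀ w t, x w t = (w - w₀) + (t : ℂ) • d := fun w t => rfl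
  have hxn : ∀ w, ‖w - w₀‖ + ‖d‖ < min r₁ r₂ → ‖x w‖ < min r₁ r₂ := by
    intro w hw
    refine lt_of_le_of_lt ?_ hw
    rw [ContinuousMap.norm_le _ (by positivity)]
    intro t
    rw [hx]
    refine (norm_add_le _ _).trans ?_
    simp [norm_smul, Circle.norm_coe]
  have hxa : ∀ w, AnalyticAt ℂ x w := by
    intro w
    exact ((ι.analyticAt _).comp (analyticAt_id.sub analyticAt_const)).add analyticAt_const
  refine ⟨fun w => circleMean (N₁ (x w) * Ring.inverse (N₂ (x w))), fun w₁ hw₁ hne => ?_⟩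
  have hb := hxn w₁ hw₁
  have hb1 : x w₁ ∈ Metric.ball (0 : C(Circle, E)) r₁ := by
    simpa using hb.trans_le (min_le_left _ _)
  have hb2 : x w₁ ∈ Metric.ball (0 : C(Circle, E)) r₂ := by
    simpa using hb.trans_le (min_le_right _ _)
  have hval : ∀ t : Circle, N₂ (x w₁) t = A (w₁ + (t : ℂ) • d) := by
    intro t; rw [hN₂' _ hb2, hx]; congr 1; abel
  have hval1 : ∀ t : Circle, N₁ (x w₁) t = c (w₁ + (t : ℂ) • d) := by
    intro t; rw [hN₁' _ hb1, hx]; congr 1; abel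
  have hunit : IsUnit (N₂ (x w₁)) := by
    rw [ContinuousMap.isUnit_iff_forall_ne_zero]
    intro t
    rw [hval]
    exact hne t (Circle.norm_coe t)
  constructor
  · refine (circleMean.analyticAt _).comp (AnalyticAt.mul ?_ ?_)
    · exact (hN₁ _ hb1).comp (hxa w₁)
    · obtain ⟨u, hu⟩ := hunit
      refine AnalyticAt.comp (g := Ring.inverse) ?_ ((hN₂ _ hb2).comp (hxa w₁))
      have := analyticAt_inverse (𝕜 := ℂ) u
      rw [hu] at this
      exact this
  · intro Q hQ hQA
    refine circleMean_eq hQ fun t => ?_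
    have h1 : N₂ (x w₁) * Ring.inverse (N₂ (x w₁)) = 1 := Ring.mul_inverse_cancel _ hunit
    have h2 : N₂ (x w₁) t * Ring.inverse (N₂ (x w₁)) t = 1 := by
      have := congrArg (fun f : C(Circle, ℂ) => f t) h1
      simpa using this
    rw [ContinuousMap.mul_apply, hval1, ← hQA t (Circle.norm_coe t), ← hval, mul_assoc, h2, mul_one]

end SeveralVariables

/-! ### Orders along lines, and division by the equation of a smooth hypersurface. -/

section SeveralVariables

variable {E : Type*} [NormedAddCommGroup E] [NormedSpace ℂ E]

theorem exists_quotient_of_order_le {f τ : ℂ → ℂ} {t : ℂ} (hf : AnalyticAt ℂ f t)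
    (hτ : AnalyticAt ℂ τ t) (hτ' : analyticOrderAt τ t ≠ ⊤)
    (h : analyticOrderAt τ t ≤ analyticOrderAt f t) :
    ∃ q : ℂ → ℂ, AnalyticAt ℂ q t ∧ ∀ᶠ s in 𝓝 t, f s = q s * τ s := by
  obtain ⟨m, hm⟩ := ENat.ne_top_iff_exists.1 hτ'
  obtain ⟨τ₂, h2, h20, h2e⟩ := (hτ.analyticOrderAt_eq_natCast).1 hm.symm
  rw [← hm] at h
  obtain ⟨f₂, h3, h3e⟩ := (natCast_le_analyticOrderAt hf).1 h
  refine ⟨fun s => f₂ s / τ₂ s, h3.div h2 h20, ?_⟩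
  filter_upwards [h2e, h3e, h2.continuousAt.eventually_ne h20] with s a b c
  rw [a, b]
  simp only [smul_eq_mul]
  field_simp

/-- Local quotients of functions of one variable glue. -/
theorem exists_glue_quotient {f τ : ℂ → ℂ} {K : Set ℂ}
    (hτ : ∀ t ∈ K, AnalyticAt ℂ τ t ∧ analyticOrderAt τ t ≠ ⊤)
    (h : ∀ t ∈ K, ∃ q : ℂ → ℂ, AnalyticAt ℂ q t ∧ ∀ᶠ s in 𝓝 t, f s = q s * τ s) :
    ∃ Q : ℂ → ℂ, ∀ t ∈ K, AnalyticAt ℂ Q t ∧ Q t * τ t = f t := by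
  classical
  choose! q hq hq' using h
  -- Away from the zeros of `τ` the quotient is forced; at a zero, which is isolated, the value is
  -- that of the local quotient chosen there.
  refine ⟨fun t => if τ t = 0 then q t t else f t / τ t, fun t ht => ?_⟩
  have hne : ∀ᶠ s in 𝓝[≠] t, τ s ≠ 0 := by
    rcases (hτ t ht).1.eventually_eq_zero_or_eventually_ne_zero with h | h
    · exact absurd (analyticOrderAt_eq_top.2 h) (hτ t ht).2
    · exact h
  have key : (fun t => if τ t = 0 then q t t else f t / τ t) =ᶠ[𝓝 t] q t := by
    rw [eventually_nhdsWithin_iff] at hne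
    filter_upwards [hne, hq' t ht] with s h1 h2
    by_cases hs : s = t
    · subst hs
      by_cases h0 : τ s = 0
      · simp [h0]
      · simp only [h0, if_false, h2]; field_simp
    · have h0 := h1 hs
      simp only [h0, if_false, h2]; field_simp
  refine ⟨(hq t ht).congr key.symm, ?_⟩
  have h1 := key.self_of_nhds
  have h2 := (hq' t ht).self_of_nhds
  rw [h2, ← h1]

/-- The order at `w` of the restriction of `f` to the line through `w` with direction `d`. -/
noncomputable def lineOrder (d : E) (f : E → ℂ) (w : E) : ℕ∞ :=
  analyticOrderAt (fun t : ℂ => f (w + t • d)) 0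

theorem analyticAt_line {f : E → ℂ} {w d : E} {t : ℂ} (hf : AnalyticAt ℂ f (w + t • d)) :
    AnalyticAt ℂ (fun t : ℂ => f (w + t • d)) t := by
  refine AnalyticAt.fun_comp hf ?_
  exact analyticAt_const.add (analyticAt_id.smul analyticAt_const)

theorem analyticAt_line_zero {f : E → ℂ} {w d : E} (hf : AnalyticAt ℂ f w) :
    AnalyticAt ℂ (fun t : ℂ => f (w + t • d)) 0 :=
  analyticAt_line (by simpa using hf)

theorem tendsto_line (w d : E) : Tendsto (fun t : ℂ => w + t • d) (𝓝 0) (𝓝 w) := by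
  have : Continuous fun t : ℂ => w + t • d := by fun_prop
  simpa using this.tendsto 0

theorem analyticOrderAt_line (f : E → ℂ) (w d : E) (t : ℂ) :
    analyticOrderAt (fun t : ℂ => f (w + t • d)) t = lineOrder d f (w + t • d) := by
  have h := analyticOrderAt_comp_of_deriv_ne_zero (f := fun t : ℂ => f (w + t • d))
    (g := fun s : ℂ => t + s) (z₀ := 0) (by fun_prop) (by simp)
  simp only [add_zero] at h
  rw [← h, lineOrder]
  congr 1
  ext s
  simp [add_smul, add_assoc]

theorem lineOrder_congr {f g : E → ℂ} {w : E} (d : E) (h : f =ᶠ[𝓝 w] g) :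
    lineOrder d f w = lineOrder d g w :=
  analyticOrderAt_congr ((tendsto_line w d).eventually h)

theorem lineOrder_mul {f g : E → ℂ} {w : E} (d : E) (hf : AnalyticAt ℂ f w)
    (hg : AnalyticAt ℂ g w) :
    lineOrder d (fun w => f w * g w) w = lineOrder d f w + lineOrder d g w :=
  analyticOrderAt_mul (analyticAt_line_zero hf) (analyticAt_line_zero hg)

theorem lineOrder_pow {f : E → ℂ} {w : E} (d : E) (hf : AnalyticAt ℂ f w) (n : ℕ) :
    lineOrder d (fun w => f w ^ n) w = n • lineOrder d f w :=
  analyticOrderAt_pow (analyticAt_line_zero hf) n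

theorem lineOrder_eq_zero {f : E → ℂ} {w : E} (d : E) (hf : AnalyticAt ℂ f w) :
    lineOrder d f w = 0 ↔ f w ≠ 0 := by
  rw [lineOrder, (analyticAt_line_zero hf).analyticOrderAt_eq_zero]
  simp

theorem deriv_line {f : E → ℂ} {w d : E} {t : ℂ} (hf : AnalyticAt ℂ f (w + t • d)) :
    deriv (fun t : ℂ => f (w + t • d)) t = fderiv ℂ f (w + t • d) d := by
  have h1 : HasDerivAt (fun t : ℂ => w + t • d) d t := by
    simpa using ((hasDerivAt_id t).smul_const d).const_add w
  exact (hf.differentiableAt.hasFDerivAt.comp_hasDerivAt t h1).deriv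

theorem lineOrder_eq_one {f : E → ℂ} {w d : E} (hf : AnalyticAt ℂ f w) (h0 : f w = 0)
    (hd : fderiv ℂ f w d ≠ 0) : lineOrder d f w = 1 := by
  refine (analyticAt_line_zero hf).analyticOrderAt_eq_one_of_zero_deriv_ne_zero (by simpa) ?_
  rw [deriv_line (by simpa using hf)]
  simpa using hd

theorem analyticAt_fderiv_apply {f : E → ℂ} {w : E} (hf : AnalyticAt ℂ f w) (d : E) :
    AnalyticAt ℂ (fun w => fderiv ℂ f w d) w :=
  ((ContinuousLinearMap.apply ℂ ℂ d).analyticAt _).fun_comp hf.fderiv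

/-- Differentiation along the line is the operator `f ↦ fderiv ℂ f · d`, which preserves
analyticity; the induction replaces `f` by its directional derivative. -/
theorem analyticAt_iteratedDeriv_line {f : E → ℂ} {w d : E} (hf : AnalyticAt ℂ f w) (j : ℕ) :
    AnalyticAt ℂ (fun w => iteratedDeriv j (fun t : ℂ => f (w + t • d)) 0) w := by
  induction j generalizing f with
  | zero => simpa using hf
  | succ j ih =>
    refine (ih (analyticAt_fderiv_apply hf d)).congr ?_
    filter_upwards [hf.eventually_analyticAt] with w' hw'
    rw [iteratedDeriv_succ']
    refine (Filter.EventuallyEq.iteratedDeriv_eq j ?_).symm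
    filter_upwards [(tendsto_line w' d).eventually hw'.eventually_analyticAt] with t ht
    exact deriv_line ht

theorem fderiv_iteratedDeriv_line {f : E → ℂ} {w d : E} (hf : AnalyticAt ℂ f w) (j : ℕ) :
    fderiv ℂ (fun w => iteratedDeriv j (fun t : ℂ => f (w + t • d)) 0) w d =
      iteratedDeriv (j + 1) (fun t : ℂ => f (w + t • d)) 0 := by
  have h := deriv_line (t := 0) (d := d) (w := w)
    (by simpa using analyticAt_iteratedDeriv_line (d := d) hf j)
  simp only [zero_smul, add_zero] at h
  rw [← h, iteratedDeriv_succ]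
  congr 1
  ext s
  have := congrFun (iteratedDeriv_comp_const_add j (fun t : ℂ => f (w + t • d)) s) 0
  simp only [add_zero] at this
  rw [← this]
  congr 1
  ext t
  simp [add_smul, add_assoc]

/-- A tube lemma for the compact set of parameters. -/
theorem eventually_forall_line {p : E → Prop} {w d : E} {K : Set ℂ} (hK : IsCompact K)
    (h : ∀ t ∈ K, ∀ᶠ w' in 𝓝 (w + t • d), p w') : ∀ᶠ w' in 𝓝 w, ∀ t ∈ K, p (w' + t • d) := by
  refine hK.eventually_forall_of_forall_eventually fun t ht => ?_
  have hc : Tendsto (fun z : E × ℂ => z.1 + z.2 • d) (𝓝 (w, t)) (𝓝 (w + t • d)) := by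
    have : Continuous fun z : E × ℂ => z.1 + z.2 • d := by fun_prop
    exact this.tendsto (w, t)
  exact hc.eventually (h t ht)

/-- Strict differentiability bounds the deviation of `τ (w' + t d) - τ w'` from `t dτ(d)` by half of
`|t| |dτ(d)|`. Thus lines in the direction `d` meet each level set of `τ` at most once near `w`. -/
theorem exists_injective_line {τ : E → ℂ} {w d : E} (hτ : AnalyticAt ℂ τ w)
    (hd : fderiv ℂ τ w d ≠ 0) :
    ∃ ρ > 0, ∀ w' (t : ℂ), w' ∈ Metric.ball w ρ → w' + t • d ∈ Metric.ball w ρ →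
      τ (w' + t • d) = τ w' → t = 0 := by
  have hs := hτ.hasStrictFDerivAt
  have hd0 : d ≠ 0 := by rintro rfl; simp at hd
  have hpos : 0 < ‖fderiv ℂ τ w d‖ / (2 * ‖d‖) := by positivity
  have hev := hs.isLittleO.def hpos
  rw [nhds_prod_eq] at hev
  obtain ⟨U, hU, V, hV, hV'⟩ := Filter.eventually_prod_iff.1 hev
  obtain ⟨ρ, hρ, hb⟩ := Metric.eventually_nhds_iff_ball.1 (hU.and hV)
  refine ⟨ρ, hρ, fun w' t h1 h2 h => ?_⟩
  have h3 := hV' (hb _ h2).1 (hb _ h1).2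
  simp only [add_sub_cancel_left, h, sub_self, zero_sub, norm_neg, map_smul, smul_eq_mul,
    norm_mul, norm_smul] at h3
  have h4 : ‖fderiv ℂ τ w d‖ / (2 * ‖d‖) * (‖t‖ * ‖d‖) = ‖t‖ * ‖fderiv ℂ τ w d‖ / 2 := by
    field_simp
  rw [h4] at h3
  have h5 : 0 < ‖fderiv ℂ τ w d‖ := by positivity
  by_contra ht
  have h6 : 0 < ‖t‖ := by positivity
  nlinarith [mul_pos h6 h5]

/-- A function vanishing on the smooth hypersurface `τ = 0` is divisible by `τ`. -/
theorem exists_eq_mul_of_eq_zero {f τ : E → ℂ} {w d : E} (hf : AnalyticAt ℂ f w)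
    (hτ : AnalyticAt ℂ τ w) (hτ0 : τ w = 0) (hd : fderiv ℂ τ w d ≠ 0)
    (h : ∀ᶠ w' in 𝓝 w, τ w' = 0 → f w' = 0) :
    ∃ g, AnalyticAt ℂ g w ∧ ∀ᶠ w' in 𝓝 w, f w' = τ w' * g w' := by
  obtain ⟨r, hr, hcirc⟩ := exists_circle_extension hf hτ
  obtain ⟨ρ, hρ, hinj⟩ := exists_injective_line hτ hd
  have hd' : ∀ᶠ w' in 𝓝 w, fderiv ℂ τ w' d ≠ 0 :=
    (analyticAt_fderiv_apply hτ d).continuousAt.eventually_ne hd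
  obtain ⟨σ, hσ, hb⟩ := Metric.eventually_nhds_iff_ball.1
    (hf.eventually_analyticAt.and (hτ.eventually_analyticAt.and (h.and hd')))
  have hd0 : d ≠ 0 := by rintro rfl; simp at hd
  -- Within `R` the averaging lemma, injectivity on lines, and the analyticity and vanishing
  -- hypotheses are all available.
  set R := min r (min ρ σ) with hR
  have hR0 : 0 < R := lt_min hr (lt_min hρ hσ)
  obtain ⟨η, hη0, hη⟩ : ∃ η : ℝ, 0 < η ∧ η * ‖d‖ < R / 2 := by
    refine ⟨R / 4 / ‖d‖, by positivity, ?_⟩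
    field_simp; norm_num
  set e : E := (η : ℂ) • d with he
  have hen : ‖e‖ < R / 2 := by
    rw [he, norm_smul, Complex.norm_real, Real.norm_of_nonneg hη0.le]; exact hη
  have hmem : ∀ w' ∈ Metric.ball w (R / 2), ∀ t : ℂ, ‖t‖ ≤ 1 → w' + t • e ∈ Metric.ball w R := by
    intro w' hw' t ht
    rw [Metric.mem_ball, dist_eq_norm] at hw' ⊢
    have : ‖t • e‖ ≤ ‖e‖ := by
      rw [norm_smul]; exact mul_le_of_le_one_left (norm_nonneg _) ht
    calc ‖w' + t • e - w‖ = ‖(w' - w) + t • e‖ := by congr 1; abel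
      _ ≤ _ := norm_add_le _ _
      _ < R := by linarith
  have hRρ : Metric.ball w R ⊆ Metric.ball w ρ :=
    Metric.ball_subset_ball ((min_le_right _ _).trans (min_le_left _ _))
  have hRσ : Metric.ball w R ⊆ Metric.ball w σ :=
    Metric.ball_subset_ball ((min_le_right _ _).trans (min_le_right _ _))
  have hηc : (η : ℂ) ≠ 0 := by exact_mod_cast hη0.ne'
  have hinj' : ∀ w' ∈ Metric.ball w R, ∀ t : ℂ, w' + t • e ∈ Metric.ball w R →
      τ (w' + t • e) = τ w' → t = 0 := by
    intro w' hw' t ht hh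
    rw [he, smul_smul] at ht hh
    have := hinj w' (t * η) (hRρ hw') (hRρ ht) hh
    simpa [hηc] using this
  have hw0 : w ∈ Metric.ball w (R / 2) := Metric.mem_ball_self (by positivity)
  have hde : ∀ w' ∈ Metric.ball w R, fderiv ℂ τ w' e ≠ 0 := by
    intro w' hw'
    rw [he, map_smul, smul_eq_mul]
    exact mul_ne_zero hηc (hb _ (hRσ hw')).2.2.2
  -- On the line through `w` the only zero of `τ` is `t = 0`, which is not on the circle;
  -- compactness extends this to the nearby lines.
  have hne : ∀ᶠ w' in 𝓝 w, ∀ t ∈ Metric.sphere (0 : ℂ) 1, τ (w' + t • e) ≠ 0 := by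
    refine eventually_forall_line (p := fun w => τ w ≠ 0) (isCompact_sphere _ _) fun t ht => ?_
    rw [mem_sphere_zero_iff_norm] at ht
    have h1 := hmem w hw0 t ht.le
    refine (hb _ (hRσ h1)).2.1.continuousAt.eventually_ne fun h0 => ?_
    have := hinj' w (Metric.mem_ball_self hR0) t h1 (by rw [h0, hτ0])
    simp [this] at ht
  obtain ⟨g, hg⟩ := hcirc e
  have hlarge : ∀ w' ∈ Metric.ball w (R / 2), ‖w' - w‖ + ‖e‖ < r := by
    intro w' hw'
    rw [Metric.mem_ball, dist_eq_norm] at hw'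
    have : R ≤ r := min_le_left _ _
    linarith
  refine ⟨g, (hg w (hlarge w hw0) fun t ht => hne.self_of_nhds t (by simpa using ht)).1, ?_⟩
  filter_upwards [hne, Metric.ball_mem_nhds w (by positivity : 0 < R / 2)] with w' h1 h2
  -- On each line `f / τ` extends over the disc: the zeros of `τ` are simple there, and `f` vanishes
  -- at them.
  obtain ⟨Q, hQ⟩ := exists_glue_quotient (f := fun t : ℂ => f (w' + t • e))
    (τ := fun t : ℂ => τ (w' + t • e)) (K := Metric.closedBall 0 1) (fun t ht => by
      rw [mem_closedBall_zero_iff] at ht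
      have h3 := hmem w' h2 t ht
      have h4 := hb _ (hRσ h3)
      refine ⟨analyticAt_line h4.2.1, ?_⟩
      rw [analyticOrderAt_line]
      by_cases h5 : τ (w' + t • e) = 0
      · rw [lineOrder_eq_one h4.2.1 h5 (hde _ h3)]; simp
      · rw [(lineOrder_eq_zero e h4.2.1).2 h5]; simp) (fun t ht => by
      rw [mem_closedBall_zero_iff] at ht
      have h3 := hmem w' h2 t ht
      have h4 := hb _ (hRσ h3)
      by_cases h5 : τ (w' + t • e) = 0
      · refine exists_quotient_of_order_le (analyticAt_line h4.1) (analyticAt_line h4.2.1) ?_ ?_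
        · rw [analyticOrderAt_line, lineOrder_eq_one h4.2.1 h5 (hde _ h3)]; simp
        · rw [analyticOrderAt_line, lineOrder_eq_one h4.2.1 h5 (hde _ h3)]
          rw [Order.one_le_iff_ne_zero, Ne, (analyticAt_line h4.1).analyticOrderAt_eq_zero, not_not]
          exact h4.2.2.1 h5
      · refine exists_quotient_of_order_le (analyticAt_line h4.1) (analyticAt_line h4.2.1) ?_ ?_
        · rw [analyticOrderAt_line, (lineOrder_eq_zero e h4.2.1).2 h5]; simp
        · rw [analyticOrderAt_line, (lineOrder_eq_zero e h4.2.1).2 h5]; simp)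
  have h3 := (hg w' (hlarge w' h2) fun t ht => h1 t (by simpa using ht)).2 Q
    (fun t ht => (hQ t ht).1) (fun t ht => (hQ t (by simp [ht])).2)
  have h4 := (hQ 0 (by simp)).2
  simp only [zero_smul, add_zero] at h4
  rw [h3, mul_comm, h4]

/-- Since `d` is transverse to `τ = 0`, each division by `τ` lowers the order along `d` by exactly
one at the zeros of `τ`. -/
theorem exists_eq_pow_mul_of_le_lineOrder {f τ : E → ℂ} {w d : E} (hf : AnalyticAt ℂ f w)
    (hτ : AnalyticAt ℂ τ w) (hτ0 : τ w = 0) (hd : fderiv ℂ τ w d ≠ 0) (m : ℕ)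
    (h : ∀ᶠ w' in 𝓝 w, τ w' = 0 → (m : ℕ∞) ≤ lineOrder d f w') :
    ∃ g, AnalyticAt ℂ g w ∧ ∀ᶠ w' in 𝓝 w, f w' = τ w' ^ m * g w' := by
  induction m generalizing f with
  | zero => exact ⟨f, hf, by simp⟩
  | succ m ih =>
    obtain ⟨g, hg, hfg⟩ := exists_eq_mul_of_eq_zero hf hτ hτ0 hd (by
      filter_upwards [h, hf.eventually_analyticAt] with w' h1 h2 h3
      by_contra h4
      have := h1 h3
      rw [(lineOrder_eq_zero d h2).2 h4] at this
      simp at this)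
    obtain ⟨g', hg', hgg'⟩ := ih hg (by
      have hd' : ∀ᶠ w' in 𝓝 w, fderiv ℂ τ w' d ≠ 0 :=
        (analyticAt_fderiv_apply hτ d).continuousAt.eventually_ne hd
      filter_upwards [h, hfg.eventually_nhds, hτ.eventually_analyticAt,
        hg.eventually_analyticAt, hd'] with w' h1 h2 h3 h4 h5 h6
      have h7 := h1 h6
      rw [lineOrder_congr d h2, lineOrder_mul d h3 h4, lineOrder_eq_one h3 h6 h5] at h7
      push_cast at h7
      rw [add_comm] at h7
      exact (ENat.add_le_add_iff_left (by simp)).1 h7)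
    refine ⟨g', hg', ?_⟩
    filter_upwards [hfg, hgg'] with w' h1 h2
    rw [h1, h2]; ring

end SeveralVariables

/-! ### Divisibility is detected in codimension one. -/

section SeveralVariables

variable {E : Type*} [NormedAddCommGroup E] [NormedSpace ℂ E]

/-- `A` divides `c` in the ring of germs of holomorphic functions at `w`. -/
def GermDvd (A c : E → ℂ) (w : E) : Prop :=
  ∃ g : E → ℂ, AnalyticAt ℂ g w ∧ ∀ᶠ w' in 𝓝 w, c w' = A w' * g w'

/-- Near `w`, the zero set of `Θ` is the smooth hypersurface `τ = 0` through `w`. -/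
def IsNicePoint (Θ τ : E → ℂ) (w : E) : Prop :=
  AnalyticAt ℂ τ w ∧ τ w = 0 ∧ fderiv ℂ τ w ≠ 0 ∧
    ∃ (N : ℕ) (u : E → ℂ), AnalyticAt ℂ u w ∧ u w ≠ 0 ∧ ∀ᶠ w' in 𝓝 w, Θ w' = τ w' ^ N * u w'

theorem GermDvd.eventually {A c : E → ℂ} {w : E} (h : GermDvd A c w) :
    ∀ᶠ w' in 𝓝 w, GermDvd A c w' := by
  obtain ⟨g, hg, h⟩ := h
  filter_upwards [hg.eventually_analyticAt, h.eventually_nhds] with w' h1 h2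
  exact ⟨g, h1, h2⟩

theorem germDvd_of_ne_zero {A c : E → ℂ} {w : E} (hA : AnalyticAt ℂ A w)
    (hc : AnalyticAt ℂ c w) (h : A w ≠ 0) : GermDvd A c w := by
  refine ⟨fun w => c w / A w, hc.div hA h, ?_⟩
  filter_upwards [hA.continuousAt.eventually_ne h] with w' h'
  field_simp

/-- The parameters of the line lying in the ball form a convex set, on which the identity theorem
would spread a vanishing germ up to `t`. -/
theorem lineOrder_ne_top_of_ball {f : E → ℂ} {w₀ w d : E} {R : ℝ}
    (hf : AnalyticOnNhd ℂ f (Metric.ball w₀ R)) (hw : w ∈ Metric.ball w₀ R) {t : ℂ}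
    (ht : w + t • d ∈ Metric.ball w₀ R) (h : f (w + t • d) ≠ 0) : lineOrder d f w ≠ ⊤ := by
  intro htop
  rw [lineOrder, analyticOrderAt_eq_top] at htop
  have hconv : Convex ℝ {s : ℂ | w + s • d ∈ Metric.ball w₀ R} := by
    intro s hs s' hs' a b ha hb hab
    have := convex_ball w₀ R hs hs' ha hb hab
    simp only [mem_ofPred_eq]
    convert this using 1
    have h1 : w = (a + b) • w := by rw [hab, one_smul]
    simp only [smul_add, add_smul, smul_assoc]
    nth_rewrite 1 [h1]
    rw [add_smul]
    abel
  have h1 : AnalyticOnNhd ℂ (fun s : ℂ => f (w + s • d)) {s : ℂ | w + s • d ∈ Metric.ball w₀ R} :=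
    fun s hs => analyticAt_line (hf _ hs)
  exact h (h1.eqOn_zero_of_preconnected_of_eventuallyEq_zero hconv.isPreconnected
    (z₀ := 0) (by simpa using hw) htop ht)

/-- The direction points from `w₀` to a nearby nonzero of `Θ`; parallel lines close to that one also
contain nonzeros. -/
theorem exists_direction {Θ : E → ℂ} {w₀ : E} {R : ℝ} (hR : 0 < R)
    (hΘ : AnalyticOnNhd ℂ Θ (Metric.ball w₀ R)) (hΘ0 : ∃ᶠ w in 𝓝 w₀, Θ w ≠ 0) :
    ∃ d : E, ∃ δ > 0, δ ≤ R ∧ ∀ w ∈ Metric.ball w₀ δ, lineOrder d Θ w ≠ ⊤ := by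
  obtain ⟨w, hw, hwb⟩ := (hΘ0.and_eventually (Metric.ball_mem_nhds w₀ hR)).exists
  refine ⟨w - w₀, ?_⟩
  have h1 : ∀ᶠ w' in 𝓝 w₀, w' + (1 : ℂ) • (w - w₀) ∈ Metric.ball w₀ R ∧
      Θ (w' + (1 : ℂ) • (w - w₀)) ≠ 0 := by
    have hc : Tendsto (fun w' => w' + (1 : ℂ) • (w - w₀)) (𝓝 w₀) (𝓝 w) := by
      have : Continuous fun w' : E => w' + (1 : ℂ) • (w - w₀) := by fun_prop
      simpa using this.tendsto w₀
    exact hc.eventually ((Metric.isOpen_ball.eventually_mem hwb).and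
      ((hΘ w hwb).continuousAt.eventually_ne hw))
  obtain ⟨δ, hδ, hb⟩ := Metric.eventually_nhds_iff_ball.1 h1
  refine ⟨min δ R, lt_min hδ hR, min_le_right _ _, fun w' hw' => ?_⟩
  have h2 := hb w' (Metric.ball_subset_ball (min_le_left _ _) hw')
  exact lineOrder_ne_top_of_ball hΘ (Metric.ball_subset_ball (min_le_right _ _) hw') h2.1 h2.2

theorem lineOrder_smul_ne_top {f : E → ℂ} {w d : E} {a : ℂ} (ha : a ≠ 0)
    (h : lineOrder d f w ≠ ⊤) : lineOrder (a • d) f w ≠ ⊤ := by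
  have h1 := analyticOrderAt_comp_of_deriv_ne_zero (f := fun t : ℂ => f (w + t • d))
    (g := fun s : ℂ => s * a) (z₀ := 0) (by fun_prop) (by simpa using ha)
  simp only [zero_mul] at h1
  rw [lineOrder] at h ⊢
  rw [← h1] at h
  convert h using 4 with t
  simp [mul_smul]

/-- If `A` divides `c` locally at each point where the zero set of `Θ` is smooth, and if the zeros
of `A` are zeros of `Θ`, then `A` divides `c`. -/
theorem germDvd_of_nice {c A Θ : E → ℂ} {w₀ : E} (hc : AnalyticAt ℂ c w₀)
    (hA : AnalyticAt ℂ A w₀) (hΘ : AnalyticAt ℂ Θ w₀) (hΘ0 : ∃ᶠ w in 𝓝 w₀, Θ w ≠ 0)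
    (hAΘ : ∀ᶠ w in 𝓝 w₀, Θ w ≠ 0 → A w ≠ 0)
    (hgood : ∀ᶠ w in 𝓝 w₀, ∀ τ, IsNicePoint Θ τ w → GermDvd A c w) : GermDvd A c w₀ := by
  obtain ⟨r, hr, hcirc⟩ := exists_circle_extension hc hA
  obtain ⟨R, hR, hb⟩ := Metric.eventually_nhds_iff_ball.1
    (hc.eventually_analyticAt.and (hA.eventually_analyticAt.and
      (hΘ.eventually_analyticAt.and (hAΘ.and hgood))))
  obtain ⟨d, δ, hδ, hδR, hfin⟩ := exists_direction hR (fun w hw => (hb w hw).2.2.1) hΘ0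
  replace hδR : Metric.ball w₀ δ ⊆ Metric.ball w₀ R := Metric.ball_subset_ball hδR
  obtain ⟨δ', hδ', hδ'δ, hδ'r⟩ : ∃ δ' > 0, δ' ≤ δ ∧ δ' ≤ r :=
    ⟨min δ r, lt_min hδ hr, min_le_left _ _, min_le_right _ _⟩
  replace hδ'δ : Metric.ball w₀ δ' ⊆ Metric.ball w₀ δ := Metric.ball_subset_ball hδ'δ
  by_contra hbad
  classical
  -- Among the points near `w₀` where divisibility fails, `w₁` is one with the least order `m` of
  -- `Θ` along `d`.
  have hex : ∃ m : ℕ, ∃ w ∈ Metric.ball w₀ δ', ¬ GermDvd A c w ∧ lineOrder d Θ w = m := by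
    have h0 : w₀ ∈ Metric.ball w₀ δ' := Metric.mem_ball_self hδ'
    obtain ⟨m, hm⟩ := ENat.ne_top_iff_exists.1 (hfin w₀ (hδ'δ h0))
    exact ⟨m, w₀, h0, hbad, hm.symm⟩
  obtain ⟨w₁, hw₁, hbad₁, hm₁⟩ := Nat.find_spec hex
  set m := Nat.find hex with hm
  have hmin : ∀ w ∈ Metric.ball w₀ δ', ¬ GermDvd A c w → (m : ℕ∞) ≤ lineOrder d Θ w := by
    intro w hw hn
    obtain ⟨k, hk⟩ := ENat.ne_top_iff_exists.1 (hfin w (hδ'δ hw))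
    rw [← hk]
    exact_mod_cast Nat.find_min' hex ⟨w, hw, hn, hk.symm⟩
  have hB : ∀ w ∈ Metric.ball w₀ δ', AnalyticAt ℂ c w ∧ AnalyticAt ℂ A w ∧ AnalyticAt ℂ Θ w ∧
      (Θ w ≠ 0 → A w ≠ 0) ∧ ∀ τ, IsNicePoint Θ τ w → GermDvd A c w :=
    fun w hw => hb w (hδR (hδ'δ hw))
  have hΘ₁ := (hB w₁ hw₁).2.2.1
  have hm0 : m ≠ 0 := by
    intro h0
    rw [h0] at hm₁
    have h2 := (hB w₁ hw₁).2.2.2.1 ((lineOrder_eq_zero d hΘ₁).1 (by exact_mod_cast hm₁))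
    exact hbad₁ (germDvd_of_ne_zero (hB w₁ hw₁).2.1 (hB w₁ hw₁).1 h2)
  obtain ⟨j, hj⟩ := Nat.exists_eq_succ_of_ne_zero hm0
  rw [Nat.succ_eq_add_one] at hj
  -- The derivative of `Θ` of order `m - 1` along `d`. At `w₁` its zero set is smooth and transverse
  -- to `d`, and by minimality of `m` it contains all the bad points of the ball.
  set τ : E → ℂ := fun w => iteratedDeriv j (fun t : ℂ => Θ (w + t • d)) 0 with hτdef
  have hτ : AnalyticAt ℂ τ w₁ := analyticAt_iteratedDeriv_line hΘ₁ j
  have hord := (analyticOrderAt_eq_nat_iff_iteratedDeriv_eq_zero (analyticAt_line_zero hΘ₁)).1 hm₁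
  have hτ0 : τ w₁ = 0 := hord.1 j (by omega)
  have hτd : fderiv ℂ τ w₁ d ≠ 0 := by
    rw [fderiv_iteratedDeriv_line hΘ₁ j, ← hj]; exact hord.2
  have hNτ : ∀ w ∈ Metric.ball w₀ δ', ¬ GermDvd A c w → τ w = 0 := by
    intro w hw hn
    exact (natCast_le_analyticOrderAt_iff_iteratedDeriv_eq_zero
      (analyticAt_line_zero (hB w hw).2.2.1)).1 (hmin w hw hn) j (by omega)
  obtain ⟨ρ, hρ, hinj⟩ := exists_injective_line hτ hτd
  obtain ⟨σ, hσ, hσb⟩ := Metric.isOpen_iff.1 Metric.isOpen_ball w₁ hw₁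
  have hd0 : d ≠ 0 := by rintro rfl; simp at hτd
  -- a radius and a multiple of the direction adapted to `w₁`
  have hpunct : ∀ᶠ t in 𝓝[≠] (0 : ℂ), Θ (w₁ + t • d) ≠ 0 := by
    rcases (analyticAt_line_zero hΘ₁ (d := d)).eventually_eq_zero_or_eventually_ne_zero with h | h
    · exact absurd (analyticOrderAt_eq_top.2 h) (hfin w₁ (hδ'δ hw₁))
    · exact h
  rw [eventually_nhdsWithin_iff] at hpunct
  obtain ⟨ε, hε, hεb⟩ := Metric.eventually_nhds_iff_ball.1 hpunct
  have hw₁r : ‖w₁ - w₀‖ < r := by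
    rw [← dist_eq_norm]; exact (Metric.mem_ball.1 hw₁).trans_le hδ'r
  set R' := min (r - ‖w₁ - w₀‖) (min ρ σ) with hR'
  have hR'0 : 0 < R' := lt_min (by linarith) (lt_min hρ hσ)
  obtain ⟨η, hη0, hη, hηε⟩ : ∃ η : ℝ, 0 < η ∧ η * ‖d‖ < R' / 2 ∧ η < ε := by
    refine ⟨min (R' / 4 / ‖d‖) (ε / 2), by positivity, ?_, ?_⟩
    · refine lt_of_le_of_lt (mul_le_mul_of_nonneg_right (min_le_left _ _) (norm_nonneg _)) ?_
      field_simp; norm_num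
    · exact (min_le_right _ _).trans_lt (by linarith)
  set e : E := (η : ℂ) • d with he
  have hηc : (η : ℂ) ≠ 0 := by exact_mod_cast hη0.ne'
  have hen : ‖e‖ < R' / 2 := by
    rw [he, norm_smul, Complex.norm_real, Real.norm_of_nonneg hη0.le]; exact hη
  have hmem : ∀ w' ∈ Metric.ball w₁ (R' / 2), ∀ t : ℂ, ‖t‖ ≤ 1 →
      w' + t • e ∈ Metric.ball w₁ R' := by
    intro w' hw' t ht
    rw [Metric.mem_ball, dist_eq_norm] at hw' ⊢
    have : ‖t • e‖ ≤ ‖e‖ := by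
      rw [norm_smul]; exact mul_le_of_le_one_left (norm_nonneg _) ht
    calc ‖w' + t • e - w₁‖ = ‖(w' - w₁) + t • e‖ := by congr 1; abel
      _ ≤ _ := norm_add_le _ _
      _ < R' := by linarith
  have hRρ : Metric.ball w₁ R' ⊆ Metric.ball w₁ ρ :=
    Metric.ball_subset_ball ((min_le_right _ _).trans (min_le_left _ _))
  have hRσ : Metric.ball w₁ R' ⊆ Metric.ball w₀ δ' :=
    (Metric.ball_subset_ball ((min_le_right _ _).trans (min_le_right _ _))).trans hσb
  have hself : w₁ ∈ Metric.ball w₁ (R' / 2) := Metric.mem_ball_self (by positivity)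
  have hcircle : ∀ᶠ w in 𝓝 w₁, ∀ t ∈ Metric.sphere (0 : ℂ) 1, A (w + t • e) ≠ 0 := by
    refine eventually_forall_line (p := fun w => A w ≠ 0) (isCompact_sphere _ _) fun t ht => ?_
    rw [mem_sphere_zero_iff_norm] at ht
    have h1 := hB _ (hRσ (hmem w₁ hself t ht.le))
    refine h1.2.1.continuousAt.eventually_ne (h1.2.2.2.1 ?_)
    rw [he, smul_smul]
    refine hεb (t * η) ?_ ?_
    · rw [mem_ball_zero_iff, norm_mul, ht, one_mul, Complex.norm_real,
        Real.norm_of_nonneg hη0.le]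
      exact hηε
    · have : t ≠ 0 := by rintro rfl; simp at ht
      simp [this, hηc]
  obtain ⟨δ₁, hδ₁, hδ₁b⟩ := Metric.eventually_nhds_iff_ball.1
    (hcircle.and (Metric.ball_mem_nhds w₁ (by positivity : 0 < R' / 2)))
  have hlarge : ∀ w' ∈ Metric.ball w₁ (R' / 2), ‖w' - w₀‖ + ‖e‖ < r := by
    intro w' hw'
    rw [Metric.mem_ball, dist_eq_norm] at hw'
    have h1 : R' ≤ r - ‖w₁ - w₀‖ := min_le_left _ _
    have h2 : ‖w' - w₀‖ ≤ ‖w' - w₁‖ + ‖w₁ - w₀‖ := by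
      simpa using norm_add_le (w' - w₁) (w₁ - w₀)
    linarith
  -- Either some nearby disc avoids the bad points, and the circle average extends `c / A` from
  -- there; or every disc contains one, and then `τ = 0` consists of bad points, which makes `w₁` a
  -- nice point.
  by_cases hcase : ∃ s ∈ Metric.ball w₁ δ₁, ∀ t ∈ Metric.closedBall (0 : ℂ) 1,
      GermDvd A c (s + t • e)
  · obtain ⟨s, hs, hsd⟩ := hcase
    obtain ⟨g, hg⟩ := hcirc e
    have hga : ∀ w ∈ Metric.ball w₁ δ₁, AnalyticAt ℂ g w := fun w hw =>
      (hg w (hlarge w (hδ₁b w hw).2) fun t ht => (hδ₁b w hw).1 t (by simpa using ht)).1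
    have hsd' : ∀ᶠ w in 𝓝 s, ∀ t ∈ Metric.closedBall (0 : ℂ) 1, GermDvd A c (w + t • e) :=
      eventually_forall_line (isCompact_closedBall _ _) fun t ht => (hsd t ht).eventually
    have hloc : ∀ᶠ w in 𝓝 s, c w - A w * g w = 0 := by
      filter_upwards [hsd', Metric.isOpen_ball.mem_nhds hs] with w h1 h2
      obtain ⟨Q, hQ⟩ := exists_glue_quotient (f := fun t : ℂ => c (w + t • e))
        (τ := fun t : ℂ => A (w + t • e)) (K := Metric.closedBall 0 1) (fun t ht => by
          rw [mem_closedBall_zero_iff] at ht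
          have h3 := hRσ (hmem w (hδ₁b w h2).2 t ht)
          refine ⟨analyticAt_line (hB _ h3).2.1, ?_⟩
          rw [analyticOrderAt_line]
          have h4 := lineOrder_smul_ne_top hηc (hfin _ (hδ'δ h3))
          intro htop
          apply h4
          rw [lineOrder, analyticOrderAt_eq_top] at htop ⊢
          filter_upwards [htop, (tendsto_line (w + t • e) e).eventually
            (Metric.isOpen_ball.mem_nhds h3)] with x hx hx'
          by_contra hne
          exact (hB _ hx').2.2.2.1 hne hx) (fun t ht => by
          obtain ⟨q, hq, hq'⟩ := h1 t ht
          refine ⟨fun t => q (w + t • e), analyticAt_line hq, ?_⟩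
          have hc : ContinuousAt (fun t : ℂ => w + t • e) t := by fun_prop
          filter_upwards [hc.eventually hq'] with x hx
          rw [hx, mul_comm])
      have h3 := (hg w (hlarge w (hδ₁b w h2).2) fun t ht =>
        (hδ₁b w h2).1 t (by simpa using ht)).2 Q
        (fun t ht => (hQ t ht).1) (fun t ht => (hQ t (by simp [ht])).2)
      have h4 := (hQ 0 (by simp)).2
      simp only [zero_smul, add_zero] at h4
      rw [h3, ← h4]; ring
    have han : AnalyticOnNhd ℂ (fun w => c w - A w * g w) (Metric.ball w₁ δ₁) := fun w hw => by
      have h1 := hB w (by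
        have := hmem w (hδ₁b w hw).2 0 (by simp)
        simpa using hRσ this)
      exact h1.1.sub (h1.2.1.mul (hga w hw))
    -- The identity theorem carries `c = A g` from a neighbourhood of `s` to the ball around `w₁`.
    have hz := han.eqOn_zero_of_preconnected_of_eventuallyEq_zero
      (convex_ball w₁ δ₁).isPreconnected hs hloc
    refine hbad₁ ⟨g, hga w₁ (Metric.mem_ball_self hδ₁), ?_⟩
    filter_upwards [Metric.ball_mem_nhds w₁ hδ₁] with w hw
    exact sub_eq_zero.1 (hz hw)
  · push Not at hcase
    have hsub : ∀ᶠ w in 𝓝 w₁, τ w = 0 → (m : ℕ∞) ≤ lineOrder d Θ w := by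
      filter_upwards [Metric.ball_mem_nhds w₁ hδ₁] with w hw h0
      obtain ⟨t, ht, hn⟩ := hcase w hw
      rw [mem_closedBall_zero_iff] at ht
      have h1 := hmem w (hδ₁b w hw).2 t ht
      have h2 := hmem w (hδ₁b w hw).2 0 (by simp)
      simp only [zero_smul, add_zero] at h2
      -- `w` and the bad point `w + t e` are on the same line and both on `τ = 0`, so they coincide.
      have h3 : t * η = 0 := by
        refine hinj w (t * η) (hRρ h2) ?_ ?_
        · rw [← smul_smul]; exact hRρ h1
        · rw [← smul_smul, h0]; exact hNτ _ (hRσ h1) hn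
      have h4 : t = 0 := by simpa [hηc] using h3
      rw [h4, zero_smul, add_zero] at hn
      exact hmin w (hRσ h2) hn
    obtain ⟨g, hg, hg'⟩ := exists_eq_pow_mul_of_le_lineOrder hΘ₁ hτ hτ0 hτd m hsub
    refine hbad₁ ((hB w₁ hw₁).2.2.2.2 τ ⟨hτ, hτ0, ?_, m, g, hg, ?_, hg'⟩)
    · intro h; simp [h] at hτd
    -- The order of `Θ` at `w₁` is exactly `m`, so nothing is left for the cofactor of `τ ^ m`.
    · rw [← lineOrder_eq_zero d hg]
      have h1 := lineOrder_congr d hg'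
      rw [lineOrder_mul d (hτ.fun_pow m) hg, hm₁, lineOrder_pow d hτ, lineOrder_eq_one hτ hτ0 hτd] at h1
      simp only [nsmul_eq_mul, mul_one] at h1
      have h2 : (m : ℕ∞) + 0 = m + lineOrder d g w₁ := by simpa using h1
      exact nonpos_iff_eq_zero.1 ((ENat.add_le_add_iff_left (by simp)).1 h2.ge)

end SeveralVariables

/-! ### Local inverses, and factorization of monomials in smooth equations. -/

section SeveralVariables

variable {E : Type*} [NormedAddCommGroup E] [NormedSpace ℂ E]

/-- A point of the ball where `f` does not vanish forces `g` to vanish around it, then on the whole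
ball by the identity theorem. Germs of holomorphic functions thus form a domain. -/
theorem eventually_eq_zero_or_of_mul {f g : E → ℂ} {w : E} (hf : AnalyticAt ℂ f w)
    (hg : AnalyticAt ℂ g w) (h : ∀ᶠ w' in 𝓝 w, f w' * g w' = 0) :
    (∀ᶠ w' in 𝓝 w, f w' = 0) ∨ ∀ᶠ w' in 𝓝 w, g w' = 0 := by
  obtain ⟨R, hR, hb⟩ := Metric.eventually_nhds_iff_ball.1
    (hf.eventually_analyticAt.and (hg.eventually_analyticAt.and h))
  by_cases hz : ∀ w' ∈ Metric.ball w R, f w' = 0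
  · left
    filter_upwards [Metric.ball_mem_nhds w hR] with w' hw'
    exact hz w' hw'
  · right
    push Not at hz
    obtain ⟨v, hv, hv0⟩ := hz
    have h1 : ∀ᶠ w' in 𝓝 v, g w' = 0 := by
      filter_upwards [(hb v hv).1.continuousAt.eventually_ne hv0, Metric.isOpen_ball.mem_nhds hv]
        with w' h1 h2
      exact (mul_eq_zero.1 (hb w' h2).2.2).resolve_left h1
    have h2 : AnalyticOnNhd ℂ g (Metric.ball w R) := fun w' hw' => (hb w' hw').2.1
    filter_upwards [Metric.ball_mem_nhds w hR] with w' hw'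
    exact h2.eqOn_zero_of_preconnected_of_eventuallyEq_zero (convex_ball w R).isPreconnected hv h1
      hw'

theorem eventually_eq_of_mul_eq {a f g : E → ℂ} {w : E} (ha : AnalyticAt ℂ a w)
    (hf : AnalyticAt ℂ f w) (hg : AnalyticAt ℂ g w) (ha0 : ∃ᶠ w' in 𝓝 w, a w' ≠ 0)
    (h : ∀ᶠ w' in 𝓝 w, a w' * f w' = a w' * g w') : ∀ᶠ w' in 𝓝 w, f w' = g w' := by
  rcases eventually_eq_zero_or_of_mul ha (hf.fun_sub hg)
    (h.mono fun w' h => by rw [mul_sub, h, sub_self]) with h1 | h1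
  · exact (ha0 (h1.mono fun w' h => not_not.2 h)).elim
  · exact h1.mono fun w' h => sub_eq_zero.1 h

theorem exists_fderiv_apply_ne_zero {τ : E → ℂ} {w : E} (h : fderiv ℂ τ w ≠ 0) :
    ∃ d, fderiv ℂ τ w d ≠ 0 := by
  by_contra hc
  push Not at hc
  exact h (ContinuousLinearMap.ext hc)

theorem frequently_ne_zero_of_fderiv {τ : E → ℂ} {w : E} (h : fderiv ℂ τ w ≠ 0) :
    ∃ᶠ w' in 𝓝 w, τ w' ≠ 0 := by
  intro hc
  refine h ?_
  have : τ =ᶠ[𝓝 w] fun _ => 0 := hc.mono fun w' h => not_not.1 h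
  rw [this.fderiv_eq]; simp

/-- A holomorphic map with bijective differential is locally invertible. -/
theorem exists_localInverse {E' : Type*} [NormedAddCommGroup E'] [NormedSpace ℂ E']
    [CompleteSpace E] [CompleteSpace E'] {F : E → E'} {w : E} (hF : AnalyticAt ℂ F w)
    (L : E ≃L[ℂ] E') (hL : fderiv ℂ F w = L) {U : Set E} (hU : U ∈ 𝓝 w) :
    ∃ e : OpenPartialHomeomorph E E', w ∈ e.source ∧ (∀ v, e v = F v) ∧ e.source ⊆ U ∧
      AnalyticOnNhd ℂ F e.source ∧ AnalyticOnNhd ℂ e.symm e.target ∧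
      ∀ v ∈ e.source, ∃ M : E ≃L[ℂ] E', fderiv ℂ F v = M := by
  have hF' : HasFDerivAt F (L : E →L[ℂ] E') w := hL ▸ hF.differentiableAt.hasFDerivAt
  have hc : ContDiffAt ℂ ω F w := hF.contDiffAt
  set e := hc.toOpenPartialHomeomorph F hF' (by simp) with he
  -- Invertible operators form an open set; analyticity of the inverse is needed on its whole
  -- domain, not only at the image of `w`.
  have hopen : ∀ᶠ v in 𝓝 w, fderiv ℂ F v ∈ Set.range ((↑) : (E ≃L[ℂ] E') → E →L[ℂ] E') := by
    refine hF.fderiv.continuousAt.eventually_mem ?_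
    rw [hL]
    exact ContinuousLinearEquiv.nhds L
  obtain ⟨V, hVs, hVo, hwV⟩ := mem_nhds_iff.1
    (inter_mem hU (inter_mem hF.eventually_analyticAt hopen))
  have hsrc : (e.restrOpen V hVo).source = e.source ∩ V := e.restrOpen_source V hVo
  have hinv : ∀ v ∈ (e.restrOpen V hVo).source, ∃ M : E ≃L[ℂ] E', fderiv ℂ F v = M := by
    intro v hv
    obtain ⟨M, hM⟩ := (hVs (hsrc ▸ hv).2).2.2
    exact ⟨M, hM.symm⟩
  refine ⟨e.restrOpen V hVo, ?_, fun v => rfl, ?_, ?_, ?_, hinv⟩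
  · rw [hsrc]; exact ⟨hc.mem_toOpenPartialHomeomorph_source hF' _, hwV⟩
  · rw [hsrc]; exact fun v hv => (hVs hv.2).1
  · rw [hsrc]; exact fun v hv => (hVs hv.2).2.1
  · intro v hv
    have h1 := (e.restrOpen V hVo).map_target hv
    obtain ⟨M, hM⟩ := hinv _ h1
    refine (e.restrOpen V hVo).analyticAt_symm hv (i := M) ?_ hM
    rw [hsrc] at h1
    exact (hVs h1.2).2.1

theorem fderiv_mul_of_eq_zero {τ g : E → ℂ} {w : E} (hτ : AnalyticAt ℂ τ w)
    (hg : AnalyticAt ℂ g w) (h0 : τ w = 0) :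
    fderiv ℂ (fun w => τ w * g w) w = g w • fderiv ℂ τ w := by
  rw [fderiv_fun_mul hτ.differentiableAt hg.differentiableAt, h0]
  ext v
  simp

/-- Straightening of a smooth hypersurface: `λ (e w) = τ w` for a linear form `λ`. -/
theorem exists_straightening [CompleteSpace E] {τ : E → ℂ} {w : E} (hτ : AnalyticAt ℂ τ w) (hτ0 : τ w = 0)
    (hτ' : fderiv ℂ τ w ≠ 0) {U : Set E} (hU : U ∈ 𝓝 w) :
    ∃ (e : OpenPartialHomeomorph E E) (l : E →L[ℂ] ℂ) (d : E), w ∈ e.source ∧ e w = 0 ∧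
      l d = 1 ∧ l = fderiv ℂ τ w ∧ (∀ v, l (e v) = τ v) ∧ e.source ⊆ U ∧
      AnalyticOnNhd ℂ e e.source ∧ AnalyticOnNhd ℂ e.symm e.target ∧
      ∀ v ∈ e.source, ∃ M : E ≃L[ℂ] E, fderiv ℂ e v = M := by
  obtain ⟨d₀, hd₀⟩ := exists_fderiv_apply_ne_zero hτ'
  set l := fderiv ℂ τ w with hl
  set d := (l d₀)⁻¹ • d₀ with hd
  have hld : l d = 1 := by simp [hd, hd₀]
  -- Because `l d = 1`, applying `l` to `F v` leaves `τ v`; and the correction term has zero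
  -- differential at `w`, so that of `F` is the identity.
  set F : E → E := fun v => (v - w) + (τ v - l (v - w)) • d with hFdef
  have hF : AnalyticAt ℂ F w := by
    refine (analyticAt_id.sub analyticAt_const).add (AnalyticAt.smul (hτ.sub ?_) analyticAt_const)
    exact (l.analyticAt _).fun_comp (analyticAt_id.sub analyticAt_const)
  have hF' : fderiv ℂ F w = (ContinuousLinearEquiv.refl ℂ E : E →L[ℂ] E) := by
    have h1 : HasFDerivAt (fun v : E => v - w) (ContinuousLinearMap.id ℂ E) w :=
      (hasFDerivAt_id w).sub_const w
    have h2 : HasFDerivAt (fun v : E => l (v - w)) l w := by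
      simpa only [map_sub] using (l.hasFDerivAt (x := w)).sub_const (l w)
    have h3 := h1.add (((hτ.differentiableAt.hasFDerivAt).sub h2).smul_const d)
    rw [show fderiv ℂ F w = _ from HasFDerivAt.fderiv (f := F) h3]
    ext v
    simp [hl]
  obtain ⟨e, h1, h2, h3, h4, h5, h6⟩ := exists_localInverse hF _ hF' hU
  have h2' : (e : E → E) = F := funext h2
  refine ⟨e, l, d, h1, ?_, hld, rfl, ?_, h3, h2' ▸ h4, h5, h2' ▸ h6⟩
  · rw [h2, hFdef]; simp [hτ0]
  · intro v; rw [h2, hFdef]; simp [hld]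

/-- Irreducibility of a smooth hypersurface. -/
theorem eq_zero_or_eq_zero_on_smooth [CompleteSpace E] {τ f g : E → ℂ} {w : E} (hτ : AnalyticAt ℂ τ w)
    (hτ0 : τ w = 0) (hτ' : fderiv ℂ τ w ≠ 0) (hf : AnalyticAt ℂ f w) (hg : AnalyticAt ℂ g w)
    (h : ∀ᶠ w' in 𝓝 w, τ w' = 0 → f w' * g w' = 0) :
    (∀ᶠ w' in 𝓝 w, τ w' = 0 → f w' = 0) ∨ ∀ᶠ w' in 𝓝 w, τ w' = 0 → g w' = 0 := by
  obtain ⟨e, l, d, h1, h2, h3, -, h4, h5, h6, h7, -⟩ :=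
    exists_straightening hτ hτ0 hτ' (Filter.univ_mem)
  have ht : e w ∈ e.target := e.map_source h1
  -- The map `v ↦ e.symm (e v - τ v • d)` is a holomorphic retraction onto `τ = 0`. Composing `f`
  -- and `g` with it reduces the claim to germs on the whole space.
  have h0 : ((fun v => e.symm (e v - τ v • d)) w) = w := by
    simp only [hτ0, zero_smul, sub_zero]
    exact e.left_inv h1
  have hr : AnalyticAt ℂ (fun v => e.symm (e v - τ v • d)) w := by
    refine AnalyticAt.fun_comp (g := e.symm) ?_ ((h6 w h1).sub (hτ.smul analyticAt_const))
    simpa [hτ0] using h7 _ ht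
  have hmem : ∀ᶠ v in 𝓝 w, e v - τ v • d ∈ e.target := by
    have hc : ContinuousAt (fun v => e v - τ v • d) w :=
      ((h6 w h1).sub (hτ.smul analyticAt_const)).continuousAt
    refine hc.eventually_mem (e.open_target.mem_nhds ?_)
    simpa [hτ0] using ht
  have hτr : ∀ᶠ v in 𝓝 w, τ (e.symm (e v - τ v • d)) = 0 := by
    filter_upwards [hmem] with v hv
    rw [← h4, e.right_inv hv, map_sub, map_smul, h3, h4]; simp
  have hrt : Tendsto (fun v => e.symm (e v - τ v • d)) (𝓝 w) (𝓝 w) := by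
    have := hr.continuousAt.tendsto
    exact this.trans (by rw [show e.symm (e w - τ w • d) = w from h0])
  have hid : ∀ᶠ v in 𝓝 w, τ v = 0 → e.symm (e v - τ v • d) = v := by
    filter_upwards [e.open_source.mem_nhds h1] with v hv hv0
    rw [hv0, zero_smul, sub_zero, e.left_inv hv]
  have hfr : AnalyticAt ℂ (fun v => f (e.symm (e v - τ v • d))) w :=
    AnalyticAt.fun_comp (by rw [show e.symm (e w - τ w • d) = w from h0]; exact hf) hr
  have hgr : AnalyticAt ℂ (fun v => g (e.symm (e v - τ v • d))) w :=
    AnalyticAt.fun_comp (by rw [show e.symm (e w - τ w • d) = w from h0]; exact hg) hr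
  have key := eventually_eq_zero_or_of_mul hfr hgr (by
    filter_upwards [hrt.eventually h, hτr] with v a b
    exact a b)
  refine key.imp (fun k => ?_) (fun k => ?_)
  · filter_upwards [k, hid] with v a b c
    rw [b c] at a; exact a
  · filter_upwards [k, hid] with v a b c
    rw [b c] at a; exact a

/-- A divisor of a monomial in local equations of smooth hypersurfaces is a monomial, up to a
unit. -/
theorem exists_monomial_of_mul_eq [CompleteSpace E] {κ : Type*} [DecidableEq κ] (I : Finset κ) {τ : κ → E → ℂ}
    {w : E} (hτ : ∀ i ∈ I, AnalyticAt ℂ (τ i) w ∧ τ i w = 0 ∧ fderiv ℂ (τ i) w ≠ 0)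
    (m : κ → ℕ) {h g v : E → ℂ} (hh : AnalyticAt ℂ h w) (hg : AnalyticAt ℂ g w)
    (hv : AnalyticAt ℂ v w) (hv0 : v w ≠ 0)
    (heq : ∀ᶠ w' in 𝓝 w, h w' * g w' = (∏ i ∈ I, τ i w' ^ m i) * v w') :
    ∃ (e : κ → ℕ) (u : E → ℂ), AnalyticAt ℂ u w ∧ u w ≠ 0 ∧
      ∀ᶠ w' in 𝓝 w, h w' = (∏ i ∈ I, τ i w' ^ e i) * u w' := by
  induction hn : ∑ i ∈ I, m i generalizing m h g with
  | zero =>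
    have hm : ∀ i ∈ I, m i = 0 := by simpa using hn
    refine ⟨m, h, hh, ?_, ?_⟩
    · intro h0
      have h1 := heq.self_of_nhds
      rw [Finset.prod_congr rfl (fun i hi => by rw [hm i hi, pow_zero])] at h1
      simp [h0] at h1
      exact hv0 h1.symm
    · refine Eventually.of_forall fun w' => ?_
      rw [Finset.prod_congr rfl (fun i hi => by rw [hm i hi, pow_zero])]
      simp
  | succ n ih =>
    obtain ⟨i, hi, hmi⟩ : ∃ i ∈ I, m i ≠ 0 := by
      by_contra hc
      push Not at hc
      rw [Finset.sum_eq_zero hc] at hn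
      omega
    obtain ⟨hτa, hτ0, hτ'⟩ := hτ i hi
    obtain ⟨d, hd⟩ := exists_fderiv_apply_ne_zero hτ'
    -- `τ i` divides one of the factors `h`, `g`, its zero set being irreducible; cancelling it
    -- lowers the degree of the monomial by one.
    set m' : κ → ℕ := Function.update m i (m i - 1) with hm'
    have hsum : ∑ j ∈ I, m' j = n := by
      rw [← Finset.add_sum_erase _ _ hi] at hn ⊢
      have h1 : ∑ j ∈ I.erase i, m' j = ∑ j ∈ I.erase i, m j :=
        Finset.sum_congr rfl fun j hj => by
          rw [hm', Function.update_of_ne (Finset.ne_of_mem_erase hj)]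
      have h2 : m' i = m i - 1 := by rw [hm', Function.update_self]
      rw [h1, h2]
      omega
    have hprod : ∀ w', ∏ j ∈ I, τ j w' ^ m j = τ i w' * ∏ j ∈ I, τ j w' ^ m' j := by
      intro w'
      rw [← Finset.mul_prod_erase _ _ hi, ← Finset.mul_prod_erase (a := i) I (fun j => τ j w' ^ m' j) hi]
      rw [Finset.prod_congr rfl (g := fun j => τ j w' ^ m j) (s₁ := I.erase i) (f := fun j => τ j w' ^ m' j) (fun j hj => by
        rw [hm', Function.update_of_ne (Finset.ne_of_mem_erase hj)])]
      simp only [hm', Function.update_self, ← mul_assoc, ← pow_succ']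
      congr 2; omega
    have hP : AnalyticAt ℂ (fun w' => (∏ j ∈ I, τ j w' ^ m' j) * v w') w :=
      (Finset.analyticAt_fun_prod I fun j hj => (hτ j hj).1.fun_pow _).fun_mul hv
    have hzero : ∀ᶠ w' in 𝓝 w, τ i w' = 0 → h w' * g w' = 0 := by
      filter_upwards [heq] with w' h1 h2
      rw [h1, hprod, h2]; simp
    rcases eq_zero_or_eq_zero_on_smooth hτa hτ0 hτ' hh hg hzero with h1 | h1
    · obtain ⟨h', hh', hh'e⟩ := exists_eq_mul_of_eq_zero hh hτa hτ0 hd h1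
      have heq' := eventually_eq_of_mul_eq hτa (hh'.fun_mul hg) hP
        (frequently_ne_zero_of_fderiv hτ') (by
          filter_upwards [heq, hh'e] with w' a b
          rw [← mul_assoc, ← b, a, hprod]; ring)
      obtain ⟨e, u, hu, hu0, hue⟩ := ih m' hh' hg heq' hsum
      refine ⟨Function.update e i (e i + 1), u, hu, hu0, ?_⟩
      filter_upwards [hue, hh'e] with w' a b
      rw [b, a, ← mul_assoc]
      congr 1
      rw [← Finset.mul_prod_erase _ _ hi, ← Finset.mul_prod_erase (a := i) I
        (fun j => τ j w' ^ Function.update e i (e i + 1) j) hi]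
      rw [Finset.prod_congr rfl (g := fun j => τ j w' ^ e j) (s₁ := I.erase i)
        (f := fun j => τ j w' ^ Function.update e i (e i + 1) j) (fun j hj => by
        rw [Function.update_of_ne (Finset.ne_of_mem_erase hj)])]
      simp only [Function.update_self]
      ring
    · obtain ⟨g', hg', hg'e⟩ := exists_eq_mul_of_eq_zero hg hτa hτ0 hd h1
      have heq' := eventually_eq_of_mul_eq hτa (hh.fun_mul hg') hP
        (frequently_ne_zero_of_fderiv hτ') (by
          filter_upwards [heq, hg'e] with w' a b
          rw [← mul_assoc (τ i w') (∏ j ∈ I, _), ← hprod, ← a, b]; ring)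
      exact ih m' hh hg' heq' hsum

/-- The zeros of a holomorphic function do not disappear under small displacements. -/
theorem eventually_exists_zero_on_line {f : E → ℂ} {w d : E} (hf : AnalyticAt ℂ f w)
    (h0 : f w = 0) (hd : lineOrder d f w ≠ ⊤) {ε : ℝ} (hε : 0 < ε) :
    ∀ᶠ w' in 𝓝 w, ∃ t : ℂ, ‖t‖ < ε ∧ f (w' + t • d) = 0 := by
  obtain ⟨r, hr, hcirc⟩ := exists_circle_extension (c := fun _ => 1) analyticAt_const hf
  have hpunct : ∀ᶠ t in 𝓝[≠] (0 : ℂ), f (w + t • d) ≠ 0 := by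
    rcases (analyticAt_line_zero hf (d := d)).eventually_eq_zero_or_eventually_ne_zero with h | h
    · exact absurd (analyticOrderAt_eq_top.2 h) hd
    · exact h
  rw [eventually_nhdsWithin_iff] at hpunct
  have hloc : ∀ᶠ t in 𝓝 (0 : ℂ), AnalyticAt ℂ f (w + t • d) :=
    (tendsto_line w d).eventually hf.eventually_analyticAt
  obtain ⟨ρ, hρ, hb⟩ := Metric.eventually_nhds_iff_ball.1 (hpunct.and hloc)
  obtain ⟨η, hη0, hη, hηε, hηr⟩ : ∃ η : ℝ, 0 < η ∧ η < ρ ∧ η < ε ∧ η * ‖d‖ < r / 2 := by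
    refine ⟨min (min (ρ / 2) (ε / 2)) (r / 2 / (‖d‖ + 1)), by positivity, ?_, ?_, ?_⟩
    · exact ((min_le_left _ _).trans (min_le_left _ _)).trans_lt (by linarith)
    · exact ((min_le_left _ _).trans (min_le_right _ _)).trans_lt (by linarith)
    · refine lt_of_le_of_lt (mul_le_mul_of_nonneg_right (min_le_right _ _) (norm_nonneg _)) ?_
      have : 0 ≤ ‖d‖ := norm_nonneg d
      rw [div_mul_eq_mul_div, div_lt_iff₀ (by positivity)]
      nlinarith
  have hηc : (η : ℂ) ≠ 0 := by exact_mod_cast hη0.ne'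
  set e : E := (η : ℂ) • d with he
  have hen : ‖e‖ < r / 2 := by
    rw [he, norm_smul, Complex.norm_real, Real.norm_of_nonneg hη0.le]; exact hηr
  have hsm : ∀ t : ℂ, ‖t‖ ≤ 1 → t * η ∈ Metric.ball (0 : ℂ) ρ := by
    intro t ht
    rw [mem_ball_zero_iff, norm_mul, Complex.norm_real, Real.norm_of_nonneg hη0.le]
    nlinarith [norm_nonneg t]
  have hne : ∀ᶠ w' in 𝓝 w, ∀ t ∈ Metric.sphere (0 : ℂ) 1, f (w' + t • e) ≠ 0 := by
    refine eventually_forall_line (p := fun w => f w ≠ 0) (isCompact_sphere _ _) fun t ht => ?_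
    rw [mem_sphere_zero_iff_norm] at ht
    have h1 := hb _ (hsm t ht.le)
    have ht0 : t ≠ 0 := by rintro rfl; simp at ht
    rw [he, smul_smul]
    exact h1.2.continuousAt.eventually_ne (h1.1 (by simp [ht0, hηc]))
  have han : ∀ᶠ w' in 𝓝 w, ∀ t ∈ Metric.closedBall (0 : ℂ) 1, AnalyticAt ℂ f (w' + t • e) := by
    refine eventually_forall_line (isCompact_closedBall _ _) fun t ht => ?_
    rw [mem_closedBall_zero_iff] at ht
    rw [he, smul_smul]
    exact (hb _ (hsm t ht)).2.eventually_analyticAt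
  have hnear : ∀ᶠ w' in 𝓝 w, ‖w' - w‖ + ‖e‖ < r := by
    filter_upwards [Metric.ball_mem_nhds w (by positivity : 0 < r / 2)] with w' hw'
    rw [Metric.mem_ball, dist_eq_norm] at hw'
    linarith
  obtain ⟨g, hg⟩ := hcirc e
  have hga := (hg w hnear.self_of_nhds
    fun t ht => hne.self_of_nhds t (by simpa using ht)).1
  -- `g` is the circle average of `1 / f`. If `f` had no zero on the disc centred at `w'`, then `g
  -- w' * f w' = 1`; but `g * f` is continuous and vanishes at `w`.
  have hgf : ∀ᶠ w' in 𝓝 w, g w' * f w' ≠ 1 := by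
    have : ContinuousAt (fun w' => g w' * f w') w := (hga.fun_mul hf).continuousAt
    refine this.eventually_ne ?_
    simp [h0]
  filter_upwards [hne, han, hnear, hgf] with w' h1 h2 h3 h4
  by_contra hc
  push Not at hc
  have hnz : ∀ t ∈ Metric.closedBall (0 : ℂ) 1, f (w' + t • e) ≠ 0 := by
    intro t ht
    rw [mem_closedBall_zero_iff] at ht
    have := hc (t * η) (by
      rw [norm_mul, Complex.norm_real, Real.norm_of_nonneg hη0.le]
      nlinarith [norm_nonneg t])
    rwa [he, smul_smul]
  have h5 := (hg w' h3 fun t ht => h1 t (by simpa using ht)).2 (fun t => (f (w' + t • e))⁻¹)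
    (fun t ht => (analyticAt_line (h2 t ht)).inv (hnz t ht))
    (fun t ht => inv_mul_cancel₀ (hnz t (by simp [ht])))
  apply h4
  rw [h5]
  simp only [zero_smul, add_zero]
  exact inv_mul_cancel₀ (by simpa using hnz 0 (by simp))

end SeveralVariables

/-! ### Generic immersions, and functions whose zeros lie on coordinate hyperplanes. -/

section SeveralVariables

variable {E : Type*} [NormedAddCommGroup E] [NormedSpace ℂ E]

/-- The `m`-th derivative along `d` is nonzero at `w`, hence nearby. -/
theorem eventually_lineOrder_le {f : E → ℂ} {w d : E} (hf : AnalyticAt ℂ f w) {m : ℕ}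
    (h : lineOrder d f w = m) : ∀ᶠ w' in 𝓝 w, lineOrder d f w' ≤ m := by
  have h1 := (analyticOrderAt_eq_nat_iff_iteratedDeriv_eq_zero (analyticAt_line_zero hf)).1 h
  filter_upwards [(analyticAt_iteratedDeriv_line (d := d) hf m).continuousAt.eventually_ne h1.2,
    hf.eventually_analyticAt] with w' h2 h3
  by_contra hc
  push Not at hc
  exact h2 ((natCast_le_analyticOrderAt_iff_iteratedDeriv_eq_zero (n := m + 1)
    (analyticAt_line_zero h3)).1 (by exact_mod_cast Order.add_one_le_of_lt hc) m (by omega))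

/-- Where `σ = 0`, the differential of `σ g` is `g` times that of `σ`; as `dτ` is nonzero at `w`, so
is `g`. -/
theorem eq_mul_unit_of_smooth {τ σ : E → ℂ} {w : E} (hτ : AnalyticAt ℂ τ w)
    (hτ' : fderiv ℂ τ w ≠ 0) (hσ : AnalyticAt ℂ σ w) (hσ0 : σ w = 0) (hσ' : fderiv ℂ σ w ≠ 0)
    (h : ∀ᶠ w' in 𝓝 w, σ w' = 0 → τ w' = 0) :
    ∃ g, AnalyticAt ℂ g w ∧ g w ≠ 0 ∧ (∀ᶠ w' in 𝓝 w, τ w' = σ w' * g w') ∧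
      fderiv ℂ τ w = g w • fderiv ℂ σ w := by
  obtain ⟨d, hd⟩ := exists_fderiv_apply_ne_zero hσ'
  obtain ⟨g, hg, hge⟩ := exists_eq_mul_of_eq_zero hτ hσ hσ0 hd h
  have h1 : fderiv ℂ τ w = g w • fderiv ℂ σ w := by
    rw [Filter.EventuallyEq.fderiv_eq (f₁ := τ) (f := fun w => σ w * g w) hge,
      fderiv_mul_of_eq_zero hσ hg hσ0]
  refine ⟨g, hg, ?_, hge, h1⟩
  intro h0
  rw [h0] at h1
  exact hτ' (h1.trans (by ext; simp))

/-- While `h` vanishes at `w`, its zeros persist on the nearby lines of direction `d`. They lie on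
`τ = 0`, which such a line meets only once, so `h` vanishes on the whole hypersurface and a factor
`τ` splits off. The order along `d` counts these steps. -/
theorem exists_eq_pow_mul_unit {h τ : E → ℂ} {w d : E} (hh : AnalyticAt ℂ h w)
    (hτ : AnalyticAt ℂ τ w) (hτ0 : τ w = 0) (hd : fderiv ℂ τ w d ≠ 0)
    (hz : ∀ᶠ w' in 𝓝 w, h w' = 0 → τ w' = 0) {m : ℕ} (hm : lineOrder d h w = m) :
    ∃ u, AnalyticAt ℂ u w ∧ u w ≠ 0 ∧ ∀ᶠ w' in 𝓝 w, h w' = τ w' ^ m * u w' := by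
  induction m generalizing h with
  | zero => exact ⟨h, hh, (lineOrder_eq_zero d hh).1 (by exact_mod_cast hm), by simp⟩
  | succ m ih =>
    have h0 : h w = 0 := by
      by_contra h0
      rw [(lineOrder_eq_zero d hh).2 h0] at hm
      exact absurd hm.symm (by exact_mod_cast Nat.succ_ne_zero m)
    obtain ⟨ρ, hρ, hinj⟩ := exists_injective_line hτ hd
    obtain ⟨ρ', hρ', hb⟩ := Metric.eventually_nhds_iff_ball.1
      (hz.and (Metric.ball_mem_nhds w hρ))
    have hzero : ∀ᶠ w' in 𝓝 w, τ w' = 0 → h w' = 0 := by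
      have hε : 0 < ρ' / 2 / (‖d‖ + 1) := by positivity
      filter_upwards [eventually_exists_zero_on_line hh h0 (d := d) (by rw [hm]; simp) hε,
        Metric.ball_mem_nhds w (by positivity : 0 < ρ' / 2)] with w' h1 h2 h3
      obtain ⟨t, ht, ht0⟩ := h1
      have h4 : w' + t • d ∈ Metric.ball w ρ' := by
        rw [Metric.mem_ball, dist_eq_norm] at h2 ⊢
        have h5 : ‖t • d‖ ≤ ρ' / 2 := by
          rw [norm_smul]
          rw [lt_div_iff₀ (by positivity)] at ht
          nlinarith [norm_nonneg t, norm_nonneg d]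
        calc ‖w' + t • d - w‖ = ‖(w' - w) + t • d‖ := by congr 1; abel
          _ ≤ _ := norm_add_le _ _
          _ < ρ' := by linarith
      have h5 : w' ∈ Metric.ball w ρ' := Metric.ball_subset_ball (by linarith) h2
      have h6 := (hb _ h4).1 ht0
      have h7 := hinj w' t (hb _ h5).2 (hb _ h4).2 (by rw [h6, h3])
      rw [h7, zero_smul, add_zero] at ht0
      exact ht0
    obtain ⟨h', hh', hhe⟩ := exists_eq_mul_of_eq_zero hh hτ hτ0 hd hzero
    obtain ⟨u, hu, hu0, hue⟩ := ih hh' (by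
      filter_upwards [hz, hhe] with w' a b c
      exact a (by rw [b, c, mul_zero])) (by
      have h1 := lineOrder_congr d hhe
      rw [lineOrder_mul d hτ hh', hm, lineOrder_eq_one hτ hτ0 hd] at h1
      push_cast at h1
      rw [add_comm] at h1
      exact le_antisymm ((ENat.add_le_add_iff_left (by simp)).1 h1.ge)
        ((ENat.add_le_add_iff_left (by simp)).1 h1.le))
    refine ⟨u, hu, hu0, ?_⟩
    filter_upwards [hhe, hue] with w' a b
    rw [a, b]; ring

/-- A holomorphic map with finite fibres is an immersion somewhere. -/
theorem exists_injective_fderiv_of_finite_fibers {b : ℕ} (m : ℕ) : ∀ {E : Type*}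
    [NormedAddCommGroup E] [NormedSpace ℂ E] [FiniteDimensional ℂ E] {ψ : E → Fin b → ℂ}
    {U : Set E}, Module.finrank ℂ E = m → IsOpen U → U.Nonempty → AnalyticOnNhd ℂ ψ U →
    (∀ c, {u ∈ U | ψ u = c}.Finite) → ∃ u ∈ U, Function.Injective (fderiv ℂ ψ u) := by
  induction m with
  | zero =>
    intro E _ _ _ ψ U hE _ hne _ _
    obtain ⟨u, hu⟩ := hne
    have := Module.finrank_zero_iff.1 hE
    exact ⟨u, hu, Function.injective_of_subsingleton _⟩
  | succ m ih =>
    intro E _ _ _ ψ U hE hU hne hψ hfin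
    have hcomp : CompleteSpace E := FiniteDimensional.complete ℂ E
    have hcoord : ∀ i, ∀ u ∈ U, AnalyticAt ℂ (fun v => ψ v i) u := fun i u hu =>
      ((ContinuousLinearMap.proj (R := ℂ) (φ := fun _ : Fin b => ℂ) i).analyticAt _).fun_comp
        (hψ u hu)
    have hfd : ∀ i, ∀ u ∈ U, fderiv ℂ (fun v => ψ v i) u =
        (ContinuousLinearMap.proj (R := ℂ) (φ := fun _ : Fin b => ℂ) i).comp (fderiv ℂ ψ u) := by
      intro i u hu
      have := (hasFDerivAt_pi'.1 (hψ u hu).differentiableAt.hasFDerivAt) i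
      exact this.fderiv
    -- If all the differentials were zero, `ψ` would be constant on a ball, which is infinite in
    -- positive dimension.
    obtain ⟨i, u₀, hu₀, hi⟩ : ∃ i, ∃ u ∈ U, fderiv ℂ (fun v => ψ v i) u ≠ 0 := by
      by_contra hc
      push Not at hc
      obtain ⟨u₀, hu₀⟩ := hne
      obtain ⟨R, hR, hRU⟩ := Metric.isOpen_iff.1 hU u₀ hu₀
      have hconst : ∀ v ∈ Metric.ball u₀ R, ψ v = ψ u₀ := by
        intro v hv
        ext i
        refine (convex_ball u₀ R).is_const_of_fderivWithin_eq_zero (𝕜 := ℂ)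
          (f := fun v => ψ v i) ?_ ?_ hv (Metric.mem_ball_self hR)
        · exact fun x hx => (hcoord i x (hRU hx)).differentiableAt.differentiableWithinAt
        · intro x hx
          rw [fderivWithin_of_isOpen Metric.isOpen_ball hx]
          exact hc i x (hRU hx)
      have h1 : (Metric.ball u₀ R).Finite :=
        (hfin (ψ u₀)).subset fun v hv => ⟨hRU hv, hconst v hv⟩
      have hnt : Nontrivial E := Module.nontrivial_of_finrank_pos (R := ℂ) (by omega)
      exact (infinite_of_mem_nhds u₀ (Metric.ball_mem_nhds u₀ hR)) h1
    set τ : E → ℂ := fun v => ψ v i - ψ u₀ i with hτ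
    have hτa : ∀ u ∈ U, AnalyticAt ℂ τ u := fun u hu => (hcoord i u hu).fun_sub analyticAt_const
    have hτd : ∀ u, fderiv ℂ τ u = fderiv ℂ (fun v => ψ v i) u := fun u => by
      rw [hτ, fderiv_sub_const]
    obtain ⟨e, l, d, he0, hez, hld, -, hle, hes, hea, hesa, hinv⟩ :=
      exists_straightening (hτa u₀ hu₀) (by simp [hτ]) (by rw [hτd]; exact hi) (hU.mem_nhds hu₀)
    -- The kernel of `l` parametrizes the level hypersurface of the component `i` through `u₀`,
    -- where the induction hypothesis applies.
    set K : Submodule ℂ E := l.ker with hK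
    set ι : K →L[ℂ] E := K.subtypeL with hι
    have hKm : Module.finrank ℂ K = m := by
      have h1 := LinearMap.finrank_range_add_finrank_ker (l : E →ₗ[ℂ] ℂ)
      have h2 : (l : E →ₗ[ℂ] ℂ).range = ⊤ := by
        rw [LinearMap.range_eq_top]
        intro c
        exact ⟨c • d, by simp [hld]⟩
      rw [h2, finrank_top, Module.finrank_self, hE] at h1
      have : Module.finrank ℂ K = Module.finrank ℂ (l : E →ₗ[ℂ] ℂ).ker := rfl
      omega
    set U' : Set K := ι ⁻¹' e.target with hU'
    have hψ' : AnalyticOnNhd ℂ (fun s => ψ (e.symm (ι s))) U' := by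
      intro s hs
      exact AnalyticAt.fun_comp (f := fun s => e.symm (ι s)) (hψ _ (hes (e.map_target hs)))
        (AnalyticAt.fun_comp (g := e.symm) (hesa _ hs) (ι.analyticAt s))
    obtain ⟨s, hs, hsinj⟩ := ih (E := K) (ψ := fun s => ψ (e.symm (ι s))) (U := U') hKm
      (e.open_target.preimage ι.continuous)
      ⟨0, by
        change ι 0 ∈ e.target
        rw [map_zero, ← hez]
        exact e.map_source he0⟩ hψ' (by
        intro c
        refine Set.Finite.of_finite_image (f := fun s => e.symm (ι s))
          ((hfin c).subset ?_) ?_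
        · rintro _ ⟨s, ⟨hs, hsc⟩, rfl⟩
          exact ⟨hes (e.map_target hs), hsc⟩
        · intro s hs s' hs' hss
          exact Subtype.val_injective (e.symm.injOn hs.1 hs'.1 hss))
    have hw := e.map_target hs
    refine ⟨e.symm (ι s), hes hw, ?_⟩
    obtain ⟨M, hM⟩ := hinv _ hw
    set w := e.symm (ι s) with hwdef
    rw [injective_iff_map_eq_zero]
    intro ξ hξ
    have he' : HasFDerivAt e (fderiv ℂ e w) w := (hea w hw).differentiableAt.hasFDerivAt
    -- A vector killed by `dψ` is killed by the differential of the component `i`, so it is tangent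
    -- to the level hypersurface.
    have h1 : l (fderiv ℂ e w ξ) = 0 := by
      have h2 : HasFDerivAt τ (l.comp (fderiv ℂ e w)) w := by
        have := (l.hasFDerivAt (x := e w)).comp w he'
        have h3 : (⇑l ∘ ⇑e) = τ := funext hle
        rwa [h3] at this
      have h4 : fderiv ℂ τ w ξ = 0 := by
        rw [hτd, hfd i w (hes hw)]
        simp [hξ]
      rw [h2.fderiv] at h4
      exact h4
    have hew : e w = ι s := e.right_inv hs
    have hψe : HasFDerivAt (fun v => ψ (e.symm v)) ((fderiv ℂ ψ w).comp (fderiv ℂ e.symm (ι s)))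
        (ι s) :=
      HasFDerivAt.comp (ι s) (hψ w (hes hw)).differentiableAt.hasFDerivAt
        (hesa _ hs).differentiableAt.hasFDerivAt
    have hsymm : (fderiv ℂ e.symm (ι s)) (fderiv ℂ e w ξ) = ξ := by
      have h2 : HasFDerivAt (fun v => e.symm (e v)) ((fderiv ℂ e.symm (ι s)).comp (fderiv ℂ e w)) w :=
        HasFDerivAt.comp (g := e.symm) w
          (by rw [hew]; exact (hesa _ hs).differentiableAt.hasFDerivAt) he'
      have h3 : (fun v => e.symm (e v)) =ᶠ[𝓝 w] id := by
        filter_upwards [e.open_source.mem_nhds hw] with v hv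
        exact e.left_inv hv
      have h4 := h2.fderiv
      rw [h3.fderiv_eq, fderiv_id] at h4
      have := congrArg (fun T => T ξ) h4
      simpa using this.symm
    have hη : (⟨fderiv ℂ e w ξ, h1⟩ : K) = 0 := by
      apply (injective_iff_map_eq_zero _).1 hsinj
      have h2 : HasFDerivAt (fun s => ψ (e.symm (ι s)))
          (((fderiv ℂ ψ w).comp (fderiv ℂ e.symm (ι s))).comp ι) s :=
        hψe.comp s ι.hasFDerivAt
      rw [h2.fderiv]
      simp only [ContinuousLinearMap.coe_comp, Function.comp_apply]
      change fderiv ℂ ψ w (fderiv ℂ e.symm (ι s) (fderiv ℂ e w ξ)) = 0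
      rw [hsymm, hξ]
    have hη' : fderiv ℂ e w ξ = 0 := congrArg Subtype.val hη
    rw [hM] at hη'
    exact (map_eq_zero_iff M M.injective).1 hη'

variable {n : ℕ}

theorem fderiv_coord (i : Fin n) (w : Fin n → ℂ) : fderiv ℂ (fun v : Fin n → ℂ => v i) w =
    ContinuousLinearMap.proj (R := ℂ) (φ := fun _ : Fin n => ℂ) i :=
  (ContinuousLinearMap.proj (R := ℂ) (φ := fun _ : Fin n => ℂ) i).hasFDerivAt.fderiv

theorem fderiv_coord_ne_zero (i : Fin n) (w : Fin n → ℂ) :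
    fderiv ℂ (fun v : Fin n → ℂ => v i) w ≠ 0 := by
  rw [fderiv_coord]
  intro h
  have := congrArg (fun T : (Fin n → ℂ) →L[ℂ] ℂ => T (Pi.single i 1)) h
  simp at this

theorem analyticAt_coord (i : Fin n) (w : Fin n → ℂ) :
    AnalyticAt ℂ (fun v : Fin n → ℂ => v i) w :=
  (ContinuousLinearMap.proj (R := ℂ) (φ := fun _ : Fin n => ℂ) i).analyticAt w

/-- At a nice point, at most one coordinate whose zeros are zeros of `Θ` vanishes. -/
theorem IsNicePoint.coord {Θ τ : (Fin n → ℂ) → ℂ} {w : Fin n → ℂ} (h : IsNicePoint Θ τ w)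
    {i : Fin n} (hi : w i = 0) (hz : ∀ᶠ w' in 𝓝 w, w' i = 0 → Θ w' = 0) :
    ∃ g, AnalyticAt ℂ g w ∧ g w ≠ 0 ∧ (∀ᶠ w' in 𝓝 w, τ w' = w' i * g w') ∧
      ∀ j, w j = 0 → (∀ᶠ w' in 𝓝 w, w' j = 0 → Θ w' = 0) → j = i := by
  obtain ⟨hτ, hτ0, hτ', N, u, hu, hu0, he⟩ := h
  have key : ∀ j, w j = 0 → (∀ᶠ w' in 𝓝 w, w' j = 0 → Θ w' = 0) →
      ∃ g, AnalyticAt ℂ g w ∧ g w ≠ 0 ∧ (∀ᶠ w' in 𝓝 w, τ w' = w' j * g w') ∧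
        fderiv ℂ τ w = g w • fderiv ℂ (fun v : Fin n → ℂ => v j) w := by
    intro j hj hz
    refine eq_mul_unit_of_smooth hτ hτ' (analyticAt_coord j w) hj (fderiv_coord_ne_zero j w) ?_
    filter_upwards [hz, he, hu.continuousAt.eventually_ne hu0] with w' a b c d
    have := a d
    rw [b] at this
    exact eq_zero_of_pow_eq_zero ((mul_eq_zero.1 this).resolve_right c)
  obtain ⟨g, hg, hg0, hge, hgd⟩ := key i hi hz
  refine ⟨g, hg, hg0, hge, fun j hj hzj => ?_⟩
  obtain ⟨g', hg', hg'0, -, hgd'⟩ := key j hj hzj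
  by_contra hne
  rw [hgd, fderiv_coord, fderiv_coord] at hgd'
  have := congrArg (fun T : (Fin n → ℂ) →L[ℂ] ℂ => T (Pi.single j 1)) hgd'
  simp only [smul_apply, ContinuousLinearMap.proj_apply, Pi.single_eq_same,
    Pi.single_eq_of_ne (Ne.symm hne), smul_eq_mul, mul_zero, mul_one] at this
  exact hg'0 this.symm

theorem lineOrder_coord {i : Fin n} {w d : Fin n → ℂ} (hi : w i = 0) (hd : d i ≠ 0) :
    lineOrder d (fun v => v i) w = 1 :=
  lineOrder_eq_one (analyticAt_coord i w) hi (by rw [fderiv_coord]; exact hd)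

theorem analyticAt_monomial (I : Finset (Fin n)) (m : Fin n → ℕ) (v : Fin n → ℂ) :
    AnalyticAt ℂ (fun v : Fin n → ℂ => ∏ i ∈ I, v i ^ m i) v :=
  Finset.analyticAt_fun_prod I fun i _ => (analyticAt_coord i v).fun_pow _

/-- At a nice point only one coordinate of `I` can vanish. If `h` vanishes there, it is a power of
this coordinate times a unit, and the exponent is its order along the transverse direction `d`,
hence at most `M`. -/
theorem germDvd_pow_of_nice {h τ : (Fin n → ℂ) → ℂ} {v d : Fin n → ℂ} {I : Finset (Fin n)}
    {M : ℕ} (hv : ∀ᶠ v' in 𝓝 v, h v' = 0 → ∃ i ∈ I, v' i = 0) (hva : AnalyticAt ℂ h v)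
    (hd : ∀ i, d i ≠ 0) (hvM : lineOrder d h v ≤ M)
    (hnice : IsNicePoint (fun v => ∏ i ∈ I, v i) τ v) :
    GermDvd h (fun v => ∏ i ∈ I, v i ^ M) v := by
  by_cases h0 : h v = 0
  · obtain ⟨i, hi, hi0⟩ := hv.self_of_nhds h0
    have hiz : ∀ j ∈ I, ∀ᶠ v' in 𝓝 v, v' j = 0 → ∏ i ∈ I, v' i = 0 := fun j hj =>
      Eventually.of_forall fun v' h => Finset.prod_eq_zero hj h
    obtain ⟨g, hg, hg0, hge, huniq⟩ := hnice.coord hi0 (hiz i hi)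
    have hz' : ∀ᶠ v' in 𝓝 v, h v' = 0 → v' i = 0 := by
      have hoth : ∀ᶠ v' in 𝓝 v, ∀ j ∈ I, j ≠ i → v' j ≠ 0 := by
        rw [Finset.eventually_all]
        intro j hj
        by_cases hji : j = i
        · exact Eventually.of_forall fun v' h => absurd hji h
        · have : v j ≠ 0 := fun hj0 => hji (huniq j hj0 (hiz j hj))
          exact ((analyticAt_coord j v).continuousAt.eventually_ne this).mono fun v' h _ => h
      filter_upwards [hv, hoth] with v' a b c
      obtain ⟨j, hj, hj0⟩ := a c
      by_cases hji : j = i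
      · rwa [← hji]
      · exact absurd hj0 (b j hj hji)
    obtain ⟨κ, hκ⟩ := ENat.ne_top_iff_exists.1 (ne_top_of_le_ne_top (by simp) hvM)
    have hκM : κ ≤ M := by rw [← hκ] at hvM; exact_mod_cast hvM
    obtain ⟨u, hu, hu0, hue⟩ := exists_eq_pow_mul_unit hva (analyticAt_coord i v) hi0
      (d := d) (by rw [fderiv_coord]; exact hd i) hz' hκ.symm
    refine ⟨fun v' => v' i ^ (M - κ) * (∏ j ∈ I.erase i, v' j ^ M) / u v',
      AnalyticAt.fun_div (((analyticAt_coord i v).fun_pow _).fun_mul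
        (analyticAt_monomial _ (fun _ => M) v)) hu hu0, ?_⟩
    filter_upwards [hue, hu.continuousAt.eventually_ne hu0] with v' a b
    rw [← Finset.mul_prod_erase _ _ hi, a]
    have h2 : v' i ^ M = v' i ^ κ * v' i ^ (M - κ) := by rw [← pow_add]; congr 1; omega
    rw [h2]
    field_simp
  · exact germDvd_of_ne_zero hva (analyticAt_monomial I (fun _ => M) v) h0

theorem eventually_diagonal_ne_zero {w : Fin n → ℂ} {I : Finset (Fin n)}
    (hI : ∀ i ∈ I, w i = 0) :
    ∀ᶠ t in 𝓝[≠] (0 : ℂ), ∀ i ∈ I, (w + t • (fun _ => 1 : Fin n → ℂ)) i ≠ 0 := by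
  filter_upwards [self_mem_nhdsWithin] with t ht i hi
  simpa [hI i hi] using ht

/-- A holomorphic function whose zeros lie on coordinate hyperplanes is a monomial up to a unit. -/
theorem exists_monomial {h : (Fin n → ℂ) → ℂ} {w : Fin n → ℂ} (hh : AnalyticAt ℂ h w)
    (I : Finset (Fin n)) (hI : ∀ i ∈ I, w i = 0)
    (hz : ∀ᶠ w' in 𝓝 w, h w' = 0 → ∃ i ∈ I, w' i = 0) :
    ∃ (e : Fin n → ℕ) (u : (Fin n → ℂ) → ℂ), AnalyticAt ℂ u w ∧ u w ≠ 0 ∧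
      ∀ᶠ w' in 𝓝 w, h w' = (∏ i ∈ I, w' i ^ e i) * u w' := by
  classical
  have hcross := eventually_diagonal_ne_zero hI
  -- A direction transverse to all the coordinate hyperplanes: the line through `w` leaves those of
  -- `I`, so `h` has finite order `M` along it, and semicontinuity bounds the orders nearby by `M`.
  obtain ⟨d, hd, hcross⟩ : ∃ d : Fin n → ℂ, (∀ i, d i ≠ 0) ∧
      ∀ᶠ t in 𝓝[≠] (0 : ℂ), ∀ i ∈ I, (w + t • d) i ≠ 0 := ⟨_, fun i => one_ne_zero, hcross⟩
  have hfin : lineOrder d h w ≠ ⊤ := by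
    intro htop
    rw [lineOrder, analyticOrderAt_eq_top] at htop
    have h1 : ∀ᶠ t in 𝓝[≠] (0 : ℂ), False := by
      filter_upwards [hcross, nhdsWithin_le_nhds htop,
        nhdsWithin_le_nhds ((tendsto_line w d).eventually hz)] with t h1 h2 h3
      obtain ⟨i, hi, hi0⟩ := h3 h2
      exact h1 i hi hi0
    exact h1.exists.elim fun _ h => h
  obtain ⟨M, hM⟩ := ENat.ne_top_iff_exists.1 hfin
  -- It suffices to divide at nice points; a divisor of a monomial is then itself a monomial up to a
  -- unit.
  have hdvd : GermDvd h (fun v => ∏ i ∈ I, v i ^ M) w := by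
    refine germDvd_of_nice (Θ := fun v => ∏ i ∈ I, v i) (analyticAt_monomial I (fun _ => M) w) hh
      (Finset.analyticAt_fun_prod I fun i _ => analyticAt_coord i w) ?_ ?_ ?_
    · have h1 : ∃ᶠ t in 𝓝 (0 : ℂ), ∏ i ∈ I, (w + t • d) i ≠ 0 :=
        (hcross.frequently.mono fun t ht => Finset.prod_ne_zero_iff.2 ht).filter_mono
          nhdsWithin_le_nhds
      exact (tendsto_line w d).frequently h1
    · filter_upwards [hz] with v h1 h2 h3
      obtain ⟨i, hi, hi0⟩ := h1 h3
      exact h2 (Finset.prod_eq_zero hi hi0)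
    · filter_upwards [hz.eventually_nhds, hh.eventually_analyticAt,
        eventually_lineOrder_le hh hM.symm] with v hv hva hvM τ hnice
      exact germDvd_pow_of_nice hv hva hd hvM hnice
  obtain ⟨g, hg, hge⟩ := hdvd
  have h1 : ∀ i ∈ I, AnalyticAt ℂ (fun v : Fin n → ℂ => v i) w ∧ w i = 0 ∧
      fderiv ℂ (fun v : Fin n → ℂ => v i) w ≠ 0 :=
    fun i hi => ⟨analyticAt_coord i w, hI i hi, fderiv_coord_ne_zero i w⟩
  have h2 : ∀ᶠ v in 𝓝 w, h v * g v = (∏ i ∈ I, v i ^ M) * 1 := by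
    filter_upwards [hge] with v hv
    rw [← hv, mul_one]
  have h3 : AnalyticAt ℂ (fun _ : Fin n → ℂ => (1 : ℂ)) w := analyticAt_const
  obtain ⟨e, u, hu, hu0, he⟩ := exists_monomial_of_mul_eq (E := Fin n → ℂ) (κ := Fin n) I
    (τ := fun i v => v i) h1 (fun _ => M) (v := fun _ => 1) hh hg h3 one_ne_zero h2
  exact ⟨e, u, hu, hu0, he⟩

/-- A holomorphic function whose zeros lie on coordinate hyperplanes, and which does not vanish
identically on any of them, is a unit. -/
theorem ne_zero_of_zeros_subset {h : (Fin n → ℂ) → ℂ} {w : Fin n → ℂ} (hh : AnalyticAt ℂ h w)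
    (I : Finset (Fin n)) (hI : ∀ i ∈ I, w i = 0)
    (hz : ∀ᶠ w' in 𝓝 w, h w' = 0 → ∃ i ∈ I, w' i = 0)
    (hne : ∀ i ∈ I, ∃ᶠ w' in 𝓝 w, w' i = 0 ∧ h w' ≠ 0) : h w ≠ 0 := by
  obtain ⟨e, u, hu, hu0, he⟩ := exists_monomial hh I hI hz
  have h0 : ∀ i ∈ I, e i = 0 := by
    intro i hi
    obtain ⟨v, ⟨hv0, hv⟩, hve⟩ := ((hne i hi).and_eventually he).exists
    by_contra hei
    apply hv
    rw [hve, Finset.prod_eq_zero hi (by rw [hv0, zero_pow hei]), zero_mul]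
  rw [he.self_of_nhds, Finset.prod_congr rfl (fun i hi => by rw [h0 i hi, pow_zero])]
  simpa using hu0

end SeveralVariables

/-! ### The logarithmic Jacobian matrix. -/

section LocalCoverings

variable {n : ℕ}

theorem apply_eq_sum_single {F : Type*} [AddCommGroup F] [Module ℂ F] [TopologicalSpace F]
    (T : (Fin n → ℂ) →L[ℂ] F) (ξ : Fin n → ℂ) : T ξ = ∑ b, ξ b • T (Pi.single b 1) := by
  conv_lhs => rw [pi_eq_sum_univ' ξ]
  simp [map_sum]

/-- Monomials are eigenvectors of the fields `w_a ∂_a`. No division by `w_a` takes place, so the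
formula is also valid on the hyperplanes. -/
theorem fderiv_monomial {I : Finset (Fin n)} {e : Fin n → ℕ} {w ξ η : Fin n → ℂ}
    (h : ∀ a ∈ I, e a ≠ 0 → η a = w a * ξ a) :
    fderiv ℂ (fun w : Fin n → ℂ => ∏ a ∈ I, w a ^ e a) w η =
      (∏ a ∈ I, w a ^ e a) * ∑ a ∈ I, (e a : ℂ) * ξ a := by
  classical
  induction I using Finset.induction_on with
  | empty => simp
  | insert a I ha ih =>
    have h1 : (fun w : Fin n → ℂ => ∏ a ∈ insert a I, w a ^ e a) =
        fun w => w a ^ e a * ∏ a ∈ I, w a ^ e a := by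
      ext w; rw [Finset.prod_insert ha]
    have h2 : HasFDerivAt (fun w : Fin n → ℂ => w a)
        (ContinuousLinearMap.proj (R := ℂ) (φ := fun _ : Fin n => ℂ) a) w :=
      (ContinuousLinearMap.proj (R := ℂ) (φ := fun _ : Fin n => ℂ) a).hasFDerivAt
    have h3 := (h2.pow (e a)).mul (analyticAt_monomial I e w).differentiableAt.hasFDerivAt
    rw [h1, show fderiv ℂ (fun w : Fin n → ℂ => w a ^ e a * ∏ a ∈ I, w a ^ e a) w = _ from
      h3.fderiv]
    simp only [add_apply, smul_apply, smul_eq_mul,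
      ContinuousLinearMap.proj_apply, Finset.sum_insert ha]
    rw [ih fun b hb => h b (Finset.mem_insert_of_mem hb), Finset.prod_insert ha]
    have h4 : (e a : ℂ) * w a ^ (e a - 1) * η a = w a ^ e a * ((e a : ℂ) * ξ a) := by
      by_cases he : e a = 0
      · simp [he]
      · rw [h a (Finset.mem_insert_self _ _) he]
        obtain ⟨k, hk⟩ := Nat.exists_eq_succ_of_ne_zero he
        rw [hk]
        simp only [Nat.succ_eq_add_one, Nat.add_sub_cancel, pow_succ]
        ring
    simp only [nsmul_eq_mul]
    linear_combination (∏ b ∈ I, w b ^ e b) * h4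

/-- The vector field with components `w_b ξ_b` for `b ∈ I`, and `ξ_b` for `b ∉ I`. -/
def logVector (I : Finset (Fin n)) (w ξ : Fin n → ℂ) : Fin n → ℂ :=
  fun b => if b ∈ I then w b * ξ b else ξ b

/-- The logarithmic Jacobian matrix of a map `Φ` with `Φ_j = u_j ∏ w_a ^ (e j a)`, `j ∈ J`. -/
noncomputable def logJacobian (Φ : (Fin n → ℂ) → Fin n → ℂ) (I J : Finset (Fin n))
    (e : Fin n → Fin n → ℕ) (u : Fin n → (Fin n → ℂ) → ℂ) (w : Fin n → ℂ) :
    Matrix (Fin n) (Fin n) ℂ := fun j b =>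
  if j ∈ J then (e j b : ℂ) + (if b ∈ I then w b else 1) * fderiv ℂ (u j) w (Pi.single b 1) / u j w
  else (if b ∈ I then w b else 1) * fderiv ℂ (fun w => Φ w j) w (Pi.single b 1)

variable {Φ : (Fin n → ℂ) → Fin n → ℂ} {I J : Finset (Fin n)} {e : Fin n → Fin n → ℕ}
  {u : Fin n → (Fin n → ℂ) → ℂ} {w : Fin n → ℂ}

theorem sum_logVector (T : (Fin n → ℂ) →L[ℂ] ℂ) (ξ : Fin n → ℂ) :
    ∑ b, (if b ∈ I then w b else 1) * T (Pi.single b 1) * ξ b = T (logVector I w ξ) := by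
  rw [apply_eq_sum_single T]
  refine Finset.sum_congr rfl fun b _ => ?_
  by_cases hb : b ∈ I
  · simp only [logVector, hb, if_true, smul_eq_mul]; ring
  · simp only [logVector, hb, if_false, smul_eq_mul]; ring

theorem logJacobian_mulVec_of_notMem {j : Fin n} (hj : j ∉ J) (ξ : Fin n → ℂ) :
    (logJacobian Φ I J e u w).mulVec ξ j = fderiv ℂ (fun w => Φ w j) w (logVector I w ξ) := by
  rw [← sum_logVector]
  simp [Matrix.mulVec, dotProduct, logJacobian, hj]

theorem logJacobian_mulVec_of_mem {j : Fin n} (hj : j ∈ J) (ξ : Fin n → ℂ) :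
    (logJacobian Φ I J e u w).mulVec ξ j =
      ∑ b, (e j b : ℂ) * ξ b + fderiv ℂ (u j) w (logVector I w ξ) / u j w := by
  rw [← sum_logVector]
  simp only [Matrix.mulVec, dotProduct, logJacobian, hj, if_true, add_mul, Finset.sum_add_distrib]
  congr 1
  rw [Finset.sum_div]
  refine Finset.sum_congr rfl fun b _ => ?_
  ring

/-- For `j ∈ J` the row is `dΦ_j / Φ_j` evaluated on logarithmic fields, written so as to remain
holomorphic across the hyperplanes. -/
theorem mul_logJacobian_mulVec {j : Fin n} (hj : j ∈ J) (he : ∀ a ∉ I, e j a = 0)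
    (hu : AnalyticAt ℂ (u j) w) (hu0 : u j w ≠ 0)
    (hΦ : ∀ᶠ w' in 𝓝 w, Φ w' j = (∏ a ∈ I, w' a ^ e j a) * u j w') (ξ : Fin n → ℂ) :
    Φ w j * (logJacobian Φ I J e u w).mulVec ξ j =
      fderiv ℂ (fun w => Φ w j) w (logVector I w ξ) := by
  rw [logJacobian_mulVec_of_mem hj, hΦ.self_of_nhds]
  rw [Filter.EventuallyEq.fderiv_eq (f₁ := fun w => Φ w j)
    (f := fun w' => (∏ a ∈ I, w' a ^ e j a) * u j w') hΦ]
  rw [fderiv_fun_mul (analyticAt_monomial I (e j) w).differentiableAt hu.differentiableAt]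
  simp only [add_apply, smul_apply, smul_eq_mul]
  rw [fderiv_monomial (ξ := ξ) (fun a ha _ => by simp [logVector, ha])]
  have h1 : ∑ b, (e j b : ℂ) * ξ b = ∑ b ∈ I, (e j b : ℂ) * ξ b := by
    symm
    refine Finset.sum_subset (Finset.subset_univ _) fun b _ hb => ?_
    simp [he b hb]
  rw [h1]
  field_simp
  ring

theorem analyticAt_logJacobian_det (hΦ : AnalyticAt ℂ Φ w) (hu : ∀ j ∈ J, AnalyticAt ℂ (u j) w)
    (hu0 : ∀ j ∈ J, u j w ≠ 0) :
    AnalyticAt ℂ (fun w => (logJacobian Φ I J e u w).det) w := by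
  simp only [Matrix.det_apply]
  refine Finset.analyticAt_fun_sum _ fun σ _ => ?_
  simp only [Units.smul_def, zsmul_eq_mul]
  refine analyticAt_const.fun_mul (Finset.analyticAt_fun_prod _ fun b _ => ?_)
  have hm : AnalyticAt ℂ (fun w : Fin n → ℂ => if b ∈ I then w b else 1) w := by
    by_cases hb : b ∈ I
    · simpa [hb] using analyticAt_coord b w
    · simpa [hb] using analyticAt_const
  by_cases hj : σ b ∈ J
  · simp only [logJacobian, hj, if_true]
    exact analyticAt_const.fun_add ((hm.fun_mul (analyticAt_fderiv_apply (hu _ hj) _)).fun_div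
      (hu _ hj) (hu0 _ hj))
  · simp only [logJacobian, hj, if_false]
    refine hm.fun_mul (analyticAt_fderiv_apply ?_ _)
    exact (analyticAt_coord (σ b) (Φ w)).fun_comp hΦ

/-- Restricted to the part of `w_a = 0` off the other hyperplanes of `I`, `Φ` still has finite
fibres, hence is immersive at points arbitrarily close to `v`. -/
theorem frequently_immersion {v : Fin n → ℂ} (hΦ : AnalyticAt ℂ Φ v)
    (hfin : ∃ O ∈ 𝓝 v, ∀ c, {w ∈ O | Φ w = c}.Finite) {a : Fin n} (ha : v a = 0)
    (hI : ∀ b ∈ I, v b = 0) :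
    ∃ᶠ w in 𝓝 v, w a = 0 ∧ (∀ b ∈ I, b ≠ a → w b ≠ 0) ∧
      ∀ η : Fin n → ℂ, η a = 0 → fderiv ℂ Φ w η = 0 → η = 0 := by
  rw [frequently_iff]
  intro U hU
  obtain ⟨O, hO, hOfin⟩ := hfin
  obtain ⟨R, hR, hb⟩ := Metric.eventually_nhds_iff_ball.1
    (hΦ.eventually_analyticAt.and (inter_mem hU hO))
  set l := ContinuousLinearMap.proj (R := ℂ) (φ := fun _ : Fin n => ℂ) a with hl
  set ι : l.ker →L[ℂ] (Fin n → ℂ) := l.ker.subtypeL with hι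
  have hιa : ∀ s, ι s a = 0 := fun s => s.2
  have hcont : Continuous fun s : l.ker => v + ι s := by fun_prop
  set W : Set (Fin n → ℂ) := Metric.ball v R ∩ ⋂ b ∈ I.erase a, {w : Fin n → ℂ | w b ≠ 0} with hW
  have hWo : IsOpen W := Metric.isOpen_ball.inter
    (isOpen_biInter_finset fun b _ => isOpen_ne.preimage (continuous_apply b))
  have hWb : ∀ w ∈ W, w ∈ Metric.ball v R := fun w hw => hw.1
  have hWne : ∀ w ∈ W, ∀ b ∈ I, b ≠ a → w b ≠ 0 := by
    intro w hw b hb hba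
    have := mem_iInter₂.1 hw.2 b (Finset.mem_erase.2 ⟨hba, hb⟩)
    exact this
  set U' : Set l.ker := (fun s => v + ι s) ⁻¹' W with hU'
  have hne : U'.Nonempty := by
    -- Moving every coordinate except `a` by `R / 2` gives a point of the hyperplane that is off the
    -- others.
    set q : Fin n → ℂ := fun b => if b = a then 0 else ((R / 2 : ℝ) : ℂ) with hq
    have hqa : q a = 0 := by simp [hq]
    refine ⟨⟨q, hqa⟩, ?_, ?_⟩
    · change v + q ∈ _
      rw [Metric.mem_ball, dist_eq_norm, add_sub_cancel_left]
      refine lt_of_le_of_lt ((pi_norm_le_iff_of_nonneg (by positivity : 0 ≤ R / 2)).2 fun b => ?_)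
        (by linarith)
      by_cases hba : b = a
      · simp only [hq, hba, if_true, norm_zero]; positivity
      · simp only [hq, hba, if_false, Complex.norm_real, Real.norm_eq_abs]
        rw [abs_of_pos (by positivity)]
    · rw [mem_iInter₂]
      intro b hb
      obtain ⟨hba, hbI⟩ := Finset.mem_erase.1 hb
      change v b + q b ≠ 0
      rw [hI b hbI, zero_add]
      simp only [hq, hba, if_false]
      exact_mod_cast (by positivity : R / 2 ≠ 0)
  have hψ : AnalyticOnNhd ℂ (fun s => Φ (v + ι s)) U' := by
    intro s hs
    exact AnalyticAt.fun_comp (f := fun s => v + ι s) (hb _ (hWb _ hs)).1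
      (analyticAt_const.add (ι.analyticAt s))
  obtain ⟨s, hs, hsinj⟩ := exists_injective_fderiv_of_finite_fibers _
    (ψ := fun s => Φ (v + ι s)) rfl (hWo.preimage hcont) hne hψ (by
      intro c
      refine Set.Finite.of_finite_image (f := fun s => v + ι s) ((hOfin c).subset ?_) ?_
      · rintro _ ⟨s, ⟨hs, hsc⟩, rfl⟩
        exact ⟨(hb _ (hWb _ hs)).2.2, hsc⟩
      · intro s _ s' _ hss
        exact Subtype.val_injective (add_left_cancel hss))
  refine ⟨v + ι s, (hb _ (hWb _ hs)).2.1, ?_, hWne _ hs, fun η hη hη0 => ?_⟩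
  · rw [Pi.add_apply, ha, hιa, add_zero]
  · have h1 : HasFDerivAt (fun s => Φ (v + ι s)) ((fderiv ℂ Φ (v + ι s)).comp ι) s :=
      HasFDerivAt.comp (f := fun s => v + ι s) s (hb _ (hWb _ hs)).1.differentiableAt.hasFDerivAt
        (ι.hasFDerivAt.const_add v)
    rw [h1.fderiv] at hsinj
    have h2 : (⟨η, hη⟩ : l.ker) = 0 := (injective_iff_map_eq_zero _).1 hsinj _ hη0
    exact congrArg Subtype.val h2

theorem eventually_prod_eq_of_mem {f : (Fin n → ℂ) → ℂ} {e : Fin n → ℕ}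
    {u : (Fin n → ℂ) → ℂ} {v : Fin n → ℂ} {a : Fin n} (ha : a ∈ I)
    (h : ∀ᶠ w in 𝓝 v, f w = (∏ b ∈ I, w b ^ e b) * u w) (hea : e a ≠ 0) :
    ∀ᶠ w in 𝓝 v, w a = 0 → f w = 0 := by
  filter_upwards [h] with w h1 h2
  rw [h1, Finset.prod_eq_zero ha (by rw [h2, zero_pow hea]), zero_mul]

/-- Two components of a map that is immersive on the hyperplane `w_a = 0` do not both vanish on this
hyperplane. -/
theorem eq_of_eq_zero_on_hyperplane {a : Fin n} (hΦ : AnalyticAt ℂ Φ w) (ha : w a = 0)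
    (himm : ∀ η : Fin n → ℂ, η a = 0 → fderiv ℂ Φ w η = 0 → η = 0) {j j' : Fin n}
    (hj : ∀ᶠ w' in 𝓝 w, w' a = 0 → Φ w' j = 0) (hj' : ∀ᶠ w' in 𝓝 w, w' a = 0 → Φ w' j' = 0) :
    j = j' := by
  classical
  have key : ∀ j, (∀ᶠ w' in 𝓝 w, w' a = 0 → Φ w' j = 0) →
      ∀ η : Fin n → ℂ, η a = 0 → fderiv ℂ Φ w η j = 0 := by
    intro j hj η hη
    have h1 : AnalyticAt ℂ (fun w => Φ w j) w := (analyticAt_coord j (Φ w)).fun_comp hΦ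
    obtain ⟨g, hg, hge⟩ := exists_eq_mul_of_eq_zero (d := Pi.single a 1) h1 (analyticAt_coord a w)
      ha (by rw [fderiv_coord]; simp) hj
    have h2 := (hasFDerivAt_pi'.1 hΦ.differentiableAt.hasFDerivAt) j
    have h3 : fderiv ℂ (fun w => Φ w j) w η = 0 := by
      rw [Filter.EventuallyEq.fderiv_eq (f₁ := fun w => Φ w j) (f := fun w => w a * g w) hge,
        fderiv_mul_of_eq_zero (analyticAt_coord a w) hg ha, fderiv_coord]
      simp [hη]
    rw [h2.fderiv] at h3
    exact h3
  by_contra hne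
  -- For `j ≠ j'` the differential would inject the hyperplane, of dimension `n - 1`, into the `n -
  -- 2` remaining components.
  let T : (LinearMap.proj (R := ℂ) (φ := fun _ : Fin n => ℂ) a).ker →ₗ[ℂ]
      ({i : Fin n // i ≠ j ∧ i ≠ j'} → ℂ) :=
    { toFun := fun η i => fderiv ℂ Φ w η.1 i.1
      map_add' := by intro x y; ext i; simp
      map_smul' := by intro c x; ext i; simp }
  have hT : Function.Injective T := by
    rw [injective_iff_map_eq_zero]
    rintro ⟨η, hη⟩ h0
    have : fderiv ℂ Φ w η = 0 := by
      ext i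
      by_cases h1 : i = j
      · subst h1; exact key _ hj η hη
      · by_cases h2 : i = j'
        · subst h2; exact key _ hj' η hη
        · exact congrFun h0 ⟨i, h1, h2⟩
    exact Subtype.ext (himm η hη this)
  have h1 := LinearMap.finrank_le_finrank_of_injective hT
  have h2 := LinearMap.finrank_range_add_finrank_ker
    (LinearMap.proj (R := ℂ) (φ := fun _ : Fin n => ℂ) a)
  have h3 : (LinearMap.proj (R := ℂ) (φ := fun _ : Fin n => ℂ) a).range = ⊤ :=
    LinearMap.range_eq_top.2 fun c => ⟨fun _ => c, rfl⟩
  rw [h3, finrank_top, Module.finrank_self, Module.finrank_fin_fun] at h2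
  rw [Module.finrank_fintype_fun_eq_card] at h1
  have h4 : Fintype.card {i : Fin n // i ≠ j ∧ i ≠ j'} + 2 ≤ n := by
    have : (Finset.univ.filter fun i : Fin n => i ≠ j ∧ i ≠ j') ∪ {j, j'} ⊆ Finset.univ :=
      Finset.subset_univ _
    have h5 := Finset.card_le_card this
    rw [Finset.card_union_of_disjoint, Finset.card_pair hne, Finset.card_univ, Fintype.card_fin]
      at h5
    · rwa [Fintype.card_subtype]
    · rw [Finset.disjoint_left]
      intro x hx hx'
      simp only [Finset.mem_filter, Finset.mem_univ, true_and] at hx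
      simp only [Finset.mem_insert, Finset.mem_singleton] at hx'
      tauto
  omega

end LocalCoverings

/-! ### Local structure of a covering along its branch locus. -/

section BranchStructure

variable {n : ℕ}

theorem fderiv_component {Φ : (Fin n → ℂ) → Fin n → ℂ} {w : Fin n → ℂ} (hΦ : AnalyticAt ℂ Φ w)
    (η : Fin n → ℂ) (j : Fin n) : fderiv ℂ Φ w η j = fderiv ℂ (fun w => Φ w j) w η := by
  have h := ((hasFDerivAt_pi'.1 hΦ.differentiableAt.hasFDerivAt) j).fderiv
  rw [h]; rfl

theorem fderiv_logVector_eq_zero {Φ : (Fin n → ℂ) → Fin n → ℂ} {I J : Finset (Fin n)}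
    {e : Fin n → Fin n → ℕ} {u : Fin n → (Fin n → ℂ) → ℂ} {w : Fin n → ℂ}
    (hΦ : AnalyticAt ℂ Φ w) (he : ∀ j ∈ J, ∀ a ∉ I, e j a = 0)
    (hu : ∀ j ∈ J, AnalyticAt ℂ (u j) w) (hu0 : ∀ j ∈ J, u j w ≠ 0)
    (hm : ∀ j ∈ J, ∀ᶠ w' in 𝓝 w, Φ w' j = (∏ a ∈ I, w' a ^ e j a) * u j w') {ξ : Fin n → ℂ}
    (h : (logJacobian Φ I J e u w).mulVec ξ = 0) : fderiv ℂ Φ w (logVector I w ξ) = 0 := by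
  ext j
  rw [fderiv_component hΦ]
  by_cases hj : j ∈ J
  · rw [← mul_logJacobian_mulVec hj (he j hj) (hu j hj) (hu0 j hj) (hm j hj), h]
    simp
  · rw [← logJacobian_mulVec_of_notMem hj, h]

theorem det_ne_zero_of_mulVec {A : Matrix (Fin n) (Fin n) ℂ}
    (h : ∀ ξ, A.mulVec ξ = 0 → ξ = 0) : A.det ≠ 0 := by
  intro h0
  obtain ⟨ξ, hξ, h1⟩ := Matrix.exists_mulVec_eq_zero_iff.2 h0
  exact hξ (h ξ h1)

/-- The logarithmic Jacobian matrix of a finite map which is branched over the hyperplanes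
`z_j = 0`, `j ∈ J`, is invertible. -/
theorem logJacobian_det_ne_zero {Φ : (Fin n → ℂ) → Fin n → ℂ} {v : Fin n → ℂ}
    (hΦ : AnalyticAt ℂ Φ v) {I J : Finset (Fin n)} (hI : ∀ a ∈ I, v a = 0)
    (hram : ∀ᶠ w in 𝓝 v, (∀ j ∈ J, Φ w j ≠ 0) → Function.Injective (fderiv ℂ Φ w))
    (hfin : ∃ O ∈ 𝓝 v, ∀ c, {w ∈ O | Φ w = c}.Finite)
    {e : Fin n → Fin n → ℕ} {u : Fin n → (Fin n → ℂ) → ℂ}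
    (he : ∀ j ∈ J, ∀ a ∉ I, e j a = 0) (heI : ∀ a ∈ I, ∃ j ∈ J, e j a ≠ 0)
    (hu : ∀ j ∈ J, AnalyticAt ℂ (u j) v) (hu0 : ∀ j ∈ J, u j v ≠ 0)
    (hm : ∀ j ∈ J, ∀ᶠ w in 𝓝 v, Φ w j = (∏ a ∈ I, w a ^ e j a) * u j w) :
    (logJacobian Φ I J e u v).det ≠ 0 := by
  have hev : ∀ᶠ w in 𝓝 v, AnalyticAt ℂ Φ w ∧ (∀ j ∈ J, AnalyticAt ℂ (u j) w) ∧
      (∀ j ∈ J, u j w ≠ 0) ∧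
      (∀ j ∈ J, ∀ᶠ w' in 𝓝 w, Φ w' j = (∏ a ∈ I, w' a ^ e j a) * u j w') := by
    refine hΦ.eventually_analyticAt.and (Filter.Eventually.and ?_ (Filter.Eventually.and ?_ ?_))
    · exact (Filter.eventually_all_finset J).2 fun j hj => (hu j hj).eventually_analyticAt
    · exact (Filter.eventually_all_finset J).2 fun j hj =>
        (hu j hj).continuousAt.eventually_ne (hu0 j hj)
    · exact (Filter.eventually_all_finset J).2 fun j hj => (hm j hj).eventually_nhds
  -- The determinant has no zero off the hyperplanes, where `Φ` is unramified, and is not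
  -- identically zero on any of them, where `Φ` is generically immersive. Such a function is a unit.
  refine ne_zero_of_zeros_subset (analyticAt_logJacobian_det hΦ hu hu0) I hI ?_ ?_
  · filter_upwards [hev, hram] with w ⟨h1, h2, h3, h4⟩ h5 h6
    by_contra hcon
    push Not at hcon
    refine det_ne_zero_of_mulVec (fun ξ hξ => ?_) h6
    have h7 := fderiv_logVector_eq_zero h1 he h2 h3 h4 hξ
    have h8 : logVector I w ξ = 0 := by
      apply h5 _ (by rw [h7, map_zero])
      intro j hj
      rw [(h4 j hj).self_of_nhds]
      exact mul_ne_zero (Finset.prod_ne_zero_iff.2 fun a ha => pow_ne_zero _ (hcon a ha)) (h3 j hj)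
    ext b
    have h9 := congrFun h8 b
    by_cases hb : b ∈ I
    · simpa [logVector, hb, hcon b hb] using h9
    · simpa [logVector, hb] using h9
  · intro a ha
    refine ((frequently_immersion hΦ hfin (hI a ha) hI).and_eventually hev).mono ?_
    rintro w ⟨⟨ha0, hb0, himm⟩, h1, h2, h3, h4⟩
    refine ⟨ha0, det_ne_zero_of_mulVec fun ξ hξ => ?_⟩
    have h8 : logVector I w ξ = 0 :=
      himm _ (by simp [logVector, ha, ha0]) (fderiv_logVector_eq_zero h1 he h2 h3 h4 hξ)
    have h9 : ∀ b, b ≠ a → ξ b = 0 := by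
      intro b hba
      have h9 := congrFun h8 b
      by_cases hb : b ∈ I
      · simpa [logVector, hb, hb0 b hb hba] using h9
      · simpa [logVector, hb] using h9
    -- Only the component `ξ_a` is left; a row whose exponent at `a` is nonzero kills it.
    obtain ⟨j, hj, hja⟩ := heI a ha
    have h10 := congrFun hξ j
    rw [logJacobian_mulVec_of_mem hj, h8, Finset.sum_eq_single a (fun b _ hb => by simp [h9 b hb])
      (by simp)] at h10
    ext b
    by_cases hb : b = a
    · subst hb
      simpa [hja] using h10
    · exact h9 b hb

/-- The components in `J` are monomials times units. A dimension count on `w_a = 0` puts each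
hyperplane of `I₀` over a single `z_j = 0`; invertibility of the logarithmic Jacobian at `v` allows
only one hyperplane over each `z_j = 0`, and what remains of it is the injectivity of `dΦ` on the
stratum `w_a = 0`, `a ∈ I₀`. -/
theorem exists_branch_structure {Φ : (Fin n → ℂ) → Fin n → ℂ} {v : Fin n → ℂ}
    (hΦ : AnalyticAt ℂ Φ v) {I J : Finset (Fin n)} (hI : ∀ a ∈ I, v a = 0)
    (hJ : ∀ j ∈ J, Φ v j = 0)
    (hz : ∀ j ∈ J, ∀ᶠ w in 𝓝 v, Φ w j = 0 → ∃ a ∈ I, w a = 0)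
    (hram : ∀ᶠ w in 𝓝 v, (∀ j ∈ J, Φ w j ≠ 0) → Function.Injective (fderiv ℂ Φ w))
    (hfin : ∃ O ∈ 𝓝 v, ∀ c, {w ∈ O | Φ w = c}.Finite) :
    ∃ (I₀ : Finset (Fin n)) (τ : Fin n → Fin n) (p : Fin n → ℕ) (u : Fin n → (Fin n → ℂ) → ℂ),
      I₀ ⊆ I ∧ Set.InjOn τ I₀ ∧ (∀ j, j ∈ J ↔ ∃ a ∈ I₀, τ a = j) ∧
      (∀ a ∈ I₀, p a ≠ 0 ∧ AnalyticAt ℂ (u a) v ∧ u a v ≠ 0 ∧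
        ∀ᶠ w in 𝓝 v, Φ w (τ a) = w a ^ p a * u a w) ∧
      ∀ ξ : Fin n → ℂ, (∀ a ∈ I₀, ξ a = 0) → fderiv ℂ Φ v ξ = 0 → ξ = 0 := by
  classical
  have hcomp : ∀ j, AnalyticAt ℂ (fun w => Φ w j) v := fun j =>
    (analyticAt_coord j (Φ v)).fun_comp hΦ
  have hmon : ∀ j, ∃ (e : Fin n → ℕ) (u : (Fin n → ℂ) → ℂ), j ∈ J → AnalyticAt ℂ u v ∧ u v ≠ 0 ∧
      ∀ᶠ w in 𝓝 v, Φ w j = (∏ a ∈ I, w a ^ e a) * u w := by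
    intro j
    by_cases hj : j ∈ J
    · obtain ⟨e, u, h⟩ := exists_monomial (hcomp j) I hI (hz j hj)
      exact ⟨e, u, fun _ => h⟩
    · exact ⟨0, 0, fun h => absurd h hj⟩
  choose e' u hmon using hmon
  set I₀ : Finset (Fin n) := I.filter fun a => ∃ j ∈ J, e' j a ≠ 0 with hI₀
  -- `I₀` drops the hyperplanes on which no component of `J` vanishes. The exponents given by `hmon`
  -- are arbitrary outside `I` and are reset to zero there.
  set e : Fin n → Fin n → ℕ := fun j a => if a ∈ I then e' j a else 0 with he
  have hsub : I₀ ⊆ I := Finset.filter_subset _ _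
  have heI : ∀ j ∈ J, ∀ a ∉ I₀, e j a = 0 := by
    intro j hj a ha
    by_cases haI : a ∈ I
    · simp only [he, haI, if_true]
      by_contra h
      exact ha (Finset.mem_filter.2 ⟨haI, j, hj, h⟩)
    · simp [he, haI]
  have hm : ∀ j ∈ J, ∀ᶠ w in 𝓝 v, Φ w j = (∏ a ∈ I₀, w a ^ e j a) * u j w := by
    intro j hj
    filter_upwards [(hmon j hj).2.2] with w hw
    rw [hw]
    congr 1
    symm
    rw [Finset.prod_subset hsub fun a _ ha => by rw [heI j hj a ha, pow_zero]]
    refine Finset.prod_congr rfl fun a ha => ?_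
    simp [he, ha]
  have heI₀ : ∀ a ∈ I₀, ∃ j ∈ J, e j a ≠ 0 := by
    intro a ha
    obtain ⟨h1, j, hj, h2⟩ := Finset.mem_filter.1 ha
    exact ⟨j, hj, by simpa [he, h1] using h2⟩
  have hI' : ∀ a ∈ I₀, v a = 0 := fun a ha => hI a (hsub ha)
  have hu : ∀ j ∈ J, AnalyticAt ℂ (u j) v := fun j hj => (hmon j hj).1
  have hu0 : ∀ j ∈ J, u j v ≠ 0 := fun j hj => (hmon j hj).2.1
  have hdet := logJacobian_det_ne_zero hΦ hI' hram hfin heI heI₀ hu hu0 hm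
  have hinj : ∀ ξ, (logJacobian Φ I₀ J e u v).mulVec ξ = 0 → ξ = 0 := by
    intro ξ hξ
    by_contra h
    exact hdet (Matrix.exists_mulVec_eq_zero_iff.1 ⟨ξ, h, hξ⟩)
  have huniq : ∀ a ∈ I₀, ∀ j ∈ J, ∀ j' ∈ J, e j a ≠ 0 → e j' a ≠ 0 → j = j' := by
    intro a ha j hj j' hj' h h'
    obtain ⟨w, ⟨ha0, -, himm⟩, h1, h2, h3⟩ := ((frequently_immersion hΦ hfin (hI' a ha)
      hI').and_eventually (hΦ.eventually_analyticAt.and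
        ((eventually_prod_eq_of_mem ha (hm j hj) h).eventually_nhds.and
        (eventually_prod_eq_of_mem ha (hm j' hj') h').eventually_nhds))).exists
    exact eq_of_eq_zero_on_hyperplane h1 ha0 himm h2 h3
  have hτ : ∀ a, ∃ j, a ∈ I₀ → j ∈ J ∧ e j a ≠ 0 := by
    intro a
    by_cases ha : a ∈ I₀
    · obtain ⟨j, hj⟩ := heI₀ a ha; exact ⟨j, fun _ => hj⟩
    · exact ⟨a, fun h => absurd h ha⟩
  choose τ hτ using hτ
  have hτeq : ∀ a ∈ I₀, ∀ j ∈ J, e j a ≠ 0 → j = τ a := fun a ha j hj h =>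
    huniq a ha j hj _ (hτ a ha).1 h (hτ a ha).2
  have hτinj : ∀ a ∈ I₀, ∀ a' ∈ I₀, τ a = τ a' → a = a' := by
    intro a ha a' ha' h
    by_contra hne
    -- The logarithmic field of `ξ` vanishes at `v`, and `ξ` is orthogonal to the exponent row of
    -- the common image, so the logarithmic Jacobian kills it.
    set ξ : Fin n → ℂ := (e (τ a) a' : ℂ) • Pi.single a 1 - (e (τ a) a : ℂ) • Pi.single a' 1
    have hlv : logVector I₀ v ξ = 0 := by
      ext b
      by_cases hb : b ∈ I₀
      · simp [logVector, hb, hI' b hb]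
      · have h1 : b ≠ a := fun h => hb (h ▸ ha)
        have h2 : b ≠ a' := fun h => hb (h ▸ ha')
        simp [logVector, hb, ξ, h1, h2]
    have h0 : (logJacobian Φ I₀ J e u v).mulVec ξ = 0 := by
      ext j
      by_cases hj : j ∈ J
      · rw [logJacobian_mulVec_of_mem hj, hlv]
        simp only [map_zero, zero_div, add_zero, Pi.zero_apply, ξ, Pi.sub_apply, Pi.smul_apply,
          smul_eq_mul, mul_sub, Finset.sum_sub_distrib, Pi.single_apply, mul_ite, mul_one, mul_zero,
          Finset.sum_ite_eq', Finset.mem_univ, if_true]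
        by_cases hja : j = τ a
        · subst hja; ring
        · have h1 : e j a = 0 := by
            by_contra h1; exact hja (hτeq a ha j hj h1)
          have h2 : e j a' = 0 := by
            by_contra h1; exact hja ((hτeq a' ha' j hj h1).trans h.symm)
          simp [h1, h2]
      · rw [logJacobian_mulVec_of_notMem hj, hlv]; simp
    have h1 := congrFun (hinj ξ h0) a
    have h2 : e (τ a) a' = 0 := by simpa [ξ, hne] using h1
    exact (hτ a' ha').2 (h ▸ h2)
  have hother : ∀ a ∈ I₀, ∀ b ∈ I₀, b ≠ a → e (τ a) b = 0 := by
    intro a ha b hb hba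
    by_contra h
    exact hba (hτinj a ha b hb (hτeq b hb _ (hτ a ha).1 h)).symm
  refine ⟨I₀, τ, fun a => e (τ a) a, fun a => u (τ a), hsub, fun a ha a' ha' h =>
    hτinj a ha a' ha' h, ?_, ?_, ?_⟩
  · intro j
    constructor
    · intro hj
      have h1 := (hm j hj).self_of_nhds
      rw [hJ j hj] at h1
      obtain ⟨a, ha, h2⟩ := Finset.prod_eq_zero_iff.1
        ((mul_eq_zero.1 h1.symm).resolve_right (hu0 j hj))
      have h3 : e j a ≠ 0 := by
        intro h; rw [h, pow_zero] at h2; exact one_ne_zero h2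
      exact ⟨a, ha, (hτeq a ha j hj h3).symm⟩
    · rintro ⟨a, ha, rfl⟩
      exact (hτ a ha).1
  · intro a ha
    refine ⟨(hτ a ha).2, hu _ (hτ a ha).1, hu0 _ (hτ a ha).1, ?_⟩
    filter_upwards [hm _ (hτ a ha).1] with w hw
    rw [hw, Finset.prod_eq_single a (fun b hb hba => by rw [hother a ha b hb hba, pow_zero])
      (fun h => absurd ha h)]
  · intro ξ hξ hD
    -- The components in `I₀` cancel the contribution of the units `u`; they do not affect the
    -- logarithmic field at `v`, which is `ξ`.
    set ξ' : Fin n → ℂ := fun b => if b ∈ I₀ then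
      -(fderiv ℂ (u (τ b)) v ξ / u (τ b) v) / (e (τ b) b : ℂ) else ξ b with hξ'
    have hlv : logVector I₀ v ξ' = ξ := by
      ext b
      by_cases hb : b ∈ I₀
      · simp [logVector, hb, hI' b hb, hξ b hb]
      · simp [logVector, hb, hξ']
    have h0 : (logJacobian Φ I₀ J e u v).mulVec ξ' = 0 := by
      ext j
      by_cases hj : j ∈ J
      · rw [logJacobian_mulVec_of_mem hj, hlv]
        have h1 := (hm j hj).self_of_nhds
        rw [hJ j hj] at h1
        obtain ⟨a, ha, h2⟩ := Finset.prod_eq_zero_iff.1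
          ((mul_eq_zero.1 h1.symm).resolve_right (hu0 j hj))
        have h3 : e j a ≠ 0 := by
          intro h; rw [h, pow_zero] at h2; exact one_ne_zero h2
        obtain rfl := hτeq a ha j hj h3
        rw [Finset.sum_eq_single a]
        · simp only [hξ', ha, if_true, Pi.zero_apply]
          have h4 : (e (τ a) a : ℂ) ≠ 0 := by exact_mod_cast h3
          field_simp
          ring
        · intro b _ hba
          by_cases hb : b ∈ I₀
          · simp [hother a ha b hb hba]
          · simp [heI _ hj b hb]
        · simp
      · rw [logJacobian_mulVec_of_notMem hj, hlv, ← fderiv_component hΦ, hD]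
    have h1 := hinj ξ' h0
    ext b
    by_cases hb : b ∈ I₀
    · exact hξ b hb
    · simpa [hξ', hb] using congrFun h1 b

end BranchStructure

/-! ### Source coordinates absorbing the units, and openness. -/

section SourceCoordinates

variable {n : ℕ}

/-- `u / u(v)` is close to `1`, in the domain of the principal logarithm. -/
theorem exists_analytic_root {E : Type*} [NormedAddCommGroup E] [NormedSpace ℂ E] {u : E → ℂ}
    {v : E} (hu : AnalyticAt ℂ u v) (hu0 : u v ≠ 0) {p : ℕ} (hp : p ≠ 0) :
    ∃ r : E → ℂ, AnalyticAt ℂ r v ∧ r v ≠ 0 ∧ ∀ᶠ w in 𝓝 v, r w ^ p = u w := by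
  obtain ⟨c, hc⟩ := IsAlgClosed.exists_pow_nat_eq (u v) (Nat.pos_of_ne_zero hp)
  have hc0 : c ≠ 0 := by
    rintro rfl
    rw [zero_pow hp] at hc
    exact hu0 hc.symm
  have h1 : AnalyticAt ℂ (fun w => u w / u v) v := hu.fun_div analyticAt_const hu0
  refine ⟨fun w => c * Complex.exp (Complex.log (u w / u v) / p), ?_, ?_, ?_⟩
  · refine analyticAt_const.fun_mul (AnalyticAt.cexp' ?_)
    refine (h1.clog ?_).fun_div analyticAt_const (by exact_mod_cast hp)
    simp [div_self hu0]
  · exact mul_ne_zero hc0 (Complex.exp_ne_zero _)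
  · filter_upwards [hu.continuousAt.eventually_ne hu0] with w hw
    have hp' : (p : ℂ) ≠ 0 := by exact_mod_cast hp
    rw [mul_pow, ← Complex.exp_nat_mul, mul_div_cancel₀ _ hp', Complex.exp_log (div_ne_zero hw hu0),
      hc, mul_div_cancel₀ _ hu0]

/-- Near `v`, the components `τ a`, `a ∈ I`, of `Φ` are powers of the coordinates `w_a` times units,
and the other components restrict to coordinates on the subspace `w_a = 0`, `a ∈ I`. -/
structure IsBranched (Φ : (Fin n → ℂ) → Fin n → ℂ) (v : Fin n → ℂ) (I : Finset (Fin n))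
    (τ : Fin n → Fin n) (p : Fin n → ℕ) (u : Fin n → (Fin n → ℂ) → ℂ) : Prop where
  analyticAt : AnalyticAt ℂ Φ v
  zero : ∀ a ∈ I, v a = 0
  inj : Set.InjOn τ I
  p_ne : ∀ a ∈ I, p a ≠ 0
  u_an : ∀ a ∈ I, AnalyticAt ℂ (u a) v
  u_ne : ∀ a ∈ I, u a v ≠ 0
  eq : ∀ a ∈ I, ∀ᶠ w in 𝓝 v, Φ w (τ a) = w a ^ p a * u a w
  block : ∀ ξ : Fin n → ℂ, (∀ a ∈ I, ξ a = 0) → fderiv ℂ Φ v ξ = 0 → ξ = 0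

variable {Φ : (Fin n → ℂ) → Fin n → ℂ} {v : Fin n → ℂ} {I : Finset (Fin n)}
  {τ : Fin n → Fin n} {p : Fin n → ℕ} {u : Fin n → (Fin n → ℂ) → ℂ}

theorem analyticAt_pi_of {F : (Fin n → ℂ) → Fin n → ℂ} {w : Fin n → ℂ}
    (h : ∀ b, AnalyticAt ℂ (fun w => F w b) w) : AnalyticAt ℂ F w :=
  analyticAt_pi_iff.2 h

/-- For `b ∈ I`, `w_b` is multiplied by a root of the unit `u_b`; the other coordinates are
components of `F ∘ Φ`. The components of `F ∘ Φ` in `I` have zero differential along the stratum, so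
`block` gives independence. -/
theorem IsBranched.exists_coordinates (h : IsBranched Φ v I τ p u) {F : (Fin n → ℂ) → Fin n → ℂ}
    (hF : AnalyticAt ℂ F (Φ v)) (hFI : ∀ b ∈ I, ∀ z, F z b = z (τ b))
    (hF' : Function.Injective (fderiv ℂ F (Φ v))) :
    ∃ W : (Fin n → ℂ) → Fin n → ℂ, AnalyticAt ℂ W v ∧ Function.Injective (fderiv ℂ W v) ∧
      (∀ b ∈ I, (∀ᶠ w in 𝓝 v, W w b ^ p b = F (Φ w) b) ∧
        ∃ r, AnalyticAt ℂ r v ∧ r v ≠ 0 ∧ ∀ w, W w b = w b * r w) ∧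
      ∀ b ∉ I, ∀ w, W w b = F (Φ w) b := by
  classical
  have hroot : ∀ b, ∃ r : (Fin n → ℂ) → ℂ, b ∈ I → AnalyticAt ℂ r v ∧ r v ≠ 0 ∧
      ∀ᶠ w in 𝓝 v, r w ^ p b = u b w := by
    intro b
    by_cases hb : b ∈ I
    · obtain ⟨r, hr⟩ := exists_analytic_root (h.u_an b hb) (h.u_ne b hb) (h.p_ne b hb)
      exact ⟨r, fun _ => hr⟩
    · exact ⟨0, fun h => absurd h hb⟩
  choose r hr using hroot
  have hFΦ : AnalyticAt ℂ (fun w => F (Φ w)) v := hF.fun_comp h.analyticAt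
  set W : (Fin n → ℂ) → Fin n → ℂ := fun w b => if b ∈ I then w b * r b w else F (Φ w) b with hW
  have hWI : ∀ b ∈ I, ∀ w, W w b = w b * r b w := fun b hb w => by simp [hW, hb]
  have hWO : ∀ b ∉ I, ∀ w, W w b = F (Φ w) b := fun b hb w => by simp [hW, hb]
  have hWa : AnalyticAt ℂ W v := by
    refine analyticAt_pi_of fun b => ?_
    by_cases hb : b ∈ I
    · simp only [hWI b hb]
      exact (analyticAt_coord b v).fun_mul (hr b hb).1
    · simp only [hWO b hb]
      exact (analyticAt_coord b _).fun_comp hFΦ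
  refine ⟨W, hWa, ?_, fun b hb => ⟨?_, r b, (hr b hb).1, (hr b hb).2.1, hWI b hb⟩, hWO⟩
  · rw [injective_iff_map_eq_zero]
    intro ξ hξ
    have hξI : ∀ b ∈ I, ξ b = 0 := by
      intro b hb
      have h1 := congrFun hξ b
      rw [fderiv_component hWa] at h1
      simp only [hWI b hb] at h1
      rw [fderiv_mul_of_eq_zero (analyticAt_coord b v) (hr b hb).1 (h.zero b hb),
        fderiv_coord] at h1
      simpa [(hr b hb).2.1] using h1
    refine h.block ξ hξI (hF' ?_)
    rw [map_zero]
    have hchain : fderiv ℂ (fun w => F (Φ w)) v ξ = fderiv ℂ F (Φ v) (fderiv ℂ Φ v ξ) := by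
      have := (hF.differentiableAt.hasFDerivAt.comp v h.analyticAt.differentiableAt.hasFDerivAt)
      rw [show fderiv ℂ (fun w => F (Φ w)) v = _ from this.fderiv]
      rfl
    rw [← hchain]
    ext b
    rw [fderiv_component hFΦ]
    by_cases hb : b ∈ I
    · have h2 : (fun w => F (Φ w) b) =ᶠ[𝓝 v] fun w => w b * (w b ^ (p b - 1) * u b w) := by
        filter_upwards [h.eq b hb] with w hw
        rw [hFI b hb, hw, ← mul_assoc, ← pow_succ',
          Nat.sub_add_cancel (Nat.pos_of_ne_zero (h.p_ne b hb))]
      rw [h2.fderiv_eq, fderiv_mul_of_eq_zero (analyticAt_coord b v)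
        (((analyticAt_coord b v).fun_pow _).fun_mul (h.u_an b hb)) (h.zero b hb), fderiv_coord]
      simp [hξI b hb]
    · have h1 := congrFun hξ b
      rw [fderiv_component hWa] at h1
      simpa only [hWO b hb] using h1
  · filter_upwards [(hr b hb).2.2, h.eq b hb] with w h1 h2
    rw [hWI b hb, mul_pow, h1, hFI b hb, h2]

theorem map_nhds_of_injective_fderiv {W : (Fin n → ℂ) → Fin n → ℂ} (hW : AnalyticAt ℂ W v)
    (h : Function.Injective (fderiv ℂ W v)) : map W (𝓝 v) = 𝓝 (W v) := by
  set L : (Fin n → ℂ) ≃L[ℂ] (Fin n → ℂ) :=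
    (LinearEquiv.ofInjectiveEndo (fderiv ℂ W v : (Fin n → ℂ) →ₗ[ℂ] _) h).toContinuousLinearEquiv
  have hL : fderiv ℂ W v = L := by ext; rfl
  have h1 := hW.hasStrictFDerivAt
  rw [hL] at h1
  exact h1.map_nhds_eq_of_equiv

/-- The open mapping theorem in one variable; the power map is not locally constant because a number
has finitely many roots. -/
theorem nhds_le_map_pow (z : ℂ) {p : ℕ} (hp : p ≠ 0) : 𝓝 (z ^ p) ≤ map (fun z : ℂ => z ^ p) (𝓝 z) := by
  refine (AnalyticAt.eventually_constant_or_nhds_le_map_nhds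
    (analyticAt_id.fun_pow p : AnalyticAt ℂ (fun z : ℂ => z ^ p) z)).resolve_left fun h => ?_
  have hfin : {w : ℂ | w ^ p = z ^ p}.Finite := by
    refine ((Polynomial.nthRoots p (z ^ p)).toFinset.finite_toSet).subset fun w hw => ?_
    simpa [Polynomial.mem_nthRoots (Nat.pos_of_ne_zero hp)] using hw
  exact infinite_of_mem_nhds z h hfin

/-- In suitable coordinates `Φ` is a product of power maps. A permutation `σ` extending `τ` matches
source and target indices. -/
theorem IsBranched.nhds_le_map (h : IsBranched Φ v I τ p u) : 𝓝 (Φ v) ≤ map Φ (𝓝 v) := by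
  classical
  obtain ⟨g, hg⟩ := Finset.exists_equiv_extend_of_card_eq (t := (Finset.univ : Finset (Fin n)))
    (s := I) (f := τ) (by simp) (Finset.subset_univ _) h.inj
  set σ : Fin n ≃ Fin n := g.trans (Equiv.subtypeUnivEquiv fun _ => Finset.mem_univ _)
  have hσ : ∀ b ∈ I, σ b = τ b := fun b hb => by simp [σ, hg b hb]
  set S : (Fin n → ℂ) ≃L[ℂ] (Fin n → ℂ) :=
    (LinearEquiv.funCongrLeft ℂ ℂ σ).toContinuousLinearEquiv with hS
  have hSa : ∀ z b, S z b = z (σ b) := fun z b => rfl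
  obtain ⟨W, hW, hWi, hWI, hWO⟩ := h.exists_coordinates (F := S)
    (S.toContinuousLinearMap.analyticAt _) (fun b hb z => by rw [hSa, hσ b hb]) (by
      rw [S.fderiv]; exact S.injective)
  set q : Fin n → ℕ := fun b => if b ∈ I then p b else 1 with hq
  have hq0 : ∀ b, q b ≠ 0 := by
    intro b
    by_cases hb : b ∈ I
    · simpa [hq, hb] using h.p_ne b hb
    · simp [hq, hb]
  have heq : ∀ᶠ w in 𝓝 v, S (Φ w) = fun b => W w b ^ q b := by
    have : ∀ b, ∀ᶠ w in 𝓝 v, S (Φ w) b = W w b ^ q b := by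
      intro b
      by_cases hb : b ∈ I
      · filter_upwards [(hWI b hb).1] with w hw
        simp only [hq, hb, if_true, hw]
      · exact .of_forall fun w => by simp [hq, hb, hWO b hb]
    filter_upwards [Filter.eventually_all.2 this] with w hw
    exact funext hw
  have h1 : 𝓝 (S (Φ v)) ≤ map (fun w => S (Φ w)) (𝓝 v) := by
    rw [Filter.map_congr heq, heq.self_of_nhds]
    have h2 : (fun w => fun b => W w b ^ q b) = (Pi.map fun b (z : ℂ) => z ^ q b) ∘ W := rfl
    rw [h2, ← Filter.map_map, map_nhds_of_injective_fderiv hW hWi, nhds_pi, nhds_pi,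
      Filter.map_piMap_pi_finite]
    exact Filter.pi_mono fun b => nhds_le_map_pow _ (hq0 b)
  have h3 := Filter.map_mono (m := S.symm) h1
  rw [Filter.map_map] at h3
  have h4 : S.symm ∘ (fun w => S (Φ w)) = Φ := by ext; simp
  rw [h4] at h3
  refine le_trans ?_ h3
  have h5 := S.symm.toHomeomorph.map_nhds_eq (S (Φ v))
  simp only [ContinuousLinearEquiv.coe_toHomeomorph, ContinuousLinearEquiv.symm_apply_apply] at h5
  exact h5.ge

/-- By openness nearby points of the target have nearby preimages, and those over `z_(τ a) = 0` lie
on `w_a = 0`. -/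
theorem IsBranched.eventually_of_zero (h : IsBranched Φ v I τ p u) {a : Fin n} (ha : a ∈ I)
    {q : (Fin n → ℂ) → Prop} (hq : ∀ᶠ w in 𝓝 v, w a = 0 → q (Φ w)) :
    ∀ᶠ z in 𝓝 (Φ v), z (τ a) = 0 → q z := by
  refine h.nhds_le_map (Filter.mem_map.2 ?_)
  filter_upwards [hq, h.eq a ha, (h.u_an a ha).continuousAt.eventually_ne (h.u_ne a ha)]
    with w h1 h2 h3 h4
  refine h1 ?_
  rw [h2] at h4
  exact pow_eq_zero_iff (h.p_ne a ha) |>.1 ((mul_eq_zero.1 h4).resolve_right h3)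

theorem frequently_coord_pattern {v : Fin n → ℂ} (S : Finset (Fin n)) (hS : ∀ a ∈ S, v a = 0) :
    ∃ᶠ w in 𝓝 v, (∀ a ∈ S, w a ≠ 0) ∧ ∀ a ∉ S, w a = v a := by
  classical
  have h1 : Tendsto (fun t : ℂ => v + t • (fun a => if a ∈ S then 1 else 0 : Fin n → ℂ))
      (𝓝[≠] 0) (𝓝 v) := (tendsto_line v _).mono_left nhdsWithin_le_nhds
  refine h1.frequently (Eventually.frequently ?_)
  filter_upwards [self_mem_nhdsWithin] with t ht
  refine ⟨fun a ha => by simpa [ha, hS a ha] using ht, fun a ha => by simp [ha]⟩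

end SourceCoordinates

/-! ### Completing linear forms to a coordinate system. -/

section LinearCompletion

variable {n : ℕ}

/-- Independent linear functionals can be completed to a coordinate system. -/
theorem exists_completion (m : ℕ) : ∀ (I : Finset (Fin n)) (l : Fin n → (Fin n → ℂ) →L[ℂ] ℂ),
    Iᶜ.card = m → (∀ c : Fin n → ℂ, (∀ a ∉ I, c a = 0) → ∑ a, c a • l a = 0 → c = 0) →
    ∃ l' : Fin n → (Fin n → ℂ) →L[ℂ] ℂ, (∀ a ∈ I, l' a = l a) ∧
      ∀ ξ, (∀ a, l' a ξ = 0) → ξ = 0 := by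
  classical
  induction m with
  | zero =>
    intro I l hI hl
    have hI' : ∀ a, a ∈ I := by
      intro a
      by_contra h
      have : a ∈ Iᶜ := Finset.mem_compl.2 h
      rw [Finset.card_eq_zero.1 hI] at this
      simp at this
    refine ⟨l, fun _ _ => rfl, fun ξ hξ => ?_⟩
    set M : Matrix (Fin n) (Fin n) ℂ := fun a b => l a (Pi.single b 1) with hM
    have hdet : M.det ≠ 0 := by
      intro h0
      obtain ⟨c, hc, h1⟩ := Matrix.exists_vecMul_eq_zero_iff.2 h0
      refine hc (hl c (fun a ha => absurd (hI' a) ha) ?_)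
      ext η
      rw [apply_eq_sum_single (∑ a, c a • l a) η]
      simp only [zero_apply]
      refine Finset.sum_eq_zero fun b _ => ?_
      have h2 := congrFun h1 b
      simp only [Matrix.vecMul, dotProduct, hM, Pi.zero_apply] at h2
      rw [show (∑ a, c a • l a) (Pi.single b 1) = ∑ a, c a * l a (Pi.single b 1) by simp, h2,
        smul_zero]
    by_contra hne
    refine hdet (Matrix.exists_mulVec_eq_zero_iff.1 ⟨ξ, hne, ?_⟩)
    ext a
    have h3 := hξ a
    rw [apply_eq_sum_single] at h3
    simpa [Matrix.mulVec, dotProduct, hM, mul_comm] using h3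
  | succ m ih =>
    intro I l hI hl
    obtain ⟨b, hb⟩ : ∃ b, b ∈ Iᶜ := Finset.card_pos.1 (by omega)
    have hb' : b ∉ I := Finset.mem_compl.1 hb
    -- Fewer than `n` forms have a common zero `ξ ≠ 0`, and a coordinate form that is nonzero on `ξ`
    -- is independent of them.
    obtain ⟨ξ, hξ, hξ0⟩ : ∃ ξ : Fin n → ℂ, (∀ a ∈ I, l a ξ = 0) ∧ ξ ≠ 0 := by
      set T : (Fin n → ℂ) →ₗ[ℂ] (I → ℂ) := LinearMap.pi fun a => (l a : (Fin n → ℂ) →ₗ[ℂ] ℂ) with hT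
      have h1 : LinearMap.ker T ≠ ⊥ := by
        apply LinearMap.ker_ne_bot_of_finrank_lt
        have h2 := Finset.card_compl_add_card I
        simp only [Module.finrank_fintype_fun_eq_card, Fintype.card_coe, Fintype.card_fin] at h2 ⊢
        omega
      obtain ⟨ξ, h2, h3⟩ := (Submodule.ne_bot_iff _).1 h1
      exact ⟨ξ, fun a ha => congrFun (LinearMap.mem_ker.1 h2) ⟨a, ha⟩, h3⟩
    obtain ⟨d, hd⟩ := Function.ne_iff.1 hξ0
    set l₁ : Fin n → (Fin n → ℂ) →L[ℂ] ℂ :=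
      Function.update l b (ContinuousLinearMap.proj (R := ℂ) (φ := fun _ : Fin n => ℂ) d) with hl₁
    have hne : ∀ a ∈ I, a ≠ b := fun a ha h => hb' (h ▸ ha)
    obtain ⟨l', h1, h2⟩ := ih (insert b I) l₁ (by
      rw [Finset.compl_insert, Finset.card_erase_of_mem hb]; omega) (by
      intro c hc hsum
      have hcb : c b = 0 := by
        have h3 := congrArg (fun T : (Fin n → ℂ) →L[ℂ] ℂ => T ξ) hsum
        simp only [sum_apply, smul_apply, zero_apply] at h3
        rw [Finset.sum_eq_single b] at h3
        · have hd' : ξ d ≠ 0 := hd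
          simpa [hl₁, hd'] using h3
        · intro a _ hab
          by_cases haI : a ∈ I
          · simp [hl₁, hab, hξ a haI]
          · rw [hc a (by simp [hab, haI]), zero_smul]
        · simp
      refine hl c (fun a ha => ?_) ?_
      · by_cases hab : a = b
        · rw [hab, hcb]
        · exact hc a (by simp [hab, ha])
      · rw [← hsum]
        refine Finset.sum_congr rfl fun a _ => ?_
        by_cases hab : a = b
        · rw [hab, hcb]; ext; simp
        · simp [hl₁, hab])
    refine ⟨l', fun a ha => ?_, h2⟩
    rw [h1 a (Finset.mem_insert_of_mem ha)]
    simp [hl₁, hne a ha]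

end LinearCompletion

/-! ### Coordinates adapted to both the branching and `Δ`. -/

section AdaptedCoordinates

variable {n : ℕ}

theorem eventually_injective_fderiv {W : (Fin n → ℂ) → Fin n → ℂ} {v : Fin n → ℂ}
    (hW : AnalyticAt ℂ W v) (h : Function.Injective (fderiv ℂ W v)) :
    ∀ᶠ w in 𝓝 v, Function.Injective (fderiv ℂ W w) := by
  set L : (Fin n → ℂ) ≃L[ℂ] (Fin n → ℂ) :=
    (LinearEquiv.ofInjectiveEndo (fderiv ℂ W v : (Fin n → ℂ) →ₗ[ℂ] _) h).toContinuousLinearEquiv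
  have hL : fderiv ℂ W v = L := by ext; rfl
  obtain ⟨e, he, -, -, -, -, h1⟩ := exists_localInverse hW L hL univ_mem
  filter_upwards [e.open_source.mem_nhds he] with w hw
  obtain ⟨M, hM⟩ := h1 w hw
  rw [hM]
  exact M.injective

theorem surjective_of_injective {T : (Fin n → ℂ) →L[ℂ] (Fin n → ℂ)} (h : Function.Injective T) :
    Function.Surjective T :=
  (LinearMap.injective_iff_surjective (f := (T : (Fin n → ℂ) →ₗ[ℂ] (Fin n → ℂ)))).1 h

theorem fderiv_component_ne_zero {W : (Fin n → ℂ) → Fin n → ℂ} {v : Fin n → ℂ}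
    (hW : AnalyticAt ℂ W v) (h : Function.Injective (fderiv ℂ W v)) (i : Fin n) :
    fderiv ℂ (fun w => W w i) v ≠ 0 := by
  intro h0
  obtain ⟨ξ, hξ⟩ := surjective_of_injective h (Pi.single i 1)
  have h1 := fderiv_component hW ξ i
  rw [h0, hξ] at h1
  simp at h1

theorem fderiv_comp_apply {E F G : Type*} [NormedAddCommGroup E] [NormedSpace ℂ E]
    [NormedAddCommGroup F] [NormedSpace ℂ F] [NormedAddCommGroup G] [NormedSpace ℂ G]
    {g : F → G} {f : E → F} {v : E} (hg : AnalyticAt ℂ g (f v)) (hf : AnalyticAt ℂ f v) (ξ : E) :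
    fderiv ℂ (fun w => g (f w)) v ξ = fderiv ℂ g (f v) (fderiv ℂ f v ξ) := by
  have := hg.differentiableAt.hasFDerivAt.comp v hf.differentiableAt.hasFDerivAt
  rw [show fderiv ℂ (fun w => g (f w)) v = _ from this.fderiv]
  rfl

variable {Φ : (Fin n → ℂ) → Fin n → ℂ} {v : Fin n → ℂ} {I₀ I K : Finset (Fin n)}
  {τ : Fin n → Fin n} {p : Fin n → ℕ} {u : Fin n → (Fin n → ℂ) → ℂ}
  {θ : (Fin n → ℂ) → Fin n → ℂ}

/-- By openness of `Φ` the smooth hypersurface `z_(τ a) = 0` is contained in the smooth hypersurface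
`θ_i = 0`, so their equations differ by a unit. -/
theorem IsBranched.eq_zero_iff_of_branch (h : IsBranched Φ v I₀ τ p u)
    (hθ : AnalyticAt ℂ θ (Φ v)) (hθ' : Function.Injective (fderiv ℂ θ (Φ v)))
    {a i : Fin n} (ha : a ∈ I₀) (hai : ∀ᶠ w in 𝓝 v, w a = 0 → θ (Φ w) i = 0) :
    ∀ᶠ z in 𝓝 (Φ v), z (τ a) = 0 ↔ θ z i = 0 := by
  have h1 := h.eventually_of_zero ha (q := fun z => θ z i = 0) hai
  have h0 : Φ v (τ a) = 0 := by
    rw [(h.eq a ha).self_of_nhds, h.zero a ha, zero_pow (h.p_ne a ha), zero_mul]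
  obtain ⟨g, hg, hg0, hge, -⟩ := eq_mul_unit_of_smooth (τ := fun z => θ z i)
    (σ := fun z => z (τ a)) ((analyticAt_coord i _).fun_comp hθ)
    (fderiv_component_ne_zero hθ hθ' i) (analyticAt_coord _ _) h0 (fderiv_coord_ne_zero _ _) h1
  filter_upwards [hge, hg.continuousAt.eventually_ne hg0] with z h2 h3
  rw [h2]
  simp [h3]

/-- `θ_i = 0` must be the branch hypersurface `z_(τ a) = 0`, whose preimage near `v` is `w_a = 0`
alone. -/
theorem IsBranched.exponent_eq_zero (h : IsBranched Φ v I₀ τ p u) (hI₀ : I₀ ⊆ I)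
    (hI : ∀ a ∈ I, v a = 0)
    (hθ : AnalyticAt ℂ θ (Φ v)) (hθ' : Function.Injective (fderiv ℂ θ (Φ v)))
    {i : Fin n} {f : Fin n → ℕ} {U : (Fin n → ℂ) → ℂ}
    (hm : ∀ᶠ w in 𝓝 v, θ (Φ w) i = (∏ a ∈ I, w a ^ f a) * U w)
    {a b : Fin n} (ha : a ∈ I₀) (hfa : f a ≠ 0) (hb : b ∈ I) (hba : b ≠ a) : f b = 0 := by
  classical
  by_contra hfb
  have h1 := h.analyticAt.continuousAt.eventually
    (h.eq_zero_iff_of_branch hθ hθ' ha (eventually_prod_eq_of_mem (hI₀ ha) hm hfa))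
  obtain ⟨w, ⟨h2, h3⟩, h4, h5, h6, h7⟩ := ((frequently_coord_pattern (I.erase b)
    (fun a ha => hI a (Finset.mem_of_mem_erase ha))).and_eventually
    (h1.and ((h.eq a ha).and (((h.u_an a ha).continuousAt.eventually_ne (h.u_ne a ha)).and
    (eventually_prod_eq_of_mem hb hm hfb))))).exists
  have h8 : w a ≠ 0 := h2 a (Finset.mem_erase.2 ⟨hba.symm, hI₀ ha⟩)
  have h9 := h4.2 (h7 (by rw [h3 b (by simp), hI b hb]))
  rw [h5] at h9
  exact mul_ne_zero (pow_ne_zero _ h8) h6 h9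

/-- Off the hyperplanes of `I₀` the map is unramified, so `θ_i ∘ Φ` has nonzero differential there;
its monomial can only be `w_a` with exponent one. -/
theorem IsBranched.eq_mul_of_unbranched (h : IsBranched Φ v I₀ τ p u) (hI₀ : I₀ ⊆ I)
    (hI : ∀ a ∈ I, v a = 0)
    (hθ : AnalyticAt ℂ θ (Φ v)) (hθ' : Function.Injective (fderiv ℂ θ (Φ v)))
    (het : ∀ᶠ w in 𝓝 v, (∀ a ∈ I₀, w a ≠ 0) → Function.Injective (fderiv ℂ Φ w))
    {i : Fin n} {f : Fin n → ℕ} {U : (Fin n → ℂ) → ℂ} (hU : AnalyticAt ℂ U v)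
    (hm : ∀ᶠ w in 𝓝 v, θ (Φ w) i = (∏ a ∈ I, w a ^ f a) * U w)
    {a : Fin n} (ha : a ∈ I) (ha₀ : a ∉ I₀) (hfa : f a ≠ 0) :
    ∀ᶠ w in 𝓝 v, θ (Φ w) i = w a * U w := by
  classical
  have hf₀ : ∀ b ∈ I₀, f b = 0 := by
    intro b hb
    by_contra hfb
    exact hfa (h.exponent_eq_zero hI₀ hI hθ hθ' hm hb hfb ha (by rintro rfl; exact ha₀ hb))
  have hθi : ∀ᶠ z in 𝓝 (Φ v), AnalyticAt ℂ θ z ∧ Function.Injective (fderiv ℂ θ z) :=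
    hθ.eventually_analyticAt.and (eventually_injective_fderiv hθ hθ')
  -- The chosen point stays on all the hyperplanes of `I` outside `I₀`, so that any further factor
  -- of the monomial would kill the differential.
  obtain ⟨w, ⟨h1, h2⟩, h3, ⟨h4, h4'⟩, h5, h6, h7⟩ := ((frequently_coord_pattern I₀ h.zero).and_eventually
    (het.and ((h.analyticAt.continuousAt.eventually hθi).and (hU.eventually_analyticAt.and
      (h.analyticAt.eventually_analyticAt.and hm.eventually_nhds))))).exists
  have hw0 : ∀ b ∈ I, b ∉ I₀ → w b = 0 := fun b hb hb' => by rw [h2 b hb', hI b hb]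
  have hfac : ∀ w : Fin n → ℂ, (∏ a ∈ I, w a ^ f a) * U w =
      w a * (w a ^ (f a - 1) * (∏ b ∈ I.erase a, w b ^ f b) * U w) := by
    intro w
    rw [← Finset.mul_prod_erase _ _ ha, ← mul_assoc, ← mul_assoc, ← pow_succ',
      Nat.sub_add_cancel (Nat.pos_of_ne_zero hfa)]
  have hrest : AnalyticAt ℂ (fun w : Fin n → ℂ =>
      w a ^ (f a - 1) * (∏ b ∈ I.erase a, w b ^ f b) * U w) w :=
    (((analyticAt_coord a w).fun_pow _).fun_mul (analyticAt_monomial _ _ w)).fun_mul h5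
  have hne : fderiv ℂ (fun w => θ (Φ w) i) w ≠ 0 := by
    refine fderiv_component_ne_zero (W := fun w => θ (Φ w)) (h4.fun_comp h6) ?_ i
    rw [injective_iff_map_eq_zero]
    intro ξ hξ
    rw [fderiv_comp_apply h4 h6] at hξ
    exact (injective_iff_map_eq_zero _).1 (h3 h1) _ ((injective_iff_map_eq_zero _).1 h4' _ hξ)
  have heq : (fun w => θ (Φ w) i) =ᶠ[𝓝 w] fun w =>
      w a * (w a ^ (f a - 1) * (∏ b ∈ I.erase a, w b ^ f b) * U w) := by
    filter_upwards [h7] with w' hw'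
    rw [hw', hfac]
  rw [heq.fderiv_eq, fderiv_mul_of_eq_zero (analyticAt_coord a w) hrest (hw0 a ha ha₀)] at hne
  have hne' : w a ^ (f a - 1) * (∏ b ∈ I.erase a, w b ^ f b) * U w ≠ 0 := by
    intro h0; rw [h0] at hne; exact hne (by ext; simp)
  have hfa1 : f a - 1 = 0 := by
    by_contra h0
    rw [hw0 a ha ha₀, zero_pow h0] at hne'
    simp at hne'
  have hfb : ∀ b ∈ I.erase a, f b = 0 := by
    intro b hb
    by_cases hb₀ : b ∈ I₀
    · exact hf₀ b hb₀
    by_contra h0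
    rw [Finset.prod_eq_zero hb (by
      rw [hw0 b (Finset.mem_of_mem_erase hb) hb₀, zero_pow h0])] at hne'
    simp at hne'
  filter_upwards [hm] with w' hw'
  rw [hw', hfac, hfa1, pow_zero, one_mul, Finset.prod_eq_one fun b hb => by rw [hfb b hb, pow_zero],
    one_mul]

/-- The target coordinates are the branch coordinates `z_(τ a)` for `a ∈ I₀` and, for the other `a ∈
I`, the equation of the branch of `Δ` that pulls back to `w_a` times a unit; linear forms complete
them. Independence is tested on the vectors `dΦ(∂_b)` with `b ∈ I`, `b ∉ I₀`, then on the branch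
coordinate directions. `ν` records which coordinate is the equation of which branch of `Δ`. -/
theorem IsBranched.exists_adapted_coordinates (h : IsBranched Φ v I₀ τ p u) (hI₀ : I₀ ⊆ I)
    (hI : ∀ a ∈ I, v a = 0) (hθ : AnalyticAt ℂ θ (Φ v))
    (hθ' : Function.Injective (fderiv ℂ θ (Φ v))) (hK : ∀ i ∈ K, θ (Φ v) i = 0)
    (hfin : ∃ O ∈ 𝓝 v, ∀ c, {w ∈ O | Φ w = c}.Finite)
    (het : ∀ᶠ w in 𝓝 v, (∀ a ∈ I₀, w a ≠ 0) → Function.Injective (fderiv ℂ Φ w))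
    (hs : ∀ i ∈ K, ∀ᶠ w in 𝓝 v, θ (Φ w) i = 0 → ∃ a ∈ I, w a = 0)
    (hs' : ∀ᶠ w in 𝓝 v, ∀ a ∈ I, w a = 0 → (∃ b ∈ I₀, w b = 0) ∨ ∃ i ∈ K, θ (Φ w) i = 0) :
    ∃ (F W : (Fin n → ℂ) → Fin n → ℂ) (q : Fin n → ℕ) (ν : Fin n → Option (Fin n)),
      AnalyticAt ℂ F (Φ v) ∧ Function.Injective (fderiv ℂ F (Φ v)) ∧
      AnalyticAt ℂ W v ∧ Function.Injective (fderiv ℂ W v) ∧ (∀ b, q b ≠ 0) ∧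
      (∀ᶠ w in 𝓝 v, ∀ b, F (Φ w) b = W w b ^ q b) ∧
      (∀ b i, ν b = some i → i ∈ K ∧ F (Φ v) b = 0 ∧
        ∀ᶠ z in 𝓝 (Φ v), F z b = 0 ↔ θ z i = 0) ∧
      ∀ i ∈ K, ∃ b, ν b = some i := by
  classical
  have hΨ : AnalyticAt ℂ (fun w => θ (Φ w)) v := hθ.fun_comp h.analyticAt
  have hmon : ∀ i, ∃ (f : Fin n → ℕ) (U : (Fin n → ℂ) → ℂ), i ∈ K → AnalyticAt ℂ U v ∧ U v ≠ 0 ∧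
      ∀ᶠ w in 𝓝 v, θ (Φ w) i = (∏ a ∈ I, w a ^ f a) * U w := by
    intro i
    by_cases hi : i ∈ K
    · obtain ⟨f, U, h1⟩ := exists_monomial ((analyticAt_coord i _).fun_comp hΨ) I hI (hs i hi)
      exact ⟨f, U, fun _ => h1⟩
    · exact ⟨0, 0, fun h => absurd h hi⟩
  choose f U hmon using hmon
  have huniq : ∀ a ∈ I, ∀ i ∈ K, ∀ i' ∈ K, f i a ≠ 0 → f i' a ≠ 0 → i = i' := by
    intro a ha i hi i' hi' h1 h2
    obtain ⟨w, ⟨ha0, -, himm⟩, h3, h4, ⟨h5, h5'⟩, h6⟩ := ((frequently_immersion h.analyticAt hfin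
      (hI a ha) hI).and_eventually
      ((eventually_prod_eq_of_mem ha (hmon i hi).2.2 h1).eventually_nhds.and
      ((eventually_prod_eq_of_mem ha (hmon i' hi').2.2 h2).eventually_nhds.and
      ((h.analyticAt.continuousAt.eventually (hθ.eventually_analyticAt.and
        (eventually_injective_fderiv hθ hθ'))).and h.analyticAt.eventually_analyticAt)))).exists
    refine eq_of_eq_zero_on_hyperplane (Φ := fun w => θ (Φ w)) (h5.fun_comp h6) ha0 ?_ h3 h4
    intro η hη hη'
    rw [fderiv_comp_apply h5 h6] at hη'
    exact himm η hη ((injective_iff_map_eq_zero _).1 h5' _ hη')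
  have hex : ∀ a, a ∈ I → a ∉ I₀ → ∃ i ∈ K, f i a ≠ 0 := by
    intro a ha ha₀
    have hU0 : ∀ᶠ w in 𝓝 v, ∀ i ∈ K, U i w ≠ 0 ∧
        θ (Φ w) i = (∏ a ∈ I, w a ^ f i a) * U i w :=
      (Filter.eventually_all_finset K).2 fun i hi =>
        ((hmon i hi).1.continuousAt.eventually_ne (hmon i hi).2.1).and (hmon i hi).2.2
    obtain ⟨w, ⟨h1, h2⟩, h3, h4⟩ := ((frequently_coord_pattern (I.erase a)
      (fun a ha => hI a (Finset.mem_of_mem_erase ha))).and_eventually (hs'.and hU0)).exists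
    rcases h3 a ha (by rw [h2 a (by simp), hI a ha]) with ⟨b, hb, hb0⟩ | ⟨i, hi, hi0⟩
    · exact absurd hb0 (h1 b (Finset.mem_erase.2 ⟨by rintro rfl; exact ha₀ hb, hI₀ hb⟩))
    · refine ⟨i, hi, fun h0 => ?_⟩
      rw [(h4 i hi).2] at hi0
      obtain ⟨c, hc, hc0⟩ := Finset.prod_eq_zero_iff.1
        ((mul_eq_zero.1 hi0).resolve_right (h4 i hi).1)
      by_cases hca : c = a
      · rw [hca, h0, pow_zero] at hc0; exact one_ne_zero hc0
      · exact pow_ne_zero _ (h1 c (Finset.mem_erase.2 ⟨hca, hc⟩)) hc0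
  -- `N a` is the branch of `Δ` containing the image of `w_a = 0`; where there is none, its value is
  -- irrelevant.
  have hN : ∀ a, ∃ i, (∃ i ∈ K, f i a ≠ 0) → i ∈ K ∧ f i a ≠ 0 := by
    intro a
    by_cases h1 : ∃ i ∈ K, f i a ≠ 0
    · obtain ⟨i, hi⟩ := h1; exact ⟨i, fun _ => hi⟩
    · exact ⟨a, fun h => absurd h h1⟩
  choose N hN using hN
  set G : Fin n → (Fin n → ℂ) → ℂ := fun a z => if a ∈ I₀ then z (τ a) else θ z (N a) with hG
  have hG₀ : ∀ a ∈ I₀, G a = fun z => z (τ a) := fun a ha => by ext; simp [hG, ha]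
  have hG₁ : ∀ a ∉ I₀, G a = fun z => θ z (N a) := fun a ha => by ext; simp [hG, ha]
  have hGa : ∀ a, AnalyticAt ℂ (G a) (Φ v) := by
    intro a
    by_cases ha : a ∈ I₀
    · rw [hG₀ a ha]; exact analyticAt_coord _ _
    · rw [hG₁ a ha]; exact (analyticAt_coord _ _).fun_comp hθ
  have hun : ∀ a ∈ I, a ∉ I₀ → ∀ᶠ w in 𝓝 v, θ (Φ w) (N a) = w a * U (N a) w := by
    intro a ha ha₀
    have h1 := hN a (hex a ha ha₀)
    exact h.eq_mul_of_unbranched hI₀ hI hθ hθ' het (hmon _ h1.1).1 (hmon _ h1.1).2.2 ha ha₀ h1.2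
  set l : Fin n → (Fin n → ℂ) →L[ℂ] ℂ := fun a => fderiv ℂ (G a) (Φ v) with hl
  have hlv : ∀ a ∈ I, ∀ b ∈ I, b ∉ I₀ →
      l a (fderiv ℂ Φ v (Pi.single b 1)) = if a = b then U (N b) v else 0 := by
    intro a ha b hb hb₀
    rw [hl, ← fderiv_comp_apply (hGa a) h.analyticAt]
    by_cases ha₀ : a ∈ I₀
    · have hab : a ≠ b := by rintro rfl; exact hb₀ ha₀
      have h1 : (fun w => G a (Φ w)) =ᶠ[𝓝 v] fun w => w a * (w a ^ (p a - 1) * u a w) := by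
        filter_upwards [h.eq a ha₀] with w hw
        simp only [hG₀ a ha₀]
        rw [hw, ← mul_assoc, ← pow_succ',
          Nat.sub_add_cancel (Nat.pos_of_ne_zero (h.p_ne a ha₀))]
      rw [h1.fderiv_eq, fderiv_mul_of_eq_zero (analyticAt_coord a v)
        (((analyticAt_coord a v).fun_pow _).fun_mul (h.u_an a ha₀)) (hI a ha), fderiv_coord]
      simp [hab]
    · have h1 : (fun w => G a (Φ w)) =ᶠ[𝓝 v] fun w => w a * U (N a) w := by
        filter_upwards [hun a ha ha₀] with w hw
        simp only [hG₁ a ha₀, hw]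
      rw [h1.fderiv_eq, fderiv_mul_of_eq_zero (analyticAt_coord a v)
        (hmon _ (hN a (hex a ha ha₀)).1).1 (hI a ha), fderiv_coord]
      by_cases hab : a = b
      · subst hab; simp
      · simp [hab]
  obtain ⟨l', hl', hl'inj⟩ := exists_completion _ I l rfl (by
    intro c hc hsum
    have hc1 : ∀ b ∉ I₀, c b = 0 := by
      intro b hb₀
      by_cases hb : b ∈ I
      · have h1 := congrArg (fun T : (Fin n → ℂ) →L[ℂ] ℂ => T (fderiv ℂ Φ v (Pi.single b 1))) hsum
        simp only [sum_apply, smul_apply, zero_apply] at h1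
        rw [Finset.sum_eq_single b] at h1
        · rw [hlv b hb b hb hb₀, if_pos rfl] at h1
          exact (smul_eq_zero.1 h1).resolve_right (hmon _ (hN b (hex b hb hb₀)).1).2.1
        · intro a _ hab
          by_cases ha : a ∈ I
          · rw [hlv a ha b hb hb₀, if_neg hab, smul_zero]
          · rw [hc a ha, zero_smul]
        · simp
      · exact hc b hb
    ext b
    by_cases hb : b ∈ I₀
    · have h1 := congrArg (fun T : (Fin n → ℂ) →L[ℂ] ℂ => T (Pi.single (τ b) 1)) hsum
      simp only [sum_apply, smul_apply, zero_apply] at h1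
      rw [Finset.sum_eq_single b] at h1
      · rw [hl] at h1
        simp only [hG₀ b hb, fderiv_coord] at h1
        simpa using h1
      · intro a _ hab
        by_cases ha : a ∈ I₀
        · rw [hl]
          simp only [hG₀ a ha, fderiv_coord]
          have : τ a ≠ τ b := fun h' => hab (h.inj ha hb h')
          simp [this]
        · rw [hc1 a ha, zero_smul]
      · simp
    · exact hc1 b hb)
  set F : (Fin n → ℂ) → Fin n → ℂ := fun z a => if a ∈ I then G a z else l' a z with hF
  have hFI : ∀ a ∈ I, (fun z => F z a) = G a := fun a ha => by ext; simp [hF, ha]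
  have hFO : ∀ a ∉ I, (fun z => F z a) = l' a := fun a ha => by ext; simp [hF, ha]
  have hFa : AnalyticAt ℂ F (Φ v) := by
    refine analyticAt_pi_of fun a => ?_
    by_cases ha : a ∈ I
    · rw [hFI a ha]; exact hGa a
    · rw [hFO a ha]; exact (l' a).analyticAt _
  have hF' : Function.Injective (fderiv ℂ F (Φ v)) := by
    rw [injective_iff_map_eq_zero]
    intro ξ hξ
    refine hl'inj ξ fun a => ?_
    have h1 := congrFun hξ a
    rw [fderiv_component hFa] at h1
    by_cases ha : a ∈ I
    · rw [hFI a ha] at h1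
      rw [hl' a ha]; exact h1
    · rw [hFO a ha, (l' a).fderiv] at h1
      exact h1
  obtain ⟨W, hW, hW', hWI, hWO⟩ := h.exists_coordinates hFa (fun b hb z => by
    rw [show F z b = G b z from congrFun (hFI b (hI₀ hb)) z, hG₀ b hb]) hF'
  refine ⟨F, W, fun b => if b ∈ I₀ then p b else 1,
    fun b => if b ∈ I ∧ ∃ i ∈ K, f i b ≠ 0 then some (N b) else none, hFa, hF', hW, hW', ?_, ?_, ?_,
    ?_⟩
  · intro b
    by_cases hb : b ∈ I₀
    · simpa [hb] using h.p_ne b hb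
    · simp [hb]
  · refine Filter.eventually_all.2 fun b => ?_
    by_cases hb : b ∈ I₀
    · filter_upwards [(hWI b hb).1] with w hw
      simp [hb, hw]
    · exact .of_forall fun w => by simp [hb, hWO b hb]
  · intro b i hbi
    by_cases hcond : b ∈ I ∧ ∃ i ∈ K, f i b ≠ 0
    · replace hbi : (if b ∈ I ∧ ∃ i ∈ K, f i b ≠ 0 then some (N b) else none) = some i := hbi
      rw [if_pos hcond] at hbi
      obtain rfl := Option.some.inj hbi
      obtain ⟨hNK, hfN⟩ := hN b hcond.2
      refine ⟨hNK, ?_⟩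
      have h1 : ∀ z, F z b = G b z := fun z => congrFun (hFI b hcond.1) z
      by_cases hb₀ : b ∈ I₀
      · simp only [h1, hG₀ b hb₀]
        refine ⟨?_, h.eq_zero_iff_of_branch hθ hθ' hb₀
          (eventually_prod_eq_of_mem hcond.1 (hmon _ hNK).2.2 hfN)⟩
        rw [(h.eq b hb₀).self_of_nhds, h.zero b hb₀, zero_pow (h.p_ne b hb₀), zero_mul]
      · simp only [h1, hG₁ b hb₀]
        exact ⟨hK _ hNK, .of_forall fun _ => by trivial⟩
    · replace hbi : (if b ∈ I ∧ ∃ i ∈ K, f i b ≠ 0 then some (N b) else none) = some i := hbi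
      rw [if_neg hcond] at hbi
      exact absurd hbi (by simp)
  · intro i hi
    have h1 := (hmon i hi).2.2.self_of_nhds
    rw [hK i hi] at h1
    obtain ⟨b, hb, hb0⟩ := Finset.prod_eq_zero_iff.1
      ((mul_eq_zero.1 h1.symm).resolve_right (hmon i hi).2.1)
    have hfb : f i b ≠ 0 := by
      intro h0; rw [h0, pow_zero] at hb0; exact one_ne_zero hb0
    refine ⟨b, ?_⟩
    have hex' : ∃ i ∈ K, f i b ≠ 0 := ⟨i, hi, hfb⟩
    show (if b ∈ I ∧ ∃ i ∈ K, f i b ≠ 0 then some (N b) else none) = some i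
    rw [if_pos ⟨hb, hex'⟩]
    rw [huniq b hb _ (hN b hex').1 i hi (hN b hex').2 hfb]

end AdaptedCoordinates

/-! ### Holomorphic charts. -/

section Charts

variable {n n' : ℕ} {X X' : Type*} [TopologicalSpace X] [ChartedSpace (Fin n → ℂ) X]
  [TopologicalSpace X'] [ChartedSpace (Fin n' → ℂ) X']

theorem contMDiffAt_vectorSpace_iff {E F : Type*} [NormedAddCommGroup E] [NormedSpace ℂ E]
    [NormedAddCommGroup F] [NormedSpace ℂ F] [CompleteSpace F] {f : E → F} {x : E} :
    ContMDiffAt 𝓘(ℂ, E) 𝓘(ℂ, F) ω f x ↔ AnalyticAt ℂ f x :=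
  contMDiffAt_iff_contDiffAt.trans ⟨fun h => h.analyticAt, fun h => h.contDiffAt⟩

variable {e : OpenPartialHomeomorph X (Fin n → ℂ)} {e' : OpenPartialHomeomorph X' (Fin n' → ℂ)}

theorem contMDiffAt_chart (he : e ∈ holCharts n X) {x : X} (hx : x ∈ e.source) :
    ContMDiffAt 𝓘(ℂ, Fin n → ℂ) 𝓘(ℂ, Fin n → ℂ) ω e x :=
  contMDiffAt_of_mem_maximalAtlas he hx

theorem contMDiffAt_chart_symm (he : e ∈ holCharts n X) {v : Fin n → ℂ} (hv : v ∈ e.target) :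
    ContMDiffAt 𝓘(ℂ, Fin n → ℂ) 𝓘(ℂ, Fin n → ℂ) ω e.symm v :=
  contMDiffAt_symm_of_mem_maximalAtlas he hv

theorem HolAt.analyticAt_chart {h : X → ℂ} (he : e ∈ holCharts n X) {v : Fin n → ℂ}
    (hv : v ∈ e.target) (hh : HolAt n h (e.symm v)) : AnalyticAt ℂ (fun w => h (e.symm w)) v :=
  contMDiffAt_vectorSpace_iff.1 (ContMDiffAt.comp v hh (contMDiffAt_chart_symm he hv))

theorem HolAt.analyticAt_chart' {h : X → ℂ} (he : e ∈ holCharts n X) {x : X}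
    (hx : x ∈ e.source) (hh : HolAt n h x) : AnalyticAt ℂ (fun w => h (e.symm w)) (e x) :=
  HolAt.analyticAt_chart he (e.map_source hx) (by rwa [e.left_inv hx])

theorem holAt_of_analyticAt {h : (Fin n → ℂ) → ℂ} (he : e ∈ holCharts n X) {x : X}
    (hx : x ∈ e.source) (hh : AnalyticAt ℂ h (e x)) : HolAt n (fun x => h (e x)) x :=
  ContMDiffAt.comp x (contMDiffAt_vectorSpace_iff.2 hh) (contMDiffAt_chart he hx)

theorem holAt_coord (he : e ∈ holCharts n X) {x : X} (hx : x ∈ e.source) (i : Fin n) :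
    HolAt n (fun x => e x i) x :=
  holAt_of_analyticAt he hx (analyticAt_coord i _)

theorem mdifferentiable_chart_of_mem (he : e ∈ holCharts n X) :
    e.MDifferentiable 𝓘(ℂ, Fin n → ℂ) 𝓘(ℂ, Fin n → ℂ) :=
  ⟨(contMDiffOn_of_mem_maximalAtlas he).mdifferentiableOn (by simp),
    (contMDiffOn_symm_of_mem_maximalAtlas he).mdifferentiableOn (by simp)⟩

/-- The expression in charts of a holomorphic map. -/
theorem Hol.analyticAt_charts {f : X → X'} (hf : Hol n n' f) (he : e ∈ holCharts n X)
    (he' : e' ∈ holCharts n' X') {v : Fin n → ℂ} (hv : v ∈ e.target)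
    (hv' : f (e.symm v) ∈ e'.source) : AnalyticAt ℂ (fun w => e' (f (e.symm w))) v :=
  have h1 : ContMDiffAt 𝓘(ℂ, Fin n → ℂ) 𝓘(ℂ, Fin n' → ℂ) ω (f ∘ e.symm) v :=
    ContMDiffAt.comp v (hf _) (contMDiffAt_chart_symm he hv)
  contMDiffAt_vectorSpace_iff.1 (ContMDiffAt.comp v (contMDiffAt_chart he' hv') h1)

theorem analyticAt_transition {e₁ : OpenPartialHomeomorph X (Fin n → ℂ)} (he : e ∈ holCharts n X)
    (he₁ : e₁ ∈ holCharts n X) {v : Fin n → ℂ} (hv : v ∈ e.target) (hv' : e.symm v ∈ e₁.source) :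
    AnalyticAt ℂ (fun w => e₁ (e.symm w)) v :=
  Hol.analyticAt_charts (f := id) contMDiff_id he he₁ hv hv'

theorem injective_fderiv_charts {Y : Type*} [TopologicalSpace Y]
    [ChartedSpace (Fin n → ℂ) Y] {f : Y → X}
    {e' : OpenPartialHomeomorph Y (Fin n → ℂ)}
    (hf : Hol n n f) (he : e ∈ holCharts n X)
    (he' : e' ∈ holCharts n Y) {v : Fin n → ℂ} (hv : v ∈ e'.target)
    (hv' : f (e'.symm v) ∈ e.source) :
    Function.Injective (fderiv ℂ (fun w => e (f (e'.symm w))) v) ↔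
      Function.Injective (mfderiv 𝓘(ℂ, Fin n → ℂ) 𝓘(ℂ, Fin n → ℂ) f (e'.symm v)) := by
  have h1 := (mdifferentiable_chart_of_mem he).mdifferentiableAt hv'
  have h2 := (hf (e'.symm v)).mdifferentiableAt (by simp)
  have h3 := (mdifferentiable_chart_of_mem he').mdifferentiableAt_symm hv
  have h4 : fderiv ℂ (fun w => e (f (e'.symm w))) v =
      (mfderiv 𝓘(ℂ, Fin n → ℂ) 𝓘(ℂ, Fin n → ℂ) e (f (e'.symm v))).comp
        ((mfderiv 𝓘(ℂ, Fin n → ℂ) 𝓘(ℂ, Fin n → ℂ) f (e'.symm v)).comp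
          (mfderiv 𝓘(ℂ, Fin n → ℂ) 𝓘(ℂ, Fin n → ℂ) e'.symm v)) := by
    rw [← mfderiv_eq_fderiv]
    have h5 := mfderiv_comp v (h1.comp (e'.symm v) h2) h3
    have h6 := mfderiv_comp (e'.symm v) h1 h2
    rw [h6] at h5
    exact h5
  have b1 := (mdifferentiable_chart_of_mem he).mfderiv_injective hv'
  have b2 := (mdifferentiable_chart_of_mem he').symm.mfderiv_bijective
    (x := v) (by simpa using hv)
  rw [h4]
  constructor
  · intro h ξ ξ' hξ
    obtain ⟨η, rfl⟩ := b2.2 ξ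
    obtain ⟨η', rfl⟩ := b2.2 ξ'
    have : η = η' := h (congrArg (mfderiv 𝓘(ℂ, Fin n → ℂ) 𝓘(ℂ, Fin n → ℂ) e (f (e'.symm v))) hξ)
    rw [this]
  · intro h
    exact b1.comp (h.comp b2.1)

/-- New coordinates from a map with invertible differential. -/
theorem exists_chart_of_injective_fderiv [IsManifold 𝓘(ℂ, Fin n → ℂ) ω X] (he : e ∈ holCharts n X) {x : X} (hx : x ∈ e.source)
    {G : (Fin n → ℂ) → Fin n → ℂ} (hG : AnalyticAt ℂ G (e x))
    (hG' : Function.Injective (fderiv ℂ G (e x))) {U : Set X} (hU : U ∈ 𝓝 x) :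
    ∃ e₁ ∈ holCharts n X, x ∈ e₁.source ∧ e₁.source ⊆ e.source ∩ U ∧ ∀ x', e₁ x' = G (e x') := by
  set L : (Fin n → ℂ) ≃L[ℂ] (Fin n → ℂ) :=
    (LinearEquiv.ofInjectiveEndo (fderiv ℂ G (e x) : (Fin n → ℂ) →ₗ[ℂ] _) hG').toContinuousLinearEquiv
  have hL : fderiv ℂ G (e x) = L := by ext; rfl
  have hU' : e.symm ⁻¹' U ∈ 𝓝 (e x) := (e.continuousAt_symm (e.map_source hx)).preimage_mem_nhds
    (by rwa [e.left_inv hx])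
  obtain ⟨g, hg1, hg2, hg3, hg4, hg5, -⟩ := exists_localInverse hG L hL hU'
  have hmem : ∀ x' ∈ (e.trans g).source, x' ∈ e.source ∧ e x' ∈ g.source := by
    intro x' hx'
    simpa using hx'
  refine ⟨e.trans g, ?_, ?_, ?_, ?_⟩
  · refine OpenPartialHomeomorph.mem_maximalAtlas_of_contMDiffOn _ ?_ ?_
    · intro x' hx'
      obtain ⟨h1, h2⟩ := hmem x' hx'
      have h3 : ContMDiffAt 𝓘(ℂ, Fin n → ℂ) 𝓘(ℂ, Fin n → ℂ) ω g (e x') := by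
        rw [show (g : (Fin n → ℂ) → Fin n → ℂ) = G from funext hg2]
        exact contMDiffAt_vectorSpace_iff.2 (hg4 _ h2)
      exact (ContMDiffAt.comp x' h3 (contMDiffAt_chart he h1)).contMDiffWithinAt
    · intro v hv
      have h1 : v ∈ g.target ∧ g.symm v ∈ e.target := by
        simpa [OpenPartialHomeomorph.trans_target] using hv
      exact (ContMDiffAt.comp v (contMDiffAt_chart_symm he h1.2)
        (contMDiffAt_vectorSpace_iff.2 (hg5 v h1.1))).contMDiffWithinAt
  · simp [hx, hg1]
  · intro x' hx'
    obtain ⟨h1, h2⟩ := hmem x' hx'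
    refine ⟨h1, ?_⟩
    have h3 : e.symm (e x') ∈ U := hg3 h2
    rwa [e.left_inv h1] at h3
  · intro x'
    simp [hg2]

/-- By continuity, only the hyperplanes through `x` are visible near `x`. -/
theorem IsNCChart.eventually_mem_iff {κ : Type*} {E : κ → Set X}
    {z : OpenPartialHomeomorph X (Fin n → ℂ)} {lab : Fin n → Option κ} (h : IsNCChart n E z lab)
    {x : X} (hx : x ∈ z.source) :
    ∀ᶠ x' in 𝓝 x, ∀ c, x' ∈ E c ↔ ∃ i, lab i = some c ∧ z x i = 0 ∧ z x' i = 0 := by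
  have h1 : ∀ᶠ x' in 𝓝 x, ∀ i, z x i ≠ 0 → z x' i ≠ 0 := by
    refine Filter.eventually_all.2 fun i => ?_
    by_cases h0 : z x i = 0
    · exact .of_forall fun _ h => absurd h0 h
    · have h2 : ContinuousAt (fun x' => z x' i) x :=
        (continuous_apply i).continuousAt.comp (z.continuousAt hx)
      filter_upwards [h2.eventually_ne h0] with x' h3 _ using h3
  filter_upwards [h1, z.open_source.mem_nhds hx] with x' h2 h3 c
  have h4 : x' ∈ E c ↔ x' ∈ E c ∩ z.source := by simp [h3]
  rw [h4, h.eq c]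
  constructor
  · rintro ⟨-, i, hi, h0⟩
    exact ⟨i, hi, by by_contra h5; exact h2 i h5 h0, h0⟩
  · rintro ⟨i, hi, -, h0⟩
    exact ⟨h3, i, hi, h0⟩

end Charts

/-! ### Ramification of Galois coverings. -/

section Ramification

variable {n : ℕ} {X Y : Type*} [TopologicalSpace X] [ChartedSpace (Fin n → ℂ) X]
  [TopologicalSpace Y] [ChartedSpace (Fin n → ℂ) Y]

/-- Deck transformations preserve the ramification and are transitive on fibres. Hence the
ramification is the whole preimage of the branch locus, so `π` is unramified where the branch
equations do not vanish. -/
theorem IsGaloisCovering.mem_ramification {π : Y → X} (h : IsGaloisCovering n π) {y : Y}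
    (hy : π y ∈ π '' ramification n π) : y ∈ ramification n π := by
  obtain ⟨y', hy', h1⟩ := hy
  obtain ⟨σ, hσ, rfl⟩ := h.galois y' y h1
  intro hb
  refine hy' ?_
  have h2 : π = π ∘ σ := funext fun u => (hσ u).symm
  have h3 : MDifferentiableAt 𝓘(ℂ, Fin n → ℂ) 𝓘(ℂ, Fin n → ℂ) σ y' :=
    (σ.contMDiff y').mdifferentiableAt (by simp)
  have h4 := mfderiv_comp y' ((h.hol (σ y')).mdifferentiableAt (by simp)) h3
  rw [← h2] at h4
  rw [h4]
  have h5 : Function.Bijective (mfderiv 𝓘(ℂ, Fin n → ℂ) 𝓘(ℂ, Fin n → ℂ) σ y') := by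
    rw [← σ.mfderivToContinuousLinearEquiv_coe (by simp)]
    exact (σ.mfderivToContinuousLinearEquiv (by simp) y').bijective
  exact hb.comp h5

end Ramification

/-! ### Existence of adapted charts. -/

section AdaptedCharts

variable {n : ℕ}

/-- Both sides are compared by their order along `∂_b` at a point of `w_b = 0` off the other
hyperplanes of `L`. -/
theorem exponent_eq_of_prod_eq {L : Finset (Fin n)} {q : Fin n → ℕ} {p : ℕ} {v : Fin n → ℂ}
    (hL : ∀ b ∈ L, v b = 0) {U : (Fin n → ℂ) → ℂ} (hU : AnalyticAt ℂ U v) (hU0 : U v ≠ 0)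
    (h : ∀ᶠ w in 𝓝 v, ∏ b ∈ L, w b ^ q b = U w * (∏ b ∈ L, w b) ^ p) {b : Fin n} (hb : b ∈ L) :
    q b = p := by
  classical
  obtain ⟨w, ⟨h1, h2⟩, h3, h4, h5⟩ := ((frequently_coord_pattern (L.erase b)
    (fun a ha => hL a (Finset.mem_of_mem_erase ha))).and_eventually
    (hU.eventually_analyticAt.and ((hU.continuousAt.eventually_ne hU0).and
      h.eventually_nhds))).exists
  have hb0 : w b = 0 := by rw [h2 b (by simp), hL b hb]
  set d : Fin n → ℂ := Pi.single b 1 with hd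
  have hone : lineOrder d (fun w : Fin n → ℂ => w b) w = 1 := lineOrder_coord hb0 (by simp [hd])
  have key : ∀ (m : ℕ) (g : (Fin n → ℂ) → ℂ), AnalyticAt ℂ g w → g w ≠ 0 →
      lineOrder d (fun w => w b ^ m * g w) w = m := by
    intro m g hg hg0
    rw [lineOrder_mul d ((analyticAt_coord b w).fun_pow m) hg,
      lineOrder_pow d (analyticAt_coord b w), hone, (lineOrder_eq_zero d hg).2 hg0]
    simp
  have hne : ∀ m : Fin n → ℕ, ∏ a ∈ L.erase b, w a ^ m a ≠ 0 := fun m =>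
    Finset.prod_ne_zero_iff.2 fun a ha => pow_ne_zero _ (h1 a ha)
  have e1 := key (q b) (fun w => ∏ a ∈ L.erase b, w a ^ q a) (analyticAt_monomial _ _ w) (hne q)
  have e2 := key p (fun w => U w * ∏ a ∈ L.erase b, w a ^ p)
    (h3.fun_mul (analyticAt_monomial (L.erase b) (fun _ => p) w)) (mul_ne_zero h4 (hne fun _ => p))
  have e3 : (fun w : Fin n → ℂ => w b ^ q b * ∏ a ∈ L.erase b, w a ^ q a) =ᶠ[𝓝 w]
      fun w => w b ^ p * (U w * ∏ a ∈ L.erase b, w a ^ p) := by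
    filter_upwards [h5] with w' hw'
    rw [Finset.mul_prod_erase _ (fun a => w' a ^ q a) hb, hw', ← Finset.prod_pow,
      ← Finset.mul_prod_erase _ (fun a => w' a ^ p) hb]
    ring
  rw [lineOrder_congr d e3, e2] at e1
  exact_mod_cast e1.symm

variable {X Y : Type*} [TopologicalSpace X] [ChartedSpace (Fin n → ℂ) X]
  [TopologicalSpace Y] [ChartedSpace (Fin n → ℂ) Y] {ι : Type*}

/-- Read in coordinates with `z = w ^ q`, the equality `π^*Δ_l = p D` says that the exponents on the
branches of `Δ_l` are all `p`, a multiple of `a_l`. The labelled hyperplanes pass through `y`, so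
none of them is lost in the germ at `y`. -/
theorem dvd_of_pullbackEq {P : OrbifoldPair n X ι} {π : Y → X} (hπ : IsAdapted P π)
    {zc : OpenPartialHomeomorph X (Fin n → ℂ)} {wc : OpenPartialHomeomorph Y (Fin n → ℂ)}
    {lab : Fin n → Option ι} {q : Fin n → ℕ} (hq : ∀ b, q b ≠ 0) {y : Y} (hy : y ∈ wc.source)
    (hz : IsNCChart n P.comp zc lab) (hw : wc ∈ holCharts n Y) (hm : MapsTo π wc.source zc.source)
    (hpow : ∀ y ∈ wc.source, ∀ i, zc (π y) i = wc y i ^ q i)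
    (hlab : ∀ b, lab b ≠ none → wc y b = 0) (b : Fin n) : P.numer (lab b) ∣ q b := by
  classical
  rcases hl : lab b with _ | l
  · simp [OrbifoldPair.numer]
  obtain ⟨p, hap, hp⟩ := hπ.pullback l
  set lab' : Fin n → Option Unit := fun s => if lab s = some l then some () else none with hlab'
  have hlab'' : ∀ s, lab' s = some () ↔ lab s = some l := fun s => by
    by_cases h : lab s = some l <;> simp [hlab', h]
  obtain ⟨u, hu, hu0, he⟩ := hp y zc lab wc lab' hz (hm hy) ⟨hw, fun _ => by
    ext y'
    by_cases hy' : y' ∈ wc.source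
    · have h1 : π y' ∈ P.comp l ↔ π y' ∈ P.comp l ∩ zc.source := by simp [hm hy']
      simp only [mem_inter_iff, mem_preimage, hy', and_true, mem_ofPred_eq, true_and, h1, hz.eq l,
        hm hy', hpow y' hy']
      simp [hlab'', hq]
    · simp [hy']⟩ hy
  set L : Finset (Fin n) := Finset.univ.filter fun s => lab s = some l with hL
  have hev : ∀ᶠ w in 𝓝 (wc y), ∏ b ∈ L, w b ^ q b = u (wc.symm w) * (∏ b ∈ L, w b) ^ p := by
    have h1 : ∀ᶠ w in 𝓝 (wc y), w ∈ wc.target := wc.open_target.mem_nhds (wc.map_source hy)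
    have h2 := (wc.continuousAt_symm (wc.map_source hy)).eventually (by rwa [wc.left_inv hy])
    filter_upwards [h1, h2] with w hw' h3
    have hs : wc.symm w ∈ wc.source := wc.map_target hw'
    rw [finprod_cond_eq_prod_of_cond_iff (t := L) _ (by intro s _; simp [hL]),
      finprod_cond_eq_prod_of_cond_iff (t := L) _ (by intro s _; simp [hL, hlab''])] at h3
    simp only [hpow _ hs, wc.right_inv hw'] at h3
    exact h3
  have := exponent_eq_of_prod_eq (L := L) (fun b hb => hlab b (by
    rw [(Finset.mem_filter.1 hb).2]; simp)) (HolAt.analyticAt_chart' hw hy hu)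
    (by rwa [wc.left_inv hy]) hev (b := b) (by simp [hL, hl])
  rw [this]
  exact hap

/-- Around every point there are adapted coordinates. -/
theorem exists_adaptedChart [IsManifold 𝓘(ℂ, Fin n → ℂ) ω X]
    [IsManifold 𝓘(ℂ, Fin n → ℂ) ω Y] {P : OrbifoldPair n X ι} {π : Y → X} (hπ : IsAdapted P π) (y : Y) :
    ∃ C : AdaptedChart P π, y ∈ C.w.source := by
  classical
  -- Three charts: `v` for `π⁻¹|Δ|` and the ramification, `z` for the branch locus, `ζ` for `Δ`. The
  -- sets `I`, `J`, `K` retain the hyperplanes through the point.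
  obtain ⟨v, labv, hyv, hv⟩ := hπ.nc_ram y
  obtain ⟨z, labz, hyz, hz⟩ := hπ.nc_branch (π y)
  obtain ⟨ζ, labζ, hyζ, hζ⟩ := P.nc (π y)
  set I : Finset (Fin n) := Finset.univ.filter fun a => labv a = some () ∧ v y a = 0 with hI
  set J : Finset (Fin n) := Finset.univ.filter fun j => labz j = some () ∧ z (π y) j = 0 with hJ
  set K : Finset (Fin n) := Finset.univ.filter fun i => labζ i ≠ none ∧ ζ (π y) i = 0 with hK
  have hπc : Continuous π := hπ.hol.continuous
  have hyt : v y ∈ v.target := v.map_source hyv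
  have hvy : v.symm (v y) = y := v.left_inv hyv
  -- transfer of local statements
  have hY : ∀ {q : Y → Prop}, (∀ᶠ y' in 𝓝 y, q y') → ∀ᶠ w in 𝓝 (v y), q (v.symm w) := by
    intro q h
    exact (v.continuousAt_symm hyt).eventually (by rwa [hvy])
  have hX : ∀ {q : X → Prop}, (∀ᶠ x in 𝓝 (π y), q x) → ∀ᶠ w in 𝓝 (v y), q (π (v.symm w)) := by
    intro q h
    exact hY (hπc.continuousAt.eventually h)
  have hvt : ∀ᶠ w in 𝓝 (v y), w ∈ v.target := v.open_target.mem_nhds hyt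
  have hS : ∀ᶠ y' in 𝓝 y, (π y' ∈ P.support ∨ y' ∈ ramification n π) ↔ ∃ a ∈ I, v y' a = 0 := by
    filter_upwards [hv.eventually_mem_iff hyv] with y' h
    have h1 := h ()
    simp only [mem_union, mem_preimage] at h1
    rw [h1]
    simp [hI, and_assoc]
  have hB : ∀ᶠ x in 𝓝 (π y), x ∈ π '' ramification n π ↔ ∃ j ∈ J, z x j = 0 := by
    filter_upwards [hz.eventually_mem_iff hyz] with x h
    rw [h ()]
    simp [hJ, and_assoc]
  have hΔ : ∀ᶠ x in 𝓝 (π y), ∀ c, x ∈ P.comp c ↔ ∃ i ∈ K, labζ i = some c ∧ ζ x i = 0 := by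
    filter_upwards [hζ.eventually_mem_iff hyζ] with x h c
    rw [h c]
    constructor
    · rintro ⟨i, h1, h2, h3⟩
      exact ⟨i, by simp [hK, h1, h2], h1, h3⟩
    · rintro ⟨i, h1, h2, h3⟩
      exact ⟨i, h2, (Finset.mem_filter.1 h1).2.2, h3⟩
  have hsupp : ∀ᶠ x in 𝓝 (π y), x ∈ P.support ↔ ∃ i ∈ K, ζ x i = 0 := by
    filter_upwards [hΔ] with x h
    simp only [OrbifoldPair.support, mem_iUnion, h]
    constructor
    · rintro ⟨c, i, h1, -, h3⟩; exact ⟨i, h1, h3⟩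
    · rintro ⟨i, h1, h3⟩
      obtain ⟨c, hc⟩ := Option.ne_none_iff_exists'.1 (Finset.mem_filter.1 h1).2.1
      exact ⟨c, i, h1, hc, h3⟩
  set Φ : (Fin n → ℂ) → Fin n → ℂ := fun w => z (π (v.symm w)) with hΦ
  set θ : (Fin n → ℂ) → Fin n → ℂ := fun x => ζ (z.symm x) with hθ
  have hΦv : Φ (v y) = z (π y) := by rw [hΦ]; simp only [hvy]
  have hΦa : AnalyticAt ℂ Φ (v y) := hπ.hol.analyticAt_charts hv.mem hz.mem hyt (by rwa [hvy])
  have hzt : z (π y) ∈ z.target := z.map_source hyz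
  have hθa : AnalyticAt ℂ θ (Φ (v y)) := by
    rw [hΦv]
    exact analyticAt_transition hz.mem hζ.mem hzt (by rwa [z.left_inv hyz])
  have hθ' : Function.Injective (fderiv ℂ θ (Φ (v y))) := by
    rw [hΦv]
    have h1 := (injective_fderiv_charts (f := (id : X → X)) contMDiff_id hζ.mem hz.mem hzt
      (by simpa [z.left_inv hyz] using hyζ)).2 (by rw [mfderiv_id]; exact fun _ _ h => h)
    exact h1
  have hzs : ∀ᶠ w in 𝓝 (v y), π (v.symm w) ∈ z.source := hX (z.open_source.mem_nhds hyz)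
  have hζs : ∀ᶠ w in 𝓝 (v y), θ (Φ w) = ζ (π (v.symm w)) := by
    filter_upwards [hzs] with w hw
    simp only [hθ, hΦ, z.left_inv hw]
  have hIz : ∀ a ∈ I, v y a = 0 := fun a ha => (Finset.mem_filter.1 ha).2.2
  have hJz : ∀ j ∈ J, Φ (v y) j = 0 := fun j hj => by
    rw [hΦv]; exact (Finset.mem_filter.1 hj).2.2
  have hSw : ∀ᶠ w in 𝓝 (v y), (π (v.symm w) ∈ P.support ∨ v.symm w ∈ ramification n π) ↔
      ∃ a ∈ I, w a = 0 := by
    filter_upwards [hY hS, hvt] with w h1 h2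
    rw [h1, v.right_inv h2]
  have hBw : ∀ᶠ w in 𝓝 (v y), v.symm w ∈ ramification n π ↔ ∃ j ∈ J, Φ w j = 0 := by
    filter_upwards [hX hB] with w h1
    rw [← h1]
    exact ⟨fun h => mem_image_of_mem _ h, hπ.toIsGaloisCovering.mem_ramification⟩
  have hram : ∀ᶠ w in 𝓝 (v y), (∀ j ∈ J, Φ w j ≠ 0) → Function.Injective (fderiv ℂ Φ w) := by
    filter_upwards [hBw, hvt, hzs] with w h1 h2 h3 h4
    refine (injective_fderiv_charts hπ.hol hz.mem hv.mem h2 h3).2 ?_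
    have h5 : v.symm w ∉ ramification n π := by
      rw [h1]; rintro ⟨j, hj, h0⟩; exact h4 j hj h0
    exact (not_not.1 h5 : Function.Bijective _).1
  have hfin : ∃ O ∈ 𝓝 (v y), ∀ c, {w ∈ O | Φ w = c}.Finite := by
    refine ⟨{w | w ∈ v.target ∧ π (v.symm w) ∈ z.source}, hvt.and hzs, fun c => ?_⟩
    refine ((hπ.finite_fiber (z.symm c)).image v).subset ?_
    rintro w ⟨⟨h1, h2⟩, rfl⟩
    refine ⟨v.symm w, ?_, v.right_inv h1⟩
    simp [hΦ, z.left_inv h2]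
  obtain ⟨I₀, τ, p, u, hI₀, hinj, hJτ, hpu, hblock⟩ := exists_branch_structure hΦa hIz hJz
    (fun j hj => by
      filter_upwards [hSw, hBw] with w h1 h2 h3
      exact h1.1 (Or.inr (h2.2 ⟨j, hj, h3⟩))) hram hfin
  have hbr : IsBranched Φ (v y) I₀ τ p u := ⟨hΦa, fun a ha => hIz a (hI₀ ha), hinj,
    fun a ha => (hpu a ha).1, fun a ha => (hpu a ha).2.1, fun a ha => (hpu a ha).2.2.1,
    fun a ha => (hpu a ha).2.2.2, hblock⟩
  have hbz : ∀ᶠ w in 𝓝 (v y), ∀ a ∈ I₀, Φ w (τ a) = 0 ↔ w a = 0 := by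
    refine (Filter.eventually_all_finset I₀).2 fun a ha => ?_
    filter_upwards [hbr.eq a ha, (hbr.u_an a ha).continuousAt.eventually_ne (hbr.u_ne a ha)]
      with w h1 h2
    rw [h1]
    simp [h2, hbr.p_ne a ha]
  obtain ⟨F, W, q, ν, hF, hF', hW, hW', hq, hFW, hν, hνK⟩ := hbr.exists_adapted_coordinates
    (K := K) hI₀ hIz hθa hθ' (fun i hi => by
      rw [hζs.self_of_nhds, hvy]; exact (Finset.mem_filter.1 hi).2.2) hfin
    (by
      filter_upwards [hram, hbz] with w h1 h2 h3
      refine h1 fun j hj => ?_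
      obtain ⟨a, ha, rfl⟩ := (hJτ j).1 hj
      rw [Ne, h2 a ha]
      exact h3 a ha)
    (fun i hi => by
      filter_upwards [hSw, hX hsupp, hζs] with w h1 h2 h3 h4
      exact h1.1 (Or.inl (h2.2 ⟨i, hi, by rw [← h3]; exact h4⟩)))
    (by
      filter_upwards [hSw, hX hsupp, hζs, hBw, hbz] with w h1 h2 h3 h4 h5 a ha h0
      rcases h1.2 ⟨a, ha, h0⟩ with h6 | h6
      · obtain ⟨i, hi, h7⟩ := h2.1 h6
        exact Or.inr ⟨i, hi, by rw [h3]; exact h7⟩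
      · obtain ⟨j, hj, h7⟩ := h4.1 h6
        obtain ⟨b, hb, rfl⟩ := (hJτ j).1 hj
        exact Or.inl ⟨b, hb, (h5 b hb).1 h7⟩)
  rw [hΦv] at hF hF' hν
  have hνev : ∀ᶠ x in 𝓝 (π y), ∀ b i, ν b = some i → (F (z x) b = 0 ↔ ζ x i = 0) := by
    have h1 : ∀ᶠ x in 𝓝 (z (π y)), ∀ b i, ν b = some i → (F x b = 0 ↔ θ x i = 0) := by
      refine Filter.eventually_all.2 fun b => Filter.eventually_all.2 fun i => ?_
      by_cases h : ν b = some i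
      · filter_upwards [(hν b i h).2.2] with x hx _ using hx
      · exact .of_forall fun _ h' => absurd h' h
    filter_upwards [(z.continuousAt hyz).eventually h1, z.open_source.mem_nhds hyz] with x h2 h3 b i h4
    rw [h2 b i h4]
    simp only [hθ, z.left_inv h3]
  -- The charts are shrunk so that the identities between germs hold on their whole domains.
  obtain ⟨zc, hzc, hyzc, hzcs, hzce⟩ := exists_chart_of_injective_fderiv hz.mem hyz hF hF'
    (hνev.and hΔ)
  have hUw : ∀ᶠ y' in 𝓝 y, π y' ∈ zc.source ∧ ∀ b, F (z (π y')) b = W (v y') b ^ q b := by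
    refine (hπc.continuousAt.eventually (zc.open_source.mem_nhds hyzc)).and ?_
    filter_upwards [(v.continuousAt hyv).eventually hFW, v.open_source.mem_nhds hyv] with y' h1 h2
    simpa [hΦ, v.left_inv h2] using h1
  obtain ⟨wc, hwc, hywc, hwcs, hwce⟩ := exists_chart_of_injective_fderiv hv.mem hyv hW hW' hUw
  set lab : Fin n → Option ι := fun b => (ν b).bind labζ with hlab
  have hnc : IsNCChart n P.comp zc lab := by
    refine ⟨hzc, fun c => ?_⟩
    ext x
    constructor
    · rintro ⟨h1, h2⟩
      obtain ⟨-, h3, h4⟩ := hzcs h2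
      obtain ⟨i, hi, h5, h6⟩ := (h4 c).1 h1
      obtain ⟨b, hb⟩ := hνK i hi
      exact ⟨h2, b, by simp [hlab, hb, h5], by rw [hzce, h3 b i hb]; exact h6⟩
    · rintro ⟨h2, b, h5, h6⟩
      obtain ⟨-, h3, h4⟩ := hzcs h2
      obtain ⟨i, hi, h7⟩ := Option.bind_eq_some_iff.1 h5
      refine ⟨(h4 c).2 ⟨i, (hν b i hi).1, h7, ?_⟩, h2⟩
      rw [← h3 b i hi, ← hzce]
      exact h6
  have hmaps : MapsTo π wc.source zc.source := fun y' hy' => (hwcs hy').2.1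
  have hpow : ∀ y' ∈ wc.source, ∀ i, zc (π y') i = wc y' i ^ q i := fun y' hy' i => by
    rw [hzce, hwce, (hwcs hy').2.2 i]
  refine ⟨⟨wc, zc, lab, q, hwc, hnc, fun i => Nat.pos_of_ne_zero (hq i), fun b => ?_, hmaps, hpow⟩,
    hywc⟩
  refine dvd_of_pullbackEq hπ hq hywc hnc hwc hmaps hpow (fun b hb => ?_) b
  obtain ⟨l, hl⟩ := Option.ne_none_iff_exists'.1 hb
  obtain ⟨i, hi, -⟩ := Option.bind_eq_some_iff.1 hl
  have h1 := (hν b i hi).2.1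
  rw [← hzce, hpow y hywc] at h1
  exact pow_eq_zero_iff (hq b) |>.1 h1

end AdaptedCharts

/-! ### Polynomials with analytic coefficients. -/

section AnalyticPolynomials

variable {E : Type*} [NormedAddCommGroup E] [NormedSpace ℂ E] {σ : Type*}

/-- Families of polynomials in the variables `σ` whose coefficients are analytic near `w`. -/
def IsAnalyticPoly (f : E → MvPolynomial σ ℂ) (w : E) : Prop :=
  (∃ S : Finset (σ →₀ ℕ), ∀ᶠ w' in 𝓝 w, (f w').support ⊆ S) ∧
    ∀ m, AnalyticAt ℂ (fun w' => (f w').coeff m) w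

theorem IsAnalyticPoly.C {a : E → ℂ} {w : E} (ha : AnalyticAt ℂ a w) :
    IsAnalyticPoly (σ := σ) (fun w => MvPolynomial.C (a w)) w := by
  classical
  refine ⟨⟨{0}, .of_forall fun w' => ?_⟩, fun m => ?_⟩
  · show (MvPolynomial.C (a w')).support ⊆ _
    rw [MvPolynomial.C_apply]
    exact MvPolynomial.support_monomial_subset
  · simp only [MvPolynomial.coeff_C]
    by_cases h : 0 = m
    · simpa [h] using ha
    · simpa [h] using analyticAt_const

theorem IsAnalyticPoly.X (i : σ) (w : E) :
    IsAnalyticPoly (fun _ : E => (MvPolynomial.X i : MvPolynomial σ ℂ)) w :=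
  ⟨⟨_, .of_forall fun _ => subset_rfl⟩, fun _ => analyticAt_const⟩

theorem IsAnalyticPoly.add {f g : E → MvPolynomial σ ℂ} {w : E} (hf : IsAnalyticPoly f w)
    (hg : IsAnalyticPoly g w) : IsAnalyticPoly (fun w => f w + g w) w := by
  classical
  obtain ⟨⟨S, hS⟩, hf⟩ := hf
  obtain ⟨⟨S', hS'⟩, hg⟩ := hg
  refine ⟨⟨S ∪ S', ?_⟩, fun m => ?_⟩
  · filter_upwards [hS, hS'] with w' h1 h2
    exact MvPolynomial.support_add.trans (Finset.union_subset_union h1 h2)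
  · simp only [MvPolynomial.coeff_add]
    exact (hf m).fun_add (hg m)

theorem IsAnalyticPoly.mul {f g : E → MvPolynomial σ ℂ} {w : E} (hf : IsAnalyticPoly f w)
    (hg : IsAnalyticPoly g w) : IsAnalyticPoly (fun w => f w * g w) w := by
  classical
  obtain ⟨⟨S, hS⟩, hf⟩ := hf
  obtain ⟨⟨S', hS'⟩, hg⟩ := hg
  refine ⟨⟨Finset.image₂ (· + ·) S S', ?_⟩, fun m => ?_⟩
  · filter_upwards [hS, hS'] with w' h1 h2
    exact (MvPolynomial.support_mul _ _).trans (Finset.image₂_subset h1 h2)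
  · simp only [MvPolynomial.coeff_mul]
    exact Finset.analyticAt_fun_sum _ fun x _ => (hf _).fun_mul (hg _)

theorem IsAnalyticPoly.sum {α : Type*} (s : Finset α) {f : α → E → MvPolynomial σ ℂ} {w : E}
    (hf : ∀ a ∈ s, IsAnalyticPoly (f a) w) : IsAnalyticPoly (fun w => ∑ a ∈ s, f a w) w := by
  classical
  induction s using Finset.induction_on with
  | empty => simpa using IsAnalyticPoly.C (σ := σ) (analyticAt_const (v := (0 : ℂ)) (x := w))
  | insert a s ha ih =>
    simp only [Finset.sum_insert ha]
    exact (hf a (by simp)).add (ih fun b hb => hf b (by simp [hb]))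

theorem IsAnalyticPoly.monomial {a : E → ℂ} {w : E} (ha : AnalyticAt ℂ a w) (m : σ →₀ ℕ) :
    IsAnalyticPoly (fun w => MvPolynomial.monomial m (a w)) w := by
  classical
  refine ⟨⟨{m}, .of_forall fun w' => MvPolynomial.support_monomial_subset⟩, fun m' => ?_⟩
  simp only [MvPolynomial.coeff_monomial]
  by_cases h : m = m'
  · simpa [h] using ha
  · simpa [h] using analyticAt_const

theorem IsAnalyticPoly.eventually {f : E → MvPolynomial σ ℂ} {w : E} (hf : IsAnalyticPoly f w) :
    ∀ᶠ w' in 𝓝 w, IsAnalyticPoly f w' := by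
  obtain ⟨⟨S, hS⟩, hf⟩ := hf
  have h1 : ∀ᶠ w' in 𝓝 w, ∀ m ∈ S, AnalyticAt ℂ (fun w' => (f w').coeff m) w' :=
    (Filter.eventually_all_finset S).2 fun m _ => (hf m).eventually_analyticAt
  filter_upwards [hS.eventually_nhds, h1] with w' h2 h3
  refine ⟨⟨S, h2⟩, fun m => ?_⟩
  by_cases hm : m ∈ S
  · exact h3 m hm
  · refine (analyticAt_const (v := (0 : ℂ))).congr ?_
    filter_upwards [h2] with w'' h4
    by_contra h5
    exact hm (h4 (MvPolynomial.mem_support_iff.2 (Ne.symm h5)))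

theorem IsAnalyticPoly.eventually_eq_sum {f : E → MvPolynomial σ ℂ} {w : E}
    (hf : IsAnalyticPoly f w) : ∃ S : Finset (σ →₀ ℕ), ∀ᶠ w' in 𝓝 w,
      f w' = ∑ m ∈ S, MvPolynomial.monomial m ((f w').coeff m) := by
  obtain ⟨⟨S, hS⟩, -⟩ := hf
  refine ⟨S, ?_⟩
  filter_upwards [hS] with w' h1
  conv_lhs => rw [(f w').as_sum]
  refine Finset.sum_subset h1 fun m _ hm => ?_
  rw [MvPolynomial.notMem_support_iff.1 hm, map_zero]

/-- The uniform bound on the supports allows the coefficientwise divisions to be made on one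
neighbourhood. -/
theorem IsAnalyticPoly.exists_div {f : E → MvPolynomial σ ℂ} {w : E} (hf : IsAnalyticPoly f w)
    {A : E → ℂ} (h : ∀ m, GermDvd A (fun w => (f w).coeff m) w) :
    ∃ g : E → MvPolynomial σ ℂ, IsAnalyticPoly g w ∧
      ∀ᶠ w' in 𝓝 w, f w' = MvPolynomial.C (A w') * g w' := by
  obtain ⟨S, hS⟩ := hf.eventually_eq_sum
  choose g hg hge using h
  refine ⟨fun w' => ∑ m ∈ S, MvPolynomial.monomial m (g m w'),
    IsAnalyticPoly.sum S fun m _ => IsAnalyticPoly.monomial (hg m) m, ?_⟩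
  have h1 : ∀ᶠ w' in 𝓝 w, ∀ m ∈ S, (f w').coeff m = A w' * g m w' :=
    (Filter.eventually_all_finset S).2 fun m _ => hge m
  filter_upwards [hS, h1] with w' h2 h3
  rw [h2, Finset.mul_sum]
  refine Finset.sum_congr rfl fun m hm => ?_
  rw [h3 m hm, MvPolynomial.C_mul_monomial]

theorem IsAnalyticPoly.analyticAt_eval [Fintype σ] {f : E → MvPolynomial σ ℂ} {w : E}
    (hf : IsAnalyticPoly f w) {F : Type*} [NormedAddCommGroup F] [NormedSpace ℂ F] {x : F}
    {g : F → E} {c : F → σ → ℂ} (hg : AnalyticAt ℂ g x) (hgx : g x = w)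
    (hc : ∀ i, AnalyticAt ℂ (fun x => c x i) x) :
    AnalyticAt ℂ (fun x => MvPolynomial.eval (c x) (f (g x))) x := by
  subst hgx
  obtain ⟨S, hS⟩ := hf.eventually_eq_sum
  have h1 : AnalyticAt ℂ (fun x => ∑ m ∈ S, (f (g x)).coeff m * ∏ i, c x i ^ m i) x := by
    refine Finset.analyticAt_fun_sum _ fun m _ => ?_
    refine ((hf.2 m).fun_comp hg).fun_mul ?_
    exact Finset.analyticAt_fun_prod _ fun i _ => (hc i).fun_pow _
  refine h1.congr ?_
  filter_upwards [hg.continuousAt.eventually hS] with x' h2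
  conv_rhs => rw [h2]
  simp only [map_sum, MvPolynomial.eval_monomial, Finsupp.prod_pow]

/-- Used for parameters in spaces that are not normed, such as `OrbJet`; it factors through the
analytic evaluation on `E × (σ → ℂ)`. -/
theorem IsAnalyticPoly.continuousAt_eval [Fintype σ] {f : E → MvPolynomial σ ℂ} {w : E}
    (hf : IsAnalyticPoly f w) {F : Type*} [TopologicalSpace F] {x : F}
    {g : F → E} {c : F → σ → ℂ} (hg : ContinuousAt g x) (hgx : g x = w)
    (hc : ∀ i, ContinuousAt (fun x => c x i) x) :
    ContinuousAt (fun x => MvPolynomial.eval (c x) (f (g x))) x := by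
  have h1 : ContinuousAt (fun y : E × (σ → ℂ) => MvPolynomial.eval y.2 (f y.1)) (w, c x) :=
    (hf.analyticAt_eval (x := (w, c x)) (g := Prod.fst) (c := Prod.snd) analyticAt_fst rfl
      fun i => ((ContinuousLinearMap.proj (R := ℂ) (φ := fun _ : σ => ℂ) i).comp
        (ContinuousLinearMap.snd ℂ E (σ → ℂ))).analyticAt _).continuousAt
  have h2 : ContinuousAt (fun x => (g x, c x)) x := hg.prodMk (continuousAt_pi.2 hc)
  exact ContinuousAt.comp (f := fun x => (g x, c x)) (by rw [hgx]; exact h1) h2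

end AnalyticPolynomials

/-! ### Taylor coefficients. -/

section TaylorCoefficients

/-- The Taylor coefficients at `0`. -/
noncomputable def taylorCoeff (j : ℕ) (g : ℂ → ℂ) : ℂ := iteratedDeriv j g 0 / (j.factorial : ℂ)

theorem taylorCoeff_zero (g : ℂ → ℂ) : taylorCoeff 0 g = g 0 := by simp [taylorCoeff]

theorem taylorCoeff_congr {f g : ℂ → ℂ} (h : f =ᶠ[𝓝 0] g) (j : ℕ) :
    taylorCoeff j f = taylorCoeff j g := by
  rw [taylorCoeff, taylorCoeff, h.iteratedDeriv_eq]

theorem taylorCoeff_succ (g : ℂ → ℂ) (j : ℕ) :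
    ((j : ℂ) + 1) * taylorCoeff (j + 1) g = taylorCoeff j (deriv g) := by
  rw [taylorCoeff, taylorCoeff, iteratedDeriv_succ', Nat.factorial_succ]
  push_cast
  have h1 : (j : ℂ) + 1 ≠ 0 := by exact_mod_cast j.succ_ne_zero
  have h2 : (j.factorial : ℂ) ≠ 0 := by exact_mod_cast j.factorial_ne_zero
  field_simp

theorem taylorCoeff_mul {f g : ℂ → ℂ} (hf : AnalyticAt ℂ f 0) (hg : AnalyticAt ℂ g 0) (j : ℕ) :
    taylorCoeff j (fun t => f t * g t) =
      ∑ x ∈ Finset.HasAntidiagonal.antidiagonal j, taylorCoeff x.1 f * taylorCoeff x.2 g := by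
  rw [taylorCoeff, iteratedDeriv_fun_mul hf.contDiffAt hg.contDiffAt,
    Finset.Nat.sum_antidiagonal_eq_sum_range_succ_mk, Finset.sum_div]
  refine Finset.sum_congr rfl fun i hi => ?_
  have hij : i ≤ j := Nat.lt_succ_iff.1 (Finset.mem_range.1 hi)
  simp only [taylorCoeff]
  rw [Nat.cast_choose ℂ hij]
  have h1 : (j.factorial : ℂ) ≠ 0 := by exact_mod_cast j.factorial_ne_zero
  have h2 : (i.factorial : ℂ) ≠ 0 := by exact_mod_cast i.factorial_ne_zero
  have h3 : ((j - i).factorial : ℂ) ≠ 0 := by exact_mod_cast (j - i).factorial_ne_zero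
  field_simp

theorem taylorCoeff_sum {α : Type*} (s : Finset α) {f : α → ℂ → ℂ}
    (hf : ∀ a ∈ s, AnalyticAt ℂ (f a) 0) (j : ℕ) :
    taylorCoeff j (fun t => ∑ a ∈ s, f a t) = ∑ a ∈ s, taylorCoeff j (f a) := by
  rw [taylorCoeff, iteratedDeriv_fun_sum fun a ha => (hf a ha).contDiffAt, Finset.sum_div]
  rfl

end TaylorCoefficients

/-! ### Taylor coefficients along curves as polynomials in orbifold jet coordinates. -/

section Representation

variable {n k : ℕ}

/-- The curve `γ` has the orbifold jet coordinates `c` over the point with coordinates `w`. -/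
structure IsCurveOver (p : Fin n → ℕ) (e : Fin n → ℕ → ℕ) (w : Fin n → ℂ)
    (c : Fin n × Fin k → ℂ) (γ : ℂ → Fin n → ℂ) : Prop where
  analyticAt : AnalyticAt ℂ γ 0
  zero : γ 0 = fun i => w i ^ p i
  coeff : ∀ i (j : Fin k), taylorCoeff (j + 1) (fun t => γ t i) = w i ^ e i (j + 1) * c (i, j)

/-- The function `G` of curves and of their orbifold jet coordinates is a polynomial in orbifold jet coordinates. -/
def HasRep {k : ℕ} (p : Fin n → ℕ) (e : Fin n → ℕ → ℕ) (w : Fin n → ℂ)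
    (G : (Fin n → ℂ) → (Fin n × Fin k → ℂ) → (ℂ → Fin n → ℂ) → ℂ) : Prop :=
  ∃ f : (Fin n → ℂ) → MvPolynomial (Fin n × Fin k) ℂ, IsAnalyticPoly f w ∧
    ∀ᶠ w' in 𝓝 w, ∀ c γ, IsCurveOver p e w' c γ → G w' c γ = MvPolynomial.eval c (f w')

variable {p : Fin n → ℕ} {e : Fin n → ℕ → ℕ} {w : Fin n → ℂ}
  {G G' : (Fin n → ℂ) → (Fin n × Fin k → ℂ) → (ℂ → Fin n → ℂ) → ℂ}

theorem HasRep.mul (h : HasRep p e w G) (h' : HasRep p e w G') :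
    HasRep p e w fun w c γ => G w c γ * G' w c γ := by
  obtain ⟨f, hf, h⟩ := h
  obtain ⟨f', hf', h'⟩ := h'
  refine ⟨_, hf.mul hf', ?_⟩
  filter_upwards [h, h'] with w' h1 h2 c γ hγ
  rw [h1 c γ hγ, h2 c γ hγ, map_mul]

theorem HasRep.sum {α : Type*} (s : Finset α) {G : α → (Fin n → ℂ) → (Fin n × Fin k → ℂ) → (ℂ → Fin n → ℂ) → ℂ}
    (h : ∀ a ∈ s, HasRep p e w (G a)) : HasRep p e w fun w c γ => ∑ a ∈ s, G a w c γ := by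
  have h' : ∀ a, ∃ f : (Fin n → ℂ) → MvPolynomial (Fin n × Fin k) ℂ, a ∈ s → IsAnalyticPoly f w ∧
      ∀ᶠ w' in 𝓝 w, ∀ c γ, IsCurveOver p e w' c γ → G a w' c γ = MvPolynomial.eval c (f w') := by
    intro a
    by_cases ha : a ∈ s
    · obtain ⟨f, hf⟩ := h a ha; exact ⟨f, fun _ => hf⟩
    · exact ⟨0, fun h => absurd h ha⟩
  choose f hf using h'
  refine ⟨_, IsAnalyticPoly.sum s fun a ha => (hf a ha).1, ?_⟩
  filter_upwards [(Filter.eventually_all_finset s).2 fun a ha => (hf a ha).2] with w' h1 c γ hγ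
  rw [map_sum]
  exact Finset.sum_congr rfl fun a ha => h1 a ha c γ hγ

theorem HasRep.base {a : (Fin n → ℂ) → ℂ} (ha : AnalyticAt ℂ a w) :
    HasRep p e w fun w (_ : Fin n × Fin k → ℂ) _ => a w :=
  ⟨_, IsAnalyticPoly.C ha, .of_forall fun _ _ _ _ => by simp⟩

theorem HasRep.congr (h : HasRep p e w G)
    (hG : ∀ᶠ w' in 𝓝 w, ∀ (c : Fin n × Fin k → ℂ) γ, IsCurveOver p e w' c γ → G' w' c γ = G w' c γ) :
    HasRep p e w G' := by
  obtain ⟨f, hf, h⟩ := h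
  refine ⟨f, hf, ?_⟩
  filter_upwards [h, hG] with w' h1 h2 c γ hγ
  rw [h2 c γ hγ, h1 c γ hγ]

theorem HasRep.coord (i : Fin n) (j : Fin k) :
    HasRep p e w fun _ (_ : Fin n × Fin k → ℂ) γ => taylorCoeff (j + 1) (fun t => γ t i) := by
  refine ⟨_, (IsAnalyticPoly.C ((analyticAt_coord i w).fun_pow (e i (j + 1)))).mul
    (IsAnalyticPoly.X (i, j) w), .of_forall fun w' c γ hγ => ?_⟩
  have h1 := hγ.coeff i j
  simp only [h1, map_mul, MvPolynomial.eval_C, MvPolynomial.eval_X]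

theorem HasRep.var (x : Fin n × Fin k) : HasRep p e w fun _ c _ => c x :=
  ⟨_, IsAnalyticPoly.X x w, .of_forall fun _ _ _ _ => by simp⟩

theorem analyticAt_powers (p : Fin n → ℕ) (w : Fin n → ℂ) :
    AnalyticAt ℂ (fun w : Fin n → ℂ => fun i => w i ^ p i) w :=
  analyticAt_pi_of fun i => (analyticAt_coord i w).fun_pow (p i)

/-- Functions analytic near `w ^ p` are analytic at the origin of the curves over points near `w`. -/
theorem eventually_analyticAt_curve {h : (Fin n → ℂ) → ℂ} (hh : AnalyticAt ℂ h fun i => w i ^ p i) :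
    ∀ᶠ w' in 𝓝 w, ∀ (c : Fin n × Fin k → ℂ) γ, IsCurveOver p e w' c γ →
      AnalyticAt ℂ h (γ 0) ∧ AnalyticAt ℂ (fun t => h (γ t)) 0 := by
  filter_upwards [(analyticAt_powers p w).continuousAt.eventually hh.eventually_analyticAt]
    with w' h1 c γ hγ
  have h2 : AnalyticAt ℂ h (γ 0) := by rw [hγ.zero]; exact h1
  exact ⟨h2, h2.fun_comp hγ.analyticAt⟩

theorem deriv_comp_curve {h : (Fin n → ℂ) → ℂ} {γ : ℂ → Fin n → ℂ} (hγ : AnalyticAt ℂ γ 0)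
    (hh : AnalyticAt ℂ h (γ 0)) : deriv (fun t => h (γ t)) =ᶠ[𝓝 0]
      fun t => ∑ i, fderiv ℂ h (γ t) (Pi.single i 1) * deriv (fun t => γ t i) t := by
  filter_upwards [hγ.eventually_analyticAt, hγ.continuousAt.eventually hh.eventually_analyticAt]
    with t h1 h2
  have h3 := (h2.differentiableAt.hasFDerivAt.comp_hasDerivAt t h1.differentiableAt.hasDerivAt).deriv
  have h4 : deriv (fun t => h (γ t)) t = fderiv ℂ h (γ t) (deriv γ t) := h3
  rw [h4, apply_eq_sum_single]
  refine Finset.sum_congr rfl fun i _ => ?_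
  rw [smul_eq_mul, mul_comm, ((hasDerivAt_pi.1 h1.differentiableAt.hasDerivAt) i).deriv]

/-- The Taylor coefficients of holomorphic functions along curves are polynomials in orbifold jet
coordinates. -/
theorem hasRep_taylorCoeff (j : ℕ) : ∀ (h : (Fin n → ℂ) → ℂ), j ≤ k →
    (AnalyticAt ℂ h fun i => w i ^ p i) →
    HasRep p e w fun _ (_ : Fin n × Fin k → ℂ) γ => taylorCoeff j (fun t => h (γ t)) := by
  induction j using Nat.strong_induction_on with
  | _ j ih =>
    intro h hj hh
    rcases j with _ | j
    · refine (HasRep.base (k := k) (p := p) (e := e)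
        (hh.fun_comp (analyticAt_powers p w))).congr (.of_forall fun w' c γ hγ => ?_)
      rw [taylorCoeff_zero, hγ.zero]
    -- `(j + 1)` times the coefficient of order `j + 1` is the `j`-th coefficient of the derivative.
    -- The chain rule and the product formula express it by coefficients of order at most `j` of the
    -- partial derivatives of `h`, and by those of the curve.
    · have hd : ∀ i : Fin n, AnalyticAt ℂ (fun z => fderiv ℂ h z (Pi.single i 1))
          fun i => w i ^ p i := fun i => analyticAt_fderiv_apply hh _
      have h1 : HasRep p e w fun _ (_ : Fin n × Fin k → ℂ) γ => (((j : ℂ) + 1)⁻¹) * ∑ i,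
          ∑ x ∈ Finset.HasAntidiagonal.antidiagonal j,
            taylorCoeff x.1 (fun t => fderiv ℂ h (γ t) (Pi.single i 1)) *
              (((x.2 : ℂ) + 1) * taylorCoeff (x.2 + 1) (fun t => γ t i)) := by
        refine (HasRep.base analyticAt_const).mul (HasRep.sum _ fun i _ => HasRep.sum _ fun x hx => ?_)
        have hx' := Finset.HasAntidiagonal.mem_antidiagonal.1 hx
        refine (ih x.1 (by omega) _ (by omega) (hd i)).mul
          ((HasRep.base analyticAt_const).mul ?_)
        exact HasRep.coord i ⟨x.2, by omega⟩
      refine h1.congr ?_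
      filter_upwards [eventually_analyticAt_curve (k := k) (e := e) hh,
        Filter.eventually_all.2 fun i => eventually_analyticAt_curve (k := k) (e := e) (hd i)]
        with w' h2 h3 c γ hγ
      have hj0 : (j : ℂ) + 1 ≠ 0 := by exact_mod_cast j.succ_ne_zero
      rw [eq_inv_mul_iff_mul_eq₀ hj0, taylorCoeff_succ,
        taylorCoeff_congr (deriv_comp_curve hγ.analyticAt (h2 c γ hγ).1)]
      have hγi : ∀ i, AnalyticAt ℂ (fun t => γ t i) 0 := fun i =>
        (analyticAt_coord i _).fun_comp hγ.analyticAt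
      rw [taylorCoeff_sum _ fun i _ => (h3 i c γ hγ).2.fun_mul (hγi i).deriv]
      refine Finset.sum_congr rfl fun i _ => ?_
      rw [taylorCoeff_mul (h3 i c γ hγ).2 (hγi i).deriv]
      refine Finset.sum_congr rfl fun x _ => ?_
      rw [taylorCoeff_succ]

/-- The Taylor coefficients of `h` along curves are divisible by powers of `v`, as if `h` had
`s` times the weight of a function whose `j`-th coefficient is divisible by `v ^ (q (1 - j b))`. -/
def HasWeight (k : ℕ) (p : Fin n → ℕ) (e : Fin n → ℕ → ℕ) (w : Fin n → ℂ) (v : (Fin n → ℂ) → ℂ)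
    (q b s : ℕ) (h : (Fin n → ℂ) → ℂ) : Prop :=
  ∀ j ≤ k, ∃ G, HasRep p e w G ∧ ∀ᶠ w' in 𝓝 w, ∀ (c : Fin n × Fin k → ℂ) γ,
    IsCurveOver p e w' c γ →
      taylorCoeff j (fun t => h (γ t)) = v w' ^ (q * (s - j * b)) * G w' c γ

variable {v : (Fin n → ℂ) → ℂ} {q b s s' : ℕ} {h h' : (Fin n → ℂ) → ℂ}

theorem HasWeight.of_analyticAt (hh : AnalyticAt ℂ h fun i => w i ^ p i) :
    HasWeight k p e w v q b 0 h := fun j hj =>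
  ⟨_, hasRep_taylorCoeff j h hj hh, .of_forall fun w' c γ _ => by simp⟩

/-- Truncated subtraction satisfies `(s + s' - j b)⁺ ≤ (s - x b)⁺ + (s' - x' b)⁺` when `x + x' = j`,
so every term of the product formula is sufficiently divisible. -/
theorem HasWeight.mul (hv : AnalyticAt ℂ v w) (hh : AnalyticAt ℂ h fun i => w i ^ p i)
    (hh' : AnalyticAt ℂ h' fun i => w i ^ p i)
    (H : HasWeight k p e w v q b s h) (H' : HasWeight k p e w v q b s' h') :
    HasWeight k p e w v q b (s + s') fun z => h z * h' z := by
  intro j hj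
  have hG : ∀ x : ℕ × ℕ, ∃ G, x ∈ Finset.HasAntidiagonal.antidiagonal j → HasRep p e w G ∧ ∀ᶠ w' in 𝓝 w,
      ∀ (c : Fin n × Fin k → ℂ) γ, IsCurveOver p e w' c γ →
      taylorCoeff x.1 (fun t => h (γ t)) * taylorCoeff x.2 (fun t => h' (γ t)) =
        v w' ^ (q * (s + s' - j * b)) * G w' c γ := by
    intro x
    by_cases hx : x ∈ Finset.HasAntidiagonal.antidiagonal j
    · have hx' := Finset.HasAntidiagonal.mem_antidiagonal.1 hx
      obtain ⟨G, hG, h1⟩ := H x.1 (by omega)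
      obtain ⟨G', hG', h2⟩ := H' x.2 (by omega)
      have hle : q * (s + s' - j * b) ≤ q * (s - x.1 * b) + q * (s' - x.2 * b) := by
        rw [← mul_add]
        refine Nat.mul_le_mul_left _ ?_
        have : j * b = x.1 * b + x.2 * b := by rw [← hx', add_mul]
        omega
      refine ⟨_, fun _ => ⟨(HasRep.base (hv.fun_pow (q * (s - x.1 * b) + q * (s' - x.2 * b) -
        q * (s + s' - j * b)))).mul (hG.mul hG'), ?_⟩⟩
      filter_upwards [h1, h2] with w' h3 h4 c γ hγ
      rw [h3 c γ hγ, h4 c γ hγ, ← mul_assoc (v w' ^ (q * (s + s' - j * b))), ← pow_add,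
        Nat.add_sub_cancel' hle, pow_add]
      ring
    · exact ⟨fun _ _ _ => 0, fun h => absurd h hx⟩
  choose G hG using hG
  refine ⟨_, HasRep.sum (Finset.HasAntidiagonal.antidiagonal j) fun x hx => (hG x hx).1, ?_⟩
  filter_upwards [(Filter.eventually_all_finset _).2 fun x hx => (hG x hx).2,
    eventually_analyticAt_curve (k := k) (e := e) hh,
    eventually_analyticAt_curve (k := k) (e := e) hh'] with w' h1 h2 h3 c γ hγ
  rw [taylorCoeff_mul (h2 c γ hγ).2 (h3 c γ hγ).2, Finset.mul_sum]
  exact Finset.sum_congr rfl fun x hx => h1 x hx c γ hγ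

theorem HasWeight.pow_mul {ζ u : (Fin n → ℂ) → ℂ} (hv : AnalyticAt ℂ v w)
    (hζ : AnalyticAt ℂ ζ fun i => w i ^ p i) (hu : AnalyticAt ℂ u fun i => w i ^ p i)
    (H : HasWeight k p e w v q b s ζ) (t : ℕ) :
    HasWeight k p e w v q b (t * s) fun z => ζ z ^ t * u z := by
  induction t with
  | zero => simpa using HasWeight.of_analyticAt hu
  | succ t ih =>
    have h1 := H.mul hv hζ ((hζ.fun_pow t).fun_mul hu) ih
    rw [add_comm, ← Nat.succ_mul] at h1
    have h2 : (fun z => ζ z ^ (t + 1) * u z) = fun z => ζ z * (ζ z ^ t * u z) := by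
      ext z; ring
    rw [h2]
    exact h1

/-- Every point has curves with prescribed orbifold jet coordinates. -/
theorem exists_isCurveOver (p : Fin n → ℕ) (e : Fin n → ℕ → ℕ) (w : Fin n → ℂ)
    (c : Fin n × Fin k → ℂ) : ∃ γ, IsCurveOver p e w c γ := by
  set P : Fin n → Polynomial ℂ := fun i => Polynomial.C (w i ^ p i) +
    ∑ j : Fin k, Polynomial.C (w i ^ e i (j + 1) * c (i, j)) * Polynomial.X ^ ((j : ℕ) + 1) with hP
  have hder : ∀ (m : ℕ) (Q : Polynomial ℂ), iteratedDeriv m (fun t => Q.eval t) 0 =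
      m.factorial * Q.coeff m := by
    intro m Q
    have h1 : iteratedDeriv m (fun t => Q.eval t) = fun t => (Polynomial.derivative^[m] Q).eval t := by
      induction m generalizing Q with
      | zero => simp
      | succ m ih =>
        rw [iteratedDeriv_succ', Function.iterate_succ_apply, ← ih]
        congr 1
        ext t
        exact Q.deriv
    rw [h1]
    simp only [← Polynomial.coeff_zero_eq_eval_zero, Polynomial.coeff_iterate_derivative, zero_add,
      Nat.descFactorial_self, nsmul_eq_mul]
  refine ⟨fun t i => (P i).eval t, analyticAt_pi_iff.2 fun i => ?_, ?_, fun i j => ?_⟩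
  · exact AnalyticAt.aeval_polynomial analyticAt_id (P i)
  · ext i
    simp [hP, Polynomial.eval_finsetSum]
  · rw [taylorCoeff, hder, mul_div_cancel_left₀ _ (by exact_mod_cast Nat.factorial_ne_zero _)]
    simp only [hP, Polynomial.coeff_add, Polynomial.coeff_C_succ, zero_add,
      Polynomial.finsetSum_coeff, Polynomial.coeff_C_mul, Polynomial.coeff_X_pow]
    rw [Finset.sum_eq_single j]
    · simp
    · intro j' _ hj'
      rw [if_neg, mul_zero]
      intro h
      exact hj' (Fin.ext (by omega))
    · simp

end Representation

/-! ### Division by powers of a coordinate of the lifted map. -/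

section Division

variable {n k : ℕ} {p : Fin n → ℕ} {e : Fin n → ℕ → ℕ}

theorem nhds_le_map_powers (hp : ∀ i, p i ≠ 0) (w : Fin n → ℂ) :
    𝓝 (fun i => w i ^ p i) ≤ map (fun w : Fin n → ℂ => fun i => w i ^ p i) (𝓝 w) := by
  have h2 : (fun w : Fin n → ℂ => fun i => w i ^ p i) = Pi.map fun i (z : ℂ) => z ^ p i := rfl
  rw [h2, nhds_pi, nhds_pi, Filter.map_piMap_pi_finite]
  exact Filter.pi_mono fun b => nhds_le_map_pow _ (hp b)

/-- Every `c` is realized by a curve, so an identity along curves is an identity of polynomials and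
can be read on coefficients. -/
theorem germDvd_coeff {f : (Fin n → ℂ) → MvPolynomial (Fin n × Fin k) ℂ} {w : Fin n → ℂ}
    {T : (ℂ → Fin n → ℂ) → ℂ} {A : (Fin n → ℂ) → ℂ}
    (hT : ∀ᶠ w' in 𝓝 w, ∀ c γ, IsCurveOver p e w' c γ → T γ = MvPolynomial.eval c (f w'))
    {G : (Fin n → ℂ) → (Fin n × Fin k → ℂ) → (ℂ → Fin n → ℂ) → ℂ} (hG : HasRep p e w G)
    (hTG : ∀ᶠ w' in 𝓝 w, ∀ c γ, IsCurveOver p e w' c γ → T γ = A w' * G w' c γ)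
    (m : Fin n × Fin k →₀ ℕ) : GermDvd A (fun w => (f w).coeff m) w := by
  obtain ⟨g, hg, hGg⟩ := hG
  refine ⟨_, hg.2 m, ?_⟩
  filter_upwards [hT, hTG, hGg] with w' h1 h2 h3
  have h4 : f w' = MvPolynomial.C (A w') * g w' := by
    refine MvPolynomial.funext fun c => ?_
    obtain ⟨γ, hγ⟩ := exists_isCurveOver p e w' c
    rw [← h1 c γ hγ, h2 c γ hγ, h3 c γ hγ]
    simp
  rw [h4, MvPolynomial.coeff_C_mul]

theorem coord_pow_unit_unique {w : Fin n → ℂ} {i : Fin n} (hi : w i = 0) {m m' : ℕ}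
    {u u' : (Fin n → ℂ) → ℂ} (hu : AnalyticAt ℂ u w) (hu0 : u w ≠ 0) (hu' : AnalyticAt ℂ u' w)
    (hu'0 : u' w ≠ 0) (h : ∀ᶠ w' in 𝓝 w, w' i ^ m * u w' = w' i ^ m' * u' w') : m = m' := by
  set d : Fin n → ℂ := Pi.single i 1 with hd
  have hone : lineOrder d (fun w : Fin n → ℂ => w i) w = 1 := lineOrder_coord hi (by simp [hd])
  have key : ∀ (m : ℕ) (g : (Fin n → ℂ) → ℂ), AnalyticAt ℂ g w → g w ≠ 0 →
      lineOrder d (fun w => w i ^ m * g w) w = m := by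
    intro m g hg hg0
    rw [lineOrder_mul d ((analyticAt_coord i w).fun_pow m) hg,
      lineOrder_pow d (analyticAt_coord i w), hone, (lineOrder_eq_zero d hg).2 hg0]
    simp
  have e1 := key m u hu hu0
  rw [lineOrder_congr d h, key m' u' hu' hu'0] at e1
  exact_mod_cast e1.symm

/-- The line in the direction `∂_i` leaves `z_i = 0` at once, so `h` has no other zero on it near
`z`. -/
theorem lineOrder_ne_top_of_zeros {h : (Fin n → ℂ) → ℂ} {z : Fin n → ℂ} {i : Fin n}
    (hi : z i = 0) (hz : ∀ᶠ z' in 𝓝 z, h z' = 0 → z' i = 0) :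
    lineOrder (Pi.single i 1) h z ≠ ⊤ := by
  intro htop
  have h1 := analyticOrderAt_eq_top.1 htop
  have h2 := (tendsto_line z (Pi.single i (1 : ℂ))).eventually hz
  have h3 : ∀ᶠ t : ℂ in 𝓝[≠] 0, False := by
    filter_upwards [h1.filter_mono nhdsWithin_le_nhds, h2.filter_mono nhdsWithin_le_nhds,
      self_mem_nhdsWithin] with t h4 h5 h6
    have := h5 h4
    simp [hi] at this
    exact h6 this
  exact (h3.exists).elim fun _ h => h

/-- This is how orbifold jet coordinates are defined; the case `j = 0` is `z_i = w_i ^ p_i` with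
`p_i = q a`. -/
theorem hasWeight_coord {w : Fin n → ℂ} {i : Fin n} {q a b : ℕ} (hp : p i = q * a)
    (he : ∀ j, e i j = q * (a - j * b)) :
    HasWeight k p e w (fun w => w i) q b a fun z => z i := by
  intro j hj
  rcases j with _ | j
  · refine ⟨_, HasRep.base (analyticAt_const (v := 1)), .of_forall fun w' c γ hγ => ?_⟩
    rw [taylorCoeff_zero, hγ.zero]
    simp [hp]
  · refine ⟨_, HasRep.var (i, ⟨j, by omega⟩), .of_forall fun w' c γ hγ => ?_⟩
    have h1 := hγ.coeff i ⟨j, by omega⟩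
    simp only [he] at h1
    exact h1

/-- Divisibility at a point where `Ψ` is a power of `ζ` up to a unit. -/
theorem germDvd_of_hasWeight {w : Fin n → ℂ} {W v U : (Fin n → ℂ) → ℂ} {N e' j : ℕ}
    {f : (Fin n → ℂ) → MvPolynomial (Fin n × Fin k) ℂ} {Ψ ζ u : (Fin n → ℂ) → ℂ}
    {q a b t : ℕ} (hj : j ≤ k)
    (hf : ∀ᶠ w' in 𝓝 w, ∀ c γ, IsCurveOver p e w' c γ →
      taylorCoeff j (fun t => Ψ (γ t)) = MvPolynomial.eval c (f w'))
    (hv : AnalyticAt ℂ v w) (hU : AnalyticAt ℂ U w) (hU0 : U w ≠ 0)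
    (hW : ∀ᶠ w' in 𝓝 w, W w' = v w' ^ N * U w')
    (hζ : AnalyticAt ℂ ζ fun i => w i ^ p i) (hu : AnalyticAt ℂ u fun i => w i ^ p i)
    (hΨ : ∀ᶠ z in 𝓝 fun i => w i ^ p i, Ψ z = ζ z ^ t * u z)
    (hwt : HasWeight k p e w v q b a ζ) (hle : N * e' ≤ q * (t * a - j * b))
    (m : Fin n × Fin k →₀ ℕ) : GermDvd (fun w => W w ^ e') (fun w => (f w).coeff m) w := by
  -- By the product rule `ζ ^ t u` has weight `t a`; `hle` says that the resulting power of `v`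
  -- contains the required power of `W`.
  obtain ⟨G, hG, h1⟩ := hwt.pow_mul hv hζ hu t j hj
  refine germDvd_coeff hf ((HasRep.base ((hv.fun_pow (q * (t * a - j * b) - N * e')).fun_mul
    ((hU.fun_pow e').fun_inv (pow_ne_zero _ hU0)))).mul hG) ?_ m
  filter_upwards [h1, hW, hU.continuousAt.eventually_ne hU0,
    (analyticAt_powers p w).continuousAt.eventually hΨ.eventually_nhds] with w' h2 h3 h4 h5 c γ hγ
  have h6 : (fun t => Ψ (γ t)) =ᶠ[𝓝 0] fun t' => ζ (γ t') ^ t * u (γ t') := by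
    have h7 : ∀ᶠ z in 𝓝 (γ 0), Ψ z = ζ z ^ t * u z := by rw [hγ.zero]; exact h5
    exact hγ.analyticAt.continuousAt.eventually h7
  rw [taylorCoeff_congr h6, h2 c γ hγ, h3, mul_pow, ← pow_mul]
  have h7 : v w' ^ (q * (t * a - j * b)) = v w' ^ (N * e') *
      v w' ^ (q * (t * a - j * b) - N * e') := by
    rw [← pow_add, Nat.add_sub_cancel' hle]
  have h8 : U w' ^ e' ≠ 0 := pow_ne_zero _ h4
  rw [h7]
  field_simp

theorem injective_fderiv_powers (hp : ∀ i, p i ≠ 0) {w : Fin n → ℂ} (hw : ∀ i, w i ≠ 0) :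
    Function.Injective (fderiv ℂ (fun w : Fin n → ℂ => fun i => w i ^ p i) w) := by
  rw [injective_iff_map_eq_zero]
  intro ξ hξ
  ext i
  have h1 := congrFun hξ i
  rw [fderiv_component (analyticAt_powers p w)] at h1
  have h2 : HasFDerivAt (fun w : Fin n → ℂ => w i)
      (ContinuousLinearMap.proj (R := ℂ) (φ := fun _ : Fin n => ℂ) i) w :=
    (ContinuousLinearMap.proj (R := ℂ) (φ := fun _ : Fin n => ℂ) i).hasFDerivAt
  rw [show fderiv ℂ (fun w : Fin n → ℂ => w i ^ p i) w = _ from (h2.pow (p i)).fderiv] at h1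
  simpa [hp i, hw i] using h1

/-- The orbifold condition implies that the Taylor coefficients of `Ψ` along curves are, up to a
power of `W`, polynomials in orbifold jet coordinates. -/
theorem exists_divided_rep {w₀ : Fin n → ℂ} (hp : ∀ i, p i ≠ 0) {q a b : Fin n → ℕ}
    (hpq : ∀ i, p i = q i * a i) (he : ∀ i j, e i j = q i * (a i - j * b i))
    {Ψ W : (Fin n → ℂ) → ℂ} (hΨ : AnalyticAt ℂ Ψ fun i => w₀ i ^ p i) (hW : AnalyticAt ℂ W w₀)
    {p' e' j : ℕ} (hj : j ≤ k) (hp' : p' ≠ 0)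
    (hWΨ : ∀ᶠ w in 𝓝 w₀, W w ^ p' = Ψ fun i => w i ^ p i) (hW0 : ∃ᶠ w in 𝓝 w₀, W w ≠ 0)
    (hcoord : ∀ᶠ w in 𝓝 w₀, ∀ i, w i = 0 → (∀ i', i' ≠ i → w i' ≠ 0) → ∀ (t N : ℕ) u,
      AnalyticAt ℂ u (fun i => w i ^ p i) → u (fun i => w i ^ p i) ≠ 0 →
      (∀ᶠ z in 𝓝 fun i => w i ^ p i, Ψ z = z i ^ t * u z) → 1 ≤ t → p i * t = N * p' →
      N * e' ≤ q i * (t * a i - j * b i))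
    (hsmooth : ∀ᶠ w in 𝓝 w₀, (∀ i, w i ≠ 0) → ∀ (t N : ℕ) ζ u,
      AnalyticAt ℂ ζ (fun i => w i ^ p i) → ζ (fun i => w i ^ p i) = 0 →
      fderiv ℂ ζ (fun i => w i ^ p i) ≠ 0 →
      AnalyticAt ℂ u (fun i => w i ^ p i) → u (fun i => w i ^ p i) ≠ 0 →
      (∀ᶠ z in 𝓝 fun i => w i ^ p i, Ψ z = ζ z ^ t * u z) → 1 ≤ t → t = N * p' →
      N * e' ≤ t - j) :
    ∃ f : (Fin n → ℂ) → MvPolynomial (Fin n × Fin k) ℂ, IsAnalyticPoly f w₀ ∧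
      ∀ᶠ w in 𝓝 w₀, ∀ c γ, IsCurveOver p e w c γ →
        taylorCoeff j (fun t => Ψ (γ t)) = W w ^ e' * MvPolynomial.eval c (f w) := by
  classical
  obtain ⟨f, hf, hfT⟩ := hasRep_taylorCoeff (k := k) (p := p) (e := e) j Ψ hj hΨ
  have hprod : ∀ w, AnalyticAt ℂ (fun w : Fin n → ℂ => ∏ i, w i) w := fun w => by
    simpa using analyticAt_monomial Finset.univ (fun _ : Fin n => 1) w
  suffices h : ∀ m, GermDvd (fun w => W w ^ e') (fun w => (f w).coeff m) w₀ by
    obtain ⟨g, hg, hge⟩ := hf.exists_div h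
    refine ⟨g, hg, ?_⟩
    filter_upwards [hge, hfT] with w h1 h2 c γ hγ
    rw [h2 c γ hγ, h1, map_mul, MvPolynomial.eval_C]
  intro m
  -- At a nice point of `W ∏ w_i` where `W` vanishes, either a single coordinate vanishes and `W` is
  -- a power of it up to a unit, or no coordinate vanishes and `w ↦ w ^ p` is a local isomorphism.
  refine germDvd_of_nice (Θ := fun w => W w * ∏ i, w i) (hf.2 m) (hW.fun_pow e')
    (hW.fun_mul (hprod w₀)) ?_ ?_ ?_
  · intro hcon
    rcases eventually_eq_zero_or_of_mul hW (hprod w₀) (hcon.mono fun w h => not_not.1 h) with h | h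
    · exact hW0 (h.mono fun w h h' => h' h)
    · obtain ⟨w, ⟨h1, h2⟩, h3⟩ := ((frequently_coord_pattern
        (Finset.univ.filter fun i => w₀ i = 0) (fun a ha => (Finset.mem_filter.1 ha).2)).and_eventually
        h).exists
      refine Finset.prod_ne_zero_iff.2 (fun i _ => ?_) h3
      by_cases hi : w₀ i = 0
      · exact h1 i (by simp [hi])
      · rw [h2 i (by simp [hi])]; exact hi
  · exact .of_forall fun w h => pow_ne_zero _ (left_ne_zero_of_mul h)
  filter_upwards [hf.eventually, hfT.eventually_nhds, hW.eventually_analyticAt,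
    (analyticAt_powers p w₀).continuousAt.eventually hΨ.eventually_analyticAt,
    hWΨ.eventually_nhds, hcoord, hsmooth] with w hf₁ hfT₁ hW₁ hΨ₁ hWΨ₁ hcoord₁ hsmooth₁ τ hnice
  by_cases hWw : W w = 0
  swap
  · exact germDvd_of_ne_zero (hW₁.fun_pow e') (hf₁.2 m) (pow_ne_zero _ hWw)
  obtain ⟨hτ, hτ0, hτ', M, u₀, hu₀, hu₀0, hΘ⟩ := id hnice
  -- `W` divides `Θ`, which is a power of `τ` times a unit, so `W` is of this form too.
  obtain ⟨N, U, hU, hU0, hWU⟩ : ∃ (N : ℕ) (U : (Fin n → ℂ) → ℂ), AnalyticAt ℂ U w ∧ U w ≠ 0 ∧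
      ∀ᶠ w' in 𝓝 w, W w' = τ w' ^ N * U w' := by
    have h1 := exists_monomial_of_mul_eq (κ := Unit) {()} (τ := fun _ => τ) (w := w)
      (fun _ _ => ⟨hτ, hτ0, hτ'⟩) (fun _ => M) hW₁ (hprod w) hu₀ hu₀0 (by simpa using hΘ)
    obtain ⟨N, U, hU, hU0, h2⟩ := h1
    exact ⟨N (), U, hU, hU0, by simpa using h2⟩
  have hN : N ≠ 0 := by
    rintro rfl
    have h1 := hWU.self_of_nhds
    rw [hWw, pow_zero, one_mul] at h1
    exact hU0 h1.symm
  by_cases hex : ∃ i, w i = 0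
  · obtain ⟨i, hi⟩ := hex
    have hzero : ∀ j : Fin n, ∀ᶠ w' in 𝓝 w, w' j = 0 → W w' * ∏ i, w' i = 0 := fun j =>
      .of_forall fun w' h => by rw [Finset.prod_eq_zero (Finset.mem_univ j) h, mul_zero]
    obtain ⟨g, hg, hg0, hτg, huniq⟩ := hnice.coord hi (hzero i)
    have hWx : ∀ᶠ w' in 𝓝 w, W w' = w' i ^ N * (g w' ^ N * U w') := by
      filter_upwards [hWU, hτg] with w' h1 h2
      rw [h1, h2, mul_pow]; ring
    have hUx : AnalyticAt ℂ (fun w => g w ^ N * U w) w := (hg.fun_pow N).fun_mul hU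
    have hUx0 : g w ^ N * U w ≠ 0 := mul_ne_zero (pow_ne_zero _ hg0) hU0
    have hzi : (fun i => w i ^ p i) i = 0 := by simp [hi, hp i]
    -- Since `w ↦ w ^ p` is open, zeros of `Ψ` can be located upstairs, where `Ψ` becomes `W ^ p'`.
    have hzz : ∀ᶠ z in 𝓝 fun i => w i ^ p i, Ψ z = 0 → z i = 0 := by
      refine nhds_le_map_powers hp w (Filter.mem_map.2 ?_)
      filter_upwards [hWΨ₁, hWx, hUx.continuousAt.eventually_ne hUx0] with w' h1 h2 h3 h4
      rw [h4] at h1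
      have h5 := pow_eq_zero_iff hp' |>.1 h1
      rw [h2] at h5
      have h6 := pow_eq_zero_iff hN |>.1 ((mul_eq_zero.1 h5).resolve_right h3)
      simp [h6, hp i]
    obtain ⟨t, ht⟩ := ENat.ne_top_iff_exists.1 (lineOrder_ne_top_of_zeros hzi hzz)
    obtain ⟨u, hu, hu0, hΨu⟩ := exists_eq_pow_mul_unit hΨ₁ (analyticAt_coord i _) hzi
      (d := Pi.single i 1) (by rw [fderiv_coord]; simp) hzz ht.symm
    -- Both sides are the order of `Ψ ∘ π = W ^ p'` along `w_i = 0`.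
    have hexp : p i * t = N * p' := by
      refine coord_pow_unit_unique hi (hu.fun_comp (analyticAt_powers p w)) hu0
        (hUx.fun_pow p') (pow_ne_zero p' hUx0) ?_
      filter_upwards [(analyticAt_powers p w).continuousAt.eventually hΨu, hWΨ₁, hWx]
        with w' h1 h2 h3
      rw [h1, h3, mul_pow, ← pow_mul] at h2
      rw [h2, pow_mul]
    have ht1 : 1 ≤ t := by
      rcases Nat.eq_zero_or_pos t with rfl | h
      · rw [mul_zero] at hexp
        exact absurd hexp.symm (mul_ne_zero hN hp')
      · exact h
    exact germDvd_of_hasWeight hj hfT₁ (analyticAt_coord i w) hUx hUx0 hWx (analyticAt_coord i _)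
      hu hΨu (hasWeight_coord (hpq i) (he i))
      (hcoord₁ i hi (fun i' hi' h => hi' (huniq i' h (hzero i'))) t N u hu hu0 hΨu ht1 hexp) m
  · push Not at hex
    have hinj := injective_fderiv_powers hp hex
    set L : (Fin n → ℂ) ≃L[ℂ] (Fin n → ℂ) :=
      (LinearEquiv.ofInjectiveEndo (fderiv ℂ (fun w : Fin n → ℂ => fun i => w i ^ p i) w :
        (Fin n → ℂ) →ₗ[ℂ] _) hinj).toContinuousLinearEquiv
    have hL : fderiv ℂ (fun w : Fin n → ℂ => fun i => w i ^ p i) w = L := by ext; rfl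
    obtain ⟨ε, hε1, hε2, -, hε3, hε4, -⟩ := exists_localInverse (analyticAt_powers p w) L hL univ_mem
    have hzt : (fun i => w i ^ p i) ∈ ε.target := by
      rw [← hε2 w]; exact ε.map_source hε1
    have hsymm : ε.symm (fun i => w i ^ p i) = w := by rw [← hε2 w, ε.left_inv hε1]
    have hsa := hε4 _ hzt
    have hζ : AnalyticAt ℂ (fun z => τ (ε.symm z)) fun i => w i ^ p i :=
      AnalyticAt.fun_comp (g := τ) (f := ε.symm) (by rw [hsymm]; exact hτ) hsa
    have hu : AnalyticAt ℂ (fun z => U (ε.symm z) ^ p') fun i => w i ^ p i :=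
      (AnalyticAt.fun_comp (g := U) (f := ε.symm) (by rw [hsymm]; exact hU) hsa).fun_pow p'
    have hinvt : ∀ᶠ z in 𝓝 fun i => w i ^ p i, (fun i => ε.symm z i ^ p i) = z := by
      filter_upwards [ε.open_target.mem_nhds hzt] with z hz
      have h1 := hε2 (ε.symm z)
      rw [ε.right_inv hz] at h1
      exact h1.symm
    have htend : Tendsto ε.symm (𝓝 fun i => w i ^ p i) (𝓝 w) := by
      have := ε.continuousAt_symm hzt
      rwa [ContinuousAt, hsymm] at this
    have hΨu : ∀ᶠ z in 𝓝 fun i => w i ^ p i,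
        Ψ z = τ (ε.symm z) ^ (N * p') * U (ε.symm z) ^ p' := by
      filter_upwards [hinvt, htend.eventually hWΨ₁, htend.eventually hWU] with z h1 h2 h3
      rw [h1, h3, mul_pow, ← pow_mul] at h2
      exact h2.symm
    have hζ' : fderiv ℂ (fun z => τ (ε.symm z)) (fun i => w i ^ p i) ≠ 0 := by
      intro h0
      obtain ⟨ξ, hξ⟩ := exists_fderiv_apply_ne_zero hτ'
      have h1 : (fun w' : Fin n → ℂ => (fun z => τ (ε.symm z)) fun i => w' i ^ p i) =ᶠ[𝓝 w] τ := by
        filter_upwards [ε.open_source.mem_nhds hε1] with w' hw'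
        show τ (ε.symm fun i => w' i ^ p i) = τ w'
        rw [← hε2 w', ε.left_inv hw']
      have h2 := fderiv_comp_apply (g := fun z => τ (ε.symm z)) hζ (analyticAt_powers p w) ξ
      rw [h1.fderiv_eq, h0] at h2
      exact hξ (by simpa using h2)
    -- Multiplicity one: the value of the equation carries one factor `τ`, and the coefficients of
    -- positive order carry none.
    have hwt : HasWeight k p e w τ 1 1 1 fun z => τ (ε.symm z) := by
      intro j' hj'
      rcases j' with _ | j'
      · refine ⟨_, HasRep.base (analyticAt_const (v := 1)), ?_⟩
        filter_upwards [ε.open_source.mem_nhds hε1] with w' hw' c γ hγ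
        rw [taylorCoeff_zero, hγ.zero, ← hε2 w', ε.left_inv hw']
        simp
      · refine ⟨_, hasRep_taylorCoeff (j' + 1) _ hj' hζ, .of_forall fun w' c γ hγ => ?_⟩
        have : 1 * (1 - (j' + 1) * 1) = 0 := by omega
        rw [this, pow_zero, one_mul]
    refine germDvd_of_hasWeight (t := N * p') hj hfT₁ hτ hU hU0 hWU hζ hu hΨu hwt ?_ m
    have h1 := hsmooth₁ hex (N * p') N _ _ hζ (by rw [hsymm]; exact hτ0) hζ' hu
      (by rw [hsymm]; exact pow_ne_zero _ hU0) hΨu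
      (Nat.one_le_iff_ne_zero.2 (mul_ne_zero hN hp')) rfl
    omega

end Division

/-! ### Arithmetic of orbifold multiplicities. -/

section Weights

/-- Denominators are cleared in `m' ≤ t m`, infinite multiplicities included: `b = 0` is trivial,
and `b' = 0` with `b ≠ 0` is excluded since the right side would be finite. -/
theorem mul_le_of_div_le {a b a' b' t : ℕ} (ha' : a' ≠ 0)
    (h : (a' : ℝ≥0∞) / (b' : ℝ≥0∞) ≤ (t : ℝ≥0∞) * ((a : ℝ≥0∞) / (b : ℝ≥0∞))) :
    a' * b ≤ t * a * b' := by
  rcases Nat.eq_zero_or_pos b with rfl | hb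
  · simp
  have hb0 : (b : ℝ≥0∞) ≠ 0 := by exact_mod_cast hb.ne'
  have hbt : (b : ℝ≥0∞) ≠ ⊤ := ENNReal.natCast_ne_top b
  have hfin : (t : ℝ≥0∞) * ((a : ℝ≥0∞) / (b : ℝ≥0∞)) ≠ ⊤ :=
    ENNReal.mul_ne_top (ENNReal.natCast_ne_top t) (ENNReal.div_ne_top (ENNReal.natCast_ne_top a) hb0)
  have hb'0 : (b' : ℝ≥0∞) ≠ 0 := by
    intro h0
    rw [h0, ENNReal.div_zero (by exact_mod_cast ha')] at h
    exact hfin (top_le_iff.1 h)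
  rw [ENNReal.div_le_iff hb'0 (ENNReal.natCast_ne_top b')] at h
  have h1 : (a' : ℝ≥0∞) * b ≤ t * a * b' := by
    calc (a' : ℝ≥0∞) * b ≤ (t * (a / b) * b') * b := by gcongr
      _ = t * b' * (a / b * b) := by ring
      _ = t * a * b' := by rw [ENNReal.div_mul_cancel hb0 hbt]; ring
  exact_mod_cast h1

/-- With `p = q a`, `p' = q' a'` and `p t = N p'`, the orbifold inequality becomes `q b ≤ N q' b'`.
Multiplying it by `j` and subtracting from the common value `p t` compares the exponents, truncation
included. -/
theorem weight_le {a b a' b' t q q' N j : ℕ} (ha' : a' ≠ 0) (h : a' * b ≤ t * a * b')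
    (hN : q * a * t = N * (q' * a')) : N * (q' * (a' - j * b')) ≤ q * (t * a - j * b) := by
  have h1 : q * b ≤ N * q' * b' := by
    refine Nat.le_of_mul_le_mul_right ?_ (Nat.pos_of_ne_zero ha')
    calc q * b * a' = q * (a' * b) := by ring
      _ ≤ q * (t * a * b') := Nat.mul_le_mul_left _ h
      _ = (q * a * t) * b' := by ring
      _ = N * q' * b' * a' := by rw [hN]; ring
  have h2 : j * (q * b) ≤ j * (N * q' * b') := Nat.mul_le_mul_left _ h1
  have e1 : N * (q' * (a' - j * b')) = N * (q' * a') - j * (N * q' * b') := by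
    rw [Nat.mul_sub, Nat.mul_sub]
    congr 1
    ring
  have e2 : q * (t * a - j * b) = q * a * t - j * (q * b) := by
    rw [Nat.mul_sub]
    congr 1 <;> ring
  rw [e1, e2, hN]
  omega

end Weights

/-! ### Jets in adapted charts. -/

section JetCoordinates

variable {n k : ℕ} {X Y : Type*} [TopologicalSpace X] [TopologicalSpace Y]
  [ChartedSpace (Fin n → ℂ) X] [ChartedSpace (Fin n → ℂ) Y] {ι : Type*}
  {P : OrbifoldPair n X ι} {π : Y → X}

theorem OrbifoldPair.numer_pos (P : OrbifoldPair n X ι) (o : Option ι) : P.numer o ≠ 0 := by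
  rcases o with _ | l
  · simp [OrbifoldPair.numer]
  · have := P.b_lt_a l
    simp only [OrbifoldPair.numer]
    omega

theorem Jet.coord_mk {γ : {γ : ℂ → X // CurveHolAt n γ 0}} {h : X → ℂ} (hh : HolAt n h (γ.1 0))
    {j : ℕ} (hj : j ≤ k) : Jet.coord (k := k) j h (Quotient.mk (jetSetoid n k X) γ) =
      taylorCoeff j (fun t => h (γ.1 t)) := by
  classical
  have h1 : HolAt n h (γ.1 0) ∧ j ≤ k := ⟨hh, hj⟩
  exact if_pos h1

theorem Jet.map_mk {n' : ℕ} {X' : Type*} [TopologicalSpace X'] [ChartedSpace (Fin n' → ℂ) X']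
    {φ : X → X'} (hφ : Hol n n' φ) (γ : {γ : ℂ → X // CurveHolAt n γ 0}) :
    Jet.map (k := k) φ hφ (Quotient.mk (jetSetoid n k X) γ) =
      Quotient.mk (jetSetoid n' k X') ⟨φ ∘ γ.1, (hφ (γ.1 0)).comp (0 : ℂ) γ.2⟩ := rfl

theorem Jet.base_map {n' : ℕ} {X' : Type*} [TopologicalSpace X'] [ChartedSpace (Fin n' → ℂ) X']
    {φ : X → X'} (hφ : Hol n n' φ) (ξ : Jet n k X) : (Jet.map φ hφ ξ).base = φ ξ.base := by
  obtain ⟨γ, rfl⟩ := Quotient.exists_rep ξ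
  rfl

/-- The jet `ξ` at `π y` has the orbifold jet coordinates `c` in the adapted chart `C`. -/
def AdaptedChart.HasCoords (C : AdaptedChart P π) (y : Y) (ξ : Jet n k X)
    (c : Fin n × Fin k → ℂ) : Prop :=
  ξ.base = π y ∧ ∀ i (j : Fin k), Jet.coord (j + 1) (fun x => C.z x i) ξ =
    C.w y i ^ C.poleOrder i (j + 1) * c (i, j)

theorem AdaptedChart.HasCoords.exists_curve {C : AdaptedChart P π} {y : Y} (hy : y ∈ C.w.source)
    {ξ : Jet n k X} {c : Fin n × Fin k → ℂ} (h : C.HasCoords y ξ c) :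
    ∃ γ : {γ : ℂ → X // CurveHolAt n γ 0}, ξ = Quotient.mk (jetSetoid n k X) γ ∧ γ.1 0 = π y ∧
      IsCurveOver C.p C.poleOrder (C.w y) c fun t => C.z (γ.1 t) := by
  obtain ⟨γ, rfl⟩ := Quotient.exists_rep ξ
  have h0 : γ.1 0 = π y := h.1
  have hs : γ.1 0 ∈ C.z.source := by rw [h0]; exact C.mapsTo hy
  refine ⟨γ, rfl, h0, contMDiffAt_vectorSpace_iff.1
    (ContMDiffAt.comp (0 : ℂ) (contMDiffAt_chart C.z_nc.mem hs) γ.2), ?_, fun i j => ?_⟩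
  · ext i
    rw [h0, C.power y hy]
  · rw [← h.2 i j, Jet.coord_mk (holAt_coord C.z_nc.mem hs i) j.2]

theorem AdaptedChart.exists_hasCoords (C : AdaptedChart P π) {y : Y} (hy : y ∈ C.w.source)
    (c : Fin n × Fin k → ℂ) : ∃ ξ : Jet n k X, C.HasCoords y ξ c := by
  obtain ⟨γ, hγ⟩ := exists_isCurveOver C.p C.poleOrder (C.w y) c
  have h0 : γ 0 = C.z (π y) := by
    rw [hγ.zero]; ext i; rw [C.power y hy]
  have ht : γ 0 ∈ C.z.target := by rw [h0]; exact C.z.map_source (C.mapsTo hy)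
  have h1 : C.z.symm (γ 0) = π y := by rw [h0, C.z.left_inv (C.mapsTo hy)]
  have hhol : CurveHolAt n (fun t => C.z.symm (γ t)) 0 :=
    ContMDiffAt.comp (0 : ℂ) (contMDiffAt_chart_symm C.z_nc.mem ht)
      (contMDiffAt_vectorSpace_iff.2 hγ.analyticAt)
  refine ⟨Quotient.mk (jetSetoid n k X) ⟨_, hhol⟩, h1, fun i j => ?_⟩
  rw [Jet.coord_mk (holAt_coord C.z_nc.mem (by
    show C.z.symm (γ 0) ∈ _; exact C.z.map_target ht) i) j.2, ← hγ.coeff i j]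
  refine taylorCoeff_congr ?_ _
  filter_upwards [hγ.analyticAt.continuousAt.eventually (C.z.open_target.mem_nhds ht)] with t h2
  show C.z (C.z.symm (γ t)) i = _
  rw [C.z.right_inv h2]

theorem AdaptedChart.mem_comp_iff (C : AdaptedChart P π) {y : Y} (hy : y ∈ C.w.source) (l : ι) :
    π y ∈ P.comp l ↔ ∃ i, C.lab i = some l ∧ C.w y i = 0 := by
  have h1 : π y ∈ P.comp l ↔ π y ∈ P.comp l ∩ C.z.source := by simp [C.mapsTo hy]
  rw [h1, C.z_nc.eq l]
  simp only [mem_ofPred_eq, C.mapsTo hy, true_and, C.power y hy]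
  simp [(C.p_pos _).ne']

theorem AdaptedChart.mem_support_iff (C : AdaptedChart P π) {y : Y} (hy : y ∈ C.w.source) :
    π y ∈ P.support ↔ ∃ i, C.lab i ≠ none ∧ C.w y i = 0 := by
  simp only [OrbifoldPair.support, mem_iUnion, C.mem_comp_iff hy]
  constructor
  · rintro ⟨l, i, h1, h2⟩; exact ⟨i, by simp [h1], h2⟩
  · rintro ⟨i, h1, h2⟩
    obtain ⟨l, hl⟩ := Option.ne_none_iff_exists'.1 h1
    exact ⟨l, i, hl, h2⟩

/-- Here `a = b = 1`, so `(1 - j)⁺ = 0` from `j = 1` on: there are no poles along hypersurfaces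
outside `Δ`. -/
theorem AdaptedChart.poleOrder_of_none (C : AdaptedChart P π) {i : Fin n} (h : C.lab i = none)
    {j : ℕ} (hj : 1 ≤ j) : C.poleOrder i j = 0 := by
  simp only [AdaptedChart.poleOrder, h, OrbifoldPair.numer, OrbifoldPair.denom]
  have : 1 - j * 1 = 0 := by omega
  rw [this, mul_zero]

theorem AdaptedChart.p_eq (C : AdaptedChart P π) (i : Fin n) :
    C.p i = C.p i / P.numer (C.lab i) * P.numer (C.lab i) :=
  (Nat.div_mul_cancel (C.dvd_p i)).symm

end JetCoordinates

/-! ### The differential in adapted coordinates. -/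

section Differential

variable {n n' k : ℕ} {X Y X' Y' ι ι' : Type*} [TopologicalSpace X] [TopologicalSpace Y]
  [ChartedSpace (Fin n → ℂ) X] [ChartedSpace (Fin n → ℂ) Y] [TopologicalSpace X']
  [TopologicalSpace Y'] [ChartedSpace (Fin n' → ℂ) X'] [ChartedSpace (Fin n' → ℂ) Y']
  {P : OrbifoldPair n X ι} {P' : OrbifoldPair n' X' ι'} {π : Y → X} {π' : Y' → X'}
  {φ : X → X'} {φt : Y → Y'}

/-- Coordinates in which a given smooth hypersurface outside of `Δ` is a coordinate hyperplane. -/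
theorem AdaptedChart.exists_smooth_chart [IsManifold 𝓘(ℂ, Fin n → ℂ) ω X]
    (C : AdaptedChart P π) {x : X} (hx : x ∈ C.z.source) (hne : ∀ i, C.z x i ≠ 0)
    {ζ : (Fin n → ℂ) → ℂ} (hζ : AnalyticAt ℂ ζ (C.z x)) (hζ' : fderiv ℂ ζ (C.z x) ≠ 0) :
    ∃ (z : OpenPartialHomeomorph X (Fin n → ℂ)) (i : Fin n), x ∈ z.source ∧
      IsNCChart n P.comp z (fun _ => none) ∧ ∀ x', z x' i = ζ (C.z x') := by
  classical
  obtain ⟨i, hi⟩ : ∃ i, fderiv ℂ ζ (C.z x) (Pi.single i 1) ≠ 0 := by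
    by_contra hcon
    push Not at hcon
    refine hζ' ?_
    ext ξ
    rw [apply_eq_sum_single]
    simp [hcon]
  -- The coordinate along which `ζ` has nonzero derivative is replaced by `ζ`.
  set G : (Fin n → ℂ) → Fin n → ℂ := fun z => Function.update z i (ζ z) with hG
  have hGi : (fun z => G z i) = ζ := by ext; simp [hG]
  have hGj : ∀ j, j ≠ i → (fun z => G z j) = fun z => z j := fun j hj => by ext; simp [hG, hj]
  have hGa : AnalyticAt ℂ G (C.z x) := by
    refine analyticAt_pi_of fun j => ?_
    by_cases hj : j = i
    · rw [hj, hGi]; exact hζ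
    · rw [hGj j hj]; exact analyticAt_coord j _
  have hG' : Function.Injective (fderiv ℂ G (C.z x)) := by
    rw [injective_iff_map_eq_zero]
    intro ξ hξ
    have h1 : ∀ j, j ≠ i → ξ j = 0 := by
      intro j hj
      have h2 := congrFun hξ j
      rw [fderiv_component hGa, hGj j hj, fderiv_coord] at h2
      simpa using h2
    have h2 := congrFun hξ i
    rw [fderiv_component hGa, hGi, apply_eq_sum_single, Finset.sum_eq_single i
      (fun j _ hj => by rw [h1 j hj, zero_smul]) (by simp)] at h2
    ext j
    by_cases hj : j = i
    · subst hj
      exact (smul_eq_zero.1 h2).resolve_right hi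
    · exact h1 j hj
  -- The new chart stays off the coordinate hyperplanes of `C.z`, hence off `Δ`, so no label is
  -- needed.
  have hU : {x' | ∀ j, C.z x' j ≠ 0} ∈ 𝓝 x := by
    refine Filter.eventually_all.2 fun j => ?_
    have h2 : ContinuousAt (fun x' => C.z x' j) x :=
      (continuous_apply j).continuousAt.comp (C.z.continuousAt hx)
    exact h2.eventually_ne (hne j)
  obtain ⟨z, hz, hxz, hzs, hze⟩ := exists_chart_of_injective_fderiv C.z_nc.mem hx hGa hG' hU
  refine ⟨z, i, hxz, ⟨hz, fun c => ?_⟩, fun x' => by rw [hze]; simp [hG]⟩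
  ext x'
  constructor
  · rintro ⟨h1, h2⟩
    have h3 : x' ∈ P.comp c ∩ C.z.source := ⟨h1, (hzs h2).1⟩
    rw [C.z_nc.eq c] at h3
    obtain ⟨-, j, -, h4⟩ := h3
    exact absurd h4 ((hzs h2).2 j)
  · rintro ⟨-, j, h1, -⟩
    simp at h1

/-- In adapted coordinates the differential of an orbifold morphism is given by polynomials in the
orbifold jet coordinates. -/
theorem exists_differential_rep [IsManifold 𝓘(ℂ, Fin n → ℂ) ω X]
    (hφ : IsOrbifoldMorphism P P' φ) (hφt : Hol n n' φt)
    (hcomm : ∀ y, π' (φt y) = φ (π y)) (hns : ∀ y, ∃ᶠ y' in 𝓝 y, φ (π y') ∉ P'.support)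
    (C : AdaptedChart P π) {y : Y} (hy : y ∈ C.w.source) (C' : AdaptedChart P' π')
    (hy' : φt y ∈ C'.w.source) (x' : Fin n' × Fin k) :
    ∃ f : (Fin n → ℂ) → MvPolynomial (Fin n × Fin k) ℂ, IsAnalyticPoly f (C.w y) ∧
      ∀ᶠ y' in 𝓝 y, ∀ (ξ : Jet n k X) c, C.HasCoords y' ξ c →
        Jet.coord (x'.2 + 1) (fun x => C'.z x x'.1) (Jet.map φ hφ.hol ξ) =
          C'.w (φt y') x'.1 ^ C'.poleOrder x'.1 (x'.2 + 1) * MvPolynomial.eval c (f (C.w y')) := by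
  classical
  obtain ⟨i', j⟩ := x'
  set Ψ : (Fin n → ℂ) → ℂ := fun z => C'.z (φ (C.z.symm z)) i' with hΨdef
  set W : (Fin n → ℂ) → ℂ := fun w => C'.w (φt (C.w.symm w)) i' with hWdef
  have hyt := C.w.map_source hy
  have hsy : C.w.symm (C.w y) = y := C.w.left_inv hy
  have hpow : ∀ {y₁}, y₁ ∈ C.w.source → (fun i => C.w y₁ i ^ C.p i) = C.z (π y₁) := fun h => by
    ext i; rw [C.power _ h]
  have hmem : ∀ᶠ y₁ in 𝓝 y, y₁ ∈ C.w.source ∧ φt y₁ ∈ C'.w.source :=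
    Filter.Eventually.and (C.w.open_source.mem_nhds hy)
      (hφt.continuous.continuousAt.eventually (C'.w.open_source.mem_nhds hy'))
  have hmemφ : ∀ {y₁}, φt y₁ ∈ C'.w.source → φ (π y₁) ∈ C'.z.source := fun h => by
    rw [← hcomm]; exact C'.mapsTo h
  have hY : ∀ {q : Y → Prop}, (∀ᶠ y' in 𝓝 y, q y') → ∀ᶠ w in 𝓝 (C.w y), q (C.w.symm w) := by
    intro q h
    exact (C.w.continuousAt_symm hyt).eventually (by rwa [hsy])
  have hwt : ∀ᶠ w in 𝓝 (C.w y), w ∈ C.w.target := C.w.open_target.mem_nhds hyt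
  have hΨat : ∀ {y₁}, y₁ ∈ C.w.source → φt y₁ ∈ C'.w.source →
      AnalyticAt ℂ Ψ fun i => C.w y₁ i ^ C.p i := by
    intro y₁ h1 h2
    rw [hpow h1]
    refine (analyticAt_coord i' _).fun_comp (hφ.hol.analyticAt_charts C.z_nc.mem C'.z_nc.mem
      (C.z.map_source (C.mapsTo h1)) ?_)
    rw [C.z.left_inv (C.mapsTo h1)]
    exact hmemφ h2
  have hW : AnalyticAt ℂ W (C.w y) :=
    (analyticAt_coord i' _).fun_comp (hφt.analyticAt_charts C.w_mem C'.w_mem hyt (by rwa [hsy]))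
  -- from curves to jets
  have htransfer : ∀ (e' : ℕ) (f : (Fin n → ℂ) → MvPolynomial (Fin n × Fin k) ℂ),
      (∀ᶠ w in 𝓝 (C.w y), ∀ c γ, IsCurveOver C.p C.poleOrder w c γ →
        taylorCoeff (j + 1) (fun t => Ψ (γ t)) = W w ^ e' * MvPolynomial.eval c (f w)) →
      ∀ᶠ y' in 𝓝 y, ∀ (ξ : Jet n k X) c, C.HasCoords y' ξ c →
        Jet.coord (j + 1) (fun x => C'.z x i') (Jet.map φ hφ.hol ξ) =
          C'.w (φt y') i' ^ e' * MvPolynomial.eval c (f (C.w y')) := by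
    intro e' f hf
    filter_upwards [hmem, (C.w.continuousAt hy).eventually hf] with y₁ ⟨h1, h1'⟩ h2 ξ c hξ
    obtain ⟨γ, rfl, h0, hγ⟩ := hξ.exists_curve h1
    have h3 := h2 c _ hγ
    simp only [hWdef, C.w.left_inv h1] at h3
    rw [← h3, Jet.map_mk, Jet.coord_mk (holAt_coord C'.z_nc.mem (by
      show φ (γ.1 0) ∈ _; rw [h0]; exact hmemφ h1') i') j.2]
    refine taylorCoeff_congr ?_ _
    have h4 : ∀ᶠ t in 𝓝 0, γ.1 t ∈ C.z.source :=
      γ.2.continuousAt.eventually (C.z.open_source.mem_nhds (by rw [h0]; exact C.mapsTo h1))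
    filter_upwards [h4] with t h5
    simp only [hΨdef, C.z.left_inv h5, Function.comp]
  -- When `z'_i' = 0` is not in `Δ'` the pole order is zero and nothing has to be divided.
  rcases hl : C'.lab i' with _ | l
  · obtain ⟨f, hf, hfT⟩ := hasRep_taylorCoeff (k := k) (p := C.p) (e := C.poleOrder) (j + 1) Ψ j.2
      (hΨat hy hy')
    refine ⟨f, hf, ?_⟩
    simp only [C'.poleOrder_of_none hl (Nat.le_add_left 1 j)]
    refine htransfer 0 f ?_
    filter_upwards [hfT] with w h1 c γ hγ
    rw [h1 c γ hγ, pow_zero, one_mul]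
  have hWΨ : ∀ᶠ w in 𝓝 (C.w y), W w ^ C'.p i' = Ψ fun i => w i ^ C.p i := by
    filter_upwards [hY hmem, hwt] with w ⟨h1, h2⟩ h3
    have h4 := hpow h1
    rw [C.w.right_inv h3] at h4
    simp only [hWdef, hΨdef, h4, C.z.left_inv (C.mapsTo h1)]
    rw [← hcomm, C'.power _ h2]
  -- If `W` vanished near the point, `φ ∘ π` would map an open set into `Δ'`.
  have hW0 : ∃ᶠ w in 𝓝 (C.w y), W w ≠ 0 := by
    intro hcon
    refine hns y ?_
    filter_upwards [(C.w.continuousAt hy).eventually hcon, hmem] with y₁ h1 ⟨h2, h3⟩ h4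
    simp only [not_not, hWdef, C.w.left_inv h2] at h1
    refine h4 ?_
    rw [← hcomm, C'.mem_support_iff h3]
    exact ⟨i', by simp [hl], h1⟩
  -- The orbifold condition, in any coordinates having the hypersurface as a coordinate hyperplane:
  -- either `C.z` itself, or a chart straightening a smooth hypersurface off the coordinate
  -- hyperplanes.
  have hmult : ∀ {y₁}, y₁ ∈ C.w.source → φt y₁ ∈ C'.w.source →
      ∀ (z : OpenPartialHomeomorph X (Fin n → ℂ)) (lab : Fin n → Option ι) (i : Fin n)
        (ζ u : (Fin n → ℂ) → ℂ) (t N : ℕ), IsNCChart n P.comp z lab → π y₁ ∈ z.source →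
      (∀ x, z x i = ζ (C.z x)) → ζ (C.z (π y₁)) = 0 → AnalyticAt ℂ u (C.z (π y₁)) →
      u (C.z (π y₁)) ≠ 0 → (∀ᶠ z in 𝓝 (C.z (π y₁)), Ψ z = ζ z ^ t * u z) → 1 ≤ t →
      P'.numer (some l) * P.denom (lab i) ≤ t * P.numer (lab i) * P'.denom (some l) := by
    intro y₁ h1 h2 z lab i ζ u t N hz hzy hζ hζ0 hu hu0 hΨu ht
    refine mul_le_of_div_le (P'.numer_pos _) (hφ.mult_le (π y₁) z lab C'.z C'.lab hz hzy C'.z_nc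
      (hmemφ h2) i i' l (by rw [hζ, hζ0]) hl t (fun x => u (C.z x)) ht
      (holAt_of_analyticAt C.z_nc.mem (C.mapsTo h1) hu) ?_ ?_)
    · filter_upwards [(C.z.continuousAt (C.mapsTo h1)).eventually hΨu,
        C.z.open_source.mem_nhds (C.mapsTo h1)] with x h3 h4
      rw [hζ, ← h3]
      simp only [hΨdef, C.z.left_inv h4]
    · exact fun h => h.self_of_nhds ⟨by rw [hζ, hζ0], hu0⟩
  have hp'eq := C'.p_eq i'
  rw [hl] at hp'eq
  have hpole : C'.poleOrder i' (j + 1) = C'.p i' / P'.numer (some l) *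
      (P'.numer (some l) - (j + 1) * P'.denom (some l)) := by
    simp only [AdaptedChart.poleOrder, hl]
  obtain ⟨f, hf, hfT⟩ := exists_divided_rep (k := k) (p := C.p) (e := C.poleOrder)
    (fun i => (C.p_pos i).ne') C.p_eq (fun i j => rfl) (hΨat hy hy') hW (p' := C'.p i')
    (e' := C'.poleOrder i' (j + 1)) (j := j + 1) j.2 (C'.p_pos i').ne' hWΨ hW0
    (by
      filter_upwards [hY hmem, hwt] with w ⟨h1, h2⟩ h3 i hi _ t N u hu hu0 hΨu ht hN
      have h4 := hpow h1
      rw [C.w.right_inv h3] at h4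
      rw [h4] at hu hu0 hΨu
      have h5 := hmult h1 h2 C.z C.lab i (fun z => z i) u t N C.z_nc (C.mapsTo h1) (fun _ => rfl)
        (by rw [← h4]; simp [hi, (C.p_pos i).ne']) hu hu0 hΨu ht
      rw [hpole]
      refine weight_le (P'.numer_pos _) h5 ?_
      rw [← C.p_eq i, ← hp'eq, hN])
    (by
      filter_upwards [hY hmem, hwt] with w ⟨h1, h2⟩ h3 hne t N ζ u hζ hζ0 hζ' hu hu0 hΨu ht hN
      have h4 := hpow h1
      rw [C.w.right_inv h3] at h4
      rw [h4] at hu hu0 hΨu hζ hζ0 hζ'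
      obtain ⟨z, i, hxz, hz, hze⟩ := C.exists_smooth_chart (C.mapsTo h1) (fun i => by
        rw [← h4]; exact pow_ne_zero _ (hne i)) hζ hζ'
      have h5 := hmult h1 h2 z _ i ζ u t N hz hxz hze hζ0 hu hu0 hΨu ht
      rw [hpole]
      -- Off the coordinate hyperplanes `a = b = 1` and the covering is unramified, whence `q = 1`.
      have h6 := weight_le (q := 1) (q' := C'.p i' / P'.numer (some l)) (N := N) (j := j + 1)
        (P'.numer_pos _) h5 (by
          rw [← hp'eq, ← hN]; simp [OrbifoldPair.numer])
      simpa [OrbifoldPair.numer, OrbifoldPair.denom] using h6)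
  exact ⟨f, hf, htransfer _ f hfT⟩

end Differential

/-! ### Stalks as polynomial rings in the generators. -/

section Stalks

variable {n k : ℕ} {X Y : Type*} [TopologicalSpace X] [TopologicalSpace Y]
  [ChartedSpace (Fin n → ℂ) X] [ChartedSpace (Fin n → ℂ) Y] {ι : Type*}
  {P : OrbifoldPair n X ι} {π : Y → X}

theorem AdaptedChart.frequently_notMem_support (C : AdaptedChart P π) {y : Y}
    (hy : y ∈ C.w.source) : ∃ᶠ y' in 𝓝 y, π y' ∉ P.support := by
  have h1 : ∃ᶠ w in 𝓝 (C.w y), ∀ a, w a ≠ 0 := by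
    refine (frequently_coord_pattern (Finset.univ.filter fun a => C.w y a = 0)
      (fun a ha => (Finset.mem_filter.1 ha).2)).mono ?_
    rintro w ⟨h1, h2⟩ a
    by_cases ha : C.w y a = 0
    · exact h1 a (by simp [ha])
    · rw [h2 a (by simp [ha])]; exact ha
  have h2 : Tendsto C.w.symm (𝓝 (C.w y)) (𝓝 y) := by
    have := C.w.continuousAt_symm (C.w.map_source hy)
    rwa [ContinuousAt, C.w.left_inv hy] at this
  refine h2.frequently ((h1.and_eventually
    (C.w.open_target.mem_nhds (C.w.map_source hy))).mono ?_)
  rintro w ⟨h3, h4⟩ h5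
  rw [C.mem_support_iff (C.w.map_target h4), C.w.right_inv h4] at h5
  obtain ⟨i, -, h6⟩ := h5
  exact h3 i h6

/-- At a point of `z_i = 0` off the other hyperplanes through `x`, the equation `z'_i' = z_i ^ t u`
shows that `Δ_l` contains `z_i = 0`, which therefore has the label `l`. Changes of adapted charts
become a special case of the theorem on differentials. -/
theorem isOrbifoldMorphism_id (hne : ∃ x, x ∉ P.support) : IsOrbifoldMorphism P P (id : X → X) := by
  refine ⟨contMDiff_id, ?_, ?_⟩
  · obtain ⟨x, hx⟩ := hne
    exact fun h => hx (h ⟨x, rfl⟩)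
  intro x z lab z' lab' hz hx hz' hx' i i' l hi hl t u ht hu heq hfr
  have hlab : lab i = some l := by
    obtain ⟨w, ⟨h1, h2⟩, h3, h4, h5⟩ := ((frequently_coord_pattern
      (Finset.univ.filter fun a => z x a = 0 ∧ a ≠ i) (v := z x)
      (fun a ha => (Finset.mem_filter.1 ha).2.1)).and_eventually
      (((z.continuousAt_symm (z.map_source hx)).eventually
        (by rw [z.left_inv hx]; exact Filter.Eventually.and heq (z'.open_source.mem_nhds hx'))).and
      ((z.continuousAt_symm (z.map_source hx)).eventually
        (by rw [z.left_inv hx]; exact z.open_source.mem_nhds hx) |>.and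
        (z.open_target.mem_nhds (z.map_source hx))))).exists
    have hwi : w i = 0 := by rw [h2 i (by simp), hi]
    have h6 : z.symm w ∈ P.comp l ∩ z'.source := by
      rw [hz'.eq l]
      refine ⟨h3.2, i', hl, ?_⟩
      have h7 := h3.1
      rw [z.right_inv h5, hwi, zero_pow (by omega), zero_mul] at h7
      exact h7
    have h7 : z.symm w ∈ P.comp l ∩ z.source := ⟨h6.1, h4⟩
    rw [hz.eq l] at h7
    obtain ⟨-, a, ha, ha0⟩ := h7
    rw [z.right_inv h5] at ha0
    by_cases hai : a = i
    · rwa [hai] at ha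
    · exfalso
      by_cases hxa : z x a = 0
      · exact h1 a (by simp [hxa, hai]) ha0
      · rw [h2 a (by simp [hxa])] at ha0
        exact hxa ha0
  rw [hlab]
  calc P.mult (some l) = 1 * P.mult (some l) := (one_mul _).symm
    _ ≤ (t : ℝ≥0∞) * P.mult (some l) := by
      gcongr
      exact_mod_cast ht

theorem Jet.map_id (h : Hol n n (id : X → X)) (ξ : Jet n k X) : Jet.map id h ξ = ξ := by
  obtain ⟨γ, rfl⟩ := Quotient.exists_rep ξ
  rfl

theorem eventually_fiberFilter {y : Y} {p : PullJet n k π → Prop} :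
    (∀ᶠ τ in fiberFilter k P π y, p τ) ↔
      ∀ᶠ y' in 𝓝 y, π y' ∉ P.support → ∀ τ : PullJet n k π, τ.1.1 = y' → p τ := by
  rw [fiberFilter, Filter.eventually_comap, eventually_nhdsWithin_iff]
  rfl

theorem germAt_eq_iff {y : Y} {s s' : PullJet n k π → ℂ} :
    germAt k P π s y = germAt k P π s' y ↔
      ∀ᶠ y' in 𝓝 y, π y' ∉ P.support → ∀ τ : PullJet n k π, τ.1.1 = y' → s τ = s' τ := by
  rw [germAt, germAt, Filter.Germ.coe_eq, ← eventually_fiberFilter]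
  rfl

/-- The orbifold jet coordinates on `π^* J_k X`, outside of `Δ`. -/
noncomputable def AdaptedChart.coords (C : AdaptedChart P π) (τ : PullJet n k π) : Fin n × Fin k → ℂ :=
  fun x => C.gen k x.1 (x.2 + 1) τ

/-- A polynomial in orbifold jet coordinates, as a function on `π^* J_k X`. -/
noncomputable def AdaptedChart.polyFun (C : AdaptedChart P π)
    (f : (Fin n → ℂ) → MvPolynomial (Fin n × Fin k) ℂ) : PullJet n k π → ℂ :=
  fun τ => MvPolynomial.eval (C.coords τ) (f (C.w τ.1.1))

theorem AdaptedChart.pow_ne_zero (C : AdaptedChart P π) {y : Y} (hy : y ∈ C.w.source)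
    (hs : π y ∉ P.support) (i : Fin n) {j : ℕ} (hj : 1 ≤ j) : C.w y i ^ C.poleOrder i j ≠ 0 := by
  by_cases h : C.lab i = none
  · rw [C.poleOrder_of_none h hj, pow_zero]; exact one_ne_zero
  · refine _root_.pow_ne_zero _ fun h0 => hs ?_
    rw [C.mem_support_iff hy]
    exact ⟨i, h, h0⟩

/-- Outside `Δ` the powers of `w_i` that occur are invertible, so the jet and its orbifold
coordinates determine each other. -/
theorem AdaptedChart.hasCoords_iff (C : AdaptedChart P π) {τ : PullJet n k π}
    (hy : τ.1.1 ∈ C.w.source) (hs : π τ.1.1 ∉ P.support) {c : Fin n × Fin k → ℂ} :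
    C.HasCoords τ.1.1 τ.1.2 c ↔ C.coords τ = c := by
  have h0 := fun i (j : Fin k) => C.pow_ne_zero hy hs i (Nat.le_add_left 1 (j : ℕ))
  constructor
  · intro h
    ext ⟨i, j⟩
    simp only [AdaptedChart.coords, AdaptedChart.gen]
    rw [h.2 i j, inv_mul_cancel_left₀ (h0 i j)]
  · rintro rfl
    refine ⟨τ.2, fun i j => ?_⟩
    simp only [AdaptedChart.coords, AdaptedChart.gen]
    rw [mul_inv_cancel_left₀ (h0 i j)]

/-- The orbifold jet coordinates of a point of the orbifold jet space. -/
noncomputable def OrbJet.coords (C : AdaptedChart P π) (q : OrbJet k P π) : Fin n × Fin k → ℂ :=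
  fun x => OrbJet.eval (C.gen k x.1 (x.2 + 1)) q

theorem OrbJet.eval_of_mem {s : PullJet n k π → ℂ} {q : OrbJet k P π}
    (h : germAt k P π s q.pt ∈ stalk k P π q.pt) : OrbJet.eval s q = q.ev ⟨_, h⟩ := dif_pos h

theorem OrbJet.coords_apply {C : AdaptedChart P π} {q : OrbJet k P π} (hC : q.pt ∈ C.w.source)
    (x : Fin n × Fin k) : q.coords C x = q.ev ⟨germAt k P π (C.gen k x.1 (x.2 + 1)) q.pt,
      gen_mem_stalk k P π C hC x.1 (Nat.le_add_left 1 _) x.2.2⟩ :=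
  OrbJet.eval_of_mem _

/-- A finite sum of products of germs of base functions and generators is the form to which the ring
homomorphisms `ev` can be applied. -/
theorem AdaptedChart.germAt_polyFun (C : AdaptedChart P π) {y : Y} (hy : y ∈ C.w.source)
    {f : (Fin n → ℂ) → MvPolynomial (Fin n × Fin k) ℂ} (hf : IsAnalyticPoly f (C.w y)) :
    ∃ S : Finset (Fin n × Fin k →₀ ℕ), f (C.w y) = ∑ m ∈ S,
        MvPolynomial.monomial m ((f (C.w y)).coeff m) ∧
      germAt k P π (C.polyFun f) y = ∑ m ∈ S,
        germAt k P π (ofBase k n π fun y' => (f (C.w y')).coeff m) y *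
          ∏ x, germAt k P π (C.gen k x.1 (x.2 + 1)) y ^ m x := by
  obtain ⟨S, hS⟩ := hf.eventually_eq_sum
  refine ⟨S, hS.self_of_nhds, ?_⟩
  have h1 : germAt k P π (C.polyFun f) y = germAt k P π (∑ m ∈ S,
      (ofBase k n π fun y' => (f (C.w y')).coeff m) * ∏ x, C.gen k x.1 (x.2 + 1) ^ m x) y := by
    rw [germAt_eq_iff]
    filter_upwards [(C.w.continuousAt hy).eventually hS] with y' h2 _ τ hτ
    subst hτ
    simp only [AdaptedChart.polyFun]
    rw [h2, map_sum, Finset.sum_apply]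
    refine Finset.sum_congr rfl fun m _ => ?_
    rw [MvPolynomial.eval_monomial, Finsupp.prod_pow]
    simp only [Pi.mul_apply, Finset.prod_apply, Pi.pow_apply, ofBase, AdaptedChart.coords]
  rw [h1]
  have h3 := map_sum (Filter.Germ.coeRingHom (fiberFilter k P π y)) (fun m =>
    (ofBase k n π fun y' => (f (C.w y')).coeff m) * ∏ x, C.gen k x.1 (x.2 + 1) ^ m x) S
  refine h3.trans (Finset.sum_congr rfl fun m _ => ?_)
  rw [map_mul, map_prod]
  simp only [map_pow]
  rfl

theorem AdaptedChart.holAt_coeff (C : AdaptedChart P π) {y : Y} (hy : y ∈ C.w.source)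
    {f : (Fin n → ℂ) → MvPolynomial (Fin n × Fin k) ℂ} (hf : IsAnalyticPoly f (C.w y))
    (m : Fin n × Fin k →₀ ℕ) : HolAt n (fun y' => (f (C.w y')).coeff m) y :=
  holAt_of_analyticAt C.w_mem hy (hf.2 m)

theorem AdaptedChart.polyFun_mem_stalk (C : AdaptedChart P π) {y : Y} (hy : y ∈ C.w.source)
    {f : (Fin n → ℂ) → MvPolynomial (Fin n × Fin k) ℂ} (hf : IsAnalyticPoly f (C.w y)) :
    germAt k P π (C.polyFun f) y ∈ stalk k P π y := by
  obtain ⟨S, -, h⟩ := C.germAt_polyFun hy hf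
  rw [h]
  exact Subring.sum_mem _ fun m _ => Subring.mul_mem _ (ofBase_mem_stalk k P π (C.holAt_coeff hy hf m))
    (Subring.prod_mem _ fun x _ => Subring.pow_mem _
      (gen_mem_stalk k P π C hy x.1 (Nat.le_add_left 1 _) x.2.2) _)

theorem OrbJet.ev_polyFun {C : AdaptedChart P π} {q : OrbJet k P π} (hC : q.pt ∈ C.w.source)
    {f : (Fin n → ℂ) → MvPolynomial (Fin n × Fin k) ℂ} (hf : IsAnalyticPoly f (C.w q.pt)) :
    q.ev ⟨_, C.polyFun_mem_stalk hC hf⟩ = MvPolynomial.eval (q.coords C) (f (C.w q.pt)) := by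
  obtain ⟨S, h1, h2⟩ := C.germAt_polyFun hC hf
  have h3 : (⟨germAt k P π (C.polyFun f) q.pt, C.polyFun_mem_stalk hC hf⟩ : stalk k P π q.pt) =
      ∑ m ∈ S, (⟨_, ofBase_mem_stalk k P π (C.holAt_coeff hC hf m)⟩ : stalk k P π q.pt) *
        ∏ x : Fin n × Fin k, (⟨germAt k P π (C.gen k x.1 (x.2 + 1)) q.pt,
      gen_mem_stalk k P π C hC x.1 (Nat.le_add_left 1 _) x.2.2⟩ : stalk k P π q.pt) ^ m x := by
    apply Subtype.ext
    simp only [AddSubmonoidClass.coe_finsetSum, Subring.coe_mul, SubmonoidClass.coe_finsetProd,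
      SubmonoidClass.coe_pow]
    exact h2
  rw [h3, h1, map_sum, map_sum]
  refine Finset.sum_congr rfl fun m _ => ?_
  rw [map_mul, map_prod, q.ev_base _ (C.holAt_coeff hC hf m), MvPolynomial.eval_monomial,
    Finsupp.prod_pow]
  congr 1
  refine Finset.prod_congr rfl fun x _ => ?_
  rw [map_pow, OrbJet.coords_apply hC]

theorem OrbJet.eval_eq {C : AdaptedChart P π} {q : OrbJet k P π} (hC : q.pt ∈ C.w.source)
    {f : (Fin n → ℂ) → MvPolynomial (Fin n × Fin k) ℂ} (hf : IsAnalyticPoly f (C.w q.pt))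
    {s : PullJet n k π → ℂ} (hs : germAt k P π s q.pt = germAt k P π (C.polyFun f) q.pt) :
    OrbJet.eval s q = MvPolynomial.eval (q.coords C) (f (C.w q.pt)) := by
  rw [OrbJet.eval_of_mem (by rw [hs]; exact C.polyFun_mem_stalk hC hf), ← OrbJet.ev_polyFun hC hf]
  congr 1
  exact Subtype.ext hs

/-- Change of adapted charts. -/
theorem AdaptedChart.exists_change [IsManifold 𝓘(ℂ, Fin n → ℂ) ω X] (hcov : ∀ y, ∃ C : AdaptedChart P π, y ∈ C.w.source)
    (C C₂ : AdaptedChart P π) {y : Y} (hy : y ∈ C.w.source) (hy₂ : y ∈ C₂.w.source)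
    (x : Fin n × Fin k) :
    ∃ f : (Fin n → ℂ) → MvPolynomial (Fin n × Fin k) ℂ, IsAnalyticPoly f (C.w y) ∧
      (∀ᶠ y' in 𝓝 y, ∀ (ξ : Jet n k X) c, C.HasCoords y' ξ c →
        Jet.coord (x.2 + 1) (fun x' => C₂.z x' x.1) ξ =
          C₂.w y' x.1 ^ C₂.poleOrder x.1 (x.2 + 1) * MvPolynomial.eval c (f (C.w y'))) ∧
      germAt k P π (C₂.gen k x.1 (x.2 + 1)) y = germAt k P π (C.polyFun f) y := by
  have hns : ∀ y, ∃ᶠ y' in 𝓝 y, π y' ∉ P.support := fun y => by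
    obtain ⟨C, hC⟩ := hcov y
    exact C.frequently_notMem_support hC
  have hid : IsOrbifoldMorphism P P (id : X → X) := isOrbifoldMorphism_id (by
    obtain ⟨y', h⟩ := (hns y).exists
    exact ⟨_, h⟩)
  obtain ⟨f, hf, h⟩ := exists_differential_rep (k := k) (π' := π) hid (φt := (id : Y → Y)) contMDiff_id
    (fun _ => rfl) hns C hy C₂ hy₂ x
  simp only [Jet.map_id, id] at h
  refine ⟨f, hf, h, germAt_eq_iff.2 ?_⟩
  filter_upwards [h, C.w.open_source.mem_nhds hy, C₂.w.open_source.mem_nhds hy₂] with y' h1 h2 h3 h4 τ hτ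
  subst hτ
  simp only [AdaptedChart.gen, AdaptedChart.polyFun]
  rw [h1 τ.1.2 _ ((C.hasCoords_iff h2 h4).2 rfl), inv_mul_cancel_left₀
    (C₂.pow_ne_zero h3 h4 x.1 (Nat.le_add_left 1 _))]

/-- The stalks consist of the germs of polynomials in orbifold jet coordinates. -/
theorem exists_polyFun [IsManifold 𝓘(ℂ, Fin n → ℂ) ω X]
    (hcov : ∀ y, ∃ C : AdaptedChart P π, y ∈ C.w.source) (C : AdaptedChart P π) {y : Y}
    (hy : y ∈ C.w.source) {s : FiberGerm k P π y} (hs : s ∈ stalk k P π y) :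
    ∃ f : (Fin n → ℂ) → MvPolynomial (Fin n × Fin k) ℂ, IsAnalyticPoly f (C.w y) ∧
      s = germAt k P π (C.polyFun f) y := by
  have hC : ∀ a : (Fin n → ℂ) → ℂ, (C.polyFun (k := k) fun w => MvPolynomial.C (a w)) =
      ofBase k n π fun y => a (C.w y) := fun a => by
    ext τ; simp [AdaptedChart.polyFun, ofBase]
  induction hs using Subring.closure_induction with
  | mem s hs =>
    rcases hs with ⟨h, hh, rfl⟩ | ⟨C₂, i, j, hy₂, h1, hk, rfl⟩
    · refine ⟨_, IsAnalyticPoly.C (HolAt.analyticAt_chart' C.w_mem hy hh), ?_⟩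
      rw [hC fun w => h (C.w.symm w), germAt_eq_iff]
      filter_upwards [C.w.open_source.mem_nhds hy] with y' h1 _ τ hτ
      subst hτ
      simp [ofBase, C.w.left_inv h1]
    -- Orders `1 ≤ j ≤ k` are indexed by `j - 1` in `Fin k`.
    · have hlt : j - 1 < k := by omega
      obtain ⟨f, hf, -, h3⟩ := C.exists_change hcov C₂ hy hy₂ ((i, ⟨j - 1, hlt⟩) : Fin n × Fin k)
      refine ⟨f, hf, ?_⟩
      rw [← h3]
      simp only [Nat.sub_add_cancel h1]
  | zero =>
    refine ⟨_, IsAnalyticPoly.C analyticAt_const (a := fun _ => 0), ?_⟩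
    rw [hC fun _ => 0]
    rfl
  | one =>
    refine ⟨_, IsAnalyticPoly.C analyticAt_const (a := fun _ => 1), ?_⟩
    rw [hC fun _ => 1]
    rfl
  | add s s' _ _ h h' =>
    obtain ⟨f, hf, rfl⟩ := h
    obtain ⟨f', hf', rfl⟩ := h'
    refine ⟨_, hf.add hf', ?_⟩
    have : C.polyFun (fun w => f w + f' w) = C.polyFun f + C.polyFun f' := by
      ext τ; simp [AdaptedChart.polyFun]
    rw [this]
    rfl
  | mul s s' _ _ h h' =>
    obtain ⟨f, hf, rfl⟩ := h
    obtain ⟨f', hf', rfl⟩ := h'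
    refine ⟨_, hf.mul hf', ?_⟩
    have : C.polyFun (fun w => f w * f' w) = C.polyFun f * C.polyFun f' := by
      ext τ; simp [AdaptedChart.polyFun]
    rw [this]
    rfl
  | neg s _ h =>
    obtain ⟨f, hf, rfl⟩ := h
    refine ⟨_, (IsAnalyticPoly.C (analyticAt_const (v := (-1 : ℂ)))).mul hf, ?_⟩
    have : C.polyFun (fun w => MvPolynomial.C (-1) * f w) = -C.polyFun f := by
      ext τ; simp [AdaptedChart.polyFun]
    rw [this]
    rfl

/-- Off the support every `c` is attained by a jet, so equal germs give equal values there; density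
and continuity extend this to `y`, where the germs themselves see nothing if `π y ∈ |Δ|`. -/
theorem AdaptedChart.eval_eq_of_germAt_eq (C : AdaptedChart P π) {y : Y} (hy : y ∈ C.w.source)
    {f g : (Fin n → ℂ) → MvPolynomial (Fin n × Fin k) ℂ} (hf : IsAnalyticPoly f (C.w y))
    (hg : IsAnalyticPoly g (C.w y))
    (h : germAt k P π (C.polyFun f) y = germAt k P π (C.polyFun g) y) (c : Fin n × Fin k → ℂ) :
    MvPolynomial.eval c (f (C.w y)) = MvPolynomial.eval c (g (C.w y)) := by
  have h1 : ∀ᶠ y' in 𝓝 y, π y' ∉ P.support →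
      MvPolynomial.eval c (f (C.w y')) = MvPolynomial.eval c (g (C.w y')) := by
    filter_upwards [germAt_eq_iff.1 h, C.w.open_source.mem_nhds hy] with y' h2 h3 h4
    obtain ⟨ξ, hξ⟩ := C.exists_hasCoords (k := k) h3 c
    have h5 := h2 h4 ⟨(y', ξ), hξ.1⟩ rfl
    have h6 := (C.hasCoords_iff (τ := ⟨(y', ξ), hξ.1⟩) h3 h4).1 hξ
    simpa only [AdaptedChart.polyFun, h6] using h5
  have hcf := hf.continuousAt_eval (C.w.continuousAt hy) rfl (c := fun _ => c)
    fun _ => continuousAt_const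
  have hcg := hg.continuousAt_eval (C.w.continuousAt hy) rfl (c := fun _ => c)
    fun _ => continuousAt_const
  by_contra hne
  have h2 : ∀ᶠ y' in 𝓝 y, MvPolynomial.eval c (f (C.w y')) ≠ MvPolynomial.eval c (g (C.w y')) :=
    ((hcf.sub hcg).eventually_ne (sub_ne_zero.2 hne)).mono fun _ h => sub_ne_zero.1 h
  obtain ⟨y', h3, h4, h5⟩ := ((C.frequently_notMem_support hy).and_eventually (h1.and h2)).exists
  exact h5 (h4 h3)

end Stalks

/-! ### Points, topology and holomorphic functions in orbifold jet coordinates. -/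

section Points

variable {n k : ℕ} {X Y : Type*} [TopologicalSpace X] [TopologicalSpace Y]
  [ChartedSpace (Fin n → ℂ) X] [ChartedSpace (Fin n → ℂ) Y] {ι : Type*}
  {P : OrbifoldPair n X ι} {π : Y → X}

theorem AdaptedChart.isSection_gen (C : AdaptedChart P π) (x : Fin n × Fin k) :
    IsSection k P π C.w.source (C.gen k x.1 (x.2 + 1)) :=
  ⟨C.w.open_source, fun _ hy => gen_mem_stalk k P π C hy x.1 (Nat.le_add_left 1 _) x.2.2⟩

namespace OrbJet

theorem eval_ofBase {q : OrbJet k P π} {h : Y → ℂ} (hh : HolAt n h q.pt) :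
    eval (ofBase k n π h) q = h q.pt := by
  rw [eval_of_mem (ofBase_mem_stalk k P π hh), q.ev_base h hh]

/-- The zero section over `U`, with no condition on its value, exhibits the preimage of `U` as a
generating open set. -/
theorem continuous_pt : Continuous (OrbJet.pt : OrbJet k P π → Y) := by
  refine continuous_def.2 fun U hU => TopologicalSpace.isOpen_generateFrom_of_mem
    ⟨U, fun _ => 0, univ, ⟨hU, fun y _ => (stalk k P π y).zero_mem⟩, isOpen_univ, ?_⟩
  ext q
  simp

theorem isOpen_eval {U : Set Y} {s : PullJet n k π → ℂ} (hs : IsSection k P π U s) {W : Set ℂ}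
    (hW : IsOpen W) : IsOpen {q : OrbJet k P π | q.pt ∈ U ∧ eval s q ∈ W} :=
  TopologicalSpace.isOpen_generateFrom_of_mem ⟨U, s, W, hs, hW, rfl⟩

theorem continuousAt_eval {U : Set Y} {s : PullJet n k π → ℂ} (hs : IsSection k P π U s)
    {q : OrbJet k P π} (hq : q.pt ∈ U) : ContinuousAt (eval s) q := by
  intro W hW
  obtain ⟨W', h1, h2, h3⟩ := mem_nhds_iff.1 hW
  rw [Filter.mem_map]
  exact Filter.mem_of_superset ((isOpen_eval hs h2).mem_nhds ⟨hq, h3⟩) fun q' hq' =>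
    h1 hq'.2

theorem continuousAt_coords {C : AdaptedChart P π} {q : OrbJet k P π} (hC : q.pt ∈ C.w.source) :
    ContinuousAt (fun q' : OrbJet k P π => q'.coords C) q :=
  continuousAt_pi.2 fun x => continuousAt_eval (C.isSection_gen x) hC

variable [IsManifold 𝓘(ℂ, Fin n → ℂ) ω X]

/-- Evaluation at `c` of a representing polynomial does not depend on the representative, so it is a
ring homomorphism: the generators satisfy no relation. -/
theorem exists_pt_coords (hcov : ∀ y, ∃ C : AdaptedChart P π, y ∈ C.w.source)
    (C : AdaptedChart P π) {y : Y} (hy : y ∈ C.w.source) (c : Fin n × Fin k → ℂ) :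
    ∃ q : OrbJet k P π, q.pt = y ∧ q.coords C = c := by
  choose f hf hs using fun x : stalk k P π y => exists_polyFun hcov C hy x.2
  have key : ∀ (x : stalk k P π y) (g : (Fin n → ℂ) → MvPolynomial (Fin n × Fin k) ℂ),
      IsAnalyticPoly g (C.w y) → (x : FiberGerm k P π y) = germAt k P π (C.polyFun g) y →
      MvPolynomial.eval c (f x (C.w y)) = MvPolynomial.eval c (g (C.w y)) := fun x g hg h =>
    C.eval_eq_of_germAt_eq hy (hf x) hg (by rw [← hs x, h]) c
  have hC : ∀ a : (Fin n → ℂ) → ℂ, (C.polyFun (k := k) fun w => MvPolynomial.C (a w)) =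
      ofBase k n π fun y => a (C.w y) := fun a => by
    ext τ; simp [AdaptedChart.polyFun, ofBase]
  let ev : stalk k P π y →+* ℂ :=
    { toFun := fun x => MvPolynomial.eval c (f x (C.w y))
      map_one' := by
        rw [key 1 _ (IsAnalyticPoly.C (analyticAt_const (v := (1 : ℂ)))) (by rw [hC fun _ => 1]; rfl)]
        simp
      map_zero' := by
        rw [key 0 _ (IsAnalyticPoly.C (analyticAt_const (v := (0 : ℂ)))) (by rw [hC fun _ => 0]; rfl)]
        simp
      map_mul' := fun x x' => by
        rw [key (x * x') _ ((hf x).mul (hf x')) (by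
          have : C.polyFun (fun w => f x w * f x' w) = C.polyFun (f x) * C.polyFun (f x') := by
            ext τ; simp [AdaptedChart.polyFun]
          rw [this, Subring.coe_mul, hs x, hs x']
          rfl), map_mul]
      map_add' := fun x x' => by
        rw [key (x + x') _ ((hf x).add (hf x')) (by
          have : C.polyFun (fun w => f x w + f x' w) = C.polyFun (f x) + C.polyFun (f x') := by
            ext τ; simp [AdaptedChart.polyFun]
          rw [this, Subring.coe_add, hs x, hs x']
          rfl), map_add] }
  refine ⟨⟨y, ev, fun h hh => ?_⟩, rfl, ?_⟩
  · have h1 := key ⟨_, ofBase_mem_stalk k P π hh⟩ _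
      (IsAnalyticPoly.C (HolAt.analyticAt_chart' C.w_mem hy hh)) (by
        rw [hC fun w => h (C.w.symm w), germAt_eq_iff]
        filter_upwards [C.w.open_source.mem_nhds hy] with y' h1 _ τ hτ
        subst hτ
        simp [ofBase, C.w.left_inv h1])
    refine h1.trans ?_
    simp [C.w.left_inv hy]
  · ext x
    rw [coords_apply hy]
    refine (key _ _ (IsAnalyticPoly.X x _) ?_).trans (by simp)
    have : C.polyFun (fun _ => MvPolynomial.X x) = C.gen k x.1 (x.2 + 1) := by
      ext τ
      simp [AdaptedChart.polyFun, AdaptedChart.coords]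
    rw [this]

theorem ext_coords (hcov : ∀ y, ∃ C : AdaptedChart P π, y ∈ C.w.source) (C : AdaptedChart P π)
    {q q' : OrbJet k P π} (hC : q.pt ∈ C.w.source) (hpt : q.pt = q'.pt)
    (hc : q.coords C = q'.coords C) : q = q' := by
  obtain ⟨y, ev, hev⟩ := q
  obtain ⟨y', ev', hev'⟩ := q'
  change y = y' at hpt
  subst hpt
  congr 1
  ext s
  obtain ⟨f, hf, hs⟩ := exists_polyFun hcov C hC s.2
  have h1 : s = ⟨_, C.polyFun_mem_stalk hC hf⟩ := Subtype.ext hs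
  have h2 := ev_polyFun (q := ⟨y, ev, hev⟩) hC hf
  have h3 := ev_polyFun (q := ⟨y, ev', hev'⟩) hC hf
  rw [h1]
  rw [hc] at h2
  exact h2.trans h3.symm

theorem exists_eval_eq (hcov : ∀ y, ∃ C : AdaptedChart P π, y ∈ C.w.source) (C : AdaptedChart P π)
    {y : Y} (hy : y ∈ C.w.source) {s : PullJet n k π → ℂ} (hs : germAt k P π s y ∈ stalk k P π y) :
    ∃ f : (Fin n → ℂ) → MvPolynomial (Fin n × Fin k) ℂ, IsAnalyticPoly f (C.w y) ∧
      ∀ᶠ y' in 𝓝 y, ∀ q : OrbJet k P π, q.pt = y' →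
        eval s q = MvPolynomial.eval (q.coords C) (f (C.w y')) := by
  obtain ⟨f, hf, h⟩ := exists_polyFun hcov C hy hs
  refine ⟨f, hf, ?_⟩
  filter_upwards [(germAt_eq_iff.1 h).eventually_nhds, C.w.open_source.mem_nhds hy,
    (C.w.continuousAt hy).eventually hf.eventually] with y' h1 h2 h3 q hq
  subst hq
  exact eval_eq h2 h3 (germAt_eq_iff.2 h1)

/-- Near `q` each local section is a polynomial in the coordinates with continuous coefficients, so
the generating open sets are controlled by the base point and the coordinates. -/
theorem tendsto_of_coords (hcov : ∀ y, ∃ C : AdaptedChart P π, y ∈ C.w.source)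
    (C : AdaptedChart P π) {α : Type*} {l : Filter α} {G : α → OrbJet k P π} {q : OrbJet k P π}
    (hC : q.pt ∈ C.w.source) (hpt : Tendsto (fun a => (G a).pt) l (𝓝 q.pt))
    (hc : Tendsto (fun a => (G a).coords C) l (𝓝 (q.coords C))) : Tendsto G l (𝓝 q) := by
  refine TopologicalSpace.tendsto_nhds_generateFrom_iff.2 ?_
  rintro O ⟨U, s, W, hs, hW, rfl⟩ ⟨hU, hqW⟩
  obtain ⟨f, hf, h⟩ := exists_eval_eq hcov C hC (hs.2 _ hU)
  have h1 : ContinuousAt (fun x : Y × (Fin n × Fin k → ℂ) =>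
      MvPolynomial.eval x.2 (f (C.w x.1))) (q.pt, q.coords C) :=
    hf.continuousAt_eval (g := fun x : Y × (Fin n × Fin k → ℂ) => C.w x.1) (c := fun x => x.2)
      ((C.w.continuousAt hC).comp (f := Prod.fst) continuousAt_fst) rfl
      fun i => (continuous_apply i).continuousAt.comp continuousAt_snd
  have h2 : Tendsto (fun a => ((G a).pt, (G a).coords C)) l (𝓝 (q.pt, q.coords C)) :=
    hpt.prodMk_nhds hc
  have h3 := h1.tendsto.comp h2
  simp only at h3
  rw [← h.self_of_nhds q rfl] at h3
  filter_upwards [hpt.eventually h, hpt.eventually (hs.1.mem_nhds hU),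
    h3.eventually (hW.mem_nhds hqW)] with a h4 h5 h6
  refine ⟨h5, ?_⟩
  rw [h4 _ rfl]
  exact h6

theorem t2Space [T2Space Y] (hcov : ∀ y, ∃ C : AdaptedChart P π, y ∈ C.w.source) :
    T2Space (OrbJet k P π) := by
  refine ⟨fun q q' hne => ?_⟩
  by_cases hpt : q.pt = q'.pt
  · obtain ⟨C, hC⟩ := hcov q.pt
    obtain ⟨x, hx⟩ : ∃ x, q.coords C x ≠ q'.coords C x := by
      by_contra! h
      exact hne (ext_coords hcov C hC hpt (funext h))
    obtain ⟨W, W', h1, h2, h3, h4, h5⟩ := t2_separation hx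
    exact ⟨_, _, isOpen_eval (C.isSection_gen x) h1, isOpen_eval (C.isSection_gen x) h2, ⟨hC, h3⟩,
      ⟨hpt ▸ hC, h4⟩, Set.disjoint_left.2 fun q'' h h' => Set.disjoint_left.1 h5 h.2 h'.2⟩
  · exact separated_by_continuous continuous_pt hpt

/-- The change of adapted charts reduces the condition on all charts to one of them. -/
theorem liesOver_iff (hcov : ∀ y, ∃ C : AdaptedChart P π, y ∈ C.w.source) (C : AdaptedChart P π)
    {q : OrbJet k P π} (hC : q.pt ∈ C.w.source) {ξ : Jet n k X} :
    q.LiesOver ξ ↔ C.HasCoords q.pt ξ (q.coords C) := by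
  constructor
  · rintro ⟨h1, h2⟩
    refine ⟨h1, fun i j => ?_⟩
    rw [h2 C hC i (j + 1) (Nat.le_add_left 1 _) j.2, coords_apply hC]
  · intro h
    refine ⟨h.1, fun C₂ hC₂ i j h1 hk => ?_⟩
    obtain ⟨j, rfl⟩ := Nat.exists_eq_add_of_le' h1
    obtain ⟨f, hf, h2, h3⟩ := C.exists_change hcov C₂ hC hC₂ ((i, ⟨j, hk⟩) : Fin n × Fin k)
    rw [h2.self_of_nhds ξ _ h, ← eval_eq hC hf h3, eval_of_mem (gen_mem_stalk k P π C₂ hC₂ i h1 hk)]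

theorem holFunAt_of_coords (C : AdaptedChart P π) {q : OrbJet k P π} (hC : q.pt ∈ C.w.source)
    {h : OrbJet k P π → ℂ} {H : (Fin n → ℂ) × (Fin n × Fin k → ℂ) → ℂ}
    (hH : AnalyticAt ℂ H (C.w q.pt, q.coords C))
    (hh : ∀ᶠ q' in 𝓝 q, h q' = H (C.w q'.pt, q'.coords C)) : HolFunAt h q := by
  -- The finitely many sections are the base coordinates and the generators, enumerated together.
  let e := Fintype.equivFin (Fin n ⊕ Fin n × Fin k)
  let s : Fin n ⊕ Fin n × Fin k → PullJet n k π → ℂ :=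
    Sum.elim (fun i => ofBase k n π fun y => C.w y i) fun x => C.gen k x.1 (x.2 + 1)
  let R : (Fin (Fintype.card (Fin n ⊕ Fin n × Fin k)) → ℂ) → (Fin n → ℂ) × (Fin n × Fin k → ℂ) :=
    fun v => (fun i => v (e (Sum.inl i)), fun x => v (e (Sum.inr x)))
  have hol : ∀ y ∈ C.w.source, ∀ i, HolAt n (fun y => C.w y i) y := fun y hy i =>
    holAt_coord C.w_mem hy i
  have hR : ∀ q' : OrbJet k P π, q'.pt ∈ C.w.source →
      R (fun i => eval (s (e.symm i)) q') = (C.w q'.pt, q'.coords C) := by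
    intro q' hq'
    refine Prod.ext (funext fun i => ?_) (funext fun x => ?_)
    · simp only [R, s, Equiv.symm_apply_apply, Sum.elim_inl]
      exact eval_ofBase (hol _ hq' i)
    · simp only [R, s, Equiv.symm_apply_apply, Sum.elim_inr]
      rfl
  refine ⟨C.w.source, _, fun i => s (e.symm i), H ∘ R, hC, fun i => ?_, ?_, ?_⟩
  · show IsSection k P π C.w.source (s (e.symm i))
    rcases e.symm i with i | x
    · exact ⟨C.w.open_source, fun y hy => ofBase_mem_stalk k P π (hol y hy i)⟩
    · exact C.isSection_gen x
  · refine AnalyticAt.comp (by rwa [hR q hC]) (AnalyticAt.prod ?_ ?_)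
    · exact AnalyticAt.pi fun i => (ContinuousLinearMap.proj (R := ℂ)
        (φ := fun _ : Fin _ => ℂ) (e (Sum.inl i))).analyticAt _
    · exact AnalyticAt.pi fun i => (ContinuousLinearMap.proj (R := ℂ)
        (φ := fun _ : Fin _ => ℂ) (e (Sum.inr i))).analyticAt _
  · filter_upwards [hh, continuous_pt.continuousAt.eventually (C.w.open_source.mem_nhds hC)]
      with q' h1 h2
    rw [h1, Function.comp_apply, hR q' h2]

theorem holCurve_of_coords (hcov : ∀ y, ∃ C : AdaptedChart P π, y ∈ C.w.source)
    {V : Type*} [TopologicalSpace V] [ChartedSpace ℂ V] {σ : V → OrbJet k P π}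
    (hpt : ContMDiff 𝓘(ℂ, ℂ) 𝓘(ℂ, Fin n → ℂ) ω fun v => (σ v).pt)
    (h : ∀ v, ∃ C : AdaptedChart P π, (σ v).pt ∈ C.w.source ∧
      ∀ x, ContMDiffAt 𝓘(ℂ, ℂ) 𝓘(ℂ, ℂ) ω (fun v' => (σ v').coords C x) v) : HolCurve σ := by
  constructor
  · refine continuous_iff_continuousAt.2 fun v => ?_
    obtain ⟨C, hC, hc⟩ := h v
    exact tendsto_of_coords hcov C hC hpt.continuous.continuousAt
      (continuousAt_pi.2 fun x => (hc x).continuousAt)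
  · intro U s hs v hv
    obtain ⟨C, hC, hc⟩ := h v
    obtain ⟨f, hf, hfs⟩ := exists_eval_eq hcov C hC (hs.2 _ hv)
    have h1 : AnalyticAt ℂ (fun x : (Fin n → ℂ) × (Fin n × Fin k → ℂ) =>
        MvPolynomial.eval x.2 (f x.1)) (C.w (σ v).pt, (σ v).coords C) :=
      hf.analyticAt_eval (g := fun x : (Fin n → ℂ) × (Fin n × Fin k → ℂ) => x.1)
        (c := fun x => x.2) analyticAt_fst rfl fun i =>
        ((ContinuousLinearMap.proj (R := ℂ) (φ := fun _ => ℂ) i).analyticAt _).comp analyticAt_snd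
    have h2a : ContMDiffAt 𝓘(ℂ, ℂ) 𝓘(ℂ, Fin n → ℂ) ω (fun v' => C.w (σ v').pt) v :=
      ContMDiffAt.comp v (contMDiffAt_chart C.w_mem hC) (hpt v)
    have h2b : ContMDiffAt 𝓘(ℂ, ℂ) 𝓘(ℂ, Fin n × Fin k → ℂ) ω (fun v' => (σ v').coords C) v :=
      contMDiffAt_pi_space.2 hc
    have h2 : ContMDiffAt 𝓘(ℂ, ℂ) 𝓘(ℂ, (Fin n → ℂ) × (Fin n × Fin k → ℂ)) ω
        (fun v' => (C.w (σ v').pt, (σ v').coords C)) v := h2a.prodMk_space h2b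
    have h3 := (contMDiffAt_vectorSpace_iff.2 h1).comp v h2
    refine h3.congr_of_eventuallyEq ?_
    filter_upwards [hpt.continuous.continuousAt.eventually hfs] with v' h4
    exact h4 _ rfl

theorem exists_liesOver (hcov : ∀ y, ∃ C : AdaptedChart P π, y ∈ C.w.source) (q : OrbJet k P π) :
    ∃ ξ, q.LiesOver ξ := by
  obtain ⟨C, hC⟩ := hcov q.pt
  obtain ⟨ξ, hξ⟩ := C.exists_hasCoords hC (q.coords C)
  exact ⟨ξ, (liesOver_iff hcov C hC).2 hξ⟩

theorem eq_of_liesOver (hcov : ∀ y, ∃ C : AdaptedChart P π, y ∈ C.w.source) {q q' : OrbJet k P π}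
    (hpt : q.pt = q'.pt) (hs : π q.pt ∉ P.support) {ξ : Jet n k X} (h : q.LiesOver ξ)
    (h' : q'.LiesOver ξ) : q = q' := by
  obtain ⟨C, hC⟩ := hcov q.pt
  have h1 := (liesOver_iff hcov C hC).1 h
  have h2 := (liesOver_iff hcov C (hpt ▸ hC)).1 h'
  rw [← hpt] at h2
  refine ext_coords hcov C hC hpt ?_
  exact ((C.hasCoords_iff (τ := ⟨(q.pt, ξ), h1.1⟩) hC hs).1 h1).symm.trans
    ((C.hasCoords_iff (τ := ⟨(q.pt, ξ), h1.1⟩) hC hs).1 h2)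

/-- Moving the base point while keeping the coordinates fixed gives a local section through `q`. -/
theorem frequently_pt (hcov : ∀ y, ∃ C : AdaptedChart P π, y ∈ C.w.source) {q : OrbJet k P π}
    {S : Set Y} (hS : ∃ᶠ y in 𝓝 q.pt, y ∈ S) :
    ∃ᶠ q' in 𝓝 q, q'.pt ∈ S := by
  obtain ⟨C, hC⟩ := hcov q.pt
  choose G hG hG' using fun y' (hy' : y' ∈ C.w.source) =>
    exists_pt_coords hcov C hy' (q.coords C)
  classical
  let G' : Y → OrbJet k P π := fun y' => if h : y' ∈ C.w.source then G y' h else q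
  have h1 : ∀ᶠ y' in 𝓝 q.pt, (G' y').pt = y' ∧ (G' y').coords C = q.coords C := by
    filter_upwards [C.w.open_source.mem_nhds hC] with y' hy'
    simp only [G', dif_pos hy']
    exact ⟨hG y' hy', hG' y' hy'⟩
  have h2 : Tendsto G' (𝓝 q.pt) (𝓝 q) := by
    refine tendsto_of_coords hcov C hC ?_ ?_
    · exact tendsto_id.congr' (h1.mono fun y' h => h.1.symm)
    · exact tendsto_const_nhds.congr' (h1.mono fun y' h => h.2.symm)
  refine h2.frequently ((hS.and_eventually h1).mono ?_)
  rintro y' ⟨h3, h4, -⟩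
  rwa [h4]

end OrbJet

end Points

/-! ### The identity theorem on connected manifolds. -/

section Identity

variable {E M : Type*} [NormedAddCommGroup E] [NormedSpace ℂ E] [TopologicalSpace M]
  [ChartedSpace E M] [IsManifold 𝓘(ℂ, E) ω M]

/-- The identity theorem: a set which is locally the zero set of a holomorphic function on a
connected manifold, and which is not everything, has empty interior. -/
theorem frequently_notMem_of_local_zeros [ConnectedSpace M] {S : Set M}
    (hS : ∀ m, ∃ h : M → ℂ, ContMDiffAt 𝓘(ℂ, E) 𝓘(ℂ, ℂ) ω h m ∧
      ∀ᶠ m' in 𝓝 m, (m' ∈ S ↔ h m' = 0)) (hne : ∃ m, m ∉ S) (m : M) : ∃ᶠ m' in 𝓝 m, m' ∉ S := by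
  -- The interior of `S` is closed: near a limit point, a local equation vanishes on an open part of
  -- a coordinate ball, hence on the ball.
  have hclopen : IsClopen {m | ∀ᶠ m' in 𝓝 m, m' ∈ S} := by
    refine ⟨?_, isOpen_setOfPred_eventually_nhds⟩
    refine isClosed_of_closure_subset fun y hy => ?_
    obtain ⟨h, hh, hhS⟩ := hS y
    have he : chartAt E y ∈ IsManifold.maximalAtlas 𝓘(ℂ, E) ω M :=
      IsManifold.chart_mem_maximalAtlas y
    have hye := mem_chart_source E y
    set e := chartAt E y
    have h1 : AnalyticAt ℂ (fun w => h (e.symm w)) (e y) :=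
      contMDiffAt_vectorSpace_iff.1 (ContMDiffAt.comp (e y)
        (by rw [e.left_inv hye]; exact hh)
        (contMDiffAt_symm_of_mem_maximalAtlas he (e.map_source hye)))
    have h2 : ∀ᶠ w in 𝓝 (e y), e.symm w ∈ S ↔ h (e.symm w) = 0 := by
      have := e.continuousAt_symm (e.map_source hye)
      rw [ContinuousAt, e.left_inv hye] at this
      exact this.eventually hhS
    obtain ⟨ε, hε, hB⟩ := Metric.eventually_nhds_iff_ball.1
      (h1.eventually_analyticAt.and (h2.and (e.open_target.mem_nhds (e.map_source hye))))
    obtain ⟨a, ha, haS⟩ := mem_closure_iff_nhds.1 hy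
      (e.source ∩ e ⁻¹' Metric.ball (e y) ε) (e.isOpen_inter_preimage Metric.isOpen_ball |>.mem_nhds
        ⟨hye, Metric.mem_ball_self hε⟩)
    have h3 : (fun w => h (e.symm w)) =ᶠ[𝓝 (e a)] 0 := by
      have h4 : ∀ᶠ w in 𝓝 (e a), e.symm w ∈ S := by
        have := e.continuousAt_symm (e.map_source ha.1)
        rw [ContinuousAt, e.left_inv ha.1] at this
        exact this.eventually haS
      filter_upwards [h4, Metric.isOpen_ball.mem_nhds ha.2] with w h5 h6
      exact (hB w h6).2.1.1 h5
    have h4 := AnalyticOnNhd.eqOn_zero_of_preconnected_of_eventuallyEq_zero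
      (fun w hw => (hB w hw).1) (convex_ball (e y) ε).isPreconnected ha.2 h3
    change ∀ᶠ m' in 𝓝 y, m' ∈ S
    filter_upwards [e.isOpen_inter_preimage Metric.isOpen_ball |>.mem_nhds
        ⟨hye, Metric.mem_ball_self hε⟩] with m' hm'
    have h5 := (hB _ hm'.2).2.1.2 (h4 hm'.2)
    rwa [e.left_inv hm'.1] at h5
  rcases isClopen_iff.1 hclopen with h | h
  · intro h'
    have : m ∈ {m | ∀ᶠ m' in 𝓝 m, m' ∈ S} := h'.mono fun m' => not_not.1
    rw [h] at this
    exact this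
  · obtain ⟨m₀, h₀⟩ := hne
    have : m₀ ∈ {m | ∀ᶠ m' in 𝓝 m, m' ∈ S} := by rw [h]; trivial
    exact (h₀ (Filter.Eventually.self_of_nhds this)).elim

variable {n : ℕ} {X ι : Type*} [TopologicalSpace X] [ChartedSpace (Fin n → ℂ) X]

/-- The product of the labelled coordinates is a local equation of `|Δ|`. -/
theorem OrbifoldPair.exists_local_equation (P : OrbifoldPair n X ι) {ψ : M → X}
    (hψ : ContMDiff 𝓘(ℂ, E) 𝓘(ℂ, Fin n → ℂ) ω ψ) (m : M) :
    ∃ h : M → ℂ, ContMDiffAt 𝓘(ℂ, E) 𝓘(ℂ, ℂ) ω h m ∧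
      ∀ᶠ m' in 𝓝 m, (m' ∈ ψ ⁻¹' P.support ↔ h m' = 0) := by
  classical
  obtain ⟨z, lab, hz, hnc⟩ := P.nc (ψ m)
  let S := Finset.univ.filter fun i => lab i ≠ none
  refine ⟨fun m' => ∏ i ∈ S, z (ψ m') i, ?_, ?_⟩
  · have h1 : AnalyticAt ℂ (fun v : Fin n → ℂ => ∏ i ∈ S, v i) (z (ψ m)) :=
      Finset.analyticAt_fun_prod _ fun i _ => analyticAt_coord i _
    exact ContMDiffAt.comp (I' := 𝓘(ℂ, Fin n → ℂ)) (g := fun v : Fin n → ℂ => ∏ i ∈ S, v i) m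
      (contMDiffAt_vectorSpace_iff.2 h1) (ContMDiffAt.comp m (contMDiffAt_chart hnc.mem hz) (hψ m))
  · filter_upwards [hψ.continuous.continuousAt.eventually (z.open_source.mem_nhds hz)] with m' hm'
    rw [Finset.prod_eq_zero_iff]
    constructor
    · intro h
      obtain ⟨l, hl⟩ := mem_iUnion.1 h
      have h1 : ψ m' ∈ P.comp l ∩ z.source := ⟨hl, hm'⟩
      rw [hnc.eq l] at h1
      obtain ⟨-, i, hi, h0⟩ := h1
      exact ⟨i, by simp [S, hi], h0⟩
    · rintro ⟨i, hi, h0⟩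
      obtain ⟨l, hl⟩ := Option.ne_none_iff_exists'.1 (Finset.mem_filter.1 hi).2
      have h1 : ψ m' ∈ P.comp l ∩ z.source := by
        rw [hnc.eq l]
        exact ⟨hm', i, hl, h0⟩
      exact mem_iUnion.2 ⟨l, h1.1⟩

theorem OrbifoldPair.frequently_notMem_support [ConnectedSpace M] (P : OrbifoldPair n X ι)
    {ψ : M → X} (hψ : ContMDiff 𝓘(ℂ, E) 𝓘(ℂ, Fin n → ℂ) ω ψ) (hne : ∃ m, ψ m ∉ P.support) (m : M) :
    ∃ᶠ m' in 𝓝 m, ψ m' ∉ P.support :=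
  frequently_notMem_of_local_zeros (P.exists_local_equation hψ) hne m

theorem OrbifoldPair.isClosed_preimage_support (P : OrbifoldPair n X ι)
    {ψ : M → X} (hψ : ContMDiff 𝓘(ℂ, E) 𝓘(ℂ, Fin n → ℂ) ω ψ) : IsClosed (ψ ⁻¹' P.support) := by
  refine isOpen_compl_iff.1 (isOpen_iff_mem_nhds.2 fun m hm => ?_)
  obtain ⟨h, h1, h2⟩ := P.exists_local_equation hψ m
  have h3 : h m ≠ 0 := fun h0 => hm (h2.self_of_nhds.2 h0)
  filter_upwards [h2, h1.continuousAt.eventually_ne h3] with m' h4 h5 h6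
  exact h5 (h4.1 h6)

end Identity

/-! ### Existence and uniqueness of the differential. -/

section Differential

variable {n n' k : ℕ} {X Y X' Y' ι ι' : Type*} [TopologicalSpace X] [TopologicalSpace Y]
  [ChartedSpace (Fin n → ℂ) X] [ChartedSpace (Fin n → ℂ) Y]
  [TopologicalSpace X'] [TopologicalSpace Y']
  [ChartedSpace (Fin n' → ℂ) X'] [ChartedSpace (Fin n' → ℂ) Y']
  [IsManifold 𝓘(ℂ, Fin n → ℂ) ω X] [IsManifold 𝓘(ℂ, Fin n' → ℂ) ω X']
  {P : OrbifoldPair n X ι} {π : Y → X} {P' : OrbifoldPair n' X' ι'} {π' : Y' → X'}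

/-- The polynomials `f` represent the differential of `φ` in orbifold jet coordinates near `y`. -/
structure RepresentsDifferential (φ : X → X') (hφ : Hol n n' φ) (φt : Y → Y')
    (C : AdaptedChart P π) (C' : AdaptedChart P' π') (y : Y)
    (f : Fin n' × Fin k → (Fin n → ℂ) → MvPolynomial (Fin n × Fin k) ℂ) : Prop where
  mem : y ∈ C.w.source
  mem' : φt y ∈ C'.w.source
  analytic : ∀ x', IsAnalyticPoly (f x') (C.w y)
  coord_eq : ∀ᶠ y' in 𝓝 y, ∀ (ξ : Jet n k X) c, C.HasCoords y' ξ c → ∀ x',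
    Jet.coord (x'.2 + 1) (fun x => C'.z x x'.1) (Jet.map φ hφ ξ) =
      C'.w (φt y') x'.1 ^ C'.poleOrder x'.1 (x'.2 + 1) * MvPolynomial.eval c (f x' (C.w y'))

namespace RepresentsDifferential

variable {φ : X → X'} {hφ : Hol n n' φ} {φt : Y → Y'} {C C₂ : AdaptedChart P π}
  {C' C₂' : AdaptedChart P' π'} {y : Y}
  {f f₂ : Fin n' × Fin k → (Fin n → ℂ) → MvPolynomial (Fin n × Fin k) ℂ}

omit [IsManifold 𝓘(ℂ, Fin n → ℂ) ω X] [IsManifold 𝓘(ℂ, Fin n' → ℂ) ω X'] in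
theorem eventually (hφt : Hol n n' φt) (h : RepresentsDifferential φ hφ φt C C' y f) :
    ∀ᶠ y' in 𝓝 y, RepresentsDifferential φ hφ φt C C' y' f := by
  filter_upwards [C.w.open_source.mem_nhds h.mem,
    hφt.continuous.continuousAt.eventually (C'.w.open_source.mem_nhds h.mem'),
    h.coord_eq.eventually_nhds, eventually_all.2 fun x' =>
      (C.w.continuousAt h.mem).eventually (h.analytic x').eventually] with y' h1 h2 h3 h4
  exact ⟨h1, h2, h4, h3⟩

theorem liesOver (hcov : ∀ y, ∃ C : AdaptedChart P π, y ∈ C.w.source)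
    (hcov' : ∀ y, ∃ C : AdaptedChart P' π', y ∈ C.w.source)
    (hcomm : ∀ y, π' (φt y) = φ (π y)) {q : OrbJet k P π}
    (h : RepresentsDifferential φ hφ φt C C' q.pt f) {q' : OrbJet k P' π'} (hpt : q'.pt = φt q.pt)
    (hq' : q'.coords C' = fun x' => MvPolynomial.eval (q.coords C) (f x' (C.w q.pt)))
    {ξ : Jet n k X} (hξ : q.LiesOver ξ) : q'.LiesOver (Jet.map φ hφ ξ) := by
  rw [OrbJet.liesOver_iff hcov' C' (by rw [hpt]; exact h.mem')]
  rw [OrbJet.liesOver_iff hcov C h.mem] at hξ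
  refine ⟨by rw [Jet.base_map, hξ.1, hpt, hcomm], fun i j => ?_⟩
  rw [h.coord_eq.self_of_nhds ξ _ hξ (i, j), hq', hpt]

/-- `L` is the local model of the differential given by the polynomials `f`. Only its limit at `q`
is used, to reach points over the divisors from points outside them. -/
theorem exists_tendsto (hcov : ∀ y, ∃ C : AdaptedChart P π, y ∈ C.w.source)
    (hcov' : ∀ y, ∃ C : AdaptedChart P' π', y ∈ C.w.source) (hφt : Hol n n' φt)
    (hcomm : ∀ y, π' (φt y) = φ (π y)) {q : OrbJet k P π}
    (h : RepresentsDifferential φ hφ φt C C' q.pt f) {q' : OrbJet k P' π'} (hpt : q'.pt = φt q.pt)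
    (hq' : q'.coords C' = fun x' => MvPolynomial.eval (q.coords C) (f x' (C.w q.pt))) :
    ∃ L : OrbJet k P π → OrbJet k P' π', Tendsto L (𝓝 q) (𝓝 q') ∧
      ∀ᶠ a in 𝓝 q, (L a).pt = φt a.pt ∧
        ∀ ξ, a.LiesOver ξ → (L a).LiesOver (Jet.map φ hφ ξ) := by
  choose L hL hL' using fun (a : OrbJet k P π) (ha : φt a.pt ∈ C'.w.source) =>
    OrbJet.exists_pt_coords hcov' C' ha
      (fun x' => MvPolynomial.eval (a.coords C) (f x' (C.w a.pt)))
  classical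
  have hpc : ContinuousAt (OrbJet.pt : OrbJet k P π → Y) q := OrbJet.continuous_pt.continuousAt
  have hev := hpc.eventually (h.eventually hφt)
  let L₁ : OrbJet k P π → OrbJet k P' π' := fun a => if ha : φt a.pt ∈ C'.w.source then L a ha else q'
  have h1 : ∀ᶠ a in 𝓝 q, (L₁ a).pt = φt a.pt ∧
      (L₁ a).coords C' = fun x' => MvPolynomial.eval (a.coords C) (f x' (C.w a.pt)) := by
    filter_upwards [hev] with a ha
    simp only [L₁, dif_pos ha.mem']
    exact ⟨hL a _, hL' a _⟩
  refine ⟨L₁, ?_, ?_⟩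
  · refine OrbJet.tendsto_of_coords hcov' C' (by rw [hpt]; exact h.mem') ?_ ?_
    · rw [hpt]
      exact (hφt.continuous.continuousAt.comp hpc).tendsto.congr' (h1.mono fun a ha => ha.1.symm)
    · rw [hq']
      refine Tendsto.congr' (h1.mono fun a ha => ha.2.symm) (tendsto_pi_nhds.2 fun x' => ?_)
      exact ((h.analytic x').continuousAt_eval (g := fun a : OrbJet k P π => C.w a.pt)
        (c := fun a => a.coords C) ((C.w.continuousAt h.mem).comp (f := OrbJet.pt) hpc) rfl
        fun i => (continuous_apply i).continuousAt.comp (OrbJet.continuousAt_coords h.mem)).tendsto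
  · filter_upwards [hev, h1] with a h2 h3
    exact ⟨h3.1, fun ξ hξ => h2.liesOver hcov hcov' hcomm h3.1 h3.2 hξ⟩

/-- The two candidates are limits at `q` of local models that agree off the preimage of `Δ'`, where
a point is determined by its jet; the target is Hausdorff. -/
theorem unique [T2Space Y'] (hcov : ∀ y, ∃ C : AdaptedChart P π, y ∈ C.w.source)
    (hcov' : ∀ y, ∃ C : AdaptedChart P' π', y ∈ C.w.source) (hφt : Hol n n' φt)
    (hcomm : ∀ y, π' (φt y) = φ (π y)) (hns : ∀ y, ∃ᶠ y' in 𝓝 y, φ (π y') ∉ P'.support)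
    {q : OrbJet k P π}
    (h : RepresentsDifferential φ hφ φt C C' q.pt f) {q' : OrbJet k P' π'} (hpt : q'.pt = φt q.pt)
    (hq' : q'.coords C' = fun x' => MvPolynomial.eval (q.coords C) (f x' (C.w q.pt)))
    (h₂ : RepresentsDifferential φ hφ φt C₂ C₂' q.pt f₂) {q₂ : OrbJet k P' π'}
    (hpt₂ : q₂.pt = φt q.pt)
    (hq₂ : q₂.coords C₂' = fun x' => MvPolynomial.eval (q.coords C₂) (f₂ x' (C₂.w q.pt))) :
    q' = q₂ := by
  have := OrbJet.t2Space (k := k) hcov'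
  obtain ⟨L, h1, h3⟩ := h.exists_tendsto hcov hcov' hφt hcomm hpt hq'
  obtain ⟨L₂, h1', h3'⟩ := h₂.exists_tendsto hcov hcov' hφt hcomm hpt₂ hq₂
  refine tendsto_nhds_unique_of_frequently_eq h1 h1' ?_
  refine ((OrbJet.frequently_pt hcov (S := {y | φ (π y) ∉ P'.support})
    (hns q.pt)).and_eventually (h3.and h3')).mono ?_
  rintro a ⟨h4, ⟨h5, h6⟩, h7, h8⟩
  obtain ⟨ξ, hξ⟩ := OrbJet.exists_liesOver hcov a
  refine OrbJet.eq_of_liesOver hcov' (h5.trans h7.symm) ?_ (h6 ξ hξ) (h8 ξ hξ)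
  rw [h5, hcomm]
  exact h4

end RepresentsDifferential

theorem exists_representsDifferential {φ : X → X'} {φt : Y → Y'}
    (hφ : IsOrbifoldMorphism P P' φ) (hφt : Hol n n' φt) (hcomm : ∀ y, π' (φt y) = φ (π y))
    (hns : ∀ y, ∃ᶠ y' in 𝓝 y, φ (π y') ∉ P'.support)
    (C : AdaptedChart P π) {y : Y} (hy : y ∈ C.w.source) (C' : AdaptedChart P' π')
    (hy' : φt y ∈ C'.w.source) :
    ∃ f : Fin n' × Fin k → (Fin n → ℂ) → MvPolynomial (Fin n × Fin k) ℂ,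
      RepresentsDifferential φ hφ.hol φt C C' y f := by
  choose f hf h using fun x' => exists_differential_rep (k := k) hφ hφt hcomm hns C hy C' hy' x'
  refine ⟨f, hy, hy', hf, ?_⟩
  filter_upwards [eventually_all.2 h] with y' h1 ξ c hξ x'
  exact h1 x' ξ c hξ

theorem exists_differential [T2Space Y'] {φ : X → X'} {φt : Y → Y'}
    (hcov : ∀ y, ∃ C : AdaptedChart P π, y ∈ C.w.source)
    (hcov' : ∀ y, ∃ C : AdaptedChart P' π', y ∈ C.w.source)
    (hφ : IsOrbifoldMorphism P P' φ) (hφt : Hol n n' φt) (hcomm : ∀ y, π' (φt y) = φ (π y))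
    (hns : ∀ y, ∃ᶠ y' in 𝓝 y, φ (π y') ∉ P'.support) :
    ∃ F : OrbJet k P π → OrbJet k P' π', OrbJet.HolMap F ∧ (∀ q, (F q).pt = φt q.pt) ∧
      ∀ q ξ, q.LiesOver ξ → (F q).LiesOver (Jet.map φ hφ.hol ξ) := by
  choose C₀ hC₀ using hcov
  choose C₀' hC₀' using hcov'
  choose f₀ hf₀ using fun y => exists_representsDifferential (k := k) hφ hφt hcomm hns (C₀ y) (hC₀ y)
    (C₀' (φt y)) (hC₀' (φt y))
  have hcov : ∀ y, ∃ C : AdaptedChart P π, y ∈ C.w.source := fun y => ⟨_, hC₀ y⟩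
  have hcov' : ∀ y, ∃ C : AdaptedChart P' π', y ∈ C.w.source := fun y => ⟨_, hC₀' y⟩
  -- `F` is defined point by point in chosen charts. By `key` any pair of charts computes it, so
  -- near each point it is given by one family of polynomials.
  choose F hF hF' using fun q : OrbJet k P π => OrbJet.exists_pt_coords (k := k) hcov'
    (C₀' (φt q.pt)) (hC₀' _)
    (fun x' => MvPolynomial.eval (q.coords (C₀ q.pt)) (f₀ q.pt x' ((C₀ q.pt).w q.pt)))
  have key : ∀ (q : OrbJet k P π) (C : AdaptedChart P π) (C' : AdaptedChart P' π') f,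
      RepresentsDifferential φ hφ.hol φt C C' q.pt f →
      (F q).coords C' = fun x' => MvPolynomial.eval (q.coords C) (f x' (C.w q.pt)) := by
    intro q C C' f hf
    obtain ⟨q', h1, h2⟩ := OrbJet.exists_pt_coords hcov' C' hf.mem'
      (fun x' => MvPolynomial.eval (q.coords C) (f x' (C.w q.pt)))
    rw [(hf₀ q.pt).unique hcov hcov' hφt hcomm hns (hF q) (hF' q) hf h1 h2, h2]
  have hpc : ∀ q : OrbJet k P π, ContinuousAt (OrbJet.pt : OrbJet k P π → Y) q := fun q =>
    OrbJet.continuous_pt.continuousAt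
  have hFpt : Continuous fun q => (F q).pt := by
    simp only [hF]
    exact hφt.continuous.comp OrbJet.continuous_pt
  refine ⟨F, ⟨?_, ?_⟩, hF, fun q ξ hξ => (hf₀ q.pt).liesOver hcov hcov' hcomm (hF q) (hF' q) hξ⟩
  · refine continuous_iff_continuousAt.2 fun q => ?_
    have hf := hf₀ q.pt
    refine OrbJet.tendsto_of_coords hcov' _ (by rw [hF]; exact hf.mem') hFpt.continuousAt ?_
    rw [key q _ _ _ hf]
    refine Tendsto.congr' (((hpc q).eventually (hf.eventually hφt)).mono fun a ha =>
      (key a _ _ _ ha).symm) (tendsto_pi_nhds.2 fun x' => ?_)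
    exact ((hf.analytic x').continuousAt_eval (g := fun a : OrbJet k P π => (C₀ q.pt).w a.pt)
      (c := fun a => a.coords (C₀ q.pt))
      (((C₀ q.pt).w.continuousAt hf.mem).comp (f := OrbJet.pt) (hpc q)) rfl
      fun i => (continuous_apply i).continuousAt.comp (OrbJet.continuousAt_coords hf.mem)).tendsto
  · intro U' s' hs' q hq
    have hf := hf₀ q.pt
    set C := C₀ q.pt
    set C' := C₀' (φt q.pt)
    set f := f₀ q.pt
    have hq' : (F q).pt ∈ C'.w.source := by rw [hF]; exact hf.mem'
    obtain ⟨g, hg, hgs⟩ := OrbJet.exists_eval_eq hcov' C' hq' (hs'.2 _ hq)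
    -- The section is a polynomial in the target coordinates, which are themselves polynomials in
    -- the source coordinates.
    let H : (Fin n → ℂ) × (Fin n × Fin k → ℂ) → ℂ := fun x =>
      MvPolynomial.eval (fun x' => MvPolynomial.eval x.2 (f x' x.1))
        (g (C'.w (φt (C.w.symm x.1))))
    have hH : AnalyticAt ℂ H (C.w q.pt, q.coords C) := by
      refine hg.analyticAt_eval (g := fun x : (Fin n → ℂ) × (Fin n × Fin k → ℂ) =>
        C'.w (φt (C.w.symm x.1))) ?_ ?_ fun x' => ?_
      · have h1 : AnalyticAt ℂ (fun w => C'.w (φt (C.w.symm w))) (C.w q.pt) :=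
          Hol.analyticAt_charts hφt C.w_mem C'.w_mem (C.w.map_source hf.mem)
            (by rw [C.w.left_inv hf.mem]; exact hf.mem')
        exact h1.comp_of_eq analyticAt_fst rfl
      · simp only [C.w.left_inv hf.mem, hF]
      · exact (hf.analytic x').analyticAt_eval
          (g := fun x : (Fin n → ℂ) × (Fin n × Fin k → ℂ) => x.1)
          (c := fun x => x.2) analyticAt_fst rfl fun i =>
          ((ContinuousLinearMap.proj (R := ℂ) (φ := fun _ => ℂ) i).analyticAt _).comp analyticAt_snd
    refine OrbJet.holFunAt_of_coords C hf.mem hH ?_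
    filter_upwards [hFpt.continuousAt.eventually hgs, (hpc q).eventually (hf.eventually hφt)]
      with a h1 h2
    rw [h1 (F a) rfl, key a _ _ _ h2]
    simp only [H, C.w.left_inv h2.mem, hF]

theorem OrbJet.HolMap.comp_curve {F : OrbJet k P π → OrbJet k P' π'} (hF : OrbJet.HolMap F)
    {V : Type*} [TopologicalSpace V] [ChartedSpace ℂ V] {σ : V → OrbJet k P π}
    (hσ : OrbJet.HolCurve σ) : OrbJet.HolCurve fun v => F (σ v) := by
  refine ⟨hF.1.comp hσ.1, fun U' s' hs' v hv => ?_⟩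
  obtain ⟨U, r, s, H, hU, hs, hH, h⟩ := hF.2 U' s' hs' (σ v) hv
  have h1 : ContMDiffAt 𝓘(ℂ, ℂ) 𝓘(ℂ, Fin r → ℂ) ω (fun v' i => OrbJet.eval (s i) (σ v')) v :=
    contMDiffAt_pi_space.2 fun i => hσ.2 U (s i) (hs i) v hU
  refine ((contMDiffAt_vectorSpace_iff.2 hH).comp v h1).congr_of_eventuallyEq ?_
  exact hσ.1.continuousAt.eventually h

/-- Maps over `φt` to the orbifold jet space which are continuous and coincide with the differential
outside of `Δ` are determined by this. -/
theorem differential_unique [T2Space Y'] [IsManifold 𝓘(ℂ, Fin n → ℂ) ω Y] [ConnectedSpace Y]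
    {φ : X → X'} {φt : Y → Y'}
    (hcov : ∀ y, ∃ C : AdaptedChart P π, y ∈ C.w.source)
    (hcov' : ∀ y, ∃ C : AdaptedChart P' π', y ∈ C.w.source)
    (hφ : Hol n n' φ) (hπ : Hol n n π) (hcomm : ∀ y, π' (φt y) = φ (π y))
    (hns : ∀ y, ∃ᶠ y' in 𝓝 y, φ (π y') ∉ P'.support) {F G : OrbJet k P π → OrbJet k P' π'}
    (hF : Continuous F) (hFpt : ∀ q, (F q).pt = φt q.pt)
    (hFl : ∀ q ξ, q.LiesOver ξ → (F q).LiesOver (Jet.map φ hφ ξ))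
    (hG : IsDifferential φ hφ φt G) : G = F := by
  have := OrbJet.t2Space (k := k) hcov'
  funext q
  have hc1 := (P'.isClosed_preimage_support (ψ := fun y => φ (π y)) (hφ.comp hπ)).isOpen_compl
  -- The complement of the preimage of `Δ'` is open and dense, and that of `π⁻¹|Δ|` is dense, so
  -- both divisors can be avoided at once.
  have h1 : ∃ᶠ y in 𝓝 q.pt, y ∈ {y | φ (π y) ∉ P'.support ∧ π y ∉ P.support} := by
    refine frequently_frequently_nhds.1 ((hns q.pt).mono fun y hy => ?_)
    obtain ⟨C, hC⟩ := hcov y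
    exact ((C.frequently_notMem_support hC).and_eventually (hc1.mem_nhds hy)).mono
      fun y' h => ⟨h.2, h.1⟩
  refine tendsto_nhds_unique_of_frequently_eq hG.1.1.continuousAt hF.continuousAt ?_
  refine (OrbJet.frequently_pt hcov h1).mono fun a ha => ?_
  obtain ⟨ξ, h2, h3⟩ := hG.2.2 a ha.2
  refine OrbJet.eq_of_liesOver hcov' ((hG.2.1 a).trans (hFpt a).symm) ?_ h3 (hFl a ξ h2)
  rw [hG.2.1, hcomm]
  exact ha.1

end Differential

/-! ### Orders of vanishing along a lifted curve. -/

section OneVariable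

theorem analyticOrderAt_ne_top_of_frequently {f : ℂ → ℂ} {z : ℂ} (h : ∃ᶠ w in 𝓝 z, f w ≠ 0) :
    analyticOrderAt f z ≠ ⊤ := fun h' => by
  rw [analyticOrderAt_eq_top] at h'
  exact h (h'.mono fun w hw => not_not.2 hw)

/-- The jet coordinates of a curve of large contact order, divided by the power of the coordinate
of a lift. -/
theorem exists_iteratedDeriv_quotient {W R ζ : ℂ → ℂ} {s : ℂ} (hW : AnalyticAt ℂ W s)
    (hR : AnalyticAt ℂ R s) (hζ : AnalyticAt ℂ ζ (R s)) {q a b j : ℕ} (hq : q * a ≠ 0)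
    (heq : ∀ᶠ s' in 𝓝 s, ζ (R s') = W s' ^ (q * a)) (hRne : ∃ᶠ s' in 𝓝 s, R s' ≠ R s)
    (hWne : ∃ᶠ s' in 𝓝 s, W s' ≠ 0)
    (hmult : W s = 0 → ∀ μ : ℕ, analyticOrderAt ζ (R s) = μ → a ≤ μ * b) :
    ∃ c, AnalyticAt ℂ c s ∧ ∀ᶠ s' in 𝓝 s,
      iteratedDeriv j ζ (R s') = W s' ^ (q * (a - j * b)) * c s' := by
  have hD : AnalyticAt ℂ (iteratedDeriv j ζ) (R s) := by
    rw [iteratedDeriv_eq_iterate]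
    exact hζ.iterated_deriv j
  have hDR : AnalyticAt ℂ (fun s' => iteratedDeriv j ζ (R s')) s := hD.fun_comp hR
  have hWo := analyticOrderAt_ne_top_of_frequently hWne
  obtain ⟨κ, hκ⟩ := ENat.ne_top_iff_exists.1 hWo
  have hpow : ∀ N : ℕ, analyticOrderAt (fun s' => W s' ^ N) s = (N * κ : ℕ) := fun N => by
    have := analyticOrderAt_pow hW N
    rw [← hκ] at this
    refine this.trans ?_
    simp
  -- In one variable, divisibility is an inequality between orders.
  suffices h : analyticOrderAt (fun s' => W s' ^ (q * (a - j * b))) s ≤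
      analyticOrderAt (fun s' => iteratedDeriv j ζ (R s')) s by
    obtain ⟨c, hc, h'⟩ := exists_quotient_of_order_le hDR (hW.fun_pow _)
      (by rw [hpow]; exact ENat.natCast_ne_top _) h
    exact ⟨c, hc, h'.mono fun s' hs' => hs'.trans (mul_comm _ _)⟩
  rw [hpow]
  by_cases hW0 : W s = 0
  swap
  · have : κ = 0 := by
      have h1 : analyticOrderAt W s = 0 := (hW.analyticOrderAt_eq_zero).2 hW0
      rw [← hκ] at h1
      exact_mod_cast h1
    simp [this]
  have hνt : analyticOrderAt (R · - R s) s ≠ ⊤ :=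
    analyticOrderAt_ne_top_of_frequently (hRne.mono fun s' h => sub_ne_zero.2 h)
  obtain ⟨ν, hν⟩ := ENat.ne_top_iff_exists.1 hνt
  have hν0 : ν ≠ 0 := by
    rintro rfl
    have h1 : AnalyticAt ℂ (R · - R s) s := hR.fun_sub analyticAt_const
    exact (h1.analyticOrderAt_eq_zero.1 (by rw [← hν]; rfl)) (sub_self _)
  -- With `κ` the order of `W`, `ν` the ramification order of `R` and `μ` the order of `ζ`, the
  -- equation `ζ ∘ R = W ^ (q a)` gives `μ ν = q a κ`.
  have h1 : analyticOrderAt ζ (R s) * ν = (q * a * κ : ℕ) := by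
    rw [hν, ← hζ.analyticOrderAt_comp hR, ← hpow]
    exact analyticOrderAt_congr heq
  have hμt : analyticOrderAt ζ (R s) ≠ ⊤ := fun h => by
    rw [h, ENat.top_mul (by exact_mod_cast hν0)] at h1
    exact ENat.natCast_ne_top _ h1.symm
  obtain ⟨μ, hμ⟩ := ENat.ne_top_iff_exists.1 hμt
  rw [← hμ] at h1
  have h2 : μ * ν = q * a * κ := by exact_mod_cast h1
  have h3 : a ≤ μ * b := hmult hW0 μ hμ.symm
  -- If `μ ≤ j`, then `a ≤ μ b ≤ j b` and there is nothing to divide by. Otherwise the `j`-th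
  -- derivative of `ζ` has order `μ - j`.
  rcases le_or_gt μ j with hj | hj
  · have h4 : a - j * b = 0 := Nat.sub_eq_zero_of_le (h3.trans (Nat.mul_le_mul_right b hj))
    simp [h4]
  have h5 : analyticOrderAt (fun s' => iteratedDeriv j ζ (R s')) s = ((μ - j) * ν : ℕ) := by
    refine (hD.analyticOrderAt_comp hR).trans ?_
    rw [← hν, iteratedDeriv_eq_iterate, analyticOrderAt_iterated_deriv hζ hμ (by omega) hj.le]
    simp
  rw [h5, Nat.cast_le]
  have ha : 0 < a := Nat.pos_of_ne_zero (right_ne_zero_of_mul hq)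
  -- After multiplication by `a`, the inequality `q (a - j b) κ ≤ (μ - j) ν` follows from `μ ν = q a
  -- κ` and `a ≤ μ b`.
  refine le_of_mul_le_mul_left (a := a) ?_ ha
  have h6 : j * ν * a ≤ j * b * (q * a * κ) := by
    rw [← h2]
    calc j * ν * a ≤ j * ν * (μ * b) := Nat.mul_le_mul_left _ h3
      _ = j * b * (μ * ν) := by ring
  calc a * (q * (a - j * b) * κ) = (a - j * b) * (q * a * κ) := by ring
    _ = a * (q * a * κ) - j * b * (q * a * κ) := Nat.sub_mul _ _ _
    _ ≤ a * (μ * ν) - j * ν * a := by rw [h2]; exact Nat.sub_le_sub_left h6 _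
    _ = a * ((μ - j) * ν) := by
      rw [show j * ν * a = a * (j * ν) by ring, ← Nat.mul_sub, Nat.sub_mul]

end OneVariable

/-! ### Lifting orbifold curves. -/

section Lift

variable {n k : ℕ} {X Y ι : Type*} [TopologicalSpace X] [TopologicalSpace Y]
  [ChartedSpace (Fin n → ℂ) X] [ChartedSpace (Fin n → ℂ) Y]
  [IsManifold 𝓘(ℂ, Fin n → ℂ) ω X]
  {P : OrbifoldPair n X ι} {π : Y → X} {r : ℝ} {f : ℂ → X}
  {V : Type*} [TopologicalSpace V] [ChartedSpace ℂ V]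
  {ρ : V → Metric.ball (0 : ℂ) r} {g : V → Y}

omit [IsManifold 𝓘(ℂ, Fin n → ℂ) ω X] in
theorem Jet.coord_ofCurve {f : ℂ → X} {t : ℂ} (hf : CurveHolAt n f t) {h : X → ℂ}
    (hh : HolAt n h (f t)) {j : ℕ} (hj : j ≤ k) :
    Jet.coord j h (Jet.ofCurve k f t hf) =
      iteratedDeriv j (fun s => h (f s)) t / (j.factorial : ℂ) := by
  rw [Jet.ofCurve, Jet.coord_mk (by simpa using hh) hj, taylorCoeff,
    iteratedDeriv_comp_const_add j (fun s => h (f s)) t]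
  simp only [add_zero]

/-- `c` gives the orbifold jet coordinates of the lift of the jets of `f` near `v`. -/
structure RepresentsLift (hD : IsLifting n π f ρ g) (C : AdaptedChart P π) (v : V)
    (c : V → Fin n × Fin k → ℂ) : Prop where
  mem : g v ∈ C.w.source
  hol : ∀ᶠ v' in 𝓝 v, ∀ x, ContMDiffAt 𝓘(ℂ, ℂ) 𝓘(ℂ, ℂ) ω (fun v' => c v' x) v'
  hasCoords : ∀ᶠ v' in 𝓝 v,
    C.HasCoords (g v') (Jet.ofCurve k f (ρ v') (hD.f_hol _ (ρ v').2)) (c v')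

/-- In a chart of `V` the quotients are functions of one variable, and the contact condition on `f`
gives the orders needed. That `ρ` is not locally constant and that `π ∘ g` is not locally inside `Δ`
excludes infinite orders. -/
theorem exists_representsLift [IsManifold 𝓘(ℂ, ℂ) ω V] (hD : IsLifting n π f ρ g)
    (hf : IsOrbifoldCurve P r f)
    (hρ : ∀ v, ∃ᶠ v' in 𝓝 v, ρ v' ≠ ρ v) (hns : ∀ v, ∃ᶠ v' in 𝓝 v, π (g v') ∉ P.support)
    (C : AdaptedChart P π) {v : V} (hC : g v ∈ C.w.source) :
    ∃ c : V → Fin n × Fin k → ℂ, RepresentsLift hD C v c := by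
  have he : chartAt ℂ v ∈ IsManifold.maximalAtlas 𝓘(ℂ, ℂ) ω V :=
    IsManifold.chart_mem_maximalAtlas v
  have hv := mem_chart_source ℂ v
  set e := chartAt ℂ v
  have hsymm : Tendsto e.symm (𝓝 (e v)) (𝓝 v) := by
    have := e.continuousAt_symm (e.map_source hv)
    rwa [ContinuousAt, e.left_inv hv] at this
  have hdown : ∀ {p : V → Prop}, (∃ᶠ v' in 𝓝 v, p v') → ∃ᶠ s in 𝓝 (e v), p (e.symm s) := by
    intro p hp
    refine (e.continuousAt hv).tendsto.frequently ((hp.and_eventually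
      (e.open_source.mem_nhds hv)).mono ?_)
    rintro v' ⟨h1, h2⟩
    rwa [e.left_inv h2]
  have hchart : ContMDiffAt 𝓘(ℂ, ℂ) 𝓘(ℂ, ℂ) ω e.symm (e v) :=
    contMDiffAt_symm_of_mem_maximalAtlas he (e.map_source hv)
  have hR : AnalyticAt ℂ (fun s => (ρ (e.symm s) : ℂ)) (e v) :=
    contMDiffAt_vectorSpace_iff.1 (ContMDiffAt.comp (I' := 𝓘(ℂ, ℂ)) (e v)
      (g := fun v' => (ρ v' : ℂ)) (hD.rho_hol _) hchart)
  have hfpt : f (ρ v) = π (g v) := (hD.comm v).symm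
  have hz : f (ρ v) ∈ C.z.source := by rw [hfpt]; exact C.mapsTo hC
  have hgev : ∀ᶠ v' in 𝓝 v, g v' ∈ C.w.source :=
    hD.g_hol.continuous.continuousAt.eventually (C.w.open_source.mem_nhds hC)
  have hquot : ∀ x : Fin n × Fin k, ∃ c : ℂ → ℂ, AnalyticAt ℂ c (e v) ∧ ∀ᶠ s in 𝓝 (e v),
      iteratedDeriv (x.2 + 1) (fun t => C.z (f t) x.1) (ρ (e.symm s)) =
        C.w (g (e.symm s)) x.1 ^ (C.poleOrder x.1 (x.2 + 1)) * c s := by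
    rintro ⟨i, j⟩
    have hp : C.p i / P.numer (C.lab i) * P.numer (C.lab i) ≠ 0 := by
      rw [← C.p_eq]; exact (C.p_pos i).ne'
    have hW : AnalyticAt ℂ (fun s => C.w (g (e.symm s)) i) (e v) := by
      refine contMDiffAt_vectorSpace_iff.1 (ContMDiffAt.comp (e v)
        (g := fun v' => C.w (g v') i) (I' := 𝓘(ℂ, ℂ)) ?_ hchart)
      rw [e.left_inv hv]
      exact ContMDiffAt.comp v (g := fun y => C.w y i) (holAt_coord C.w_mem hC i) (hD.g_hol v)
    have hRv : (ρ (e.symm (e v)) : ℂ) = ρ v := by rw [e.left_inv hv]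
    have hζ : AnalyticAt ℂ (fun t => C.z (f t) i) (ρ v) :=
      contMDiffAt_vectorSpace_iff.1 (ContMDiffAt.comp (ρ v : ℂ) (g := fun x => C.z x i)
        (holAt_coord C.z_nc.mem hz i) (hD.f_hol _ (ρ v).2))
    have hpower : ∀ᶠ s in 𝓝 (e v), C.z (f (ρ (e.symm s))) i = C.w (g (e.symm s)) i ^ C.p i := by
      filter_upwards [hsymm.eventually hgev] with s hs
      rw [← hD.comm, C.power _ hs]
    by_cases hlab : C.lab i = none
    · refine ⟨fun s => iteratedDeriv (j + 1) (fun t => C.z (f t) i) (ρ (e.symm s)), ?_, ?_⟩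
      · have h1 : AnalyticAt ℂ (iteratedDeriv (j + 1) fun t => C.z (f t) i) (ρ v) := by
          rw [iteratedDeriv_eq_iterate]
          exact hζ.iterated_deriv _
        exact h1.fun_comp_of_eq hR hRv
      · refine Filter.Eventually.of_forall fun s => ?_
        rw [C.poleOrder_of_none hlab (Nat.le_add_left 1 _), pow_zero, one_mul]
    obtain ⟨l, hl⟩ := Option.ne_none_iff_exists'.1 hlab
    have hRne : ∃ᶠ s in 𝓝 (e v), (ρ (e.symm s) : ℂ) ≠ ρ (e.symm (e v)) := by
      refine hdown (p := fun v' => (ρ v' : ℂ) ≠ ρ (e.symm (e v))) ((hρ v).mono fun v' h1 h2 => ?_)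
      rw [e.left_inv hv] at h2
      exact h1 (Subtype.ext h2)
    have hWne : ∃ᶠ s in 𝓝 (e v), C.w (g (e.symm s)) i ≠ 0 := by
      refine ((hdown (hns v)).and_eventually (hsymm.eventually hgev)).mono ?_
      rintro s ⟨h1, h2⟩ h3
      exact h1 ((C.mem_support_iff h2).2 ⟨i, hlab, h3⟩)
    refine exists_iteratedDeriv_quotient hW hR (by rw [hRv]; exact hζ) hp
      (by rw [← C.p_eq]; exact hpower) hRne hWne ?_
    intro h0 μ hμ
    simp only [e.left_inv hv] at h0 hμ
    have h1 : C.z (f (ρ v)) i = 0 := by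
      rw [hfpt, C.power _ hC, h0, zero_pow (C.p_pos i).ne']
    have h2 := hf.mult_le (ρ v) (ρ v).2 C.z C.lab C.z_nc hz i l hl h1
    rw [hμ, ← hl, OrbifoldPair.mult] at h2
    -- The contact inequality `m ≤ μ` is the inequality `m' ≤ t m` with `t = μ` and the trivial
    -- multiplicity `1 / 1`.
    have h3 := mul_le_of_div_le (a := 1) (b := 1) (t := μ) (P.numer_pos (C.lab i))
      (b' := P.denom (C.lab i)) (by simpa using h2)
    simpa using h3
  choose c hc hceq using hquot
  -- The factorial comes from the Taylor normalization of the jet coordinates.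
  refine ⟨fun v' x => c x (e v') / ((x.2 + 1 : ℕ).factorial : ℂ), hC, ?_, ?_⟩
  · filter_upwards [(e.continuousAt hv).eventually
      (eventually_all.2 fun x => (hc x).eventually_analyticAt), e.open_source.mem_nhds hv]
      with v' h1 h2 x
    exact ContMDiffAt.comp v' (g := fun s => c x s / ((x.2 + 1 : ℕ).factorial : ℂ))
      (contMDiffAt_vectorSpace_iff.2 ((h1 x).fun_div analyticAt_const
        (Nat.cast_ne_zero.2 (Nat.factorial_ne_zero _))))
      (contMDiffAt_of_mem_maximalAtlas he h2)
  · filter_upwards [(e.continuousAt hv).eventually (eventually_all.2 hceq), hgev,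
      e.open_source.mem_nhds hv] with v' h1 h2 h3
    have hfv : f (ρ v') ∈ C.z.source := by rw [← hD.comm]; exact C.mapsTo h2
    refine ⟨?_, fun i j => ?_⟩
    · rw [hD.comm]
      show f (ρ v' + 0) = f (ρ v')
      rw [add_zero]
    · have h4 := h1 (i, j)
      simp only [e.left_inv h3] at h4
      rw [Jet.coord_ofCurve _ (holAt_coord C.z_nc.mem hfv i) j.2, h4, mul_div_assoc]

theorem RepresentsLift.exists_tendsto {hD : IsLifting n π f ρ g}
    (hcov : ∀ y, ∃ C : AdaptedChart P π, y ∈ C.w.source) {C : AdaptedChart P π} {v : V}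
    {c : V → Fin n × Fin k → ℂ} (h : RepresentsLift hD C v c) {q : OrbJet k P π} (hq : q.pt = g v)
    (hqc : q.coords C = c v) :
    ∃ L : V → OrbJet k P π, Tendsto L (𝓝 v) (𝓝 q) ∧ ∀ᶠ v' in 𝓝 v, (L v').pt = g v' ∧
      (L v').LiesOver (Jet.ofCurve k f (ρ v') (hD.f_hol _ (ρ v').2)) := by
  choose L hL hL' using fun (v' : V) (hv' : g v' ∈ C.w.source) =>
    OrbJet.exists_pt_coords hcov C hv' (c v')
  classical
  have hgc : ContinuousAt g v := hD.g_hol.continuous.continuousAt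
  obtain ⟨L₁, hL₁⟩ : ∃ L₁ : V → OrbJet k P π, ∀ v' hv', L₁ v' = L v' hv' :=
    ⟨fun v' => if hv' : g v' ∈ C.w.source then L v' hv' else q, fun v' hv' => dif_pos hv'⟩
  have h1 : ∀ᶠ v' in 𝓝 v, g v' ∈ C.w.source ∧ (L₁ v').pt = g v' ∧ (L₁ v').coords C = c v' := by
    filter_upwards [hgc.eventually (C.w.open_source.mem_nhds h.mem)] with v' hv'
    rw [hL₁ v' hv']
    exact ⟨hv', hL v' _, hL' v' _⟩
  refine ⟨L₁, ?_, ?_⟩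
  · refine OrbJet.tendsto_of_coords hcov C (by rw [hq]; exact h.mem) ?_ ?_
    · rw [hq]
      exact hgc.tendsto.congr' (h1.mono fun a ha => ha.2.1.symm)
    · rw [hqc]
      exact Tendsto.congr' (h1.mono fun a ha => ha.2.2.symm)
        (tendsto_pi_nhds.2 fun x => (h.hol.self_of_nhds x).continuousAt)
  · filter_upwards [h.hasCoords, h1] with v' h2 h3
    refine ⟨h3.2.1, ?_⟩
    rw [OrbJet.liesOver_iff hcov C (by rw [h3.2.1]; exact h3.1), h3.2.1, h3.2.2]
    exact h2

/-- The value at each `v` is built in its own chart. Outside `Δ` the jet determines it, and since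
the jet space is Hausdorff, limits force the local constructions to agree; this gives holomorphy as
well as uniqueness. -/
theorem exists_unique_jetLift [T2Space Y] [IsManifold 𝓘(ℂ, ℂ) ω V]
    (hcov : ∀ y, ∃ C : AdaptedChart P π, y ∈ C.w.source) (hD : IsLifting n π f ρ g)
    (hf : IsOrbifoldCurve P r f)
    (hρ : ∀ v, ∃ᶠ v' in 𝓝 v, ρ v' ≠ ρ v) (hns : ∀ v, ∃ᶠ v' in 𝓝 v, π (g v') ∉ P.support) :
    ∃! σ : V → OrbJet k P π, IsJetLift f hD.f_hol ρ g σ := by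
  have := OrbJet.t2Space (k := k) hcov
  have huniq : ∀ {v : V} {q q' : OrbJet k P π} {L L' : V → OrbJet k P π},
      Tendsto L (𝓝 v) (𝓝 q) → Tendsto L' (𝓝 v) (𝓝 q') →
      (∀ᶠ v' in 𝓝 v, (L v').pt = g v' ∧
        (L v').LiesOver (Jet.ofCurve k f (ρ v') (hD.f_hol _ (ρ v').2))) →
      (∀ᶠ v' in 𝓝 v, (L' v').pt = g v' ∧
        (L' v').LiesOver (Jet.ofCurve k f (ρ v') (hD.f_hol _ (ρ v').2))) → q = q' := by
    intro v q q' L L' h1 h2 h3 h4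
    refine tendsto_nhds_unique_of_frequently_eq h1 h2 (((hns v).and_eventually (h3.and h4)).mono ?_)
    rintro v' ⟨h5, h6, h7⟩
    exact OrbJet.eq_of_liesOver hcov (h6.1.trans h7.1.symm) (by rw [h6.1]; exact h5) h6.2 h7.2
  choose C hC using fun v => hcov (g v)
  choose c hc using fun v => exists_representsLift (k := k) hD hf hρ hns (C v) (hC v)
  choose σ hσ hσc using fun v => OrbJet.exists_pt_coords hcov (C v) (hC v) (c v v)
  have hlies : ∀ v, (σ v).LiesOver (Jet.ofCurve k f (ρ v) (hD.f_hol _ (ρ v).2)) := fun v => by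
    rw [OrbJet.liesOver_iff hcov (C v) (by rw [hσ]; exact hC v), hσ, hσc]
    exact (hc v).hasCoords.self_of_nhds
  have key : ∀ v, ∀ᶠ v' in 𝓝 v, (σ v').coords (C v) = c v v' := by
    intro v
    have hgc : ContinuousAt g v := hD.g_hol.continuous.continuousAt
    filter_upwards [(hc v).hol.eventually_nhds, (hc v).hasCoords.eventually_nhds,
      hgc.eventually ((C v).w.open_source.mem_nhds (hC v))] with v' h1 h2 h3
    obtain ⟨q, hq, hqc⟩ := OrbJet.exists_pt_coords hcov (C v) h3 (c v v')
    obtain ⟨L, hL, hL'⟩ := RepresentsLift.exists_tendsto (hD := hD) hcov ⟨h3, h1, h2⟩ hq hqc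
    obtain ⟨L₂, hL₂, hL₂'⟩ := (hc v').exists_tendsto hcov (hσ v') (hσc v')
    rw [huniq hL₂ hL hL₂' hL', hqc]
  have hcurve : OrbJet.HolCurve σ := by
    refine OrbJet.holCurve_of_coords hcov ?_ fun v => ⟨C v, by rw [hσ]; exact hC v, fun x => ?_⟩
    · simp only [hσ]
      exact hD.g_hol
    · exact ((hc v).hol.self_of_nhds x).congr_of_eventuallyEq
        ((key v).mono fun v' h => congrFun h x)
  have hlift : IsJetLift f hD.f_hol ρ g σ := ⟨hcurve, fun v => ⟨hσ v, hlies v⟩⟩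
  refine ⟨σ, hlift, fun σ' hσ' => funext fun v => ?_⟩
  exact huniq hσ'.1.1.continuousAt hlift.1.1.continuousAt
    (Filter.Eventually.of_forall hσ'.2) (Filter.Eventually.of_forall hlift.2)

end Lift

/-! ### Non-constancy of `ρ`. -/

section

variable {V : Type*} [TopologicalSpace V] [ConnectedSpace V] [ChartedSpace ℂ V]
  [IsManifold 𝓘(ℂ, ℂ) ω V] {r : ℝ} {ρ : V → Metric.ball (0 : ℂ) r}

/-- A disc has more than one point, so `ρ - ρ v` is not identically zero and the identity theorem
applies. -/
theorem frequently_ne_of_surjective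
    (hρ : ContMDiff 𝓘(ℂ, ℂ) 𝓘(ℂ, ℂ) ω (fun v => (ρ v : ℂ))) (hs : Function.Surjective ρ) (v : V) :
    ∃ᶠ v' in 𝓝 v, ρ v' ≠ ρ v := by
  refine frequently_notMem_of_local_zeros (E := ℂ) (S := {v' | ρ v' = ρ v})
    (fun m => ⟨fun v' => (ρ v' : ℂ) - ρ v, ?_, Filter.Eventually.of_forall fun v' => ?_⟩) ?_ v
  · have h1 : AnalyticAt ℂ (fun z : ℂ => z - ρ v) (ρ m) := analyticAt_id.fun_sub analyticAt_const
    exact ContMDiffAt.comp (I' := 𝓘(ℂ, ℂ)) m (contMDiffAt_vectorSpace_iff.2 h1) (hρ m)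
  · rw [sub_eq_zero, mem_ofPred_eq, Subtype.ext_iff]
  · by_contra! h
    have hr : 0 < r := by
      have h1 := (ρ v).2
      rw [Metric.mem_ball] at h1
      exact dist_nonneg.trans_lt h1
    have h1 : ∀ x y : Metric.ball (0 : ℂ) r, x = y := fun x y => by
      obtain ⟨a, rfl⟩ := hs x
      obtain ⟨b, rfl⟩ := hs y
      exact (h a).trans (h b).symm
    have h2 := congrArg Subtype.val (h1 ⟨0, Metric.mem_ball_self hr⟩ ⟨((r / 2 : ℝ) : ℂ), by
      rw [mem_ball_zero_iff, Complex.norm_real, Real.norm_of_nonneg (by positivity)]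
      linarith⟩)
    simp only at h2
    have h3 : (0 : ℝ) = r / 2 := by exact_mod_cast h2
    linarith

end

end OrbiJet

/-! ### The main theorem. -/

theorem mainTheorem5 {n n' : ℕ} {X Y X' Y' ι ι' : Type*}
    [TopologicalSpace X] [T2Space X] [ChartedSpace (Fin n → ℂ) X]
    [IsManifold 𝓘(ℂ, Fin n → ℂ) ω X]
    [TopologicalSpace Y] [T2Space Y] [ConnectedSpace Y] [ChartedSpace (Fin n → ℂ) Y]
    [IsManifold 𝓘(ℂ, Fin n → ℂ) ω Y]
    [TopologicalSpace X'] [T2Space X'] [ChartedSpace (Fin n' → ℂ) X']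
    [IsManifold 𝓘(ℂ, Fin n' → ℂ) ω X']
    [TopologicalSpace Y'] [T2Space Y'] [ConnectedSpace Y'] [ChartedSpace (Fin n' → ℂ) Y']
    [IsManifold 𝓘(ℂ, Fin n' → ℂ) ω Y']
    (P : OrbiJet.OrbifoldPair n X ι) (P' : OrbiJet.OrbifoldPair n' X' ι')
    (π : Y → X) (hπ : OrbiJet.IsAdapted P π)
    (π' : Y' → X') (hπ' : OrbiJet.IsAdapted P' π')
    (φ : X → X') (hφ : OrbiJet.IsOrbifoldMorphism P P' φ)
    (φt : Y → Y') (hφt : OrbiJet.Hol n n' φt) (hcomm : ∀ y, π' (φt y) = φ (π y)) (k : ℕ) :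
    ∃ F : OrbiJet.OrbJet k P π → OrbiJet.OrbJet k P' π',
      OrbiJet.IsDifferential φ hφ.hol φt F ∧
      (∀ G : OrbiJet.OrbJet k P π → OrbiJet.OrbJet k P' π',
        OrbiJet.IsDifferential φ hφ.hol φt G → G = F) ∧
      ∀ (r : ℝ) (f : ℂ → X) (V : Type uV) [TopologicalSpace V] [T2Space V] [ConnectedSpace V]
        [ChartedSpace ℂ V] [IsManifold 𝓘(ℂ, ℂ) ω V]
        (ρ : V → Metric.ball (0 : ℂ) r) (g : V → Y)
        (hD : OrbiJet.IsLifting n π f ρ g), OrbiJet.IsOrbifoldCurve P r f →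
        (∃! σ : V → OrbiJet.OrbJet k P π, OrbiJet.IsJetLift f hD.f_hol ρ g σ) ∧
        ∀ σ : V → OrbiJet.OrbJet k P π, OrbiJet.IsJetLift f hD.f_hol ρ g σ →
          OrbiJet.IsJetLift (φ ∘ f) (fun t ht => (hD.f_hol t ht).comp hφ.hol) ρ (φt ∘ g)
            (fun v => F (σ v)) := by
  have hcov := OrbiJet.exists_adaptedChart hπ
  have hcov' := OrbiJet.exists_adaptedChart hπ'
  -- `π` is surjective, so `φ ∘ π` leaves `Δ'` somewhere; as `Y` is connected, it does so on a dense
  -- set.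
  have hns : ∀ y, ∃ᶠ y' in 𝓝 y, φ (π y') ∉ P'.support := by
    refine P'.frequently_notMem_support (ψ := fun y => φ (π y)) (hφ.hol.comp hπ.hol) ?_
    obtain ⟨_, ⟨x, rfl⟩, hx⟩ := not_subset.1 hφ.not_subset
    obtain ⟨y, rfl⟩ := hπ.surj x
    exact ⟨y, hx⟩
  obtain ⟨F, hF, hFpt, hFl⟩ := OrbiJet.exists_differential (k := k) hcov hcov' hφ hφt hcomm hns
  refine ⟨F, ⟨hF, hFpt, fun q _ => ?_⟩, fun G hG =>
    OrbiJet.differential_unique hcov hcov' hφ.hol hπ.hol hcomm hns hF.1 hFpt hFl hG, ?_⟩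
  · obtain ⟨ξ, hξ⟩ := q.exists_liesOver hcov
    exact ⟨ξ, hξ, hFl q ξ hξ⟩
  intro r f V _ _ _ _ _ ρ g hD hf
  refine ⟨OrbiJet.exists_unique_jetLift hcov hD hf
    (OrbiJet.frequently_ne_of_surjective hD.rho_hol hD.rho_surj) ?_, fun σ hσ =>
    ⟨hF.comp_curve hσ.1, fun v => ⟨?_, ?_⟩⟩⟩
  -- The same argument on the connected surface `V`: `ρ` is surjective and `f` is not contained in
  -- `Δ`.
  · refine P.frequently_notMem_support (ψ := fun v => π (g v)) (hπ.hol.comp hD.g_hol) ?_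
    obtain ⟨t, ht, hft⟩ := hf.not_subset
    obtain ⟨v, hv⟩ := hD.rho_surj ⟨t, ht⟩
    refine ⟨v, ?_⟩
    rw [hD.comm, hv]
    exact hft
  · rw [hFpt, (hσ.2 v).1]
    rfl
  · exact hFl _ _ (hσ.2 v).2
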